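/- **Setting.** Let $d\in\{2,3\}$, let $\Omega\subset\mathbb R^d$ be a bounded polygonal/polyhedral domain, $T>0$, let $\rho,\chi,\omega,\alpha,\beta,s>0$ be constants and let $\mathcal C,\mathcal D$ be symmetric fourth-order tensors on $\mathbb S=\mathbb R^{d\times d}_{\rm sym}$ such that $\mathcal C$ and $\mathcal D-\mathcal C$ are positive definite; put $\mathcal A=\mathcal C^{-1}$, $\mathcal G=(\mathcal D-\mathcal C)^{-1}$, and $$\|(v,q)\|_{\mathcal H_1}^2=\rho\|v\|_{0,\Omega}^2+\chi\|q\|_{0,\Omega}^2,\qquad \|(\tau_E,\tau_V,\varphi)\|_{\mathcal H_2}^2=(\mathcal A\tau_E,\tau_E)_\Omega+(\omega\mathcal G\tau_V,\omega\tau_V)_\Omega+s\|\varphi\|_{0,\Omega}^2 .$$ Let $(u,p,\sigma_E,\sigma_V,\psi)$ solve, on $\Omega\times[0,T]$, $$\rho\dot u-\operatorname{div}(\sigma_E+\omega\sigma_V-\alpha\psi I_d)=F,\quad \dot\sigma_E=\mathcal C\varepsilon(u),\quad \omega\dot\sigma_V+\sigma_V=(\mathcal D-\mathcal C)\varepsilon(u),\quad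 \chi\dot p+\beta p+\nabla\psi=0,\quad s\dot\psi+\operatorname{div}p+\alpha\operatorname{div}u=g,$$ with $u=0$, $\psi=0$ on $\partial\Omega$; all five unknowns are in $C^1([0,T];L^2)$, $u(t)\in H_0^1(\Omega,\mathbb R^d)$, $p(t)\in H(\operatorname{div},\Omega)$, $\psi(t)\in H^1_0(\Omega)$, $(\sigma_E+\omega\sigma_V-\alpha\psi I_d)(t)\in H(\operatorname{div},\Omega,\mathbb S)$, and $\varepsilon(u)$, $\operatorname{div}p$, $\nabla\psi$ and $\operatorname{div}(\sigma_E+\omega\sigma_V-\alpha\psi I_d)$ are in $C^0([0,T];L^2)$. Let $\mathcal T_h$ be a simplicial mesh of $\overline\Omega$, possibly with hanging nodes, that is shape regular and locally quasi-uniform ($h_K\le\gamma h_F$ for every face $F$ of $K$), $\mathcal F_h$ its set of faces (the intersections $K\cap K'$ of two distinct elements that have positive $(d-1)$-measure, and the boundary faces), $h_F$ the diameter of $F$, $h_{\mathcal F}|_F=h_F$, $n$ the outward unit normal on element boundaries, and $\|\cdot\|_{0,\partial\mathcal T_h}$ the $L^2$ norm over all element boundaries, so that interior faces are counted from both sides.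 For $k\ge 0$ let $\mathcal P_m$ denote (piecewise) polynomials of total degree at most $m$, $\Pi^m_{\mathcal T}$, $\Pi^m_{\mathcal F}$ the $L^2$-orthogonal projections onto $\mathcal P_m(\mathcal T_h)$, $\mathcal P_m(\mathcal F_h)$, and $$|(v,\hat v)|_{\mathcal U}^2=\|\varepsilon(v)\|^2_{0,\mathcal T_h}+\Big\|\tfrac{k+1}{h_{\mathcal F}^{1/2}}(v-\hat v)\Big\|^2_{0,\partial\mathcal T_h},\quad |(q,\hat q)|_{\mathcal Q}^2=\|\operatorname{div}q\|^2_{0,\mathcal T_h}+\Big\|\tfrac{k+1}{h_{\mathcal F}^{1/2}}(q-\hat q)\Big\|^2_{0,\partial\mathcal T_h}.$$ For $t\in[0,T]$ let $(u_h,\hat u_h)$, $(p_h,\hat p_h)$, $\sigma_{E,h},\sigma_{V,h}$, $\psi_h$, of class $C^1$ in time with values in $\mathcal P_{k+1}(\mathcal T_h,\mathbb R^d)\times\mathcal P_{k+1}(\mathcal F_h^0,\mathbb R^d)$ ($\mathcal F^0_h$: vanishing on boundary faces), $\mathcal P_{k+1}(\mathcal T_h,\mathbb R^d)\times\mathcal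 P_{k+1}(\mathcal F_h,\mathbb R^d)$, $\mathcal P_k(\mathcal T_h,\mathbb S)$ (twice) and $\mathcal P_k(\mathcal T_h)$, solve the HDG scheme $$\begin{aligned}&\rho(\dot u_h,v)+\chi(\dot p_h,q)+(\mathcal A\dot\sigma_{E,h},\tau_E)+(\omega\mathcal G\dot\sigma_{V,h},\omega\tau_V)+s(\dot\psi_h,\varphi)+(\mathcal G\sigma_{V,h},\omega\tau_V)+\beta(p_h,q)\\&\quad+B_h((v,\hat v,q,\hat q),(\sigma_{E,h},\sigma_{V,h},\psi_h))-B_h((u_h,\hat u_h,p_h,\hat p_h),(\tau_E,\tau_V,\varphi))\\&\quad+\Big\langle\tfrac{(k+1)^2}{h_{\mathcal F}}(u_h-\hat u_h),v-\hat v\Big\rangle_{\partial\mathcal T_h}+\Big\langle\tfrac{(k+1)^2}{h_{\mathcal F}}(p_h-\hat p_h),q-\hat q\Big\rangle_{\partial\mathcal T_h}=(F,v)+(g,\varphi)\end{aligned}$$ for all discrete test functions in the same spaces, where, with $\tau=\tau_E+\omega\tau_V-\alpha\varphi I_d$, $$B_h((v,\hat v,q,\hat q),(\tau_E,\tau_V,\varphi))=(\tau,\varepsilon(v))_{\mathcal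 T_h}-(\varphi,\operatorname{div}q)_{\mathcal T_h}-\langle\tau n,v-\hat v\rangle_{\partial\mathcal T_h}+\langle\varphi n,q-\hat q\rangle_{\partial\mathcal T_h},$$ with initial values $u_h(0)=\Pi^{k+1}_{\mathcal T}u(0)$, $p_h(0)=\Pi^{k+1}_{\mathcal T}p(0)$, $\sigma_{E,h}(0)=\Pi^k_{\mathcal T}\sigma_E(0)$, $\sigma_{V,h}(0)=\Pi^k_{\mathcal T}\sigma_V(0)$, $\psi_h(0)=\Pi^k_{\mathcal T}\psi(0)$ for the volume unknowns. **Lemma.** There is a constant $C>0$, independent of the mesh $\mathcal T_h$ (within the class with fixed shape-regularity and quasi-uniformity constants, in particular of $h$), of $k$ and of the solution, such that the following holds. Assume that $\sigma_E+\omega\sigma_V-\alpha\psi I_d$, $u$ and $p$ are in $C^0([0,T];H^s(\mathcal T_h))$ for some $s>1/2$, that the traces of $p$ from the two sides of every interior face coincide (so that $p|_{\mathcal F_h}$ is defined) and that $\sigma_E$ and $\sigma_V$ have $L^2$ traces on the element boundaries. Put $e_{u,h}=\Pi^{k+1}_{\mathcal T}u-u_h$, $e_{p,h}=\Pi^{k+1}_{\mathcal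 T}p-p_h$, $e_{\sigma_\star,h}=\Pi^k_{\mathcal T}\sigma_\star-\sigma_{\star,h}$ ($\star\in\{E,V\}$), $e_{\psi,h}=\Pi^k_{\mathcal T}\psi-\psi_h$, $\chi_{\sigma_\star}=\sigma_\star-\Pi^k_{\mathcal T}\sigma_\star$, $\chi_\psi=\psi-\Pi^k_{\mathcal T}\psi$, and $\vec\chi_w=\big(w-\Pi_{\mathcal T}^{k+1}w,\ w|_{\mathcal F_h}-\Pi_{\mathcal F}^{k+1}(w|_{\mathcal F_h})\big)$ for $w\in\{u,p\}$. Then $$\begin{aligned}&\max_{[0,T]}\|(e_{u,h},e_{p,h})\|^2_{\mathcal H_1}+\max_{[0,T]}\|(e_{\sigma_E,h},e_{\sigma_V,h},e_{\psi,h})\|^2_{\mathcal H_2}\\&\quad\le C\int_0^T\Big(\Big\|\tfrac{h_{\mathcal F}^{1/2}}{k+1}\chi_{\sigma_E}\Big\|^2_{0,\partial\mathcal T_h}+\Big\|\tfrac{h_{\mathcal F}^{1/2}}{k+1}\chi_{\sigma_V}\Big\|^2_{0,\partial\mathcal T_h}+\Big\|\tfrac{h_{\mathcal F}^{1/2}}{k+1}\chi_\psi\Big\|^2_{0,\partial\mathcal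 T_h}+|\vec\chi_u|^2_{\mathcal U}+|\vec\chi_p|^2_{\mathcal Q}\Big)\,dt .\end{aligned}$$ -/

import Mathlib

noncomputable section

open MeasureTheory Set Filter Topology
open scoped ENNReal NNReal

namespace HDG

/-! ### Vectors, symmetric tensors, coefficients -/

/-- Euclidean space `ℝᵈ`. -/
abbrev Vec (d : ℕ) : Type := EuclideanSpace ℝ (Fin d)

/-- The symmetric matrices inside `ℝ^{d×d}`, where `ℝ^{d×d}` carries the Frobenius inner product. -/
def symSubmodule (d : ℕ) : Submodule ℝ (EuclideanSpace ℝ (Fin d × Fin d)) where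
  carrier := {τ | ∀ i j, τ (i, j) = τ (j, i)}
  add_mem' := by
    intro a b ha hb i j
    simp [ha i j, hb i j]
  zero_mem' := by
    intro i j
    simp
  smul_mem' := by
    intro c a ha i j
    simp [ha i j]

/-- The space of symmetric `d × d` matrices with the inner product `σ : τ = ∑ σᵢⱼ τᵢⱼ`. -/
abbrev Sym (d : ℕ) : Type := symSubmodule d

/-- The symmetric part `(M + Mᵀ) / 2` of a matrix. -/
def symPart {d : ℕ} (M : Fin d → Fin d → ℝ) : Sym d :=
  ⟨WithLp.toLp 2 (fun ij : Fin d × Fin d => (M ij.1 ij.2 + M ij.2 ij.1) / 2), by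
    intro i j
    change (M i j + M j i) / 2 = (M j i + M i j) / 2
    ring⟩

/-- The identity matrix. -/
def idSym (d : ℕ) : Sym d := symPart (fun i j => if i = j then 1 else 0)

/-- The trace of a symmetric matrix. -/
def trSym {d : ℕ} (τ : Sym d) : ℝ := ∑ i, τ.1 (i, i)

/-- The matrix-vector product `τ n`. -/
def mulVecSym {d : ℕ} (τ : Sym d) (n : Vec d) : Vec d :=
  WithLp.toLp 2 (fun i => ∑ j, τ.1 (i, j) * n j)

/-- The symmetrised tensor product `(a ⊗ b + b ⊗ a) / 2`. -/
def symDyad {d : ℕ} (a b : Vec d) : Sym d := symPart (fun i j => a i * b j)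

/-- The (classical) strain `ε(v) = (∇v + (∇v)ᵀ) / 2`. -/
def strain {d : ℕ} (v : Vec d → Vec d) (x : Vec d) : Sym d :=
  symPart (fun i j => (fderiv ℝ v x (EuclideanSpace.single j 1)) i)

/-- The (classical) divergence. -/
def divergence {d : ℕ} (v : Vec d → Vec d) (x : Vec d) : ℝ :=
  ∑ i, (fderiv ℝ v x (EuclideanSpace.single i 1)) i

/-- The coefficients of the model: `ρ`, `χ`, `ω`, `α`, `β`, `s` are positive, the fourth-order
tensors `𝒞` and `𝒟` are symmetric, and `𝒞` and `𝒟 - 𝒞` (hence `𝒟`) are positive definite. -/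
structure Coefficients (d : ℕ) where
  ρ : ℝ
  χ : ℝ
  ω : ℝ
  α : ℝ
  β : ℝ
  s : ℝ
  𝒞 : Sym d →L[ℝ] Sym d
  𝒟 : Sym d →L[ℝ] Sym d
  ρ_pos : 0 < ρ
  χ_pos : 0 < χ
  ω_pos : 0 < ω
  α_pos : 0 < α
  β_pos : 0 < β
  s_pos : 0 < s
  𝒞_symm : ∀ σ τ : Sym d, inner ℝ (𝒞 σ) τ = inner ℝ σ (𝒞 τ)
  𝒟_symm : ∀ σ τ : Sym d, inner ℝ (𝒟 σ) τ = inner ℝ σ (𝒟 τ)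
  𝒞_pos : ∀ τ : Sym d, τ ≠ 0 → 0 < inner ℝ (𝒞 τ) τ
  𝒟_sub_𝒞_pos : ∀ τ : Sym d, τ ≠ 0 → 0 < inner ℝ ((𝒟 - 𝒞) τ) τ

/-- `𝒜 = 𝒞⁻¹`. -/
def Coefficients.𝒜 {d : ℕ} (m : Coefficients d) : Sym d →L[ℝ] Sym d := Ring.inverse m.𝒞

/-- `𝒢 = (𝒟 - 𝒞)⁻¹`. -/
def Coefficients.𝒢 {d : ℕ} (m : Coefficients d) : Sym d →L[ℝ] Sym d := Ring.inverse (m.𝒟 - m.𝒞)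

/-- The total stress `τ_E + ω τ_V - α φ I_d`. -/
def Coefficients.totalStress {d : ℕ} (m : Coefficients d) (τE τV : Sym d) (φ : ℝ) : Sym d :=
  τE + m.ω • τV - (m.α * φ) • idSym d

/-! ### Weak derivatives on `Ω` -/

/-- `L²(Ω, V)`. -/
abbrev L2 {d : ℕ} (Ω : Set (Vec d)) (V : Type) [NormedAddCommGroup V] : Type :=
  Lp V 2 (volume.restrict Ω)

/-- `φ ∈ C_c^∞(Ω)`. -/
def IsTest {d : ℕ} (Ω : Set (Vec d)) (φ : Vec d → ℝ) : Prop :=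
  ContDiff ℝ (⊤ : ℕ∞) φ ∧ HasCompactSupport φ ∧ tsupport φ ⊆ Ω

/-- `G` is the weak gradient of the scalar function `f` in `Ω`. -/
def IsWeakGrad {d : ℕ} (Ω : Set (Vec d)) (f : Vec d → ℝ) (G : Vec d → Vec d) : Prop :=
  ∀ φ, IsTest Ω φ → ∫ x in Ω, f x • gradient φ x = -∫ x in Ω, φ x • G x

/-- `g` is the weak divergence of the vector field `w` in `Ω`. -/
def IsWeakDiv {d : ℕ} (Ω : Set (Vec d)) (w : Vec d → Vec d) (g : Vec d → ℝ) : Prop :=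
  ∀ φ, IsTest Ω φ → ∫ x in Ω, inner ℝ (w x) (gradient φ x) = -∫ x in Ω, φ x * g x

/-- `g` is the weak (row-wise) divergence of the tensor field `τ` in `Ω`. -/
def IsWeakDivSym {d : ℕ} (Ω : Set (Vec d)) (τ : Vec d → Sym d) (g : Vec d → Vec d) : Prop :=
  ∀ φ, IsTest Ω φ → ∫ x in Ω, mulVecSym (τ x) (gradient φ x) = -∫ x in Ω, φ x • g x

/-- `e` is the weak strain `ε(v) = (∇v + (∇v)ᵀ) / 2` of the vector field `v` in `Ω`. -/
def IsWeakStrain {d : ℕ} (Ω : Set (Vec d)) (v : Vec d → Vec d) (e : Vec d → Sym d) : Prop :=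
  ∀ φ, IsTest Ω φ → ∫ x in Ω, symDyad (v x) (gradient φ x) = -∫ x in Ω, φ x • e x

/-- `f ∈ H¹₀(Ω)`: `f` is a limit of test functions in the norm of `H¹(Ω)`. -/
def MemH10 {d : ℕ} (Ω : Set (Vec d)) (f : Vec d → ℝ) : Prop :=
  MemLp f 2 (volume.restrict Ω) ∧
  ∃ G : Vec d → Vec d, MemLp G 2 (volume.restrict Ω) ∧
    ∃ φ : ℕ → Vec d → ℝ, (∀ n, IsTest Ω (φ n)) ∧
      Tendsto (fun n => eLpNorm (fun x => f x - φ n x) 2 (volume.restrict Ω)) atTop (𝓝 0) ∧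
      Tendsto (fun n => eLpNorm (fun x => G x - gradient (φ n) x) 2 (volume.restrict Ω))
        atTop (𝓝 0)

/-! ### The continuous problem -/

/-- The strong time derivative on `[0, T]` (one-sided at the end points). -/
def dt {X : Type} [NormedAddCommGroup X] [NormedSpace ℝ X] (T : ℝ) (f : ℝ → X) (t : ℝ) : X :=
  derivWithin f (Icc 0 T) t

/-- A solution `(u, p, σ_E, σ_V, ψ)` of the first-order system on `[0, T]` with `u = 0`, `ψ = 0` on
`∂Ω` and sources `F`, `g`, in the class `C¹([0,T]; 𝓗₁ × 𝓗₂) ∩ C⁰([0,T]; 𝓧₁ × 𝓧₂)`. The fields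
`εu`, `divp`, `divσ`, `gradψ` are the weak derivatives that occur in `𝓧₁` and `𝓧₂`. -/
structure ExactSolution {d : ℕ} (m : Coefficients d) (Ω : Set (Vec d)) (T : ℝ)
    (F : ℝ → L2 Ω (Vec d)) (g : ℝ → L2 Ω ℝ) where
  u : ℝ → L2 Ω (Vec d)
  p : ℝ → L2 Ω (Vec d)
  σE : ℝ → L2 Ω (Sym d)
  σV : ℝ → L2 Ω (Sym d)
  ψ : ℝ → L2 Ω ℝ
  εu : ℝ → L2 Ω (Sym d)
  divp : ℝ → L2 Ω ℝ
  divσ : ℝ → L2 Ω (Vec d)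
  gradψ : ℝ → L2 Ω (Vec d)
  u_C1 : ContDiffOn ℝ 1 u (Icc 0 T)
  p_C1 : ContDiffOn ℝ 1 p (Icc 0 T)
  σE_C1 : ContDiffOn ℝ 1 σE (Icc 0 T)
  σV_C1 : ContDiffOn ℝ 1 σV (Icc 0 T)
  ψ_C1 : ContDiffOn ℝ 1 ψ (Icc 0 T)
  u_mem : ∀ t ∈ Icc 0 T, ∀ i, MemH10 Ω (fun x => u t x i)
  ψ_mem : ∀ t ∈ Icc 0 T, MemH10 Ω (ψ t)
  εu_weak : ∀ t ∈ Icc 0 T, IsWeakStrain Ω (u t) (εu t)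
  divp_weak : ∀ t ∈ Icc 0 T, IsWeakDiv Ω (p t) (divp t)
  divσ_weak : ∀ t ∈ Icc 0 T,
    IsWeakDivSym Ω (fun x => m.totalStress (σE t x) (σV t x) (ψ t x)) (divσ t)
  gradψ_weak : ∀ t ∈ Icc 0 T, IsWeakGrad Ω (ψ t) (gradψ t)
  εu_cont : ContinuousOn εu (Icc 0 T)
  divp_cont : ContinuousOn divp (Icc 0 T)
  divσ_cont : ContinuousOn divσ (Icc 0 T)
  gradψ_cont : ContinuousOn gradψ (Icc 0 T)
  momentum : ∀ t ∈ Icc 0 T, ∀ᵐ x ∂(volume.restrict Ω),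
    m.ρ • (dt T u t) x - divσ t x = F t x
  elastic : ∀ t ∈ Icc 0 T, ∀ᵐ x ∂(volume.restrict Ω),
    (dt T σE t) x = m.𝒞 (εu t x)
  viscous : ∀ t ∈ Icc 0 T, ∀ᵐ x ∂(volume.restrict Ω),
    m.ω • (dt T σV t) x + σV t x = (m.𝒟 - m.𝒞) (εu t x)
  flux : ∀ t ∈ Icc 0 T, ∀ᵐ x ∂(volume.restrict Ω),
    m.χ • (dt T p t) x + m.β • p t x + gradψ t x = 0
  conservation : ∀ t ∈ Icc 0 T, ∀ᵐ x ∂(volume.restrict Ω),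
    m.s * (dt T ψ t) x + divp t x + m.α * trSym (εu t x) = g t x

/-! ### Meshes -/

/-- A nondegenerate `d`-simplex in `ℝᵈ` (a triangle for `d = 2`, a tetrahedron for `d = 3`). -/
abbrev Elem (d : ℕ) : Type := Affine.Simplex ℝ (Vec d) d

/-- The closed simplex as a set. -/
def body {d : ℕ} (K : Elem d) : Set (Vec d) := convexHull ℝ (range K.points)

/-- The facet of `K` opposite to the `i`-th vertex. -/
def facet {d : ℕ} (K : Elem d) (i : Fin (d + 1)) : Set (Vec d) :=
  convexHull ℝ (K.points '' {j | j ≠ i})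

/-- The `(d-1)`-dimensional surface measure. -/
def area (d : ℕ) : Measure (Vec d) := Measure.euclideanHausdorffMeasure (d - 1)

/-- A polygonal (`d = 2`) or polyhedral (`d = 3`) bounded domain. -/
structure IsPolyhedralDomain {d : ℕ} (Ω : Set (Vec d)) : Prop where
  isOpen : IsOpen Ω
  isConnected : IsConnected Ω
  isBounded : Bornology.IsBounded Ω
  regular : interior (closure Ω) = Ω
  polyhedral : ∃ S : Finset (Elem d), closure Ω = ⋃ K ∈ S, body K

open Classical in
/-- The interior faces: the sets `K ∩ K'` of positive `(d-1)`-measure, `K ≠ K'` in the mesh. -/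
def interiorFaces {d : ℕ} (𝒯 : Finset (Elem d)) : Finset (Set (Vec d)) :=
  ((𝒯 ×ˢ 𝒯).filter (fun q => q.1 ≠ q.2 ∧ 0 < area d (body q.1 ∩ body q.2))).image
    (fun q => body q.1 ∩ body q.2)

open Classical in
/-- The boundary faces: the parts of positive `(d-1)`-measure of the facets that lie on `∂Ω`
(that is, the facets contained in `∂Ω` whenever no facet lies only partly on `∂Ω`). -/
def boundaryFaces {d : ℕ} (Ω : Set (Vec d)) (𝒯 : Finset (Elem d)) : Finset (Set (Vec d)) :=
  ((𝒯 ×ˢ (Finset.univ : Finset (Fin (d + 1)))).image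
    (fun q => facet q.1 q.2 ∩ frontier Ω)).filter (fun F => 0 < area d F)

open Classical in
/-- All the faces `𝓕_h` of the mesh. -/
def faces {d : ℕ} (Ω : Set (Vec d)) (𝒯 : Finset (Elem d)) : Finset (Set (Vec d)) :=
  interiorFaces 𝒯 ∪ boundaryFaces Ω 𝒯

open Classical in
/-- The set `𝓕(K)` of the faces of the mesh that lie on the boundary of the element `K`. -/
def facesOf {d : ℕ} (Ω : Set (Vec d)) (𝒯 : Finset (Elem d)) (K : Elem d) : Finset (Set (Vec d)) :=
  (faces Ω 𝒯).filter (fun F => F ⊆ body K)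

/-- A simplicial mesh of `closure Ω`, possibly with hanging nodes, which is shape regular with
constant `κ` and locally quasi-uniform with constant `γ`. -/
structure IsMesh {d : ℕ} (Ω : Set (Vec d)) (κ γ : ℝ) (𝒯 : Finset (Elem d)) : Prop where
  cover : (⋃ K ∈ 𝒯, body K) = closure Ω
  disjoint : ∀ K ∈ 𝒯, ∀ K' ∈ 𝒯, K ≠ K' → Disjoint (interior (body K)) (interior (body K'))
  shapeRegular : ∀ K ∈ 𝒯, ∃ c, Metric.closedBall c (Metric.diam (body K) / κ) ⊆ body K
  quasiUniform : ∀ K ∈ 𝒯, ∀ F ∈ facesOf Ω 𝒯 K, Metric.diam (body K) ≤ γ * Metric.diam F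

open Classical in
/-- The unit normal vector on the face `F` of `K` that points out of `K`. -/
def normal {d : ℕ} (K : Elem d) (F : Set (Vec d)) : Vec d :=
  if h : ∃ n : Vec d, ‖n‖ = 1 ∧ ∀ x ∈ F, ∀ y ∈ body K, inner ℝ n (y - x) ≤ 0 then h.choose else 0

/-! ### Functions on the mesh -/

/-- Functions given on every element separately. -/
abbrev Broken (d : ℕ) (V : Type) : Type := Elem d → Vec d → V

/-- Functions on the skeleton: one function on every face. -/
abbrev Skel (d : ℕ) (V : Type) : Type := Set (Vec d) → Vec d → V

/-- Functions on the element boundaries: one function for every element and every face of it. -/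
abbrev BdFun (d : ℕ) (V : Type) : Type := Elem d → Set (Vec d) → Vec d → V

section Spaces

variable {d : ℕ} {V : Type} [NormedAddCommGroup V] [InnerProductSpace ℝ V]

/-- `f` is a polynomial function of total degree at most `n`. -/
def IsPolyReal (n : ℕ) (f : Vec d → ℝ) : Prop :=
  ∃ P : MvPolynomial (Fin d) ℝ, P.totalDegree ≤ n ∧ ∀ x, f x = MvPolynomial.eval (fun i => x i) P

/-- All the components of `f` are polynomial functions of total degree at most `n`. -/
def IsPoly (n : ℕ) (f : Vec d → V) : Prop :=
  ∀ ℓ : V →L[ℝ] ℝ, IsPolyReal n (fun x => ℓ (f x))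

/-- `v ∈ 𝒫_n(𝒯_h, V)`. -/
def IsBrokenPoly (𝒯 : Finset (Elem d)) (n : ℕ) (v : Broken d V) : Prop :=
  ∀ K ∈ 𝒯, IsPoly n (v K)

/-- `w ∈ 𝒫_n(𝓕_h, V)`. -/
def IsSkelPoly (Ω : Set (Vec d)) (𝒯 : Finset (Elem d)) (n : ℕ) (w : Skel d V) : Prop :=
  ∀ F ∈ faces Ω 𝒯, IsPoly n (w F)

/-- `w` vanishes on the boundary faces. -/
def VanishesOnBoundary (Ω : Set (Vec d)) (𝒯 : Finset (Elem d)) (w : Skel d V) : Prop :=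
  ∀ F ∈ boundaryFaces Ω 𝒯, ∀ x ∈ F, w F x = 0

open Classical in
/-- The `L²(μ)`-orthogonal projection of `f` onto the polynomials of degree at most `n`. -/
def l2Proj (μ : Measure (Vec d)) (n : ℕ) (f : Vec d → V) : Vec d → V :=
  if h : ∃ P : Vec d → V, IsPoly n P ∧
      ∀ Q : Vec d → V, IsPoly n Q → ∫ x, inner ℝ (f x - P x) (Q x) ∂μ = 0
  then h.choose else 0

/-- `Π_𝒯^n f`, for a function `f` on `Ω`. -/
def projT (n : ℕ) (f : Vec d → V) : Broken d V :=
  fun K => l2Proj (volume.restrict (body K)) n f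

/-- `Π_𝓕^n w`, for a function `w` on the skeleton. -/
def projF (n : ℕ) (w : Skel d V) : Skel d V :=
  fun F => l2Proj ((area d).restrict F) n (w F)

/-- The inner product `(f, g)_{𝒯_h}`. -/
def volInner (𝒯 : Finset (Elem d)) (f g : Broken d V) : ℝ :=
  ∑ K ∈ 𝒯, ∫ x in body K, inner ℝ (f K x) (g K x)

/-- `⟨c f, g⟩_{∂𝒯_h}`, with a weight `c` that is constant on every face. -/
def bdInner (Ω : Set (Vec d)) (𝒯 : Finset (Elem d)) (c : Set (Vec d) → ℝ) (f g : BdFun d V) : ℝ :=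
  ∑ K ∈ 𝒯, ∑ F ∈ facesOf Ω 𝒯 K, ∫ x in F, inner ℝ (c F • f K F x) (g K F x) ∂(area d)

/-- The squared norm `‖f‖²_{0,𝒯_h}`, as an element of `[0, ∞]`. -/
def volNormSq (𝒯 : Finset (Elem d)) (f : Broken d V) : ℝ≥0∞ :=
  ∑ K ∈ 𝒯, ∫⁻ x in body K, ‖f K x‖ₑ ^ 2

/-- The squared weighted norm `‖c f‖²_{0,∂𝒯_h}`, as an element of `[0, ∞]`. -/
def bdNormSq (Ω : Set (Vec d)) (𝒯 : Finset (Elem d)) (c : Set (Vec d) → ℝ) (f : BdFun d V) :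
    ℝ≥0∞ :=
  ∑ K ∈ 𝒯, ∑ F ∈ facesOf Ω 𝒯 K, ∫⁻ x in F, ‖c F • f K F x‖ₑ ^ 2 ∂(area d)

/-- The jump `v - v̂` on the element boundaries of a (continuous on each element) broken function
`v` and a skeleton function `v̂`. -/
def jump (v : Broken d V) (w : Skel d V) : BdFun d V := fun K F x => v K x - w F x

/-- `g ∈ L²(F, V)` is the trace on the face `F` of `K` of the function `f` on `K`: in the mean
over `0 < δ < ε`, the values of `f` at distance parameter `δ` from the face, along the segments
from `F` to the centroid of `K`, converge to `g` in `L²(F)` as `ε → 0`. Such a `g` is unique up to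
null sets and does not change if `f` is modified on a null set; for `f ∈ H^s(K, V)` with `s > 1/2`
it is the usual trace. -/
def IsTrace (K : Elem d) (F : Set (Vec d)) (f g : Vec d → V) : Prop :=
  MemLp g 2 ((area d).restrict F) ∧
  Tendsto (fun ε : ℝ => (∫⁻ δ in Ioo 0 ε, ∫⁻ x in F,
      ‖f (x + δ • (Finset.univ.centroid ℝ K.points - x)) - g x‖ₑ ^ 2 ∂(area d)) / ENNReal.ofReal ε)
    (𝓝[>] 0) (𝓝 0)

/-- The squared Sobolev-Slobodeckij semi-norm of `H^s(K, V)`, for `0 < s < 1`. -/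
def sobolevSeminormSq (s : ℝ) (K : Elem d) (f : Vec d → V) : ℝ≥0∞ :=
  ∫⁻ x in body K, ∫⁻ y in body K, ‖f x - f y‖ₑ ^ 2 / ENNReal.ofReal (‖x - y‖ ^ ((d : ℝ) + 2 * s))

/-- A function which is continuous from `[0, T]` to `L²` is continuous from `[0, T]` to the broken
Sobolev space `H^s(𝒯_h, V)` (where `0 < s < 1`). -/
def ContinuousInHs (s : ℝ) (𝒯 : Finset (Elem d)) (T : ℝ) (f : ℝ → Vec d → V) : Prop :=
  ∀ t ∈ Icc 0 T, ∀ K ∈ 𝒯, sobolevSeminormSq s K (f t) < ∞ ∧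
    Tendsto (fun τ => sobolevSeminormSq s K (fun x => f τ x - f t x)) (𝓝[Icc 0 T] t) (𝓝 0)

/-- The time derivative of a time-dependent broken function, at every point of every element. -/
def dtBroken (T : ℝ) (v : ℝ → Broken d V) (t : ℝ) : Broken d V :=
  fun K x => dt T (fun τ => v τ K x) t

/-- `v ∈ C¹([0,T]; 𝒫_n(𝒯_h, V))`. Since the space is finite dimensional, `C¹` may be tested
pointwise. -/
def IsC1Broken (𝒯 : Finset (Elem d)) (n : ℕ) (T : ℝ) (v : ℝ → Broken d V) : Prop :=
  (∀ t ∈ Icc 0 T, IsBrokenPoly 𝒯 n (v t)) ∧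
  ∀ K ∈ 𝒯, ∀ x, ContDiffOn ℝ 1 (fun t => v t K x) (Icc 0 T)

/-- `w ∈ C¹([0,T]; 𝒫_n(𝓕_h, V))`. -/
def IsC1Skel (Ω : Set (Vec d)) (𝒯 : Finset (Elem d)) (n : ℕ) (T : ℝ) (w : ℝ → Skel d V) : Prop :=
  (∀ t ∈ Icc 0 T, IsSkelPoly Ω 𝒯 n (w t)) ∧
  ∀ F ∈ faces Ω 𝒯, ∀ x ∈ F, ContDiffOn ℝ 1 (fun t => w t F x) (Icc 0 T)

end Spaces

/-! ### Inner products, seminorms and the bilinear form -/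

section Forms

variable {d : ℕ}

/-- The inner product of `𝓗₁` for functions given elementwise. -/
def innerH1 (m : Coefficients d) (𝒯 : Finset (Elem d)) (u p v q : Broken d (Vec d)) : ℝ :=
  m.ρ * volInner 𝒯 u v + m.χ * volInner 𝒯 p q

/-- The inner product of `𝓗₂` for functions given elementwise. -/
def innerH2 (m : Coefficients d) (𝒯 : Finset (Elem d)) (σE σV : Broken d (Sym d)) (ψ : Broken d ℝ)
    (τE τV : Broken d (Sym d)) (φ : Broken d ℝ) : ℝ :=
  volInner 𝒯 (fun K x => m.𝒜 (σE K x)) τE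
    + volInner 𝒯 (fun K x => m.𝒢 (m.ω • σV K x)) (fun K x => m.ω • τV K x)
    + m.s * volInner 𝒯 ψ φ

/-- The stabilisation weight `(k+1) / h_F^{1/2}`. -/
def jumpWeight (k : ℕ) (F : Set (Vec d)) : ℝ := (k + 1) / Real.sqrt (Metric.diam F)

/-- The weight `h_F^{1/2} / (k+1)`. -/
def traceWeight (k : ℕ) (F : Set (Vec d)) : ℝ := Real.sqrt (Metric.diam F) / (k + 1)

/-- The bilinear form `B_h` on polynomial arguments. -/
def Bh (m : Coefficients d) (Ω : Set (Vec d)) (𝒯 : Finset (Elem d))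
    (v : Broken d (Vec d)) (v' : Skel d (Vec d)) (q : Broken d (Vec d)) (q' : Skel d (Vec d))
    (τE τV : Broken d (Sym d)) (φ : Broken d ℝ) : ℝ :=
  volInner 𝒯 (fun K x => m.totalStress (τE K x) (τV K x) (φ K x)) (fun K x => strain (v K) x)
    - volInner 𝒯 φ (fun K x => divergence (q K) x)
    - bdInner Ω 𝒯 (fun _ => 1)
        (fun K F x => mulVecSym (m.totalStress (τE K x) (τV K x) (φ K x)) (normal K F)) (jump v v')
    + bdInner Ω 𝒯 (fun _ => 1) (fun K F x => φ K x • normal K F) (jump q q')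

/-! ### The semi-discrete problem -/

/-- A solution of the semi-discrete HDG problem with polynomial degree `k` (and `k + 1`), sources
`F`, `g`, whose volume unknowns start from the `L²`-projections of the initial values
`u0`, `p0`, `σE0`, `σV0`, `ψ0`. The unknowns with a prime are the ones on the skeleton. -/
structure DiscreteSolution (m : Coefficients d) (Ω : Set (Vec d)) (𝒯 : Finset (Elem d)) (k : ℕ)
    (T : ℝ) (F : ℝ → L2 Ω (Vec d)) (g : ℝ → L2 Ω ℝ)
    (u0 p0 : L2 Ω (Vec d)) (σE0 σV0 : L2 Ω (Sym d)) (ψ0 : L2 Ω ℝ) where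
  u : ℝ → Broken d (Vec d)
  u' : ℝ → Skel d (Vec d)
  p : ℝ → Broken d (Vec d)
  p' : ℝ → Skel d (Vec d)
  σE : ℝ → Broken d (Sym d)
  σV : ℝ → Broken d (Sym d)
  ψ : ℝ → Broken d ℝ
  u_C1 : IsC1Broken 𝒯 (k + 1) T u
  p_C1 : IsC1Broken 𝒯 (k + 1) T p
  u'_C1 : IsC1Skel Ω 𝒯 (k + 1) T u'
  u'_boundary : ∀ t ∈ Icc 0 T, VanishesOnBoundary Ω 𝒯 (u' t)
  p'_C1 : IsC1Skel Ω 𝒯 (k + 1) T p'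
  σE_C1 : IsC1Broken 𝒯 k T σE
  σV_C1 : IsC1Broken 𝒯 k T σV
  ψ_C1 : IsC1Broken 𝒯 k T ψ
  equation : ∀ t ∈ Icc 0 T, ∀ (v q : Broken d (Vec d)) (v' q' : Skel d (Vec d))
      (τE τV : Broken d (Sym d)) (φ : Broken d ℝ),
    IsBrokenPoly 𝒯 (k + 1) v → IsBrokenPoly 𝒯 (k + 1) q →
    IsSkelPoly Ω 𝒯 (k + 1) v' → VanishesOnBoundary Ω 𝒯 v' → IsSkelPoly Ω 𝒯 (k + 1) q' →
    IsBrokenPoly 𝒯 k τE → IsBrokenPoly 𝒯 k τV → IsBrokenPoly 𝒯 k φ →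
    innerH1 m 𝒯 (dtBroken T u t) (dtBroken T p t) v q
      + innerH2 m 𝒯 (dtBroken T σE t) (dtBroken T σV t) (dtBroken T ψ t) τE τV φ
      + volInner 𝒯 (fun K x => m.𝒢 (σV t K x)) (fun K x => m.ω • τV K x)
      + m.β * volInner 𝒯 (p t) q
      + Bh m Ω 𝒯 v v' q q' (σE t) (σV t) (ψ t)
      - Bh m Ω 𝒯 (u t) (u' t) (p t) (p' t) τE τV φ
      + bdInner Ω 𝒯 (fun E => jumpWeight k E ^ 2) (jump (u t) (u' t)) (jump v v')
      + bdInner Ω 𝒯 (fun E => jumpWeight k E ^ 2) (jump (p t) (p' t)) (jump q q')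
    = volInner 𝒯 (fun _ => F t) v + volInner 𝒯 (fun _ => g t) φ
  u_init : ∀ K ∈ 𝒯, ∀ x, u 0 K x = projT (k + 1) u0 K x
  p_init : ∀ K ∈ 𝒯, ∀ x, p 0 K x = projT (k + 1) p0 K x
  σE_init : ∀ K ∈ 𝒯, ∀ x, σE 0 K x = projT k σE0 K x
  σV_init : ∀ K ∈ 𝒯, ∀ x, σV 0 K x = projT k σV0 K x
  ψ_init : ∀ K ∈ 𝒯, ∀ x, ψ 0 K x = projT k ψ0 K x

/-! ### Traces of the exact solution and the quantities in the estimate -/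

variable {m : Coefficients d} {Ω : Set (Vec d)} {T : ℝ} {F : ℝ → L2 Ω (Vec d)} {g : ℝ → L2 Ω ℝ}

/-- The traces of the exact solution on the skeleton of a mesh: `u'` and `p'` are the
(single-valued) restrictions `u|_{𝓕_h}` and `p|_{𝓕_h}`, while `σE`, `σV`, `ψ` are the traces
taken from each element. -/
structure SkeletonTraces (y : ExactSolution m Ω T F g) (𝒯 : Finset (Elem d)) where
  u' : ℝ → Skel d (Vec d)
  p' : ℝ → Skel d (Vec d)
  σE : ℝ → BdFun d (Sym d)
  σV : ℝ → BdFun d (Sym d)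
  ψ : ℝ → BdFun d ℝ
  u_trace : ∀ t ∈ Icc 0 T, ∀ K ∈ 𝒯, ∀ E ∈ facesOf Ω 𝒯 K, IsTrace K E (y.u t) (u' t E)
  p_trace : ∀ t ∈ Icc 0 T, ∀ K ∈ 𝒯, ∀ E ∈ facesOf Ω 𝒯 K, IsTrace K E (y.p t) (p' t E)
  σE_trace : ∀ t ∈ Icc 0 T, ∀ K ∈ 𝒯, ∀ E ∈ facesOf Ω 𝒯 K, IsTrace K E (y.σE t) (σE t K E)
  σV_trace : ∀ t ∈ Icc 0 T, ∀ K ∈ 𝒯, ∀ E ∈ facesOf Ω 𝒯 K, IsTrace K E (y.σV t) (σV t K E)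
  ψ_trace : ∀ t ∈ Icc 0 T, ∀ K ∈ 𝒯, ∀ E ∈ facesOf Ω 𝒯 K, IsTrace K E (y.ψ t) (ψ t K E)

/-- The jump `χ_w - χ̂_w` on `∂𝒯_h` of the projection errors `χ_w = w - Π_𝒯^n w` and
`χ̂_w = w|_{𝓕_h} - Π_𝓕^n (w|_{𝓕_h})`, where `w'` is the restriction `w|_{𝓕_h}`. -/
def projErrorJump (n : ℕ) (w : Vec d → Vec d) (w' : Skel d (Vec d)) : BdFun d (Vec d) :=
  fun K E x => (w' E x - projT n w K x) - (w' E x - projF n w' E x)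

/-- The squared seminorm `|(χ_u, χ̂_u)|²_𝓤` at time `t`. -/
def seminormUSq (y : ExactSolution m Ω T F g) {𝒯 : Finset (Elem d)} (γ : SkeletonTraces y 𝒯)
    (k : ℕ) (t : ℝ) : ℝ≥0∞ :=
  volNormSq 𝒯 (fun K x => y.εu t x - strain (projT (k + 1) (y.u t) K) x)
    + bdNormSq Ω 𝒯 (jumpWeight k) (projErrorJump (k + 1) (y.u t) (γ.u' t))

/-- The squared seminorm `|(χ_p, χ̂_p)|²_𝓠` at time `t`. -/
def seminormQSq (y : ExactSolution m Ω T F g) {𝒯 : Finset (Elem d)} (γ : SkeletonTraces y 𝒯)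
    (k : ℕ) (t : ℝ) : ℝ≥0∞ :=
  volNormSq 𝒯 (fun K x => y.divp t x - divergence (projT (k + 1) (y.p t) K) x)
    + bdNormSq Ω 𝒯 (jumpWeight k) (projErrorJump (k + 1) (y.p t) (γ.p' t))

/-- The integrand on the right-hand side of the estimate. -/
def approxErrorSq (y : ExactSolution m Ω T F g) {𝒯 : Finset (Elem d)} (γ : SkeletonTraces y 𝒯)
    (k : ℕ) (t : ℝ) : ℝ≥0∞ :=
  bdNormSq Ω 𝒯 (traceWeight k) (fun K E x => γ.σE t K E x - projT k (y.σE t) K x)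
    + bdNormSq Ω 𝒯 (traceWeight k) (fun K E x => γ.σV t K E x - projT k (y.σV t) K x)
    + bdNormSq Ω 𝒯 (traceWeight k) (fun K E x => γ.ψ t K E x - projT k (y.ψ t) K x)
    + (seminormUSq y γ k t + seminormQSq y γ k t)

/-- The projected error `Π_𝒯^n w - w_h`. -/
def projError {V : Type} [NormedAddCommGroup V] [InnerProductSpace ℝ V] (n : ℕ) (w : Vec d → V)
    (wh : Broken d V) : Broken d V :=
  fun K x => projT n w K x - wh K x

/-- The squared norm `‖(e_{u,h}, e_{p,h})‖²_{𝓗₁}` at time `t`. -/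
def errorH1Sq (y : ExactSolution m Ω T F g) {𝒯 : Finset (Elem d)} {k : ℕ}
    (yh : DiscreteSolution m Ω 𝒯 k T F g (y.u 0) (y.p 0) (y.σE 0) (y.σV 0) (y.ψ 0)) (t : ℝ) : ℝ :=
  innerH1 m 𝒯 (projError (k + 1) (y.u t) (yh.u t)) (projError (k + 1) (y.p t) (yh.p t))
    (projError (k + 1) (y.u t) (yh.u t)) (projError (k + 1) (y.p t) (yh.p t))

/-- The squared norm `‖(e_{σ_E,h}, e_{σ_V,h}, e_{ψ,h})‖²_{𝓗₂}` at time `t`. -/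
def errorH2Sq (y : ExactSolution m Ω T F g) {𝒯 : Finset (Elem d)} {k : ℕ}
    (yh : DiscreteSolution m Ω 𝒯 k T F g (y.u 0) (y.p 0) (y.σE 0) (y.σV 0) (y.ψ 0)) (t : ℝ) : ℝ :=
  innerH2 m 𝒯 (projError k (y.σE t) (yh.σE t)) (projError k (y.σV t) (yh.σV t))
    (projError k (y.ψ t) (yh.ψ t)) (projError k (y.σE t) (yh.σE t))
    (projError k (y.σV t) (yh.σV t)) (projError k (y.ψ t) (yh.ψ t))

end Forms

end HDG

end

open HDG

/-!
The projected errors `e = Πw - w_h` satisfy the equations of the scheme up to consistency terms, and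
the estimate is an energy estimate for these equations.

The exact solution is first shown to satisfy the scheme when tested with discrete functions
(`exact_tested`). This needs Green's formula on every element for fields that have an `L²` trace and
a weak divergence (`green_element`). It is proved by testing the weak formulation with a cut-off
function of the element. In polar coordinates around the centroid, the contribution of the cut-off
layer converges to the boundary integral of the trace, as traces are defined by averages over such
layers (`tendsto_layer`, `tendsto_boundary_layer`). Summing over the elements shows that the normal
component of the total stress is continuous across interior faces (`bdInner_stress_skel`) and that
functions in `H¹₀(Ω)` have single-valued traces that vanish on `∂Ω` (`sum_trace_H10_ae_eq_zero`,
`trace_H10_boundary`), so that skeleton test functions do not contribute. With hanging nodes a facet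
is, up to a null set, the disjoint union of several faces (`area_restrict_facet`), and almost every
point of an interior face lies on exactly two elements (`area_inter_inter`).

The scheme is subtracted and both equations are tested with the projected errors. Orthogonality of
the projections removes all the terms that are not listed in `energy_identity`. By Young's
inequality the terms with jumps of the discrete error are absorbed by the stabilisation. What
remains are the approximation errors of the statement and traces of discrete errors. The latter
carry the weight `h_F^{1/2} / (k + 1)` and are bounded by the energy with a constant independent of
`h` and `k` (`bdNormSq_le_volNormSq`). This degree-robust inverse inequality rests on
`q(1)² ≤ (n + 1)² ∫₀¹ q²` for polynomials `q` of degree `n` (`eval_one_sq_le`), used on the segments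
from a facet to the opposite vertex, and on shape regularity. The outcome is the differential
inequality `E' ≤ C₁ E + C₂ R` (`exists_energy_estimate`), where `E` is the energy of the projected
errors and `R` is the integrand on the right-hand side of the claim.

The energy is of class `C¹` in time (`energy_contDiffOn`) and vanishes at `t = 0` by the choice of
the initial values (`energy_zero`), so Gronwall's inequality (`gronwall_lintegral`) gives the bound.
-/

noncomputable section

open MeasureTheory Set Filter Topology
open scoped ENNReal NNReal

namespace HDG

variable {d : ℕ}

/-! ### Barycentric coordinates and facets of a simplex -/

/-- The vertices of a nondegenerate `d`-simplex in `ℝᵈ` as an affine basis. -/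
def vertexBasis (K : Elem d) : AffineBasis (Fin (d + 1)) ℝ (Vec d) :=
  ⟨K.points, K.independent, by
    rw [K.independent.affineSpan_eq_top_iff_card_eq_finrank_add_one]
    simp⟩

/-- The `i`-th barycentric coordinate. -/
def bary (K : Elem d) (i : Fin (d + 1)) (x : Vec d) : ℝ := (vertexBasis K).coord i x

/-- The gradient of the `i`-th barycentric coordinate. -/
def baryGrad (K : Elem d) (i : Fin (d + 1)) : Vec d :=
  (InnerProductSpace.toDual ℝ (Vec d)).symm
    (LinearMap.toContinuousLinearMap ((vertexBasis K).coord i).linear)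

lemma bary_sub (K : Elem d) (i : Fin (d + 1)) (x y : Vec d) :
    bary K i y = bary K i x + inner ℝ (baryGrad K i) (y - x) := by
  unfold baryGrad bary
  rw [InnerProductSpace.toDual_symm_apply]
  have := ((vertexBasis K).coord i).linearMap_vsub y x
  simp only [vsub_eq_sub] at this
  rw [LinearMap.coe_toContinuousLinearMap', this]
  ring

lemma bary_lineMap (K : Elem d) (i : Fin (d + 1)) (x c : Vec d) (δ : ℝ) :
    bary K i (x + δ • (c - x)) = (1 - δ) * bary K i x + δ * bary K i c := by
  rw [bary_sub K i x (x + δ • (c - x)), bary_sub K i x c, add_sub_cancel_left, inner_smul_right]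
  ring

lemma bary_point (K : Elem d) (i j : Fin (d + 1)) :
    bary K i (K.points j) = if i = j then 1 else 0 := by
  classical
  exact (vertexBasis K).coord_apply i j

lemma sum_bary (K : Elem d) (x : Vec d) : ∑ i, bary K i x = 1 :=
  (vertexBasis K).sum_coord_apply_eq_one x

lemma eq_of_bary_eq (K : Elem d) {x y : Vec d} (h : ∀ i, bary K i x = bary K i y) : x = y :=
  (vertexBasis K).ext_elem h

lemma sum_bary_smul (K : Elem d) (x : Vec d) : ∑ i, bary K i x • K.points i = x :=
  (vertexBasis K).linear_combination_coord_eq_self x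

lemma continuous_bary (K : Elem d) (i : Fin (d + 1)) : Continuous (bary K i) :=
  continuous_barycentric_coord (vertexBasis K) i

lemma body_eq (K : Elem d) : body K = {x | ∀ i, 0 ≤ bary K i x} :=
  (vertexBasis K).convexHull_eq_nonneg_coord

lemma mem_body {K : Elem d} {x : Vec d} : x ∈ body K ↔ ∀ i, 0 ≤ bary K i x := by
  rw [body_eq]; rfl

lemma mem_interior_body {K : Elem d} {x : Vec d} : x ∈ interior (body K) ↔ ∀ i, 0 < bary K i x := by
  have : interior (body K) = {x | ∀ i, 0 < bary K i x} := (vertexBasis K).interior_convexHull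
  rw [this]; rfl

lemma bary_le_one {K : Elem d} {x : Vec d} (hx : x ∈ body K) (i : Fin (d + 1)) :
    bary K i x ≤ 1 := by
  rw [← sum_bary K x]
  exact Finset.single_le_sum (f := fun i => bary K i x) (fun j _ => mem_body.1 hx j)
    (Finset.mem_univ i)

lemma convex_body (K : Elem d) : Convex ℝ (body K) := convex_convexHull _ _

lemma isCompact_body (K : Elem d) : IsCompact (body K) :=
  (finite_range K.points).isCompact_convexHull ℝ

lemma isClosed_body (K : Elem d) : IsClosed (body K) := (isCompact_body K).isClosed

lemma facet_subset_body (K : Elem d) (i : Fin (d + 1)) : facet K i ⊆ body K :=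
  convexHull_mono (image_subset_range _ _)

lemma mem_facet {K : Elem d} {i : Fin (d + 1)} {x : Vec d} :
    x ∈ facet K i ↔ x ∈ body K ∧ bary K i x = 0 := by
  constructor
  · intro hx
    refine ⟨facet_subset_body K i hx, ?_⟩
    have hconv : Convex ℝ {x | bary K i x = 0} := by
      have : {x | bary K i x = 0} = ((vertexBasis K).coord i) ⁻¹' {0} := rfl
      rw [this]
      exact (convex_singleton (0 : ℝ)).affine_preimage _
    refine convexHull_min ?_ hconv hx
    rintro _ ⟨j, hj, rfl⟩
    simp only [mem_ofPred_eq] at hj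
    change bary K i (K.points j) = 0
    rw [bary_point, if_neg (Ne.symm hj)]
  · rintro ⟨hx, h0⟩
    rw [mem_body] at hx
    have h1 := sum_bary K x
    have h2 := sum_bary_smul K x
    rw [← Finset.add_sum_erase _ _ (Finset.mem_univ i), h0, zero_add] at h1
    rw [← Finset.add_sum_erase _ _ (Finset.mem_univ i), h0, zero_smul, zero_add] at h2
    rw [← h2]
    refine (convex_convexHull ℝ _).sum_mem (fun j _ => hx j) h1 fun j hj => ?_
    exact subset_convexHull _ _ ⟨j, Finset.ne_of_mem_erase hj, rfl⟩

lemma isCompact_facet (K : Elem d) (i : Fin (d + 1)) : IsCompact (facet K i) :=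
  ((toFinite _).image _).isCompact_convexHull ℝ

lemma isClosed_facet (K : Elem d) (i : Fin (d + 1)) : IsClosed (facet K i) :=
  (isCompact_facet K i).isClosed

/-- The centroid of an element. -/
def center (K : Elem d) : Vec d := Finset.univ.centroid ℝ K.points

lemma bary_center (K : Elem d) (i : Fin (d + 1)) : bary K i (center K) = ((d : ℝ) + 1)⁻¹ := by
  have := (vertexBasis K).coord_apply_centroid (Finset.mem_univ i)
  rw [Finset.card_univ, Fintype.card_fin] at this
  push_cast at this
  exact this

lemma baryGrad_ne_zero (hd : 1 ≤ d) (K : Elem d) (i : Fin (d + 1)) : baryGrad K i ≠ 0 := by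
  intro h
  have h1 := bary_sub K i (center K) (K.points i)
  rw [h, inner_zero_left, bary_point, if_pos rfl, bary_center] at h1
  have : (1 : ℝ) ≤ d := by exact_mod_cast hd
  have h2 : ((d : ℝ) + 1) * 1 = ((d : ℝ) + 1) * (((d : ℝ) + 1)⁻¹ + 0) := by rw [← h1]
  rw [add_zero, mul_inv_cancel₀ (by positivity)] at h2
  linarith

lemma center_mem_interior (K : Elem d) : center K ∈ interior (body K) := by
  rw [mem_interior_body]
  intro i
  rw [bary_center]
  positivity

lemma closure_interior_body (K : Elem d) : closure (interior (body K)) = body K := by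
  rw [(convex_body K).closure_interior_eq_closure_of_nonempty_interior
    ⟨_, center_mem_interior K⟩, (isClosed_body K).closure_eq]

lemma volume_frontier_body (K : Elem d) : volume (frontier (body K)) = 0 :=
  (convex_body K).addHaar_frontier _

/-! ### Integration over cones -/

/-- The point that divides the segment from `x` to the apex `c` in the ratio `δ : 1 - δ`. -/
def coneMap (c : Vec d) (z : ℝ × Vec d) : Vec d := z.2 + z.1 • (c - z.2)

lemma continuous_coneMap (c : Vec d) : Continuous (coneMap c) := by
  unfold coneMap; fun_prop

lemma bary_coneMap (K : Elem d) (i : Fin (d + 1)) (c : Vec d) (z : ℝ × Vec d) :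
    bary K i (coneMap c z) = (1 - z.1) * bary K i z.2 + z.1 * bary K i c :=
  bary_lineMap K i z.2 c z.1

/-- The open cone with base `E` and apex `c`. -/
def cone (c : Vec d) (E : Set (Vec d)) : Set (Vec d) := coneMap c '' (Ioo 0 1 ×ˢ E)

lemma volume_eq_lintegral_area (p v : Vec d) (hv : v ≠ 0) {t : Set (Vec d)}
    (ht : MeasurableSet t) :
    volume t = ‖v‖ₑ * ∫⁻ r : ℝ, area d (t ∩ {y | inner ℝ v (y - p) = r * ‖v‖ ^ 2}) := by
  have h := EuclideanGeometry.euclideanHausdorffMeasure_eq_lintegral p hv ht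
  rw [finrank_euclideanSpace_fin] at h
  rw [EuclideanSpace.euclideanHausdorffMeasure_eq_volume] at h
  rw [h]
  congr 1
  refine lintegral_congr fun r => ?_
  unfold area
  congr 2
  ext y
  simp only [SetLike.mem_coe, AffineSubspace.mem_mk', mem_ofPred_eq, vsub_eq_sub, vadd_eq_add]
  rw [Submodule.mem_orthogonal_singleton_iff_inner_right]
  rw [show y - (r • v + p) = (y - p) - r • v by abel, inner_sub_right, inner_smul_right,
    real_inner_self_eq_norm_sq, sub_eq_zero]

lemma mem_cone_iff {K : Elem d} {i : Fin (d + 1)} {c : Vec d} (hc : 0 < bary K i c)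
    {E : Set (Vec d)} (hE : ∀ x ∈ E, bary K i x = 0) {y : Vec d} :
    y ∈ cone c E ↔ (0 < bary K i y ∧ bary K i y < bary K i c) ∧
      c + (1 - bary K i y / bary K i c)⁻¹ • (y - c) ∈ E := by
  constructor
  · rintro ⟨⟨δ, x⟩, ⟨hδ, hx⟩, rfl⟩
    simp only [mem_Ioo] at hδ
    have h := bary_coneMap K i c (δ, x)
    simp only [hE x hx, mul_zero, zero_add] at h
    have h1 : 1 - δ ≠ 0 := by linarith [hδ.2]
    refine ⟨?_, ?_⟩
    · rw [h]; constructor <;> nlinarith [hδ.1, hδ.2]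
    · rw [h, mul_div_cancel_right₀ _ hc.ne']
      have : coneMap c (δ, x) - c = (1 - δ) • (x - c) := by
        simp only [coneMap]; module
      rw [this, smul_smul, inv_mul_cancel₀ h1, one_smul, add_sub_cancel]
      exact hx
  · rintro ⟨⟨h0, h1⟩, h2⟩
    have hδ : bary K i y / bary K i c < 1 := (div_lt_one hc).2 h1
    refine ⟨(bary K i y / bary K i c, _), ⟨⟨div_pos h0 hc, hδ⟩, h2⟩, ?_⟩
    have h3 : 1 - bary K i y / bary K i c ≠ 0 := by linarith
    simp only [coneMap]
    set δ := bary K i y / bary K i c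
    have : c + (1 - δ)⁻¹ • (y - c) + δ • (c - (c + (1 - δ)⁻¹ • (y - c)))
        = c + ((1 - δ) * (1 - δ)⁻¹) • (y - c) := by module
    rw [this, mul_inv_cancel₀ h3, one_smul, add_sub_cancel]

lemma measurableSet_cone {K : Elem d} {i : Fin (d + 1)} {c : Vec d} (hc : 0 < bary K i c)
    {E : Set (Vec d)} (hE : ∀ x ∈ E, bary K i x = 0) (hEm : MeasurableSet E) :
    MeasurableSet (cone c E) := by
  have : cone c E = (bary K i ⁻¹' Ioo 0 (bary K i c)) ∩
      (fun y => c + (1 - bary K i y / bary K i c)⁻¹ • (y - c)) ⁻¹' E := by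
    ext y
    exact mem_cone_iff hc hE
  rw [this]
  have hb := (continuous_bary K i).measurable
  refine (hb measurableSet_Ioo).inter ?_
  have hm : Measurable fun y => c + (1 - bary K i y / bary K i c)⁻¹ • (y - c) :=
    measurable_const.add (((hb.div_const _).const_sub 1).inv.smul (measurable_id.sub_const c))
  exact hm hEm

/-- The distance of the apex `c` from the hyperplane of the `i`-th facet. -/
def coneHeight (K : Elem d) (i : Fin (d + 1)) (c : Vec d) : ℝ := bary K i c / ‖baryGrad K i‖

/-- The volume of a part of a cone, sliced by hyperplanes parallel to the base. The slice at relative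
height `r` is the image of a part of `E` under the homothety with centre `c` and ratio `1 - r`,
which scales the surface measure by `(1 - r)^(d-1)`. -/
lemma volume_inter_cone (hd : 1 ≤ d) {K : Elem d} {i : Fin (d + 1)} {c : Vec d}
    (hc : 0 < bary K i c) {E : Set (Vec d)} (hE : ∀ x ∈ E, bary K i x = 0) (hEm : MeasurableSet E)
    {t : Set (Vec d)} (ht : MeasurableSet t) :
    volume (t ∩ cone c E) = ENNReal.ofReal (coneHeight K i c) *
      ∫⁻ r in Ioo (0 : ℝ) 1, ENNReal.ofReal ((1 - r) ^ (d - 1)) *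
        area d (E ∩ {x | coneMap c (r, x) ∈ t}) := by
  have ha := baryGrad_ne_zero hd K i
  have hna : 0 < ‖baryGrad K i‖ := norm_pos_iff.2 ha
  set a := baryGrad K i with ha_def
  set L := bary K i c with hL
  set v : Vec d := (L / ‖a‖ ^ 2) • a with hv
  have hv0 : v ≠ 0 := smul_ne_zero (by positivity) ha
  have hnv : ‖v‖ = coneHeight K i c := by
    rw [hv, norm_smul, Real.norm_of_nonneg (by positivity), coneHeight, ← ha_def, ← hL]
    field_simp
  have hnv' : ‖v‖ₑ = ENNReal.ofReal (coneHeight K i c) := by rw [← hnv, ofReal_norm]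
  have key : ∀ (r : ℝ) (y : Vec d), inner ℝ v (y - (c - v)) = r * ‖v‖ ^ 2 ↔ bary K i y = r * L := by
    intro r y
    have h1 := bary_sub K i c y
    rw [← ha_def, ← hL] at h1
    have h2 : y - (c - v) = (y - c) + v := by abel
    rw [h2, inner_add_right, real_inner_self_eq_norm_sq, hv, real_inner_smul_left, norm_smul,
      Real.norm_of_nonneg (by positivity), h1]
    have hLne := hc.ne'
    constructor
    · intro h
      field_simp at h
      linarith
    · intro h
      have : inner ℝ a (y - c) = r * L - L := by linarith
      rw [this]
      field_simp
      ring
  rw [volume_eq_lintegral_area (c - v) v hv0 (ht.inter (measurableSet_cone hc hE hEm)),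
    hnv', ← lintegral_indicator measurableSet_Ioo]
  congr 1
  refine lintegral_congr fun r => ?_
  by_cases hr : r ∈ Ioo (0 : ℝ) 1
  · rw [indicator_of_mem hr]
    have hr1 : 0 < 1 - r := by linarith [hr.2]
    have himg : t ∩ cone c E ∩ {y | inner ℝ v (y - (c - v)) = r * ‖v‖ ^ 2}
        = AffineMap.homothety c (1 - r) '' (E ∩ {x | coneMap c (r, x) ∈ t}) := by
      have hh : ∀ x, AffineMap.homothety c (1 - r) x = coneMap c (r, x) := by
        intro x
        simp only [AffineMap.homothety_apply, coneMap, vsub_eq_sub, vadd_eq_add]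
        module
      ext y
      constructor
      · rintro ⟨⟨hyt, ⟨δ, x⟩, ⟨hδ, hx⟩, rfl⟩, hy⟩
        have h := (key _ _).1 hy
        rw [bary_coneMap, ← hL] at h
        simp only [hE x hx, mul_zero, zero_add] at h
        have : δ = r := mul_right_cancel₀ hc.ne' h
        subst this
        exact ⟨x, ⟨hx, hyt⟩, hh x⟩
      · rintro ⟨x, ⟨hx, hxt⟩, rfl⟩
        rw [hh]
        refine ⟨⟨hxt, ⟨(r, x), ⟨hr, hx⟩, rfl⟩⟩, ?_⟩
        refine (key _ _).2 ?_
        rw [bary_coneMap, ← hL]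
        simp [hE x hx]
    rw [himg, area, euclideanHausdorffMeasure_homothety_image _ _ hr1.ne']
    rw [ENNReal.smul_def, smul_eq_mul]
    congr 1
    rw [ENNReal.ofReal_pow hr1.le, ENNReal.coe_pow, ← enorm_eq_nnnorm,
      Real.enorm_of_nonneg hr1.le]
  · rw [indicator_of_notMem hr]
    have : t ∩ cone c E ∩ {y | inner ℝ v (y - (c - v)) = r * ‖v‖ ^ 2} = ∅ := by
      ext y
      simp only [mem_empty_iff_false, iff_false]
      rintro ⟨⟨hyt, ⟨δ, x⟩, ⟨hδ, hx⟩, rfl⟩, hy⟩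
      have h := (key _ _).1 hy
      rw [bary_coneMap, ← hL] at h
      simp only [hE x hx, mul_zero, zero_add] at h
      exact hr (mul_right_cancel₀ hc.ne' h ▸ hδ)
    rw [this, measure_empty]

lemma coneHeight_pos (hd : 1 ≤ d) {K : Elem d} {i : Fin (d + 1)} {c : Vec d}
    (hc : 0 < bary K i c) : 0 < coneHeight K i c :=
  div_pos hc (norm_pos_iff.2 (baryGrad_ne_zero hd K i))

/-- The measure `(1 - δ)^(d-1) dδ` on `(0, 1)`, the radial part of the volume of a cone. -/
def radial (d : ℕ) : Measure ℝ :=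
  (volume.restrict (Ioo 0 1)).withDensity fun δ => ENNReal.ofReal ((1 - δ) ^ (d - 1))

lemma measurable_radial_density (d : ℕ) :
    Measurable fun δ : ℝ => ENNReal.ofReal ((1 - δ) ^ (d - 1)) := by
  fun_prop

lemma radial_le (d : ℕ) : radial d ≤ volume.restrict (Ioo (0 : ℝ) 1) := by
  rw [radial]
  calc _ ≤ (volume.restrict (Ioo (0 : ℝ) 1)).withDensity 1 := by
        refine withDensity_mono ?_
        refine (ae_restrict_iff' measurableSet_Ioo).2 (Eventually.of_forall fun δ hδ => ?_)
        simp only [Pi.one_apply]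
        rw [ENNReal.ofReal_le_one]
        exact pow_le_one₀ (by linarith [hδ.2]) (by linarith [hδ.1])
    _ = _ := withDensity_one

instance : IsFiniteMeasure (radial d) :=
  isFiniteMeasure_of_le _ (radial_le d)

lemma radial_univ_pos (d : ℕ) :
    0 < ∫⁻ r in Ioo (0 : ℝ) 1, ENNReal.ofReal ((1 - r) ^ (d - 1)) := by
  rw [setLIntegral_pos_iff (measurable_radial_density d)]
  have : Ioo (0 : ℝ) 1 ⊆ Function.support (fun r : ℝ => ENNReal.ofReal ((1 - r) ^ (d - 1)))
      ∩ Ioo 0 1 := by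
    intro r hr
    refine ⟨?_, hr⟩
    rw [Function.mem_support]
    have : 0 < 1 - r := by linarith [hr.2]
    have : 0 < (1 - r) ^ (d - 1) := by positivity
    simpa using this
  exact lt_of_lt_of_le (by simp) (measure_mono this)

lemma volume_cone (hd : 1 ≤ d) {K : Elem d} {i : Fin (d + 1)} {c : Vec d}
    (hc : 0 < bary K i c) {E : Set (Vec d)} (hE : ∀ x ∈ E, bary K i x = 0)
    (hEm : MeasurableSet E) :
    volume (cone c E) = ENNReal.ofReal (coneHeight K i c) *
      ((∫⁻ r in Ioo (0 : ℝ) 1, ENNReal.ofReal ((1 - r) ^ (d - 1))) * area d E) := by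
  have := volume_inter_cone hd hc hE hEm MeasurableSet.univ
  simp only [univ_inter, mem_univ, ofPred_true, inter_univ] at this
  rw [this, lintegral_mul_const _ (measurable_radial_density d)]

/-- The cone formula read backwards: the surface measure of a flat set is finite if the volume of the
cone over it is. -/
lemma area_lt_top_of_volume_cone (hd : 1 ≤ d) {K : Elem d} {i : Fin (d + 1)} {c : Vec d}
    (hc : 0 < bary K i c) {E : Set (Vec d)} (hE : ∀ x ∈ E, bary K i x = 0)
    (hEm : MeasurableSet E) (h : volume (cone c E) < ∞) : area d E < ∞ := by
  rw [volume_cone hd hc hE hEm] at h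
  by_contra hcon
  rw [not_lt, top_le_iff] at hcon
  rw [hcon, ENNReal.mul_top (radial_univ_pos d).ne', ENNReal.mul_top] at h
  · exact lt_irrefl _ h
  · simpa using coneHeight_pos hd hc

lemma area_eq_zero_of_volume_cone (hd : 1 ≤ d) {K : Elem d} {i : Fin (d + 1)} {c : Vec d}
    (hc : 0 < bary K i c) {E : Set (Vec d)} (hE : ∀ x ∈ E, bary K i x = 0)
    (hEm : MeasurableSet E) (h : volume (cone c E) = 0) : area d E = 0 := by
  rw [volume_cone hd hc hE hEm] at h
  have h1 := coneHeight_pos hd hc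
  rcases mul_eq_zero.1 h with h | h
  · simp only [ENNReal.ofReal_eq_zero] at h; linarith
  · exact (mul_eq_zero.1 h).resolve_left (radial_univ_pos d).ne'

lemma cone_subset_body {K : Elem d} {c : Vec d} (hc : c ∈ body K) {E : Set (Vec d)}
    (hE : E ⊆ body K) : cone c E ⊆ body K := by
  rintro _ ⟨⟨δ, x⟩, ⟨hδ, hx⟩, rfl⟩
  have : coneMap c (δ, x) = (1 - δ) • x + δ • c := by simp only [coneMap]; module
  rw [this]
  exact convex_body K (hE hx) hc (by linarith [hδ.2]) hδ.1.le (by ring)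

lemma volume_body_lt_top (K : Elem d) : volume (body K) < ∞ := (isCompact_body K).measure_lt_top

lemma point_mem_body (K : Elem d) (i : Fin (d + 1)) : K.points i ∈ body K :=
  subset_convexHull _ _ (mem_range_self i)

lemma bary_point_self (K : Elem d) (i : Fin (d + 1)) : bary K i (K.points i) = 1 := by
  rw [bary_point, if_pos rfl]

lemma bary_center_pos (K : Elem d) (i : Fin (d + 1)) : 0 < bary K i (center K) := by
  rw [bary_center]; positivity

lemma bary_eq_zero_of_mem_facet {K : Elem d} {i : Fin (d + 1)} {x : Vec d} (hx : x ∈ facet K i) :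
    bary K i x = 0 := (mem_facet.1 hx).2

lemma area_facet_lt_top (hd : 1 ≤ d) (K : Elem d) (i : Fin (d + 1)) : area d (facet K i) < ∞ := by
  refine area_lt_top_of_volume_cone hd (bary_center_pos K i)
    (fun x hx => bary_eq_zero_of_mem_facet hx) (isClosed_facet K i).measurableSet ?_
  exact (measure_mono (cone_subset_body (interior_subset (center_mem_interior K))
    (facet_subset_body K i))).trans_lt (volume_body_lt_top K)

/-- The polar decomposition of the volume of a cone. -/
theorem volume_restrict_cone (hd : 1 ≤ d) {K : Elem d} {i : Fin (d + 1)} {c : Vec d}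
    (hc : 0 < bary K i c) {E : Set (Vec d)} (hE : ∀ x ∈ E, bary K i x = 0)
    (hEm : MeasurableSet E) (hfin : area d E < ∞) :
    volume.restrict (cone c E) = ENNReal.ofReal (coneHeight K i c) •
      ((radial d).prod ((area d).restrict E)).map (coneMap c) := by
  have : IsFiniteMeasure ((area d).restrict E) := ⟨by simpa using hfin⟩
  ext t ht
  have hm : MeasurableSet (coneMap c ⁻¹' t) := (continuous_coneMap c).measurable ht
  rw [Measure.restrict_apply ht, volume_inter_cone hd hc hE hEm ht, Measure.smul_apply, smul_eq_mul,
    Measure.map_apply (continuous_coneMap c).measurable ht, Measure.prod_apply hm, radial,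
    lintegral_withDensity_eq_lintegral_mul _ (measurable_radial_density d)
      (measurable_measure_prodMk_left hm)]
  congr 1
  refine lintegral_congr fun r => ?_
  simp only [Pi.mul_apply]
  rw [Measure.restrict_apply (measurable_prodMk_left hm), inter_comm]
  rfl

lemma volume_hyperplane (a : Vec d) (ha : a ≠ 0) (t : ℝ) : volume {y : Vec d | inner ℝ a y = t} = 0 := by
  have h : {y : Vec d | inner ℝ a y = t}
      = (AffineSubspace.mk' ((t / ‖a‖ ^ 2) • a) (Submodule.span ℝ {a})ᗮ : Set (Vec d)) := by
    ext y
    simp only [SetLike.mem_coe, AffineSubspace.mem_mk', mem_ofPred_eq, vsub_eq_sub]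
    rw [Submodule.mem_orthogonal_singleton_iff_inner_right, inner_sub_right, inner_smul_right,
      real_inner_self_eq_norm_sq, div_mul_cancel₀ _ (by simpa using ha), sub_eq_zero]
  rw [h]
  refine Measure.addHaar_affineSubspace _ _ fun htop => ha ?_
  have h2 : (AffineSubspace.mk' ((t / ‖a‖ ^ 2) • a) (Submodule.span ℝ {a})ᗮ).direction = ⊤ := by
    rw [htop, AffineSubspace.direction_top]
  rw [AffineSubspace.direction_mk'] at h2
  have h3 : a ∈ (Submodule.span ℝ {a})ᗮ := h2 ▸ Submodule.mem_top
  rw [Submodule.mem_orthogonal_singleton_iff_inner_right] at h3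
  exact inner_self_eq_zero.1 h3

lemma bary_eq_inner (K : Elem d) (i : Fin (d + 1)) (y : Vec d) :
    bary K i y = bary K i 0 + inner ℝ (baryGrad K i) y := by
  simpa using bary_sub K i 0 y

lemma baryGrad_ne (K : Elem d) {i j : Fin (d + 1)} (hij : i ≠ j) :
    baryGrad K i ≠ baryGrad K j := by
  intro h
  have h1 := bary_sub K i (K.points j) (K.points i)
  have h2 := bary_sub K j (K.points j) (K.points i)
  rw [h] at h1
  simp only [bary_point, if_neg hij, if_neg hij.symm, if_true] at h1 h2
  linarith

lemma volume_bary_eq (K : Elem d) {i j : Fin (d + 1)} (hij : i ≠ j) :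
    volume {y | bary K i y = bary K j y} = 0 := by
  have h := volume_hyperplane (baryGrad K i - baryGrad K j) (sub_ne_zero.2 (baryGrad_ne K hij))
    (bary K j 0 - bary K i 0)
  refine measure_mono_null (fun y hy => ?_) h
  simp only [mem_ofPred_eq] at hy ⊢
  rw [bary_eq_inner K i, bary_eq_inner K j] at hy
  rw [inner_sub_left]
  linarith

/-- Two facets of a simplex intersect in a set of vanishing surface measure. -/
lemma area_facet_inter_facet (hd : 1 ≤ d) (K : Elem d) {i j : Fin (d + 1)} (hij : i ≠ j) :
    area d (facet K i ∩ facet K j) = 0 := by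
  have hc : 0 < bary K i (K.points i) := by rw [bary_point_self]; exact one_pos
  refine area_eq_zero_of_volume_cone hd hc
    (fun x hx => bary_eq_zero_of_mem_facet hx.1)
    ((isClosed_facet K i).inter (isClosed_facet K j)).measurableSet ?_
  refine measure_mono_null ?_ (volume_hyperplane (baryGrad K j) (baryGrad_ne_zero hd K j)
    (-bary K j 0))
  rintro _ ⟨z, ⟨_, hx⟩, rfl⟩
  have h := bary_coneMap K j (K.points i) z
  rw [bary_eq_zero_of_mem_facet hx.2, bary_point, if_neg hij.symm, bary_eq_inner] at h
  simp only [mem_ofPred_eq]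
  linarith

/-- Up to a null set, a simplex is the disjoint union of the cones over its facets with the centroid
as apex. -/
theorem volume_restrict_body (hd : 2 ≤ d) (K : Elem d) :
    volume.restrict (body K) =
      ∑ i, volume.restrict (cone (center K) (facet K i)) := by
  have hm : ∀ i, MeasurableSet (cone (center K) (facet K i)) := fun i =>
    measurableSet_cone (bary_center_pos K i) (fun x hx => bary_eq_zero_of_mem_facet hx)
      (isClosed_facet K i).measurableSet
  have hle : ∀ i, ∀ y ∈ cone (center K) (facet K i), ∀ j, bary K i y ≤ bary K j y := by
    rintro i _ ⟨z, ⟨hz, hx⟩, rfl⟩ j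
    rw [bary_coneMap, bary_coneMap, bary_center, bary_center, bary_eq_zero_of_mem_facet hx]
    have := mem_body.1 (facet_subset_body K i hx) j
    have : 0 ≤ (1 - z.1) * bary K j z.2 := mul_nonneg (by linarith [hz.2]) this
    linarith
  have hae : body K =ᵐ[volume] ⋃ i, cone (center K) (facet K i) := by
    refine Filter.EventuallyLE.antisymm ?_ ?_
    · have h1 : ∀ᵐ y ∂(volume : Measure (Vec d)), y ∉ frontier (body K) :=
        compl_mem_ae_iff.2 (volume_frontier_body K)
      have : Nonempty (Fin d) := ⟨⟨0, by omega⟩⟩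
      have h2 : ∀ᵐ y ∂(volume : Measure (Vec d)), y ≠ center K := by
        have : Nontrivial (Vec d) := by
          infer_instance
        exact compl_mem_ae_iff.2 (measure_singleton _)
      filter_upwards [h1, h2] with y hy1 hy2 hy
      have hyi : y ∈ interior (body K) := by
        by_contra hcon
        exact hy1 ⟨subset_closure hy, hcon⟩
      rw [mem_interior_body] at hyi
      -- The cone that contains `y` belongs to the smallest barycentric coordinate.
      obtain ⟨i, -, hi⟩ := Finset.exists_min_image Finset.univ (fun i => bary K i y)
        ⟨0, Finset.mem_univ _⟩
      have hi' : ∀ j, bary K i y ≤ bary K j y := fun j => hi j (Finset.mem_univ j)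
      have hlt : bary K i y < bary K i (center K) := by
        by_contra hcon
        rw [not_lt, bary_center] at hcon
        refine hy2 (eq_of_bary_eq K fun j => ?_)
        rw [bary_center]
        have hsum : ∑ j, (bary K j y - ((d : ℝ) + 1)⁻¹) = 0 := by
          rw [Finset.sum_sub_distrib, sum_bary]
          simp only [Finset.sum_const, Finset.card_univ, Fintype.card_fin, nsmul_eq_mul]
          push_cast
          rw [mul_inv_cancel₀ (by positivity), sub_self]
        have := (Finset.sum_eq_zero_iff_of_nonneg
          (fun j _ => sub_nonneg.2 (hcon.trans (hi' j)))).1 hsum j (Finset.mem_univ j)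
        linarith
      refine mem_iUnion.2 ⟨i, (mem_cone_iff (bary_center_pos K i)
        (fun x hx => bary_eq_zero_of_mem_facet hx)).2 ⟨⟨hyi i, hlt⟩, ?_⟩⟩
      have hb : ∀ j, bary K j (center K + (1 - bary K i y / bary K i (center K))⁻¹ •
          (y - center K)) = (1 - bary K i y / bary K i (center K))⁻¹ *
            (bary K j y - bary K i y) := by
        intro j
        have hlt' : bary K i y / bary K i (center K) < 1 :=
          (div_lt_one (bary_center_pos K i)).2 hlt
        rw [bary_sub K j (center K), add_sub_cancel_left, inner_smul_right]
        have := bary_sub K j (center K) y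
        have h3 : inner ℝ (baryGrad K j) (y - center K) = bary K j y - bary K j (center K) := by
          linarith
        have h4 : 1 - bary K i y / bary K i (center K) ≠ 0 := by linarith
        rw [h3]
        rw [eq_inv_mul_iff_mul_eq₀ h4, mul_add, mul_inv_cancel_left₀ h4, bary_center, bary_center]
        field_simp
        ring
      rw [mem_facet, mem_body]
      refine ⟨fun j => ?_, ?_⟩
      · rw [hb]
        refine mul_nonneg (inv_nonneg.2 ?_) (sub_nonneg.2 (hi' j))
        have hlt' : bary K i y / bary K i (center K) < 1 :=
          (div_lt_one (bary_center_pos K i)).2 hlt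
        linarith
      · rw [hb]; simp
    · refine Eventually.of_forall fun y hy => ?_
      obtain ⟨i, hi⟩ := mem_iUnion.1 hy
      exact cone_subset_body (interior_subset (center_mem_interior K)) (facet_subset_body K i) hi
  rw [Measure.restrict_congr_set hae, Measure.restrict_iUnion_ae ?_ fun i => (hm i).nullMeasurableSet,
    Measure.sum_fintype]
  intro i j hij
  refine measure_mono_null (fun y hy => ?_) (volume_bary_eq K hij)
  exact le_antisymm (hle i y hy.1 j) (hle j y hy.2 i)

/-! ### The faces of a mesh -/

/-- The union of the pairwise intersections of the facets, i.e. the faces of codimension two. It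
contains no relative interior point of a facet. -/
def ridge (K : Elem d) : Set (Vec d) := ⋃ i, ⋃ j, ⋃ (_ : i ≠ j), facet K i ∩ facet K j

lemma area_ridge (hd : 1 ≤ d) (K : Elem d) : area d (ridge K) = 0 := by
  simp only [ridge, measure_iUnion_null_iff]
  exact fun i j hij => area_facet_inter_facet hd K hij

lemma bary_pos_of_notMem_ridge {K : Elem d} {x : Vec d} (hx : x ∉ ridge K) {i j : Fin (d + 1)}
    (hi : x ∈ facet K i) (hij : j ≠ i) : 0 < bary K j x := by
  have hK := facet_subset_body K i hi
  refine lt_of_le_of_ne (mem_body.1 hK j) fun h0 => hx ?_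
  simp only [ridge, mem_iUnion]
  exact ⟨i, j, hij.symm, hi, mem_facet.2 ⟨hK, h0.symm⟩⟩

lemma facet_unique_of_notMem_ridge {K : Elem d} {x : Vec d} (hx : x ∉ ridge K) {i j : Fin (d + 1)}
    (hi : x ∈ facet K i) (hj : x ∈ facet K j) : i = j := by
  by_contra hij
  have := bary_pos_of_notMem_ridge hx hi (Ne.symm hij)
  rw [(mem_facet.1 hj).2] at this
  exact lt_irrefl _ this

lemma exists_facet_of_notMem_interior {K : Elem d} {x : Vec d} (hx : x ∈ body K)
    (hx' : x ∉ interior (body K)) : ∃ i, x ∈ facet K i := by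
  rw [mem_interior_body] at hx'
  push Not at hx'
  obtain ⟨i, hi⟩ := hx'
  exact ⟨i, mem_facet.2 ⟨hx, le_antisymm hi (mem_body.1 hx i)⟩⟩

lemma notMem_interior_of_mem_facet {K : Elem d} {x : Vec d} {i : Fin (d + 1)}
    (hx : x ∈ facet K i) : x ∉ interior (body K) := fun h => by
  have := mem_interior_body.1 h i
  rw [(mem_facet.1 hx).2] at this
  exact lt_irrefl _ this

variable {Ω : Set (Vec d)} {κ γ : ℝ} {𝒯 : Finset (Elem d)}

lemma interior_body_subset (hΩ : IsPolyhedralDomain Ω) (hT : IsMesh Ω κ γ 𝒯) {K : Elem d}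
    (hK : K ∈ 𝒯) : interior (body K) ⊆ Ω := by
  rw [← hΩ.regular]
  refine interior_mono ?_
  rw [← hT.cover]
  exact subset_biUnion_of_mem (u := fun K => body K) hK

lemma body_subset_closure (hT : IsMesh Ω κ γ 𝒯) {K : Elem d} (hK : K ∈ 𝒯) :
    body K ⊆ closure Ω := by
  rw [← hT.cover]
  exact subset_biUnion_of_mem (u := fun K => body K) hK

/-- An open set that meets an element also meets its interior. -/
lemma inter_interior_nonempty {K : Elem d} {U : Set (Vec d)} (hU : IsOpen U) {x : Vec d}
    (hx : x ∈ body K) (hxU : x ∈ U) : (U ∩ interior (body K)).Nonempty := by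
  rw [← closure_interior_body K] at hx
  exact mem_closure_iff.1 hx U hU hxU

lemma disjoint_interior_body (hT : IsMesh Ω κ γ 𝒯) {K K' : Elem d}
    (hK : K ∈ 𝒯) (hK' : K' ∈ 𝒯) (hne : K ≠ K') : Disjoint (interior (body K)) (body K') := by
  rw [Set.disjoint_left]
  intro x hx hx'
  obtain ⟨y, hy, hy'⟩ := inter_interior_nonempty isOpen_interior hx' hx
  exact Set.disjoint_left.1 (hT.disjoint K hK K' hK' hne) hy hy'

/-- Two elements that share a relative interior point of a facet of each lie on opposite sides of
that facet and cover a neighbourhood of the point. -/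
lemma union_mem_nhds (hT : IsMesh Ω κ γ 𝒯) {K K' : Elem d} (hK : K ∈ 𝒯) (hK' : K' ∈ 𝒯)
    (hne : K ≠ K') {x : Vec d} (hx : x ∈ body K) (hx' : x ∈ body K') (hr : x ∉ ridge K)
    (hr' : x ∉ ridge K') : body K ∪ body K' ∈ 𝓝 x := by
  obtain ⟨i, hi⟩ := exists_facet_of_notMem_interior hx fun h =>
    Set.disjoint_left.1 (disjoint_interior_body hT hK hK' hne) h hx'
  obtain ⟨j, hj⟩ := exists_facet_of_notMem_interior hx' fun h =>
    Set.disjoint_left.1 (disjoint_interior_body hT hK' hK hne.symm) h hx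
  have hU : ∀ᶠ y in 𝓝 x, (∀ l, l ≠ i → 0 < bary K l y) ∧ ∀ l, l ≠ j → 0 < bary K' l y := by
    refine (eventually_all.2 fun l => ?_).and (eventually_all.2 fun l => ?_)
    · by_cases hl : l = i
      · exact Eventually.of_forall fun _ h => absurd hl h
      · filter_upwards [(continuous_bary K l).continuousAt.eventually
          (lt_mem_nhds (bary_pos_of_notMem_ridge hr hi hl))] with y hy _ using hy
    · by_cases hl : l = j
      · exact Eventually.of_forall fun _ h => absurd hl h
      · filter_upwards [(continuous_bary K' l).continuousAt.eventually
          (lt_mem_nhds (bary_pos_of_notMem_ridge hr' hj hl))] with y hy _ using hy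
  have hrefl : Tendsto (fun y : Vec d => x + (x - y)) (𝓝 x) (𝓝 x) := by
    have : Continuous fun y : Vec d => x + (x - y) := by fun_prop
    simpa using this.tendsto x
  filter_upwards [hU, hrefl.eventually hU] with y hy hy'
  -- Otherwise the reflection of `y` in `x` would lie in the interior of both elements.
  by_contra hcon
  simp only [mem_union, not_or] at hcon
  have h1 : bary K i y < 0 := by
    by_contra h
    refine hcon.1 (mem_body.2 fun l => ?_)
    by_cases hl : l = i
    · subst hl; exact not_lt.1 h
    · exact (hy.1 l hl).le
  have h2 : bary K' j y < 0 := by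
    by_contra h
    refine hcon.2 (mem_body.2 fun l => ?_)
    by_cases hl : l = j
    · subst hl; exact not_lt.1 h
    · exact (hy.2 l hl).le
  have h3 : ∀ (L : Elem d) (l : Fin (d + 1)), bary L l x = 0 →
      bary L l (x + (x - y)) = - bary L l y := by
    intro L l h0
    have e1 := bary_sub L l x (x + (x - y))
    have e2 := bary_sub L l x y
    rw [show x + (x - y) - x = -(y - x) by abel, inner_neg_right] at e1
    linarith
  refine Set.disjoint_left.1 (hT.disjoint K hK K' hK' hne)
    (show x + (x - y) ∈ _ from mem_interior_body.2 fun l => ?_) (mem_interior_body.2 fun l => ?_)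
  · by_cases hl : l = i
    · subst hl; rw [h3 K l (mem_facet.1 hi).2]; linarith
    · exact hy'.1 l hl
  · by_cases hl : l = j
    · subst hl; rw [h3 K' l (mem_facet.1 hj).2]; linarith
    · exact hy'.2 l hl

/-- At almost every common point of two elements, these fill a neighbourhood, so that the point is
interior to the closure of `Ω`. As `Ω` is regular, the point is not on `∂Ω`. -/
lemma area_inter_frontier (hd : 1 ≤ d) (hΩ : IsPolyhedralDomain Ω) (hT : IsMesh Ω κ γ 𝒯)
    {K K' : Elem d} (hK : K ∈ 𝒯) (hK' : K' ∈ 𝒯) (hne : K ≠ K') :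
    area d (body K ∩ body K' ∩ frontier Ω) = 0 := by
  refine measure_mono_null (fun x hx => ?_)
    (measure_union_null (area_ridge hd K) (area_ridge hd K'))
  by_contra hcon
  simp only [mem_union, not_or] at hcon
  have h := union_mem_nhds hT hK hK' hne hx.1.1 hx.1.2 hcon.1 hcon.2
  have h1 : x ∈ interior (closure Ω) := mem_interior_iff_mem_nhds.2
    (mem_of_superset h (union_subset (body_subset_closure hT hK) (body_subset_closure hT hK')))
  rw [hΩ.regular] at h1
  exact hΩ.isOpen.frontier_eq ▸ hx.2 |>.2 h1

/-- At almost every common point of two elements, these fill a neighbourhood, which leaves no room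
for a third element. -/
lemma area_inter_inter (hd : 1 ≤ d) (hT : IsMesh Ω κ γ 𝒯)
    {K₁ K₂ K₃ : Elem d} (h₁ : K₁ ∈ 𝒯) (h₂ : K₂ ∈ 𝒯) (h₃ : K₃ ∈ 𝒯) (h₁₂ : K₁ ≠ K₂) (h₁₃ : K₁ ≠ K₃)
    (h₂₃ : K₂ ≠ K₃) : area d (body K₁ ∩ body K₂ ∩ body K₃) = 0 := by
  refine measure_mono_null (fun x hx => ?_)
    (measure_union_null (area_ridge hd K₁) (area_ridge hd K₂))
  by_contra hcon
  simp only [mem_union, not_or] at hcon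
  have h := union_mem_nhds hT h₁ h₂ h₁₂ hx.1.1 hx.1.2 hcon.1 hcon.2
  obtain ⟨y, hyU, hy⟩ := inter_interior_nonempty isOpen_interior hx.2
    (mem_interior_iff_mem_nhds.2 h)
  rcases interior_subset hyU with hy' | hy'
  · exact Set.disjoint_left.1 (disjoint_interior_body hT h₃ h₁ h₁₃.symm) hy hy'
  · exact Set.disjoint_left.1 (disjoint_interior_body hT h₃ h₂ h₂₃.symm) hy hy'

lemma mem_interiorFaces {F : Set (Vec d)} : F ∈ interiorFaces 𝒯 ↔
    ∃ K ∈ 𝒯, ∃ K' ∈ 𝒯, K ≠ K' ∧ 0 < area d (body K ∩ body K') ∧ body K ∩ body K' = F := by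
  simp only [interiorFaces, Finset.mem_image, Finset.mem_filter, Finset.mem_product, Prod.exists]
  constructor
  · rintro ⟨a, b, ⟨⟨ha, hb⟩, hne, hpos⟩, h⟩
    exact ⟨a, ha, b, hb, hne, hpos, h⟩
  · rintro ⟨a, ha, b, hb, hne, hpos, h⟩
    exact ⟨a, b, ⟨⟨ha, hb⟩, hne, hpos⟩, h⟩

lemma mem_boundaryFaces {F : Set (Vec d)} : F ∈ boundaryFaces Ω 𝒯 ↔
    ∃ K ∈ 𝒯, ∃ i, facet K i ∩ frontier Ω = F ∧ 0 < area d F := by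
  simp only [boundaryFaces, Finset.mem_filter, Finset.mem_image, Finset.mem_product, Prod.exists,
    Finset.mem_univ, and_true]
  constructor
  · rintro ⟨⟨K, i, hK, h⟩, hpos⟩
    exact ⟨K, hK, i, h, hpos⟩
  · rintro ⟨K, hK, i, h, hpos⟩
    exact ⟨⟨K, i, hK, h⟩, hpos⟩

lemma mem_faces {F : Set (Vec d)} :
    F ∈ faces Ω 𝒯 ↔ F ∈ interiorFaces 𝒯 ∨ F ∈ boundaryFaces Ω 𝒯 := by
  simp only [faces, Finset.mem_union]

lemma mem_facesOf {F : Set (Vec d)} {K : Elem d} :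
    F ∈ facesOf Ω 𝒯 K ↔ F ∈ faces Ω 𝒯 ∧ F ⊆ body K := by
  simp only [facesOf, Finset.mem_filter]

lemma area_pos_of_mem_faces {F : Set (Vec d)} (hF : F ∈ faces Ω 𝒯) : 0 < area d F := by
  rcases mem_faces.1 hF with h | h
  · obtain ⟨K, _, K', _, _, hpos, rfl⟩ := mem_interiorFaces.1 h; exact hpos
  · obtain ⟨K, _, i, _, hpos⟩ := mem_boundaryFaces.1 h; exact hpos

lemma isCompact_of_mem_faces {F : Set (Vec d)} (hF : F ∈ faces Ω 𝒯) : IsCompact F := by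
  rcases mem_faces.1 hF with h | h
  · obtain ⟨K, _, K', _, _, hpos, rfl⟩ := mem_interiorFaces.1 h
    exact (isCompact_body K).inter_right (isClosed_body K')
  · obtain ⟨K, _, i, rfl, hpos⟩ := mem_boundaryFaces.1 h
    exact (isCompact_facet K i).inter_right isClosed_frontier

lemma measurableSet_of_mem_faces {F : Set (Vec d)} (hF : F ∈ faces Ω 𝒯) : MeasurableSet F :=
  (isCompact_of_mem_faces hF).measurableSet

/-- An element that contains a face between two elements is one of the two. -/
lemma eq_or_eq_of_inter_subset (hd : 1 ≤ d) (hT : IsMesh Ω κ γ 𝒯)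
    {K K₁ K₂ : Elem d} (hK : K ∈ 𝒯) (h₁ : K₁ ∈ 𝒯) (h₂ : K₂ ∈ 𝒯) (h₁₂ : K₁ ≠ K₂)
    (hpos : 0 < area d (body K₁ ∩ body K₂)) (hsub : body K₁ ∩ body K₂ ⊆ body K) :
    K = K₁ ∨ K = K₂ := by
  by_contra hcon
  push Not at hcon
  have h := area_inter_inter hd hT h₁ h₂ hK h₁₂ hcon.1.symm hcon.2.symm
  rw [inter_eq_left.2 hsub] at h
  exact hpos.ne' h

/-- Only one element contains a given boundary face. -/
lemma eq_of_boundaryFace_subset (hd : 1 ≤ d) (hΩ : IsPolyhedralDomain Ω) (hT : IsMesh Ω κ γ 𝒯)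
    {K K' : Elem d} (hK : K ∈ 𝒯) (hK' : K' ∈ 𝒯) {F : Set (Vec d)} (hF : F ∈ boundaryFaces Ω 𝒯)
    (h : F ⊆ body K) (h' : F ⊆ body K') : K = K' := by
  by_contra hne
  obtain ⟨K₁, _, i, rfl, hpos⟩ := mem_boundaryFaces.1 hF
  refine hpos.ne' (measure_mono_null (fun x hx => ?_) (area_inter_frontier hd hΩ hT hK hK' hne))
  exact ⟨⟨h hx, h' hx⟩, hx.2⟩

/-- A face of `K` is the intersection of `K` with another element, or the part of one of its own
facets that lies on `∂Ω`. -/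
lemma facesOf_cases (hd : 1 ≤ d) (hΩ : IsPolyhedralDomain Ω) (hT : IsMesh Ω κ γ 𝒯) {K : Elem d}
    (hK : K ∈ 𝒯) {F : Set (Vec d)} (hF : F ∈ facesOf Ω 𝒯 K) :
    (∃ K' ∈ 𝒯, K ≠ K' ∧ F = body K ∩ body K') ∨ ∃ i, F = facet K i ∩ frontier Ω := by
  obtain ⟨hF, hsub⟩ := mem_facesOf.1 hF
  rcases mem_faces.1 hF with h | h
  · left
    obtain ⟨K₁, h₁, K₂, h₂, hne, hpos, rfl⟩ := mem_interiorFaces.1 h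
    rcases eq_or_eq_of_inter_subset hd hT hK h₁ h₂ hne hpos hsub with rfl | rfl
    · exact ⟨K₂, h₂, hne, rfl⟩
    · exact ⟨K₁, h₁, hne.symm, inter_comm _ _⟩
  · right
    obtain ⟨K₁, h₁, i, hi, hpos⟩ := mem_boundaryFaces.1 h
    have : F ⊆ body K₁ := hi ▸ inter_subset_left.trans (facet_subset_body K₁ i)
    obtain rfl := eq_of_boundaryFace_subset hd hΩ hT hK h₁ h hsub this
    exact ⟨i, hi.symm⟩

/-- Every face of an element lies in one of its facets, also if there are hanging nodes. -/
lemma exists_facet_of_mem_facesOf (hd : 1 ≤ d) (hΩ : IsPolyhedralDomain Ω) (hT : IsMesh Ω κ γ 𝒯)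
    {K : Elem d} (hK : K ∈ 𝒯) {F : Set (Vec d)} (hF : F ∈ facesOf Ω 𝒯 K) :
    ∃ i, F ⊆ facet K i := by
  rcases facesOf_cases hd hΩ hT hK hF with ⟨K', hK', hne, rfl⟩ | ⟨i, rfl⟩
  · have hpos := area_pos_of_mem_faces (mem_facesOf.1 hF).1
    obtain ⟨x, hx, hxr⟩ : ∃ x ∈ body K ∩ body K', x ∉ ridge K := by
      by_contra hcon
      push Not at hcon
      exact hpos.ne' (measure_mono_null hcon (area_ridge hd K))
    have hdisj := Set.disjoint_left.1 (disjoint_interior_body hT hK hK' hne)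
    obtain ⟨i, hi⟩ := exists_facet_of_notMem_interior hx.1 fun h => hdisj h hx.2
    refine ⟨i, fun y hy => mem_facet.2 ⟨hy.1, ?_⟩⟩
    by_contra hne0
    have hypos : 0 < bary K i y := lt_of_le_of_ne (mem_body.1 hy.1 i) (Ne.symm hne0)
    -- The midpoint of `x` and `y` lies in the interior of `K` and in `K'`.
    have hmid : x + (1 / 2 : ℝ) • (y - x) = (1 / 2 : ℝ) • x + (1 / 2 : ℝ) • y := by module
    refine hdisj (show x + (1 / 2 : ℝ) • (y - x) ∈ _ from mem_interior_body.2 fun l => ?_) ?_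
    · rw [bary_lineMap]
      have h1 := mem_body.1 hy.1 l
      by_cases hl : l = i
      · subst hl
        rw [(mem_facet.1 hi).2]
        linarith
      · have := bary_pos_of_notMem_ridge hxr hi hl
        linarith
    · rw [hmid]
      exact convex_body K' hx.2 hy.2 (by norm_num) (by norm_num) (by norm_num)
  · exact ⟨i, inter_subset_left⟩

/-- The index of the facet of `K` that contains the face `F`, and `0` if no facet does. -/
def facetIndex (K : Elem d) (F : Set (Vec d)) : Fin (d + 1) :=
  open Classical in if h : ∃ i, F ⊆ facet K i then h.choose else 0

lemma subset_facetIndex (hd : 1 ≤ d) (hΩ : IsPolyhedralDomain Ω) (hT : IsMesh Ω κ γ 𝒯)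
    {K : Elem d} (hK : K ∈ 𝒯) {F : Set (Vec d)} (hF : F ∈ facesOf Ω 𝒯 K) :
    F ⊆ facet K (facetIndex K F) := by
  have h := exists_facet_of_mem_facesOf hd hΩ hT hK hF
  rw [facetIndex, dif_pos h]
  exact h.choose_spec

lemma area_lt_top_of_mem_facesOf (hd : 1 ≤ d) (hΩ : IsPolyhedralDomain Ω) (hT : IsMesh Ω κ γ 𝒯)
    {K : Elem d} (hK : K ∈ 𝒯) {F : Set (Vec d)} (hF : F ∈ facesOf Ω 𝒯 K) : area d F < ∞ :=
  (measure_mono (subset_facetIndex hd hΩ hT hK hF)).trans_lt (area_facet_lt_top hd K _)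

lemma exists_mem_of_mem_faces {F : Set (Vec d)} (hF : F ∈ faces Ω 𝒯) :
    ∃ K ∈ 𝒯, F ∈ facesOf Ω 𝒯 K := by
  rcases mem_faces.1 hF with h | h
  · obtain ⟨K, hK, K', _, _, hpos, rfl⟩ := mem_interiorFaces.1 h
    exact ⟨K, hK, mem_facesOf.2 ⟨hF, inter_subset_left⟩⟩
  · obtain ⟨K, hK, i, rfl, hpos⟩ := mem_boundaryFaces.1 h
    exact ⟨K, hK, mem_facesOf.2 ⟨hF, inter_subset_left.trans (facet_subset_body K i)⟩⟩

/-- Distinct faces of the mesh overlap in a set of vanishing surface measure. -/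
lemma area_face_inter_face (hd : 1 ≤ d) (hΩ : IsPolyhedralDomain Ω) (hT : IsMesh Ω κ γ 𝒯)
    {F F' : Set (Vec d)} (hF : F ∈ faces Ω 𝒯) (hF' : F' ∈ faces Ω 𝒯) (hne : F ≠ F') :
    area d (F ∩ F') = 0 := by
  have hib : ∀ F ∈ interiorFaces 𝒯, ∀ F' ∈ boundaryFaces Ω 𝒯, area d (F ∩ F') = 0 := by
    intro F hF F' hF'
    obtain ⟨K₁, h₁, K₂, h₂, h₁₂, -, rfl⟩ := mem_interiorFaces.1 hF
    obtain ⟨K₃, h₃, i, rfl, -⟩ := mem_boundaryFaces.1 hF'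
    refine measure_mono_null ?_ (area_inter_frontier hd hΩ hT h₁ h₂ h₁₂)
    exact fun x hx => ⟨hx.1, hx.2.2⟩
  rcases mem_faces.1 hF with h | h <;> rcases mem_faces.1 hF' with h' | h'
  · obtain ⟨K₁, h₁, K₂, h₂, h₁₂, -, rfl⟩ := mem_interiorFaces.1 h
    obtain ⟨K₃, h₃, K₄, h₄, h₃₄, -, rfl⟩ := mem_interiorFaces.1 h'
    by_cases h31 : K₃ = K₁ ∨ K₃ = K₂
    · by_cases h41 : K₄ = K₁ ∨ K₄ = K₂
      · exfalso
        rcases h31 with rfl | rfl <;> rcases h41 with rfl | rfl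
        · exact h₃₄ rfl
        · exact hne rfl
        · exact hne (inter_comm _ _)
        · exact h₃₄ rfl
      · push Not at h41
        refine measure_mono_null ?_ (area_inter_inter hd hT h₁ h₂ h₄ h₁₂ h41.1.symm h41.2.symm)
        exact fun x hx => ⟨hx.1, hx.2.2⟩
    · push Not at h31
      refine measure_mono_null ?_ (area_inter_inter hd hT h₁ h₂ h₃ h₁₂ h31.1.symm h31.2.symm)
      exact fun x hx => ⟨hx.1, hx.2.1⟩
  · exact hib F h F' h'
  · rw [inter_comm]; exact hib F' h' F h
  · obtain ⟨K₁, h₁, i, rfl, -⟩ := mem_boundaryFaces.1 h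
    obtain ⟨K₂, h₂, j, rfl, -⟩ := mem_boundaryFaces.1 h'
    by_cases hK : K₁ = K₂
    · subst hK
      by_cases hij : i = j
      · subst hij; exact absurd rfl hne
      · refine measure_mono_null ?_ (area_facet_inter_facet hd K₁ hij)
        exact fun x hx => ⟨hx.1.1, hx.2.1⟩
    · refine measure_mono_null ?_ (area_inter_frontier hd hΩ hT h₁ h₂ hK)
      exact fun x hx => ⟨⟨facet_subset_body _ _ hx.1.1, facet_subset_body _ _ hx.2.1⟩, hx.1.2⟩

/-- Almost every point of the boundary of an element lies on one of its faces. -/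
lemma ae_exists_face (hΩ : IsPolyhedralDomain Ω) (hT : IsMesh Ω κ γ 𝒯)
    {K : Elem d} (hK : K ∈ 𝒯) (i : Fin (d + 1)) :
    ∀ᵐ x ∂(area d), x ∈ facet K i → ∃ F ∈ facesOf Ω 𝒯 K, x ∈ F := by
  have h1 : ∀ᵐ x ∂(area d), x ∈ facet K i ∩ frontier Ω → 0 < area d (facet K i ∩ frontier Ω) := by
    by_cases h : area d (facet K i ∩ frontier Ω) = 0
    · filter_upwards [compl_mem_ae_iff.2 h] with x hx hx' using absurd hx' hx
    · exact Eventually.of_forall fun _ _ => pos_iff_ne_zero.2 h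
  have h2 : ∀ᵐ x ∂(area d), ∀ K' ∈ 𝒯, x ∈ body K ∩ body K' → 0 < area d (body K ∩ body K') := by
    refine (ae_ball_iff 𝒯.countable_toSet).2 fun K' _ => ?_
    by_cases h : area d (body K ∩ body K') = 0
    · filter_upwards [compl_mem_ae_iff.2 h] with x hx hx' using absurd hx' hx
    · exact Eventually.of_forall fun _ _ => pos_iff_ne_zero.2 h
  filter_upwards [h1, h2] with x hx1 hx2 hx
  by_cases hfr : x ∈ frontier Ω
  · have hpos := hx1 ⟨hx, hfr⟩
    exact ⟨_, mem_facesOf.2 ⟨mem_faces.2 (Or.inr (mem_boundaryFaces.2 ⟨K, hK, i, rfl, hpos⟩)),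
      inter_subset_left.trans (facet_subset_body K i)⟩, hx, hfr⟩
  · have hxK := facet_subset_body K i hx
    have hxΩ : x ∈ Ω := by
      by_contra hcon
      exact hfr (hΩ.isOpen.frontier_eq ▸ ⟨body_subset_closure hT hK hxK, hcon⟩)
    obtain ⟨K', hK', hne, hxK'⟩ : ∃ K' ∈ 𝒯, K ≠ K' ∧ x ∈ body K' := by
      by_contra hcon
      push Not at hcon
      -- Without a second element through `x`, the element `K` alone covers `Ω` near `x`.
      refine notMem_interior_of_mem_facet hx (mem_interior_iff_mem_nhds.2 ?_)
      have hev : ∀ᶠ y in 𝓝 x, ∀ K' ∈ 𝒯, K ≠ K' → y ∉ body K' := by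
        refine (Finset.eventually_all 𝒯).2 fun K' hK' => ?_
        by_cases hne : K = K'
        · exact Eventually.of_forall fun _ h => absurd hne h
        · filter_upwards [(isClosed_body K').isOpen_compl.mem_nhds (hcon K' hK' hne)] with y hy _
            using hy
      filter_upwards [hev, hΩ.isOpen.mem_nhds hxΩ] with y hy hyΩ
      have hy' : y ∈ ⋃ K ∈ 𝒯, body K := hT.cover ▸ subset_closure hyΩ
      obtain ⟨L, hL, hyL⟩ := mem_iUnion₂.1 hy'
      by_contra hcon'
      refine hy L hL ?_ hyL
      rintro rfl
      exact hcon' hyL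
    exact ⟨_, mem_facesOf.2 ⟨mem_faces.2 (Or.inl (mem_interiorFaces.2
      ⟨K, hK, K', hK', hne, hx2 K' hK' ⟨hxK, hxK'⟩, rfl⟩)), inter_subset_left⟩, hxK, hxK'⟩

open Classical in
/-- Up to a null set, a facet is the disjoint union of the faces that it contains. With hanging nodes
there may be several of them. -/
lemma area_restrict_facet (hd : 1 ≤ d) (hΩ : IsPolyhedralDomain Ω) (hT : IsMesh Ω κ γ 𝒯)
    {K : Elem d} (hK : K ∈ 𝒯) (i : Fin (d + 1)) :
    (area d).restrict (facet K i) =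
      ∑ F ∈ facesOf Ω 𝒯 K with facetIndex K F = i, (area d).restrict F := by
  have hae : facet K i =ᵐ[area d] ⋃ F : {F // F ∈ facesOf Ω 𝒯 K ∧ facetIndex K F = i}, F.1 := by
    refine Filter.EventuallyLE.antisymm ?_ ?_
    · filter_upwards [ae_exists_face hΩ hT hK i, compl_mem_ae_iff.2 (area_ridge hd K)] with x hx hr hxi
      obtain ⟨F, hF, hxF⟩ := hx hxi
      exact mem_iUnion.2 ⟨⟨F, hF, facet_unique_of_notMem_ridge hr
        (subset_facetIndex hd hΩ hT hK hF hxF) hxi⟩, hxF⟩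
    · refine Eventually.of_forall fun x hx => ?_
      obtain ⟨⟨F, hF, rfl⟩, hxF⟩ := mem_iUnion.1 hx
      exact subset_facetIndex hd hΩ hT hK hF hxF
  let _ : Fintype {F // F ∈ facesOf Ω 𝒯 K ∧ facetIndex K F = i} :=
    Fintype.subtype ((facesOf Ω 𝒯 K).filter fun F => facetIndex K F = i) (by simp)
  rw [Measure.restrict_congr_set hae, Measure.restrict_iUnion_ae]
  · rw [Measure.sum_fintype,
      Finset.sum_subtype (p := fun F => F ∈ facesOf Ω 𝒯 K ∧ facetIndex K F = i)]
    simp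
  · intro F F' hne
    exact area_face_inter_face hd hΩ hT (mem_facesOf.1 F.2.1).1 (mem_facesOf.1 F'.2.1).1
      fun h => hne (Subtype.ext h)
  · exact fun F => (measurableSet_of_mem_faces (mem_facesOf.1 F.2.1).1).nullMeasurableSet

/-- Polar decomposition of the volume of an element over its faces. -/
theorem volume_restrict_body_eq_sum_faces (hd : 2 ≤ d) (hΩ : IsPolyhedralDomain Ω)
    (hT : IsMesh Ω κ γ 𝒯) {K : Elem d} (hK : K ∈ 𝒯) :
    volume.restrict (body K) = ∑ F ∈ facesOf Ω 𝒯 K,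
      ENNReal.ofReal (coneHeight K (facetIndex K F) (center K)) •
        ((radial d).prod ((area d).restrict F)).map (coneMap (center K)) := by
  classical
  have hd1 : 1 ≤ d := by omega
  rw [volume_restrict_body hd K, ← Finset.sum_fiberwise (facesOf Ω 𝒯 K) (facetIndex K)]
  refine Finset.sum_congr rfl fun i _ => ?_
  rw [volume_restrict_cone hd1 (bary_center_pos K i) (fun x hx => bary_eq_zero_of_mem_facet hx)
    (isClosed_facet K i).measurableSet (area_facet_lt_top hd1 K i),
    area_restrict_facet hd1 hΩ hT hK i]
  have hfin : ∀ F ∈ (facesOf Ω 𝒯 K).filter (fun F => facetIndex K F = i),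
      IsFiniteMeasure ((area d).restrict F) := fun F hF =>
    ⟨by simpa using area_lt_top_of_mem_facesOf hd1 hΩ hT hK (Finset.mem_filter.1 hF).1⟩
  have hfin' : IsFiniteMeasure
      (∑ F ∈ facesOf Ω 𝒯 K with facetIndex K F = i, (area d).restrict F) := by
    rw [← area_restrict_facet hd1 hΩ hT hK i]
    exact ⟨by simpa using area_facet_lt_top hd1 K i⟩
  have hc := (continuous_coneMap (center K)).measurable
  ext t ht
  rw [Measure.smul_apply, Measure.map_apply hc ht, Measure.prod_apply (hc ht),
    Measure.finsetSum_apply]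
  simp only [Measure.finsetSum_apply]
  rw [lintegral_finsetSum', Finset.smul_sum]
  · refine Finset.sum_congr rfl fun F hF => ?_
    have := hfin F hF
    rw [Measure.smul_apply, Measure.map_apply hc ht, Measure.prod_apply (hc ht),
      (Finset.mem_filter.1 hF).2]
  · intro F hF
    have := hfin F hF
    exact (measurable_measure_prodMk_left (hc ht)).aemeasurable

/-- The outward normal of a face is the normalised negative gradient of the barycentric coordinate
that vanishes on it. -/
lemma normal_eq (hd : 1 ≤ d) (hΩ : IsPolyhedralDomain Ω) (hT : IsMesh Ω κ γ 𝒯)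
    {K : Elem d} (hK : K ∈ 𝒯) {F : Set (Vec d)} (hF : F ∈ facesOf Ω 𝒯 K) :
    normal K F = -(‖baryGrad K (facetIndex K F)‖⁻¹ • baryGrad K (facetIndex K F)) := by
  set i := facetIndex K F with hi_def
  set a := baryGrad K i with ha_def
  have hna : 0 < ‖a‖ := norm_pos_iff.2 (baryGrad_ne_zero hd K i)
  have hsub := subset_facetIndex hd hΩ hT hK hF
  obtain ⟨x, hx, hxr⟩ : ∃ x ∈ F, x ∉ ridge K := by
    by_contra hcon
    push Not at hcon
    exact (area_pos_of_mem_faces (mem_facesOf.1 hF).1).ne' (measure_mono_null hcon (area_ridge hd K))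
  have hxi := hsub hx
  have h : ∃ n : Vec d, ‖n‖ = 1 ∧ ∀ x ∈ F, ∀ y ∈ body K, inner ℝ n (y - x) ≤ 0 := by
    refine ⟨-(‖a‖⁻¹ • a), ?_, fun x hx y hy => ?_⟩
    · rw [norm_neg, norm_smul, norm_inv, norm_norm, inv_mul_cancel₀ hna.ne']
    · have h1 := bary_sub K i x y
      rw [(mem_facet.1 (hsub hx)).2, zero_add] at h1
      rw [inner_neg_left, real_inner_smul_left, ← h1]
      have := mem_body.1 hy i
      have : 0 ≤ ‖a‖⁻¹ * bary K i y := by positivity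
      linarith
  rw [normal, dif_pos h]
  obtain ⟨hn1, hn⟩ := h.choose_spec
  set n := h.choose
  set t := inner ℝ a n / ‖a‖ ^ 2 with ht
  -- The tangential part `n - t a` of the normal vanishes.
  have hz : n - t • a = 0 := by
    set z := n - t • a with hz_def
    have haz : inner ℝ a z = 0 := by
      rw [hz_def, inner_sub_right, inner_smul_right, real_inner_self_eq_norm_sq, ht,
        div_mul_cancel₀ _ (by positivity), sub_self]
    -- A small tangential displacement of `x` stays in `K`.
    have hev : ∀ᶠ ε : ℝ in 𝓝 0, ∀ l, l ≠ i → 0 < bary K l (x + ε • z) := by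
      refine eventually_all.2 fun l => ?_
      by_cases hl : l = i
      · exact Eventually.of_forall fun _ h => absurd hl h
      · have hc : Continuous fun ε : ℝ => bary K l (x + ε • z) :=
          (continuous_bary K l).comp (by fun_prop)
        have h0 : 0 < bary K l (x + (0 : ℝ) • z) := by
          simpa using bary_pos_of_notMem_ridge hxr hxi hl
        filter_upwards [hc.continuousAt.eventually (lt_mem_nhds h0)] with ε hε _ using hε
    obtain ⟨ε, hε, hε0⟩ := ((hev.filter_mono nhdsWithin_le_nhds).and
      (self_mem_nhdsWithin (a := (0 : ℝ)) (s := Ioi 0))).exists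
    have hmem : x + ε • z ∈ body K := mem_body.2 fun l => by
      by_cases hl : l = i
      · rw [hl, bary_sub K i x, add_sub_cancel_left, inner_smul_right, ← ha_def, haz,
          (mem_facet.1 hxi).2]
        simp
      · exact (hε l hl).le
    have h1 := hn x hx _ hmem
    rw [add_sub_cancel_left, inner_smul_right] at h1
    have h2 : inner ℝ n z = ‖z‖ ^ 2 := by
      have : n = z + t • a := by rw [hz_def]; abel
      rw [this, inner_add_left, real_inner_smul_left, haz, real_inner_self_eq_norm_sq]
      ring
    rw [h2] at h1
    have h3 : ‖z‖ ^ 2 ≤ 0 := by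
      by_contra hcon
      exact absurd h1 (not_le.2 (mul_pos hε0 (not_le.1 hcon)))
    exact norm_eq_zero.1 (pow_eq_zero_iff two_ne_zero |>.1 (le_antisymm h3 (sq_nonneg _)))
  have hnt : n = t • a := sub_eq_zero.1 hz
  have ht0 : t ≤ 0 := by
    have h1 := hn x hx (center K) (interior_subset (center_mem_interior K))
    have h2 := bary_sub K i x (center K)
    rw [(mem_facet.1 hxi).2, zero_add] at h2
    rw [hnt, real_inner_smul_left, ← h2] at h1
    by_contra hcon
    exact absurd h1 (not_le.2 (mul_pos (not_le.1 hcon) (bary_center_pos K i)))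
  have ht1 : -t * ‖a‖ = 1 := by
    rw [← hn1, hnt, norm_smul, Real.norm_of_nonpos ht0]
  have ht2 : t = -‖a‖⁻¹ := by
    have := eq_inv_of_mul_eq_one_left ht1
    linarith
  rw [hnt, ht2, neg_smul]

/-! ### Polynomial functions -/

lemma IsPolyReal.add {n : ℕ} {f g : Vec d → ℝ} (hf : IsPolyReal n f) (hg : IsPolyReal n g) :
    IsPolyReal n (fun x => f x + g x) := by
  obtain ⟨P, hP, hfP⟩ := hf
  obtain ⟨Q, hQ, hgQ⟩ := hg
  exact ⟨P + Q, (MvPolynomial.totalDegree_add _ _).trans (max_le hP hQ), fun x => by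
    simp only [hfP, hgQ, map_add]⟩

lemma IsPolyReal.const_mul {n : ℕ} {f : Vec d → ℝ} (hf : IsPolyReal n f) (c : ℝ) :
    IsPolyReal n (fun x => c * f x) := by
  obtain ⟨P, hP, hfP⟩ := hf
  refine ⟨c • P, (MvPolynomial.totalDegree_smul_le _ _).trans hP, fun x => by
    simp only [hfP, MvPolynomial.smul_eval]⟩

lemma isPolyReal_zero (n : ℕ) : IsPolyReal n (fun _ : Vec d => 0) :=
  ⟨0, by simp, fun x => by simp⟩

lemma hasFDerivAt_eval (P : MvPolynomial (Fin d) ℝ) (x : Vec d) :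
    HasFDerivAt (fun y : Vec d => MvPolynomial.eval (fun i => y i) P)
      (∑ i, MvPolynomial.eval (fun i => x i) (MvPolynomial.pderiv i P) •
        (EuclideanSpace.proj i : Vec d →L[ℝ] ℝ)) x := by
  induction P using MvPolynomial.induction_on with
  | C a => simpa using hasFDerivAt_const a x
  | add p q hp hq =>
    simp only [map_add, add_smul, Finset.sum_add_distrib]
    exact hp.add hq
  | mul_X p i hp =>
    have h1 : HasFDerivAt (fun y : Vec d => y i) (EuclideanSpace.proj i : Vec d →L[ℝ] ℝ) x :=
      (EuclideanSpace.proj i : Vec d →L[ℝ] ℝ).hasFDerivAt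
    have h2 := hp.mul h1
    simp only [map_mul, MvPolynomial.eval_X]
    refine h2.congr_fderiv ?_
    ext v
    simp only [Derivation.leibniz, MvPolynomial.pderiv_X, map_add, smul_eq_mul, map_mul,
      MvPolynomial.eval_X, add_smul, Finset.sum_add_distrib, Finset.smul_sum]
    simp only [Pi.single_apply, _root_.add_apply, _root_.smul_apply,
      _root_.sum_apply, smul_eq_mul, PiLp.proj_apply]
    congr 1
    · rw [Finset.sum_eq_single i]
      · simp
      · intro b _ hb; simp [hb.symm]
      · simp
    · refine Finset.sum_congr rfl fun j _ => by ring

lemma totalDegree_pderiv_le {n : ℕ} {P : MvPolynomial (Fin d) ℝ} (hP : P.totalDegree ≤ n + 1)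
    (i : Fin d) : (MvPolynomial.pderiv i P).totalDegree ≤ n := by
  rw [P.as_sum, map_sum]
  refine MvPolynomial.totalDegree_finsetSum_le fun s hs => ?_
  rw [MvPolynomial.pderiv_monomial]
  by_cases h0 : s i = 0
  · simp [h0]
  · refine (MvPolynomial.totalDegree_monomial_le _ _).trans ?_
    have h1 : s.sum (fun _ e => e) ≤ n + 1 := (MvPolynomial.le_totalDegree hs).trans hP
    have h2 : (s - Finsupp.single i 1).sum (fun _ e => e) + 1 = s.sum (fun _ e => e) := by
      have h3 : s - Finsupp.single i 1 + Finsupp.single i 1 = s :=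
        tsub_add_cancel_of_le (Finsupp.single_le_iff.2 (by omega))
      conv_rhs => rw [← h3]
      rw [Finsupp.sum_add_index' (by simp) (by simp)]
      simp
    have h3 : (s - Finsupp.single i 1).sum (fun _ e => e) ≤ n := by omega
    exact h3

lemma IsPolyReal.contDiff {n : ℕ} {f : Vec d → ℝ} (hf : IsPolyReal n f) {m : ℕ∞} :
    ContDiff ℝ m f := by
  obtain ⟨P, -, hP⟩ := hf
  obtain rfl : f = fun x => MvPolynomial.eval (fun i => x i) P := funext hP
  clear hP
  induction P using MvPolynomial.induction_on with
  | C a => simpa using contDiff_const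
  | add p q hp hq => simpa using hp.add hq
  | mul_X p i hp =>
    simp only [map_mul, MvPolynomial.eval_X]
    exact hp.mul (EuclideanSpace.proj i : Vec d →L[ℝ] ℝ).contDiff

lemma IsPolyReal.fderiv_apply {n : ℕ} {f : Vec d → ℝ} (hf : IsPolyReal (n + 1) f) (v : Vec d) :
    IsPolyReal n (fun x => fderiv ℝ f x v) := by
  obtain ⟨P, hP, hfP⟩ := hf
  obtain rfl : f = fun x => MvPolynomial.eval (fun i => x i) P := funext hfP
  have h : (fun x => fderiv ℝ (fun x : Vec d => MvPolynomial.eval (fun i => x i) P) x v)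
      = fun x : Vec d => MvPolynomial.eval (fun i => x i) (∑ i, v i • MvPolynomial.pderiv i P) := by
    ext x
    rw [(hasFDerivAt_eval P x).fderiv]
    simp only [_root_.sum_apply, _root_.smul_apply, smul_eq_mul,
      PiLp.proj_apply, map_sum, MvPolynomial.smul_eval]
    exact Finset.sum_congr rfl fun j _ => mul_comm _ _
  rw [h]
  refine ⟨_, MvPolynomial.totalDegree_finsetSum_le fun i _ => ?_, fun x => rfl⟩
  exact (MvPolynomial.totalDegree_smul_le _ _).trans (totalDegree_pderiv_le hP i)

/-- The restriction of a polynomial to a line is a polynomial of one variable. -/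
lemma IsPolyReal.exists_polynomial {n : ℕ} {f : Vec d → ℝ} (hf : IsPolyReal n f) (a b : Vec d) :
    ∃ p : Polynomial ℝ, p.natDegree ≤ n ∧ ∀ r : ℝ, f (a + r • b) = p.eval r := by
  obtain ⟨P, hP, hfP⟩ := hf
  refine ⟨MvPolynomial.aeval (fun i => Polynomial.C (a i) + Polynomial.C (b i) * Polynomial.X) P,
    ?_, fun r => ?_⟩
  · have := MvPolynomial.aeval_natDegree_le (m := n) (n := 1) P hP
      (fun i => Polynomial.C (a i) + Polynomial.C (b i) * Polynomial.X) (fun i => by compute_degree)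
    simpa using this
  · rw [hfP]
    clear hP hfP
    induction P using MvPolynomial.induction_on with
    | C c => simp
    | add p q hp hq => simp only [map_add, Polynomial.eval_add, hp, hq]
    | mul_X p i hp =>
      simp only [map_mul, Polynomial.eval_mul, hp, MvPolynomial.eval_X, MvPolynomial.aeval_X]
      simp only [PiLp.add_apply, PiLp.smul_apply, smul_eq_mul, Polynomial.eval_add,
        Polynomial.eval_mul, Polynomial.eval_C, Polynomial.eval_X]
      ring

section

variable {V : Type} [NormedAddCommGroup V] [InnerProductSpace ℝ V]
  {W : Type} [NormedAddCommGroup W] [InnerProductSpace ℝ W] {n : ℕ} {f g : Vec d → V}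

lemma IsPoly.add (hf : IsPoly n f) (hg : IsPoly n g) : IsPoly n (fun x => f x + g x) := fun ℓ => by
  simpa using (hf ℓ).add (hg ℓ)

lemma IsPoly.const_smul (hf : IsPoly n f) (c : ℝ) : IsPoly n (fun x => c • f x) := fun ℓ => by
  simpa using (hf ℓ).const_mul c

lemma IsPoly.sub (hf : IsPoly n f) (hg : IsPoly n g) : IsPoly n (fun x => f x - g x) := by
  have := hf.add (hg.const_smul (-1))
  simpa [sub_eq_add_neg] using this

lemma isPoly_zero (n : ℕ) : IsPoly n (fun _ : Vec d => (0 : V)) := fun ℓ => by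
  simpa using isPolyReal_zero n

lemma IsPoly.sum {ι : Type*} (s : Finset ι) {f : ι → Vec d → V} (hf : ∀ i ∈ s, IsPoly n (f i)) :
    IsPoly n (fun x => ∑ i ∈ s, f i x) := by
  classical
  induction s using Finset.induction_on with
  | empty => simpa using isPoly_zero n
  | insert a s ha ih =>
    simp only [Finset.sum_insert ha]
    exact (hf a (Finset.mem_insert_self _ _)).add
      (ih fun i hi => hf i (Finset.mem_insert_of_mem hi))

lemma IsPoly.clm_comp (hf : IsPoly n f) (L : V →L[ℝ] W) : IsPoly n (fun x => L (f x)) :=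
  fun ℓ => hf (ℓ.comp L)

lemma isPoly_real_iff {f : Vec d → ℝ} : IsPoly n f ↔ IsPolyReal n f := by
  refine ⟨fun h => h (ContinuousLinearMap.id ℝ ℝ), fun h ℓ => ?_⟩
  have : (fun x => ℓ (f x)) = fun x => ℓ 1 * f x := by
    ext x
    rw [← mul_one (f x), ← smul_eq_mul, map_smul, smul_eq_mul, mul_comm, smul_eq_mul, mul_one]
  rw [this]
  exact h.const_mul _

/-- A real polynomial times a constant vector. -/
lemma IsPolyReal.smul_const {f : Vec d → ℝ} (hf : IsPolyReal n f) (v : V) :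
    IsPoly n (fun x => f x • v) := fun ℓ => by
  have : (fun x => ℓ (f x • v)) = fun x => ℓ v * f x := by
    ext x; rw [map_smul, smul_eq_mul, mul_comm]
  rw [this]
  exact hf.const_mul _

variable [FiniteDimensional ℝ V]

lemma IsPoly.contDiff (hf : IsPoly n f) {m : ℕ∞} : ContDiff ℝ m f := by
  have h : f = fun x => ∑ j, inner ℝ (stdOrthonormalBasis ℝ V j) (f x) • stdOrthonormalBasis ℝ V j := by
    ext x; exact ((stdOrthonormalBasis ℝ V).sum_repr' (f x)).symm
  rw [h]
  exact ContDiff.sum fun j _ => ((hf (innerSL ℝ (stdOrthonormalBasis ℝ V j))).contDiff).smul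
    contDiff_const

lemma IsPoly.continuous (hf : IsPoly n f) : Continuous f := (hf.contDiff (m := 0)).continuous

lemma IsPoly.differentiable (hf : IsPoly n f) : Differentiable ℝ f :=
  (hf.contDiff (m := 1)).differentiable (by simp)

lemma IsPoly.fderiv_apply (hf : IsPoly (n + 1) f) (v : Vec d) :
    IsPoly n (fun x => fderiv ℝ f x v) := fun ℓ => by
  have : (fun x => ℓ (fderiv ℝ f x v)) = fun x => fderiv ℝ (fun y => ℓ (f y)) x v := by
    ext x
    have h := (ℓ.hasFDerivAt (x := f x)).comp x (hf.differentiable x).hasFDerivAt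
    have h2 : fderiv ℝ (fun y => ℓ (f y)) x = ℓ.comp (fderiv ℝ f x) := h.fderiv
    rw [h2]; rfl
  rw [this]
  exact (hf ℓ).fderiv_apply v

variable (d n V) in
/-- The space of polynomial functions of degree at most `n` with values in `V`. -/
def polySpace : Submodule ℝ (Vec d → V) where
  carrier := {f | IsPoly n f}
  add_mem' ha hb := ha.add hb
  zero_mem' := isPoly_zero n
  smul_mem' c _ hf := hf.const_smul c

instance : FiniteDimensional ℝ (polySpace d V n) := by
  let b := stdOrthonormalBasis ℝ V
  let Φ : (Fin (Module.finrank ℝ V) → MvPolynomial.restrictTotalDegree (Fin d) ℝ n) →ₗ[ℝ]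
      (Vec d → V) :=
    { toFun := fun P x => ∑ j, MvPolynomial.eval (fun i => x i) (P j).1 • b j
      map_add' := by
        intro P Q; ext x
        simp [add_smul, Finset.sum_add_distrib]
      map_smul' := by
        intro c P; ext x
        simp [Finset.smul_sum, smul_smul] }
  have hle : polySpace d V n ≤ LinearMap.range Φ := by
    intro f hf
    choose P hP hfP using fun j => hf (innerSL ℝ (b j))
    refine ⟨fun j => ⟨P j, (MvPolynomial.mem_restrictTotalDegree _ _ _).2 (hP j)⟩, ?_⟩
    ext x
    have : ∑ j, inner ℝ (b j) (f x) • b j = f x := b.sum_repr' (f x)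
    rw [← this]
    change ∑ j, MvPolynomial.eval (fun i => x i) (P j) • b j = _
    refine Finset.sum_congr rfl fun j _ => ?_
    rw [← hfP]; rfl
  exact Submodule.finiteDimensional_of_le hle

/-! ### The `L²` projection -/

lemma memLp_of_continuous {ν : Measure (Vec d)} {S : Set (Vec d)} (hS : IsCompact S)
    (hν : ν S < ∞) (hf : Continuous f) : MemLp f 2 (ν.restrict S) := by
  have : IsFiniteMeasure (ν.restrict S) := ⟨by simpa using hν⟩
  obtain ⟨C, hC⟩ := hS.exists_bound_of_continuousOn hf.continuousOn
  refine MemLp.of_bound hf.aestronglyMeasurable C ?_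
  exact (ae_restrict_iff' hS.measurableSet).2 (Eventually.of_forall hC)

/-- The `L²` projection onto polynomials exists: the polynomials have a finite-dimensional image in
`L²`, onto which there is an orthogonal projection. -/
lemma exists_l2Proj {ν : Measure (Vec d)} {S : Set (Vec d)} (hS : IsCompact S)
    (hν : ν S < ∞) (hf : MemLp f 2 (ν.restrict S)) (n : ℕ) :
    ∃ P : Vec d → V, IsPoly n P ∧
      ∀ Q : Vec d → V, IsPoly n Q → ∫ x, inner ℝ (f x - P x) (Q x) ∂(ν.restrict S) = 0 := by
  let Φ : polySpace d V n →ₗ[ℝ] Lp V 2 (ν.restrict S) :=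
    { toFun := fun q => (memLp_of_continuous hS hν (IsPoly.continuous q.2)).toLp q.1
      map_add' := fun p q => rfl
      map_smul' := fun c q => rfl }
  have hfd : FiniteDimensional ℝ (LinearMap.range Φ) := inferInstance
  obtain ⟨P, hP⟩ : (LinearMap.range Φ).starProjection hf.toLp ∈ LinearMap.range Φ :=
    Submodule.starProjection_apply_mem _ _
  refine ⟨P.1, P.2, fun Q hQ => ?_⟩
  have h := Submodule.starProjection_inner_eq_zero (K := LinearMap.range Φ) hf.toLp (Φ ⟨Q, hQ⟩) ⟨_, rfl⟩
  rw [← hP, L2.inner_def] at h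
  rw [← h]
  refine integral_congr_ae ?_
  filter_upwards [Lp.coeFn_sub hf.toLp (Φ P), hf.coeFn_toLp,
    (memLp_of_continuous hS hν (IsPoly.continuous P.2)).coeFn_toLp,
    (memLp_of_continuous hS hν (IsPoly.continuous hQ)).coeFn_toLp] with x h1 h2 h3 h4
  rw [h1]
  simp only [Pi.sub_apply]
  rw [h2]
  change _ = inner ℝ (f x - (memLp_of_continuous hS hν (IsPoly.continuous P.2)).toLp P.1 x)
    ((memLp_of_continuous hS hν (IsPoly.continuous hQ)).toLp Q x)
  rw [h3, h4]

omit [FiniteDimensional ℝ V] in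
lemma isPoly_l2Proj (μ : Measure (Vec d)) (n : ℕ) (f : Vec d → V) : IsPoly n (l2Proj μ n f) := by
  unfold l2Proj
  split_ifs with h
  · exact h.choose_spec.1
  · exact isPoly_zero n

lemma l2Proj_orthogonal {ν : Measure (Vec d)} {S : Set (Vec d)} (hS : IsCompact S)
    (hν : ν S < ∞) (hf : MemLp f 2 (ν.restrict S)) {Q : Vec d → V} (hQ : IsPoly n Q) :
    ∫ x in S, inner ℝ (f x - l2Proj (ν.restrict S) n f x) (Q x) ∂ν = 0 := by
  have h := exists_l2Proj hS hν hf n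
  rw [l2Proj, dif_pos h]
  exact h.choose_spec.2 Q hQ

omit [FiniteDimensional ℝ V] in
lemma integrable_inner_of_memLp {μ : Measure (Vec d)} (hf : MemLp f 2 μ) (hg : MemLp g 2 μ) :
    Integrable (fun x => inner ℝ (f x) (g x)) μ := by
  refine (hf.norm.integrable_mul hg.norm).mono' (hf.1.inner hg.1) (Eventually.of_forall fun x => ?_)
  exact norm_inner_le_norm _ _

lemma l2Proj_inner {ν : Measure (Vec d)} {S : Set (Vec d)} (hS : IsCompact S)
    (hν : ν S < ∞) (hf : MemLp f 2 (ν.restrict S)) {Q : Vec d → V} (hQ : IsPoly n Q) :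
    ∫ x in S, inner ℝ (l2Proj (ν.restrict S) n f x) (Q x) ∂ν = ∫ x in S, inner ℝ (f x) (Q x) ∂ν := by
  have h := l2Proj_orthogonal hS hν hf hQ
  have hQ' := memLp_of_continuous hS hν hQ.continuous
  have hP' := memLp_of_continuous hS hν (isPoly_l2Proj (ν.restrict S) n f).continuous
  simp only [inner_sub_left] at h
  rw [integral_sub (integrable_inner_of_memLp hf hQ') (integrable_inner_of_memLp hP' hQ')] at h
  linarith

/-- A polynomial need not vanish when it vanishes almost everywhere on `S`, so the projection of zero
is determined only up to null sets. -/
lemma l2Proj_ae_eq_zero {ν : Measure (Vec d)} {S : Set (Vec d)} (hS : IsCompact S)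
    (hν : ν S < ∞) (hf : f =ᵐ[ν.restrict S] 0) :
    l2Proj (ν.restrict S) n f =ᵐ[ν.restrict S] 0 := by
  have hf2 : MemLp f 2 (ν.restrict S) := MemLp.ae_eq hf.symm MemLp.zero
  set P := l2Proj (ν.restrict S) n f with hP
  have hPp := isPoly_l2Proj (ν.restrict S) n f
  have h := l2Proj_inner hS hν hf2 hPp
  have h2 : ∫ x in S, inner ℝ (f x) (P x) ∂ν = 0 := by
    rw [← integral_zero (Vec d) ℝ]
    exact integral_congr_ae (hf.mono fun x hx => by simp [hx])
  rw [← hP, h2] at h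
  have hP' := memLp_of_continuous hS hν hPp.continuous
  rw [integral_eq_zero_iff_of_nonneg (fun x => real_inner_self_nonneg)
    (integrable_inner_of_memLp hP' hP')] at h
  filter_upwards [h] with x hx
  exact inner_self_eq_zero.1 hx

/-! ### Polynomials depending on time -/

/-- A curve of polynomials which is pointwise of class `C¹` has coefficients of class `C¹`, because
the point evaluations span the dual of the space of polynomials. -/
lemma exists_C1_coefficients {T : ℝ} {v : ℝ → Vec d → V} (hv : ∀ t ∈ Icc 0 T, IsPoly n (v t))
    (hC1 : ∀ x, ContDiffOn ℝ 1 (fun t => v t x) (Icc 0 T)) :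
    ∃ (m : ℕ) (b : Fin m → Vec d → V) (c : Fin m → ℝ → ℝ), (∀ j, IsPoly n (b j)) ∧
      (∀ j, ContDiffOn ℝ 1 (c j) (Icc 0 T)) ∧
      ∀ t ∈ Icc 0 T, ∀ x, v t x = ∑ j, c j t • b j x := by
  classical
  let b := Module.finBasis ℝ (polySpace d V n)
  let w : ℝ → polySpace d V n := fun t => if h : IsPoly n (v t) then ⟨v t, h⟩ else 0
  have hw : ∀ t ∈ Icc 0 T, (w t).1 = v t := fun t ht => by
    simp only [w, dif_pos (hv t ht)]
  let ev : Vec d × Fin (Module.finrank ℝ V) → polySpace d V n →ₗ[ℝ] ℝ := fun p =>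
    ((innerSL ℝ (stdOrthonormalBasis ℝ V p.2)).toLinearMap.comp (LinearMap.proj p.1)).comp
      (polySpace d V n).subtype
  have hker : ∀ φ : polySpace d V n →ₗ[ℝ] ℝ, φ ∈ Submodule.span ℝ (range ev) := by
    intro φ
    refine FiniteDimensional.mem_span_of_iInf_ker_le_ker fun q hq => ?_
    have : q = 0 := by
      ext1; funext x
      refine (stdOrthonormalBasis ℝ V).toBasis.ext_elem fun j => ?_
      have := (Submodule.mem_iInf _).1 hq (x, j)
      have h2 : inner ℝ (stdOrthonormalBasis ℝ V j) (q.1 x) = 0 := this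
      simpa [OrthonormalBasis.repr_apply_apply] using h2
    rw [this]; exact Submodule.zero_mem _
  have hreg : ∀ φ : polySpace d V n →ₗ[ℝ] ℝ, ContDiffOn ℝ 1 (fun t => φ (w t)) (Icc 0 T) := by
    intro φ
    induction hker φ using Submodule.span_induction with
    | mem φ h =>
      obtain ⟨p, rfl⟩ := h
      have h1 : ContDiffOn ℝ 1 (fun t => innerSL ℝ (stdOrthonormalBasis ℝ V p.2) (v t p.1))
          (Icc 0 T) := (ContinuousLinearMap.contDiff _).comp_contDiffOn (hC1 p.1)
      exact h1.congr fun t ht => by rw [← hw t ht]; rfl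
    | zero => exact contDiffOn_const
    | add φ ψ _ _ h1 h2 => exact h1.add h2
    | smul c φ _ h1 => exact h1.const_smul c
  refine ⟨_, fun j => (b j).1, fun j t => b.coord j (w t), fun j => (b j).2,
    fun j => hreg _, fun t ht x => ?_⟩
  have h1 := b.sum_repr (w t)
  have h2 := congrArg (fun q : polySpace d V n => q.1 x) h1
  rw [hw t ht] at h2
  rw [← h2, AddSubmonoidClass.coe_finsetSum, Finset.sum_apply]
  rfl

end

/-! ### An inverse inequality for traces of polynomials -/

/-- The `L²(0, 1)` inner product on polynomials. -/
def polyBilin : LinearMap.BilinForm ℝ (Polynomial ℝ) :=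
  LinearMap.mk₂ ℝ (fun p q => ∫ r in (0 : ℝ)..1, p.eval r * q.eval r)
    (fun p p' q => by
      simp only [Polynomial.eval_add, add_mul]
      exact intervalIntegral.integral_add ((p.continuous.mul q.continuous).intervalIntegrable _ _)
        ((p'.continuous.mul q.continuous).intervalIntegrable _ _))
    (fun c p q => by
      simp only [Polynomial.eval_smul, smul_eq_mul, mul_assoc]
      exact intervalIntegral.integral_const_mul _ _)
    (fun p q q' => by
      simp only [Polynomial.eval_add, mul_add]
      exact intervalIntegral.integral_add ((p.continuous.mul q.continuous).intervalIntegrable _ _)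
        ((p.continuous.mul q'.continuous).intervalIntegrable _ _))
    (fun c p q => by
      simp only [Polynomial.eval_smul, smul_eq_mul, mul_left_comm]
      exact intervalIntegral.integral_const_mul _ _)

lemma polyBilin_apply (p q : Polynomial ℝ) :
    polyBilin p q = ∫ r in (0 : ℝ)..1, p.eval r * q.eval r := rfl

lemma polyBilin_comm (p q : Polynomial ℝ) : polyBilin p q = polyBilin q p := by
  simp only [polyBilin_apply, mul_comm]

lemma polyBilin_self_nonneg (p : Polynomial ℝ) : 0 ≤ polyBilin p p :=
  intervalIntegral.integral_nonneg zero_le_one fun _ _ => mul_self_nonneg _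

lemma eq_zero_of_polyBilin_self {p : Polynomial ℝ} (h : polyBilin p p = 0) : p = 0 := by
  by_contra hp
  have hc : Continuous fun r : ℝ => p.eval r * p.eval r := p.continuous.mul p.continuous
  obtain ⟨r, hr, hr0⟩ : ∃ r ∈ Icc (0 : ℝ) 1, p.eval r ≠ 0 := by
    by_contra hcon
    push Not at hcon
    refine hp (Polynomial.eq_zero_of_infinite_isRoot p ?_)
    exact (Icc_infinite (zero_lt_one (α := ℝ))).mono fun r hr => hcon r hr
  have := intervalIntegral.integral_pos zero_lt_one hc.continuousOn
    (fun x _ => mul_self_nonneg (p.eval x)) ⟨r, hr, mul_self_pos.2 hr0⟩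
  rw [polyBilin_apply] at h
  exact this.ne' h

/-- A monic polynomial of degree `n` which is orthogonal to the polynomials of lower degree. -/
lemma exists_orthogonal_polynomial (n : ℕ) : ∃ P : Polynomial ℝ, P.natDegree ≤ n ∧ P.coeff n = 1 ∧
    ∀ q : Polynomial ℝ, q.degree < n → polyBilin P q = 0 := by
  set W := Polynomial.degreeLT ℝ n with hW
  have hfd : FiniteDimensional ℝ W := inferInstance
  let Φ : W →ₗ[ℝ] Module.Dual ℝ W := polyBilin.restrict W
  have hinj : Function.Injective Φ := by
    rw [← LinearMap.ker_eq_bot, LinearMap.ker_eq_bot']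
    intro p hp
    have h : polyBilin p.1 p.1 = 0 := LinearMap.congr_fun hp p
    exact Subtype.ext (eq_zero_of_polyBilin_self h)
  have hsurj : Function.Surjective Φ :=
    (LinearMap.injective_iff_surjective_of_finrank_eq_finrank
      (Subspace.dual_finrank_eq (K := ℝ) (V := W)).symm).1 hinj
  obtain ⟨⟨w, hw⟩, hw2⟩ := hsurj ((polyBilin (Polynomial.X ^ n)).comp W.subtype)
  obtain ⟨z, hz'⟩ : ∃ z : Polynomial ℝ, z = Polynomial.X ^ n - w := ⟨_, rfl⟩
  have hwdeg : w.degree < n := Polynomial.mem_degreeLT.1 hw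
  refine ⟨z, ?_, ?_, fun q hq => ?_⟩
  · rw [hz']
    refine Polynomial.natDegree_le_of_degree_le ?_
    exact (Polynomial.degree_sub_le _ _).trans (max_le (Polynomial.degree_X_pow_le n) hwdeg.le)
  · rw [hz', Polynomial.coeff_sub, Polynomial.coeff_X_pow_self,
      Polynomial.coeff_eq_zero_of_degree_lt hwdeg, sub_zero]
  · have h : polyBilin w q = polyBilin (Polynomial.X ^ n) q :=
      LinearMap.congr_fun hw2 ⟨q, Polynomial.mem_degreeLT.2 hq⟩
    rw [hz', map_sub, LinearMap.sub_apply, h, sub_self]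

/-- For the orthogonal polynomial of degree `n`, integrating `(r P²)'` and using that
`r P' - n P` has lower degree gives the value at the end point. -/
lemma eval_one_sq_of_orthogonal {n : ℕ} {P : Polynomial ℝ} (hdeg : P.natDegree ≤ n)
    (horth : ∀ q : Polynomial ℝ, q.degree < n → polyBilin P q = 0) :
    P.eval 1 ^ 2 = (2 * n + 1) * polyBilin P P := by
  set Q := Polynomial.X * Polynomial.derivative P with hQ
  have h1 : polyBilin P Q = n * polyBilin P P := by
    have hlow : (Q - Polynomial.C (n : ℝ) * P).degree < n := by
      rw [Polynomial.degree_lt_iff_coeff_zero]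
      intro m hm
      rw [Polynomial.coeff_sub, Polynomial.coeff_C_mul, hQ]
      cases m with
      | zero =>
        have : n = 0 := by omega
        simp [this]
      | succ m =>
        rw [Polynomial.coeff_X_mul, Polynomial.coeff_derivative]
        rcases Nat.lt_or_ge n (m + 1) with h | h
        · rw [Polynomial.coeff_eq_zero_of_natDegree_lt (by omega)]; ring
        · have : n = m + 1 := by omega
          rw [this]; push_cast; ring
    have := horth _ hlow
    rw [map_sub, sub_eq_zero] at this
    rw [this, ← Polynomial.smul_eq_C_mul, map_smul, smul_eq_mul]
  have h2 : ∫ r in (0 : ℝ)..1, (P.eval r * P.eval r + 2 * (P.eval r * Q.eval r))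
      = P.eval 1 ^ 2 := by
    have hder : ∀ r ∈ uIcc (0 : ℝ) 1, HasDerivAt (fun r => r * (P.eval r * P.eval r))
        (P.eval r * P.eval r + 2 * (P.eval r * Q.eval r)) r := by
      intro r _
      have h := (hasDerivAt_id r).mul ((P.hasDerivAt r).mul (P.hasDerivAt r))
      refine h.congr_deriv ?_
      simp only [hQ, Polynomial.eval_mul, Polynomial.eval_X, id, Pi.mul_apply]
      ring
    rw [intervalIntegral.integral_eq_sub_of_hasDerivAt hder]
    · ring
    · exact Continuous.intervalIntegrable (by fun_prop) _ _
  rw [intervalIntegral.integral_add (Continuous.intervalIntegrable (by fun_prop) _ _)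
    (Continuous.intervalIntegrable (by fun_prop) _ _), intervalIntegral.integral_const_mul,
    ← polyBilin_apply, ← polyBilin_apply, h1] at h2
  rw [← h2]; ring

/-- The induction step for the end point estimate: Cauchy's inequality with the weights `m²` and
`2 m + 1`, whose sum is `(m + 1)²`. -/
lemma sq_add_le_of_sq_le {x y S U m : ℝ} (hS : 0 ≤ S) (hU : 0 ≤ U) (hm : 0 ≤ m)
    (hx : x ^ 2 ≤ m ^ 2 * S) (hy : y ^ 2 ≤ (2 * m + 1) * U) :
    (x + y) ^ 2 ≤ (m + 1) ^ 2 * (S + U) := by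
  have h1 : x * y ≤ ((2 * m + 1) * S + m ^ 2 * U) / 2 := by
    refine (le_abs_self _).trans (abs_le_of_sq_le_sq ?_ (by positivity))
    have h2 : (x * y) ^ 2 ≤ (m ^ 2 * S) * ((2 * m + 1) * U) := by
      rw [mul_pow]
      exact mul_le_mul hx hy (sq_nonneg _) (by positivity)
    nlinarith [sq_nonneg ((2 * m + 1) * S - m ^ 2 * U)]
  nlinarith

/-- The value of a polynomial of degree at most `n` at an end point of an interval is controlled by
its `L²` norm, with the sharp growth in `n`. By induction on `n`: split off the multiple of the
orthogonal polynomial that carries the leading coefficient. -/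
theorem eval_one_sq_le (n : ℕ) (q : Polynomial ℝ) (hq : q.natDegree ≤ n) :
    q.eval 1 ^ 2 ≤ (n + 1) ^ 2 * ∫ r in (0 : ℝ)..1, q.eval r ^ 2 := by
  have hB : ∀ q : Polynomial ℝ, ∫ r in (0 : ℝ)..1, q.eval r ^ 2 = polyBilin q q := fun q => by
    rw [polyBilin_apply]; simp only [sq]
  rw [hB]
  induction n generalizing q with
  | zero =>
    rw [Polynomial.eq_C_of_natDegree_le_zero hq, polyBilin_apply]
    simp [sq]
  | succ n ih =>
    obtain ⟨P, hP, hP1, horth⟩ := exists_orthogonal_polynomial (n + 1)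
    set a := q.coeff (n + 1)
    set w := q - Polynomial.C a * P with hw
    have hwdeg : w.degree < (n + 1 : ℕ) := by
      rw [Polynomial.degree_lt_iff_coeff_zero]
      intro m hm
      rw [hw, Polynomial.coeff_sub, Polynomial.coeff_C_mul]
      rcases Nat.lt_or_ge (n + 1) m with h | h
      · rw [Polynomial.coeff_eq_zero_of_natDegree_lt (by omega),
          Polynomial.coeff_eq_zero_of_natDegree_lt (by omega)]
        ring
      · have : m = n + 1 := by omega
        rw [this, hP1]; ring
    have hwn : w.natDegree ≤ n := by
      refine Polynomial.natDegree_le_of_degree_le ?_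
      refine Polynomial.degree_le_iff_coeff_zero _ _ |>.2 fun m hm => ?_
      exact (Polynomial.degree_lt_iff_coeff_zero _ _).1 hwdeg m (by exact_mod_cast hm)
    have hqw : q = w + a • P := by rw [hw, Polynomial.smul_eq_C_mul]; ring
    have h1 := ih w hwn
    have h2 := eval_one_sq_of_orthogonal hP horth
    have h3 := horth w hwdeg
    have h4 : polyBilin q q = polyBilin w w + a ^ 2 * polyBilin P P := by
      conv_lhs => rw [hqw]
      simp only [map_add, LinearMap.add_apply, map_smul, LinearMap.smul_apply, smul_eq_mul]
      rw [polyBilin_comm w P, h3]; ring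
    have h5 : q.eval 1 = w.eval 1 + a * P.eval 1 := by
      conv_lhs => rw [hqw]
      simp
    rw [h4, h5]
    push_cast at h2 ⊢
    refine sq_add_le_of_sq_le (polyBilin_self_nonneg w)
      (mul_nonneg (sq_nonneg a) (polyBilin_self_nonneg P)) (by positivity) h1 ?_
    rw [mul_pow, h2]
    exact le_of_eq (by ring)

/-- The end point estimate with the weight that occurs in the volume of a cone. Applying the
unweighted estimate to `r p(1 - r)` produces the weight `(1 - δ)²`, which is at most
`(1 - δ)^(d-1)` because `d ≤ 3`. -/
lemma eval_zero_sq_le (hd : d = 2 ∨ d = 3) (n : ℕ) (p : Polynomial ℝ) (hp : p.natDegree ≤ n) :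
    p.eval 0 ^ 2 ≤ (n + 2) ^ 2 * ∫ δ in (0 : ℝ)..1, (1 - δ) ^ (d - 1) * p.eval δ ^ 2 := by
  set q : Polynomial ℝ := Polynomial.X * p.comp (1 - Polynomial.X) with hq
  have hqd : q.natDegree ≤ n + 1 := by
    refine (Polynomial.natDegree_mul_le).trans ?_
    have h1 : (p.comp (1 - Polynomial.X)).natDegree ≤ p.natDegree * 1 := by
      refine (Polynomial.natDegree_comp_le).trans (Nat.mul_le_mul_left _ ?_)
      compute_degree
    have h2 : (Polynomial.X : Polynomial ℝ).natDegree ≤ 1 := Polynomial.natDegree_X_le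
    omega
  have h := eval_one_sq_le (n + 1) q hqd
  have hq1 : q.eval 1 = p.eval 0 := by simp [hq]
  have hqr : ∀ r, q.eval r ^ 2 = (fun δ => (1 - δ) ^ 2 * p.eval δ ^ 2) (1 - r) := by
    intro r
    simp only [hq, Polynomial.eval_mul, Polynomial.eval_X, Polynomial.eval_comp,
      Polynomial.eval_sub, Polynomial.eval_one]
    ring
  rw [hq1] at h
  simp only [hqr] at h
  rw [intervalIntegral.integral_comp_sub_left (fun δ => (1 - δ) ^ 2 * p.eval δ ^ 2) 1, sub_self,
    sub_zero] at h
  push_cast at h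
  rw [show (n : ℝ) + 2 = n + 1 + 1 by ring]
  refine h.trans (mul_le_mul_of_nonneg_left ?_ (by positivity))
  refine intervalIntegral.integral_mono_on zero_le_one
    (Continuous.intervalIntegrable (by fun_prop) _ _)
    (Continuous.intervalIntegrable (by fun_prop) _ _) fun δ hδ => ?_
  refine mul_le_mul_of_nonneg_right ?_ (sq_nonneg _)
  exact pow_le_pow_of_le_one (by linarith [hδ.2]) (by linarith [hδ.1]) (by omega)

section

variable {V : Type} [NormedAddCommGroup V] [InnerProductSpace ℝ V] [FiniteDimensional ℝ V]
  {n : ℕ} {v : Vec d → V}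

lemma norm_sq_le_radial (hd : d = 2 ∨ d = 3) (hv : IsPoly n v) (c x : Vec d) :
    ‖v x‖ₑ ^ 2 ≤ ENNReal.ofReal ((n + 2) ^ 2) * ∫⁻ δ, ‖v (coneMap c (δ, x))‖ₑ ^ 2 ∂(radial d) := by
  have hc : Continuous fun δ : ℝ => v (coneMap c (δ, x)) :=
    hv.continuous.comp ((continuous_coneMap c).comp (by fun_prop))
  have hreal : ‖v x‖ ^ 2 ≤ (n + 2) ^ 2 *
      ∫ δ in (0 : ℝ)..1, (1 - δ) ^ (d - 1) * ‖v (coneMap c (δ, x))‖ ^ 2 := by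
    let b := stdOrthonormalBasis ℝ V
    have hb : ∀ w : V, ‖w‖ ^ 2 = ∑ j, (inner ℝ (b j) w : ℝ) ^ 2 := fun w => by
      rw [← b.sum_sq_norm_inner_right w]; simp
    simp only [hb, Finset.mul_sum]
    rw [intervalIntegral.integral_finsetSum, Finset.mul_sum]
    · refine Finset.sum_le_sum fun j _ => ?_
      obtain ⟨p, hp, hpv⟩ := (hv (innerSL ℝ (b j))).exists_polynomial x (c - x)
      simp only [innerSL_apply_apply] at hpv
      have := eval_zero_sq_le hd n p hp
      simp only [← hpv] at this
      simpa [coneMap] using this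
    · intro j _
      refine Continuous.intervalIntegrable ?_ _ _
      exact (by fun_prop : Continuous fun δ : ℝ => (1 - δ) ^ (d - 1)).mul
        ((continuous_const.inner hc).pow 2)
  have hI : ∫⁻ δ, ‖v (coneMap c (δ, x))‖ₑ ^ 2 ∂(radial d)
      = ENNReal.ofReal (∫ δ in (0 : ℝ)..1, (1 - δ) ^ (d - 1) * ‖v (coneMap c (δ, x))‖ ^ 2) := by
    have hmeas : Measurable fun δ : ℝ => ‖v (coneMap c (δ, x))‖ₑ ^ 2 :=
      hc.enorm.measurable.pow_const 2
    rw [radial, lintegral_withDensity_eq_lintegral_mul _ (measurable_radial_density d) hmeas,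
      intervalIntegral.integral_of_le zero_le_one,
      integral_Ioc_eq_integral_Ioo, ofReal_integral_eq_lintegral_ofReal]
    · refine setLIntegral_congr_fun measurableSet_Ioo fun δ hδ => ?_
      have : 0 ≤ (1 - δ) ^ (d - 1) := pow_nonneg (by linarith [hδ.2]) _
      rw [ENNReal.ofReal_mul this, ENNReal.ofReal_pow (norm_nonneg _), ofReal_norm]
      rfl
    · refine Continuous.integrableOn_Icc (a := 0) (b := 1) ?_ |>.mono_set Ioo_subset_Icc_self
      exact (by fun_prop : Continuous fun δ : ℝ => (1 - δ) ^ (d - 1)).mul (hc.norm.pow 2)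
    · refine (ae_restrict_iff' measurableSet_Ioo).2 (Eventually.of_forall fun δ hδ => ?_)
      have : 0 ≤ (1 - δ) ^ (d - 1) := pow_nonneg (by linarith [hδ.2]) _
      positivity
  rw [hI, ← ENNReal.ofReal_mul (by positivity), ← ofReal_norm, ← ENNReal.ofReal_pow (norm_nonneg _)]
  exact ENNReal.ofReal_le_ofReal hreal

/-- Trace inverse inequality on a facet: integrate the one-dimensional estimate over the segments
that join the facet to the opposite vertex. -/
lemma lintegral_facet_le (hd : d = 2 ∨ d = 3) (hv : IsPoly n v) (K : Elem d) (i : Fin (d + 1)) :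
    ∫⁻ x in facet K i, ‖v x‖ₑ ^ 2 ∂(area d) ≤
      ENNReal.ofReal ((n + 2) ^ 2 * ‖baryGrad K i‖) * ∫⁻ x in body K, ‖v x‖ₑ ^ 2 := by
  have hd1 : 1 ≤ d := by omega
  have hc : 0 < bary K i (K.points i) := by rw [bary_point_self]; exact one_pos
  have hfin := area_facet_lt_top hd1 K i
  have : IsFiniteMeasure ((area d).restrict (facet K i)) := ⟨by simpa using hfin⟩
  have hcone := volume_restrict_cone hd1 hc (fun x hx => bary_eq_zero_of_mem_facet hx)
    (isClosed_facet K i).measurableSet hfin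
  have hmeas : Measurable fun x => ‖v x‖ₑ ^ 2 := hv.continuous.enorm.measurable.pow_const 2
  have hpos := norm_pos_iff.2 (baryGrad_ne_zero hd1 K i)
  set J := ∫⁻ x in facet K i, ∫⁻ δ, ‖v (coneMap (K.points i) (δ, x))‖ₑ ^ 2 ∂(radial d) ∂(area d)
    with hJ
  have h1 : ∫⁻ x in cone (K.points i) (facet K i), ‖v x‖ₑ ^ 2
      = ENNReal.ofReal ‖baryGrad K i‖⁻¹ * J := by
    rw [hcone, lintegral_smul_measure, lintegral_map hmeas (continuous_coneMap _).measurable,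
      lintegral_prod_symm' (fun z => ‖v (coneMap (K.points i) z)‖ₑ ^ 2)
        (hmeas.comp (continuous_coneMap _).measurable), coneHeight,
      bary_point_self, one_div, smul_eq_mul]
  have h2 : ENNReal.ofReal ‖baryGrad K i‖⁻¹ * J ≤ ∫⁻ x in body K, ‖v x‖ₑ ^ 2 := by
    rw [← h1]
    exact lintegral_mono_set (cone_subset_body (point_mem_body K i) (facet_subset_body K i))
  calc ∫⁻ x in facet K i, ‖v x‖ₑ ^ 2 ∂(area d)
      ≤ ∫⁻ x in facet K i, ENNReal.ofReal ((n + 2) ^ 2) *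
          ∫⁻ δ, ‖v (coneMap (K.points i) (δ, x))‖ₑ ^ 2 ∂(radial d) ∂(area d) :=
        lintegral_mono fun x => norm_sq_le_radial hd hv _ x
    _ = ENNReal.ofReal ((n + 2) ^ 2) * J := lintegral_const_mul' _ _ ENNReal.ofReal_ne_top
    _ = ENNReal.ofReal ((n + 2) ^ 2 * ‖baryGrad K i‖) * (ENNReal.ofReal ‖baryGrad K i‖⁻¹ * J) := by
        rw [← mul_assoc, ← ENNReal.ofReal_mul (by positivity), mul_assoc, mul_inv_cancel₀ hpos.ne',
          mul_one]
    _ ≤ _ := by gcongr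

/-- In a shape regular element the heights are comparable with the diameter: moving from the centre
of the inscribed ball against the gradient, the barycentric coordinate drops by at most `1`. -/
lemma diam_mul_norm_baryGrad_le {κ : ℝ} (hκ : 0 < κ) {K : Elem d}
    (h : ∃ c, Metric.closedBall c (Metric.diam (body K) / κ) ⊆ body K) (i : Fin (d + 1)) :
    Metric.diam (body K) * ‖baryGrad K i‖ ≤ κ := by
  obtain ⟨c, hc⟩ := h
  set r := Metric.diam (body K) / κ with hr
  have hr0 : 0 ≤ r := div_nonneg Metric.diam_nonneg hκ.le
  set a := baryGrad K i with ha
  have hrd : Metric.diam (body K) = r * κ := by rw [hr, div_mul_cancel₀ _ hκ.ne']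
  rcases eq_or_lt_of_le (norm_nonneg a) with h0 | hpos
  · rw [← h0, mul_zero]; exact hκ.le
  have hcK : c ∈ body K := hc (Metric.mem_closedBall_self hr0)
  have hy : c + (-(r / ‖a‖)) • a ∈ body K := hc (by
    rw [Metric.mem_closedBall, dist_eq_norm, add_sub_cancel_left, norm_smul, norm_neg, norm_div,
      norm_norm, Real.norm_of_nonneg hr0, div_mul_cancel₀ _ hpos.ne'])
  have h1 := mem_body.1 hy i
  rw [bary_sub K i c, add_sub_cancel_left, inner_smul_right, ← ha, real_inner_self_eq_norm_sq] at h1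
  have h2 := bary_le_one hcK i
  have h3 : r / ‖a‖ * ‖a‖ ^ 2 = r * ‖a‖ := by field_simp
  rw [hrd]
  nlinarith

variable {Ω : Set (Vec d)} {κ γ : ℝ} {𝒯 : Finset (Elem d)}

lemma diam_le_of_mem_facesOf {K : Elem d} {F : Set (Vec d)} (hF : F ∈ facesOf Ω 𝒯 K) :
    Metric.diam F ≤ Metric.diam (body K) :=
  Metric.diam_mono (mem_facesOf.1 hF).2 (isCompact_body K).isBounded

/-- The inverse inequality for the weighted traces of a piecewise polynomial, with a constant that
does not depend on the polynomial degree. The factor `4` comes from `(k + 2)² ≤ 4 (k + 1)²`, the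
factor `d + 1` from the number of facets, and `κ` bounds the ratio of diameter and height. -/
theorem bdNormSq_le_volNormSq (hd : d = 2 ∨ d = 3) (hΩ : IsPolyhedralDomain Ω)
    (hT : IsMesh Ω κ γ 𝒯) (hκ : 0 < κ) {k : ℕ} {v : Broken d V} (hv : IsBrokenPoly 𝒯 k v) :
    bdNormSq Ω 𝒯 (traceWeight k) (fun K _ x => v K x) ≤
      ENNReal.ofReal (4 * κ * (d + 1)) * volNormSq 𝒯 v := by
  classical
  have hd1 : 1 ≤ d := by omega
  unfold bdNormSq volNormSq
  rw [Finset.mul_sum]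
  refine Finset.sum_le_sum fun K hK => ?_
  set h := Metric.diam (body K) with hh
  have hh0 : 0 ≤ h := Metric.diam_nonneg
  calc ∑ F ∈ facesOf Ω 𝒯 K, ∫⁻ x in F, ‖traceWeight k F • v K x‖ₑ ^ 2 ∂(area d)
      ≤ ∑ F ∈ facesOf Ω 𝒯 K, ENNReal.ofReal (h / (k + 1) ^ 2) *
          ∫⁻ x in F, ‖v K x‖ₑ ^ 2 ∂(area d) := by
        refine Finset.sum_le_sum fun F hF => ?_
        rw [← lintegral_const_mul' _ _ ENNReal.ofReal_ne_top]
        refine lintegral_mono fun x => ?_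
        rw [enorm_smul, mul_pow, ← ofReal_norm, ← ENNReal.ofReal_pow (norm_nonneg _)]
        gcongr
        rw [Real.norm_eq_abs, sq_abs, traceWeight, div_pow, Real.sq_sqrt Metric.diam_nonneg]
        gcongr
        exact diam_le_of_mem_facesOf hF
    _ = ENNReal.ofReal (h / (k + 1) ^ 2) * ∑ i, ∫⁻ x in facet K i, ‖v K x‖ₑ ^ 2 ∂(area d) := by
        rw [← Finset.mul_sum, ← Finset.sum_fiberwise (facesOf Ω 𝒯 K) (facetIndex K)]
        congr 1
        refine Finset.sum_congr rfl fun i _ => ?_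
        rw [area_restrict_facet hd1 hΩ hT hK i, lintegral_finsetSum_measure]
    _ ≤ ENNReal.ofReal (h / (k + 1) ^ 2) * ∑ i : Fin (d + 1),
          ENNReal.ofReal ((k + 2) ^ 2 * ‖baryGrad K i‖) * ∫⁻ x in body K, ‖v K x‖ₑ ^ 2 := by
        gcongr with i
        exact lintegral_facet_le hd (hv K hK) K i
    _ = ∑ i : Fin (d + 1), ENNReal.ofReal (h / (k + 1) ^ 2 * ((k + 2) ^ 2 * ‖baryGrad K i‖)) *
          ∫⁻ x in body K, ‖v K x‖ₑ ^ 2 := by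
        rw [Finset.mul_sum]
        refine Finset.sum_congr rfl fun i _ => ?_
        rw [← mul_assoc, ← ENNReal.ofReal_mul (by positivity)]
    _ ≤ ∑ i : Fin (d + 1), ENNReal.ofReal (4 * κ) * ∫⁻ x in body K, ‖v K x‖ₑ ^ 2 := by
        refine Finset.sum_le_sum fun i _ => mul_le_mul_left (ENNReal.ofReal_le_ofReal ?_) _
        have h1 := diam_mul_norm_baryGrad_le hκ (hT.shapeRegular K hK) i
        have h2 : ((k : ℝ) + 2) ^ 2 ≤ 4 * (k + 1) ^ 2 := by nlinarith [(Nat.cast_nonneg k : (0 : ℝ) ≤ k)]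
        have h3 : h / (k + 1) ^ 2 * ((k + 2) ^ 2 * ‖baryGrad K i‖)
            = (((k : ℝ) + 2) ^ 2 / (k + 1) ^ 2) * (h * ‖baryGrad K i‖) := by ring
        rw [h3]
        have h4 : (((k : ℝ) + 2) ^ 2 / (k + 1) ^ 2) ≤ 4 := by
          rw [div_le_iff₀ (by positivity)]; exact h2
        exact mul_le_mul h4 h1 (by positivity) (by norm_num)
    _ = _ := by
        rw [Finset.sum_const, Finset.card_univ, Fintype.card_fin, nsmul_eq_mul, ← mul_assoc,
          ENNReal.ofReal_mul (by positivity : 0 ≤ 4 * κ)]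
        congr 1
        rw [mul_comm]
        congr 1
        rw [← ENNReal.ofReal_natCast]
        push_cast
        rfl

end

/-! ### Polar integration and limits of layer averages -/

section

variable {Ω : Set (Vec d)} {κ γ : ℝ} {𝒯 : Finset (Elem d)}

lemma map_coneMap_absolutelyContinuous (hd : 2 ≤ d) (hΩ : IsPolyhedralDomain Ω)
    (hT : IsMesh Ω κ γ 𝒯) {K : Elem d} (hK : K ∈ 𝒯) {F : Set (Vec d)} (hF : F ∈ facesOf Ω 𝒯 K) :
    ((radial d).prod ((area d).restrict F)).map (coneMap (center K)) ≪ volume.restrict (body K) := by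
  have hpos := coneHeight_pos (by omega : 1 ≤ d) (bary_center_pos K (facetIndex K F))
  rw [volume_restrict_body_eq_sum_faces hd hΩ hT hK]
  intro t ht
  rw [Measure.finsetSum_apply, Finset.sum_eq_zero_iff] at ht
  have h := ht F hF
  rw [Measure.smul_apply, smul_eq_mul, mul_eq_zero] at h
  exact h.resolve_left (by simpa using hpos)

lemma volume_absolutelyContinuous_radial (d : ℕ) : volume.restrict (Ioo (0 : ℝ) 1) ≪ radial d := by
  refine withDensity_absolutelyContinuous' (measurable_radial_density d).aemeasurable ?_
  refine (ae_restrict_iff' measurableSet_Ioo).2 (Eventually.of_forall fun δ hδ => ?_)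
  have : 0 < 1 - δ := by linarith [hδ.2]
  have : 0 < (1 - δ) ^ (d - 1) := by positivity
  simpa using this

lemma quasiMeasurePreserving_coneMap (hd : 2 ≤ d) (hΩ : IsPolyhedralDomain Ω)
    (hT : IsMesh Ω κ γ 𝒯) {K : Elem d} (hK : K ∈ 𝒯) {F : Set (Vec d)} (hF : F ∈ facesOf Ω 𝒯 K) :
    Measure.QuasiMeasurePreserving (coneMap (center K))
      ((volume.restrict (Ioo (0 : ℝ) 1)).prod ((area d).restrict F)) (volume.restrict (body K)) := by
  have hfin := area_lt_top_of_mem_facesOf (by omega) hΩ hT hK hF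
  have : IsFiniteMeasure ((area d).restrict F) := ⟨by simpa using hfin⟩
  refine ⟨(continuous_coneMap _).measurable, ?_⟩
  have h1 : (volume.restrict (Ioo (0 : ℝ) 1)).prod ((area d).restrict F) ≪
      (radial d).prod ((area d).restrict F) :=
    (volume_absolutelyContinuous_radial d).prod Measure.AbsolutelyContinuous.rfl
  exact (h1.map (continuous_coneMap _).measurable).trans
    (map_coneMap_absolutelyContinuous hd hΩ hT hK hF)

variable {V : Type} [NormedAddCommGroup V] [NormedSpace ℝ V]

/-- Integration over an element in polar coordinates with respect to the centroid. -/
theorem integral_body_eq (hd : 2 ≤ d) (hΩ : IsPolyhedralDomain Ω)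
    (hT : IsMesh Ω κ γ 𝒯) {K : Elem d} (hK : K ∈ 𝒯) {f : Vec d → V}
    (hf : IntegrableOn f (body K)) :
    ∫ y in body K, f y = ∑ F ∈ facesOf Ω 𝒯 K, coneHeight K (facetIndex K F) (center K) •
      ∫ δ in (0 : ℝ)..1, (1 - δ) ^ (d - 1) • ∫ x in F, f (coneMap (center K) (δ, x)) ∂(area d) := by
  have hd1 : 1 ≤ d := by omega
  have hc := (continuous_coneMap (center K)).measurable
  have hf' : Integrable f (volume.restrict (body K)) := hf
  have hint : ∀ F ∈ facesOf Ω 𝒯 K, Integrable f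
      (((radial d).prod ((area d).restrict F)).map (coneMap (center K))) := by
    intro F hF
    have hpos := coneHeight_pos hd1 (bary_center_pos K (facetIndex K F))
    rw [volume_restrict_body_eq_sum_faces hd hΩ hT hK, integrable_finsetSum_measure] at hf'
    exact (integrable_smul_measure (by simpa using hpos) ENNReal.ofReal_ne_top).1 (hf' F hF)
  rw [volume_restrict_body_eq_sum_faces hd hΩ hT hK, integral_finsetSum_measure fun F hF =>
    (hint F hF).smul_measure ENNReal.ofReal_ne_top]
  refine Finset.sum_congr rfl fun F hF => ?_
  have hpos := coneHeight_pos hd1 (bary_center_pos K (facetIndex K F))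
  have hfin := area_lt_top_of_mem_facesOf hd1 hΩ hT hK hF
  have : IsFiniteMeasure ((area d).restrict F) := ⟨by simpa using hfin⟩
  rw [integral_smul_measure, ENNReal.toReal_ofReal hpos.le]
  congr 1
  rw [integral_map hc.aemeasurable (hint F hF).1, integral_prod]
  · rw [radial, integral_withDensity_eq_integral_toReal_smul (measurable_radial_density d)
      (Eventually.of_forall fun _ => ENNReal.ofReal_lt_top),
      intervalIntegral.integral_of_le zero_le_one, integral_Ioc_eq_integral_Ioo]
    refine setIntegral_congr_fun measurableSet_Ioo fun δ hδ => ?_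
    have : 0 ≤ (1 - δ) ^ (d - 1) := pow_nonneg (by linarith [hδ.2]) _
    simp only [ENNReal.toReal_ofReal this]
  · exact (integrable_map_measure (hint F hF).1 hc.aemeasurable).1 (hint F hF)

end

section

variable {X V : Type} [NormedAddCommGroup X] [NormedSpace ℝ X] [NormedAddCommGroup V]
  [NormedSpace ℝ V]

lemma lintegral_layer_eq {X : Type} [NormedAddCommGroup X] {K : Elem d}
    {F : Set (Vec d)} {w g : Vec d → X} [SFinite ((area d).restrict F)]
    (hg : AEStronglyMeasurable g ((area d).restrict F))
    (hw : AEStronglyMeasurable (fun z => w (coneMap (center K) z))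
      ((volume.restrict (Ioo (0 : ℝ) 1)).prod ((area d).restrict F))) {ε : ℝ} (hε : ε ≤ 1) :
    ∫⁻ z, ‖w (coneMap (center K) z) - g z.2‖ₑ ^ 2
      ∂((volume.restrict (Ioo (0 : ℝ) ε)).prod ((area d).restrict F)) =
    ∫⁻ δ in Ioo 0 ε, ∫⁻ x in F,
      ‖w (x + δ • (Finset.univ.centroid ℝ K.points - x)) - g x‖ₑ ^ 2 ∂(area d) := by
  have hle : volume.restrict (Ioo (0 : ℝ) ε) ≤ volume.restrict (Ioo (0 : ℝ) 1) :=
    Measure.restrict_mono (Ioo_subset_Ioo_right hε) le_rfl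
  have h1 : AEStronglyMeasurable (fun z => w (coneMap (center K) z))
      ((volume.restrict (Ioo (0 : ℝ) ε)).prod ((area d).restrict F)) :=
    hw.mono_measure (Measure.prod_mono hle le_rfl)
  have h2 : AEMeasurable (fun z => ‖w (coneMap (center K) z) - g z.2‖ₑ ^ 2)
      ((volume.restrict (Ioo (0 : ℝ) ε)).prod ((area d).restrict F)) :=
    (h1.sub hg.comp_snd).enorm.pow_const 2
  rw [lintegral_prod _ h2]
  rfl

/-- The defining property of the trace, as a statement on product measures. -/
lemma isTrace_iff_prod {X : Type} [NormedAddCommGroup X] [InnerProductSpace ℝ X] {K : Elem d}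
    {F : Set (Vec d)} {w g : Vec d → X} [SFinite ((area d).restrict F)]
    (hg : MemLp g 2 ((area d).restrict F))
    (hw : AEStronglyMeasurable (fun z => w (coneMap (center K) z))
      ((volume.restrict (Ioo (0 : ℝ) 1)).prod ((area d).restrict F))) :
    IsTrace K F w g ↔ Tendsto (fun ε : ℝ => (∫⁻ z, ‖w (coneMap (center K) z) - g z.2‖ₑ ^ 2
      ∂((volume.restrict (Ioo (0 : ℝ) ε)).prod ((area d).restrict F))) / ENNReal.ofReal ε)
      (𝓝[>] 0) (𝓝 0) := by
  refine ⟨fun h => h.2.congr' ?_, fun h => ⟨hg, h.congr' ?_⟩⟩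
  all_goals
    filter_upwards [Ioo_mem_nhdsGT (zero_lt_one (α := ℝ))] with ε hε
    rw [lintegral_layer_eq hg.1 hw hε.2.le]

lemma IsTrace.clm {X Y : Type} [NormedAddCommGroup X] [InnerProductSpace ℝ X]
    [NormedAddCommGroup Y] [InnerProductSpace ℝ Y] {K : Elem d} {F : Set (Vec d)}
    {w g : Vec d → X} (h : IsTrace K F w g) (A : X →L[ℝ] Y) :
    IsTrace K F (fun x => A (w x)) (fun x => A (g x)) := by
  refine ⟨A.comp_memLp' h.1, ?_⟩
  have h1 : ∀ a b : X, ‖A a - A b‖ₑ ^ 2 ≤ ‖A‖ₑ ^ 2 * ‖a - b‖ₑ ^ 2 := by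
    intro a b
    rw [← map_sub, ← mul_pow]
    exact pow_le_pow_left₀ (by positivity) (A.le_opENorm _) 2
  have hfin : ‖A‖ₑ ^ 2 ≠ ∞ := ENNReal.pow_ne_top enorm_ne_top
  have h2 := ENNReal.Tendsto.const_mul h.2 (Or.inr hfin)
  rw [mul_zero] at h2
  refine tendsto_of_tendsto_of_tendsto_of_le_of_le tendsto_const_nhds h2 (fun _ => zero_le)
    fun ε => ?_
  simp only
  rw [← mul_div_assoc, ← lintegral_const_mul' _ _ hfin]
  refine ENNReal.div_le_div_right (lintegral_mono fun δ => ?_) _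
  rw [← lintegral_const_mul' _ _ hfin]
  exact lintegral_mono fun x => h1 _ _

lemma IsTrace.add {X : Type} [NormedAddCommGroup X] [InnerProductSpace ℝ X] {K : Elem d}
    {F : Set (Vec d)} {w₁ g₁ w₂ g₂ : Vec d → X} [SFinite ((area d).restrict F)]
    (h₁ : IsTrace K F w₁ g₁) (h₂ : IsTrace K F w₂ g₂)
    (hw₁ : AEStronglyMeasurable (fun z => w₁ (coneMap (center K) z))
      ((volume.restrict (Ioo (0 : ℝ) 1)).prod ((area d).restrict F)))
    (hw₂ : AEStronglyMeasurable (fun z => w₂ (coneMap (center K) z))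
      ((volume.restrict (Ioo (0 : ℝ) 1)).prod ((area d).restrict F))) :
    IsTrace K F (fun x => w₁ x + w₂ x) (fun x => g₁ x + g₂ x) := by
  refine (isTrace_iff_prod (h₁.1.add h₂.1) (hw₁.add hw₂)).2 ?_
  have h := ENNReal.Tendsto.const_mul (((isTrace_iff_prod h₁.1 hw₁).1 h₁).add
    ((isTrace_iff_prod h₂.1 hw₂).1 h₂)) (a := 2) (Or.inr ENNReal.ofNat_ne_top)
  rw [add_zero, mul_zero] at h
  refine tendsto_of_tendsto_of_tendsto_of_le_of_le' tendsto_const_nhds h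
    (Eventually.of_forall fun _ => zero_le) ?_
  filter_upwards [Ioo_mem_nhdsGT (zero_lt_one (α := ℝ))] with ε hε
  have hle : volume.restrict (Ioo (0 : ℝ) ε) ≤ volume.restrict (Ioo (0 : ℝ) 1) :=
    Measure.restrict_mono (Ioo_subset_Ioo_right hε.2.le) le_rfl
  have hm₁ : AEMeasurable (fun z => ‖w₁ (coneMap (center K) z) - g₁ z.2‖ₑ ^ 2)
      ((volume.restrict (Ioo (0 : ℝ) ε)).prod ((area d).restrict F)) :=
    ((hw₁.mono_measure (Measure.prod_mono hle le_rfl)).sub h₁.1.1.comp_snd).enorm.pow_const 2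
  rw [← ENNReal.add_div, ← mul_div_assoc, ← lintegral_add_left' hm₁,
    ← lintegral_const_mul' _ _ ENNReal.ofNat_ne_top]
  refine ENNReal.div_le_div_right (lintegral_mono fun z => ?_) _
  have h3 : ∀ a b c e : X, ‖a + b - (c + e)‖ₑ ^ 2 ≤ 2 * (‖a - c‖ₑ ^ 2 + ‖b - e‖ₑ ^ 2) := by
    intro a b c e
    rw [add_sub_add_comm]
    refine (pow_le_pow_left₀ (by positivity) (enorm_add_le _ _) 2).trans ?_
    have := ENNReal.rpow_add_le_mul_rpow_add_rpow ‖a - c‖ₑ ‖b - e‖ₑ one_le_two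
    norm_num at this
    exact this
  exact h3 _ _ _ _

/-- Averages over a layer along the face `F`, weighted by bounded multipliers that converge after
rescaling the layer, converge to an integral of the trace. -/
theorem tendsto_layer {X : Type} [NormedAddCommGroup X] [InnerProductSpace ℝ X] {K : Elem d}
    {F : Set (Vec d)} {w g : Vec d → X} (hFm : MeasurableSet F) (hfin : area d F < ∞)
    (h : IsTrace K F w g)
    (hw : AEStronglyMeasurable (fun z => w (coneMap (center K) z))
      ((volume.restrict (Ioo (0 : ℝ) 1)).prod ((area d).restrict F)))
    {N M : ℝ} (hN : 0 < N) {m : ℝ → ℝ × Vec d → X →L[ℝ] V} {m₀ : ℝ → Vec d → X →L[ℝ] V}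
    (hm : ∀ ε, Continuous (m ε))
    (hM : ∀ ε > 0, N * ε < 1 → ∀ δ ∈ Icc (0 : ℝ) 1, ∀ x ∈ F, ‖m ε (δ, x)‖ ≤ M)
    (hlim : ∀ t ∈ Ioo (0 : ℝ) 1, ∀ᵐ x ∂((area d).restrict F),
      Tendsto (fun ε => m ε (N * ε * t, x)) (𝓝[>] 0) (𝓝 (m₀ t x))) :
    Tendsto (fun ε : ℝ => ε⁻¹ • ∫ δ in (0 : ℝ)..N * ε, ∫ x in F,
        m ε (δ, x) (w (coneMap (center K) (δ, x))) ∂(area d)) (𝓝[>] 0)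
      (𝓝 (N • ∫ t in (0 : ℝ)..1, ∫ x in F, m₀ t x (g x) ∂(area d))) := by
  have : IsFiniteMeasure ((area d).restrict F) := ⟨by simpa using hfin⟩
  set μ := (area d).restrict F with hμ
  have hg1 : Integrable g μ := h.1.integrable one_le_two
  have hev : ∀ᶠ ε : ℝ in 𝓝[>] 0, 0 < ε ∧ N * ε < 1 := by
    have : Ioo (0 : ℝ) N⁻¹ ∈ 𝓝[>] 0 := Ioo_mem_nhdsGT (by positivity)
    filter_upwards [this] with ε hε
    refine ⟨hε.1, ?_⟩
    have := mul_lt_mul_of_pos_left hε.2 hN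
    rwa [mul_inv_cancel₀ hN.ne'] at this
  -- With `w` replaced by its trace, substitute `δ = N ε t` and use dominated convergence.
  have hA : Tendsto (fun ε : ℝ => ε⁻¹ • ∫ δ in (0 : ℝ)..N * ε, ∫ x, m ε (δ, x) (g x) ∂μ) (𝓝[>] 0)
      (𝓝 (N • ∫ t in (0 : ℝ)..1, ∫ x, m₀ t x (g x) ∂μ)) := by
    have heq : ∀ᶠ ε : ℝ in 𝓝[>] 0, N • (∫ t in (0 : ℝ)..1, ∫ x, m ε (N * ε * t, x) (g x) ∂μ)
        = ε⁻¹ • ∫ δ in (0 : ℝ)..N * ε, ∫ x, m ε (δ, x) (g x) ∂μ := by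
      filter_upwards [hev] with ε hε
      have := intervalIntegral.smul_integral_comp_mul_left
        (fun δ => ∫ x, m ε (δ, x) (g x) ∂μ) (N * ε) (a := 0) (b := 1)
      simp only [mul_zero, mul_one] at this
      rw [← this, smul_smul, mul_comm N ε, inv_mul_cancel_left₀ hε.1.ne']
    refine Tendsto.congr' heq ?_
    refine Tendsto.const_smul ?_ N
    have hmeas : ∀ ε, AEStronglyMeasurable (fun z : ℝ × Vec d => m ε (N * ε * z.1, z.2) (g z.2))
        ((volume.restrict (uIoc (0 : ℝ) 1)).prod μ) := by
      intro ε
      have h1 : AEStronglyMeasurable (fun z : ℝ × Vec d => m ε (N * ε * z.1, z.2))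
          ((volume.restrict (uIoc (0 : ℝ) 1)).prod μ) :=
        ((hm ε).comp (by fun_prop)).aestronglyMeasurable
      have h2 : AEStronglyMeasurable (fun z : ℝ × Vec d => g z.2)
          ((volume.restrict (uIoc (0 : ℝ) 1)).prod μ) := hg1.1.comp_snd
      exact (isBoundedBilinearMap_apply (𝕜 := ℝ) (E := X) (F := V)).continuous.comp_aestronglyMeasurable
        (h1.prodMk h2)
    refine intervalIntegral.tendsto_integral_filter_of_dominated_convergence
      (fun _ => |M| * ∫ x, ‖g x‖ ∂μ) ?_ ?_ ?_ ?_
    · exact Eventually.of_forall fun ε => (hmeas ε).integral_prod_right'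
    · filter_upwards [hev] with ε hε
      refine Eventually.of_forall fun t ht => ?_
      rw [uIoc_of_le zero_le_one] at ht
      rw [← integral_const_mul]
      refine norm_integral_le_of_norm_le (hg1.norm.const_mul _) ?_
      refine (ae_restrict_iff' hFm).2 (Eventually.of_forall fun x hx => ?_)
      refine (ContinuousLinearMap.le_opNorm _ _).trans ?_
      refine mul_le_mul_of_nonneg_right ((hM ε hε.1 hε.2 _ ?_ x hx).trans (le_abs_self _))
        (norm_nonneg _)
      have hNe : 0 < N * ε := mul_pos hN hε.1
      exact ⟨by nlinarith [ht.1], by nlinarith [ht.1, ht.2]⟩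
    · exact _root_.intervalIntegrable_const
    · have hne : ∀ᵐ t : ℝ, t ≠ 1 := compl_mem_ae_iff.2 (measure_singleton _)
      filter_upwards [hne] with t ht1 ht
      rw [uIoc_of_le zero_le_one] at ht
      have ht' : t ∈ Ioo (0 : ℝ) 1 := ⟨ht.1, lt_of_le_of_ne ht.2 ht1⟩
      refine tendsto_integral_filter_of_dominated_convergence (fun x => |M| * ‖g x‖) ?_ ?_
        (hg1.norm.const_mul _) ?_
      · refine Eventually.of_forall fun ε => ?_
        have h1 : AEStronglyMeasurable (fun x : Vec d => m ε (N * ε * t, x)) μ :=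
          ((hm ε).comp (by fun_prop)).aestronglyMeasurable
        exact (isBoundedBilinearMap_apply (𝕜 := ℝ) (E := X) (F := V)).continuous.comp_aestronglyMeasurable
          (h1.prodMk hg1.1)
      · filter_upwards [hev] with ε hε
        refine (ae_restrict_iff' hFm).2 (Eventually.of_forall fun x hx => ?_)
        refine (ContinuousLinearMap.le_opNorm _ _).trans ?_
        refine mul_le_mul_of_nonneg_right ((hM ε hε.1 hε.2 _ ?_ x hx).trans (le_abs_self _))
          (norm_nonneg _)
        have hNe : 0 < N * ε := mul_pos hN hε.1
        exact ⟨by nlinarith [ht.1], by nlinarith [ht.1, ht.2]⟩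
      · filter_upwards [hlim t ht'] with x hx
        exact ((ContinuousLinearMap.apply ℝ V (g x)).continuous.tendsto _).comp hx
  -- The difference is small by the definition of the trace.
  have hB : Tendsto (fun ε : ℝ => (ε⁻¹ • ∫ δ in (0 : ℝ)..N * ε, ∫ x,
        m ε (δ, x) (w (coneMap (center K) (δ, x))) ∂μ)
        - ε⁻¹ • ∫ δ in (0 : ℝ)..N * ε, ∫ x, m ε (δ, x) (g x) ∂μ) (𝓝[>] 0) (𝓝 0) := by
    have hN0 : Tendsto (fun ε : ℝ => N * ε) (𝓝[>] 0) (𝓝[>] 0) := by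
      refine tendsto_nhdsWithin_iff.2 ⟨?_, ?_⟩
      · have : Tendsto (fun ε : ℝ => N * ε) (𝓝 0) (𝓝 (N * 0)) := tendsto_id.const_mul N
        rw [mul_zero] at this
        exact this.mono_left nhdsWithin_le_nhds
      · filter_upwards [self_mem_nhdsWithin] with ε hε using mul_pos hN hε
    have htr := ((isTrace_iff_prod h.1 hw).1 h).comp hN0
    set R : ℝ → ℝ≥0∞ := fun ε => (∫⁻ z, ‖w (coneMap (center K) z) - g z.2‖ₑ ^ 2
      ∂((volume.restrict (Ioo (0 : ℝ) (N * ε))).prod μ)) / ENNReal.ofReal (N * ε) with hR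
    have htr' : Tendsto R (𝓝[>] 0) (𝓝 0) := htr
    have hq : Tendsto (fun ε => (R ε).toReal) (𝓝[>] 0) (𝓝 0) := by
      have := (ENNReal.tendsto_toReal ENNReal.zero_ne_top).comp htr'
      simpa [Function.comp_def] using this
    have hsq : Tendsto (fun ε => √(R ε).toReal) (𝓝[>] 0) (𝓝 0) := by
      have := (Real.continuous_sqrt.tendsto 0).comp hq
      simpa [Function.comp_def] using this
    have hid : Tendsto (fun ε : ℝ => ε) (𝓝[>] 0) (𝓝 0) := nhdsWithin_le_nhds
    -- This comes from `a ≤ (s + a² / s) / 2` with `s = √R + ε`. The summand `ε` keeps `s` positive.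
    have hbound : Tendsto (fun ε : ℝ => |M| * N / 2 *
        ((√(R ε).toReal + ε) * μ.real univ + √(R ε).toReal)) (𝓝[>] 0) (𝓝 0) := by
      have := ((((hsq.add hid).mul_const (μ.real univ)).add hsq).const_mul (|M| * N / 2))
      simpa using this
    refine squeeze_zero_norm' ?_ hbound
    filter_upwards [hev, htr'.eventually (gt_mem_nhds zero_lt_one)] with ε hε hRε
    have hNε : 0 < N * ε := mul_pos hN hε.1
    have hRfin : R ε ≠ ∞ := (lt_trans hRε ENNReal.one_lt_top).ne
    set P := (volume.restrict (Ioo (0 : ℝ) (N * ε))).prod μ with hP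
    set D : ℝ × Vec d → X := fun z => w (coneMap (center K) z) - g z.2 with hD
    have hle : volume.restrict (Ioo (0 : ℝ) (N * ε)) ≤ volume.restrict (Ioo (0 : ℝ) 1) :=
      Measure.restrict_mono (Ioo_subset_Ioo_right hε.2.le) le_rfl
    have hDm : AEStronglyMeasurable D P :=
      (hw.mono_measure (Measure.prod_mono hle le_rfl)).sub hg1.1.comp_snd
    have hlint : ∫⁻ z, ‖D z‖ₑ ^ 2 ∂P = R ε * ENNReal.ofReal (N * ε) := by
      rw [hR]
      exact (ENNReal.div_mul_cancel (by simpa using hNε) ENNReal.ofReal_ne_top).symm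
    have hD2 : MemLp D 2 P := by
      refine ⟨hDm, ?_⟩
      rw [eLpNorm_lt_top_iff_lintegral_rpow_enorm_lt_top two_ne_zero ENNReal.ofNat_ne_top]
      simp only [ENNReal.toReal_ofNat, ENNReal.rpow_ofNat]
      rw [hlint]
      exact ENNReal.mul_lt_top hRfin.lt_top ENNReal.ofReal_lt_top
    have hD1 : Integrable D P := hD2.integrable one_le_two
    have hDsq : ∫ z, ‖D z‖ ^ 2 ∂P = (R ε).toReal * (N * ε) := by
      rw [integral_eq_lintegral_of_nonneg_ae (Eventually.of_forall fun z => sq_nonneg _)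
        (hDm.norm.pow 2)]
      simp_rw [ENNReal.ofReal_pow (norm_nonneg _), ofReal_norm]
      rw [hlint, ENNReal.toReal_mul, ENNReal.toReal_ofReal hNε.le]
    have hg2 : Integrable (fun z : ℝ × Vec d => g z.2) P := hg1.comp_snd _
    have hae : ∀ᵐ z ∂P, ‖m ε z‖ ≤ |M| := by
      have ha1 : ∀ᵐ z ∂P, z.1 ∈ Ioo (0 : ℝ) (N * ε) :=
        Measure.quasiMeasurePreserving_fst.ae (ae_restrict_mem measurableSet_Ioo)
      have ha2 : ∀ᵐ z ∂P, z.2 ∈ F :=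
        Measure.quasiMeasurePreserving_snd.ae (ae_restrict_mem hFm)
      filter_upwards [ha1, ha2] with z h1 h2
      exact (hM ε hε.1 hε.2 z.1 ⟨h1.1.le, h1.2.le.trans hε.2.le⟩ z.2 h2).trans (le_abs_self _)
    have happ : ∀ f : ℝ × Vec d → X, Integrable f P → Integrable (fun z => m ε z (f z)) P := by
      intro f hf
      refine (hf.norm.const_mul |M|).mono' ?_ ?_
      · exact (isBoundedBilinearMap_apply (𝕜 := ℝ) (E := X) (F := V)).continuous.comp_aestronglyMeasurable
          ((hm ε).aestronglyMeasurable.prodMk hf.1)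
      · filter_upwards [hae] with z hz
        exact (ContinuousLinearMap.le_opNorm _ _).trans
          (mul_le_mul_of_nonneg_right hz (norm_nonneg _))
    have hw1 : Integrable (fun z => w (coneMap (center K) z)) P :=
      (hD1.add hg2).congr (Eventually.of_forall fun z => by simp [hD])
    have hiter : ∀ f : ℝ × Vec d → X, Integrable f P →
        ∫ δ in (0 : ℝ)..N * ε, ∫ x, m ε (δ, x) (f (δ, x)) ∂μ = ∫ z, m ε z (f z) ∂P := by
      intro f hf
      rw [intervalIntegral.integral_of_le hNε.le, integral_Ioc_eq_integral_Ioo,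
        integral_prod _ (happ f hf)]
    rw [hiter (fun z => w (coneMap (center K) z)) hw1, hiter (fun z => g z.2) hg2, ← smul_sub,
      ← integral_sub (happ _ hw1) (happ _ hg2)]
    simp only [← map_sub]
    rw [norm_smul, norm_inv, Real.norm_of_nonneg hε.1.le]
    set s := √(R ε).toReal + ε with hs
    have hspos : 0 < s := add_pos_of_nonneg_of_pos (Real.sqrt_nonneg _) hε.1
    have hPuniv : P.real univ = N * ε * μ.real univ := by
      rw [hP, measureReal_def, ← univ_prod_univ, Measure.prod_prod, ENNReal.toReal_mul]
      simp [hNε.le, measureReal_def]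
    have hDs : Integrable (fun z => ‖D z‖ ^ 2) P := hD2.integrable_norm_pow two_ne_zero
    have h1 : ‖∫ z, m ε z (D z) ∂P‖ ≤ ∫ z, |M| * ((s + ‖D z‖ ^ 2 / s) / 2) ∂P := by
      refine norm_integral_le_of_norm_le ?_ ?_
      · exact (((integrable_const s).add (hDs.div_const s)).div_const 2).const_mul |M|
      · filter_upwards [hae] with z hz
        refine (ContinuousLinearMap.le_opNorm _ _).trans
          (mul_le_mul hz ?_ (norm_nonneg _) (abs_nonneg _))
        have h2 : 2 * ‖D z‖ * s ≤ s * s + ‖D z‖ ^ 2 := by nlinarith [sq_nonneg (‖D z‖ - s)]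
        rw [le_div_iff₀ two_pos, ← mul_le_mul_iff_left₀ hspos, add_mul,
          div_mul_cancel₀ _ hspos.ne']
        linarith
    have h2 : ∫ z, |M| * ((s + ‖D z‖ ^ 2 / s) / 2) ∂P
        = |M| * ((s * (N * ε * μ.real univ) + (R ε).toReal * (N * ε) / s) / 2) := by
      rw [integral_const_mul, integral_div, integral_add (integrable_const s) (hDs.div_const s),
        integral_div, hDsq, integral_const, hPuniv, smul_eq_mul, mul_comm s]
    have h3 : (R ε).toReal / s ≤ √(R ε).toReal := by
      rw [div_le_iff₀ hspos]
      have := Real.mul_self_sqrt (ENNReal.toReal_nonneg (a := R ε))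
      nlinarith [Real.sqrt_nonneg (R ε).toReal, hε.1]
    calc ε⁻¹ * ‖∫ z, m ε z (D z) ∂P‖
        ≤ ε⁻¹ * (|M| * ((s * (N * ε * μ.real univ) + (R ε).toReal * (N * ε) / s) / 2)) := by
          rw [← h2]
          exact mul_le_mul_of_nonneg_left h1 (inv_nonneg.2 hε.1.le)
      _ = |M| * N / 2 * (s * μ.real univ + (R ε).toReal / s) := by
          have := hε.1.ne'
          field_simp
      _ ≤ |M| * N / 2 * (s * μ.real univ + √(R ε).toReal) := by
          refine mul_le_mul_of_nonneg_left (by linarith) (by positivity)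
  have := hB.add hA
  simpa using this

end

/-! ### Green's formula on an element -/

/-- A smooth step: `0` on `(-∞, 1/3]` and `1` on `[2/3, ∞)`. -/
def step (t : ℝ) : ℝ := Real.smoothTransition (3 * t - 1)

lemma contDiff_step {n : ℕ∞} : ContDiff ℝ n step :=
  Real.smoothTransition.contDiff.comp ((contDiff_const.mul contDiff_id).sub contDiff_const)

lemma step_eq_zero {t : ℝ} (ht : t ≤ 1 / 3) : step t = 0 :=
  Real.smoothTransition.zero_of_nonpos (by linarith)

lemma step_eq_one {t : ℝ} (ht : 2 / 3 ≤ t) : step t = 1 :=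
  Real.smoothTransition.one_of_one_le (by linarith)

lemma step_nonneg (t : ℝ) : 0 ≤ step t := Real.smoothTransition.nonneg _

lemma step_le_one (t : ℝ) : step t ≤ 1 := Real.smoothTransition.le_one _

lemma continuous_deriv_step : Continuous (deriv step) :=
  (contDiff_step (n := ⊤)).continuous_deriv (by exact_mod_cast le_top)

lemma differentiable_step : Differentiable ℝ step :=
  (contDiff_step (n := ⊤)).differentiable (by simp)

lemma deriv_step_eq_zero {t : ℝ} (ht : 2 / 3 < t) : deriv step t = 0 := by
  have : step =ᶠ[𝓝 t] fun _ => 1 := by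
    filter_upwards [lt_mem_nhds ht] with s hs using step_eq_one hs.le
  rw [this.deriv_eq, deriv_const]

lemma deriv_step_eq_zero' {t : ℝ} (ht : t < 1 / 3) : deriv step t = 0 := by
  have : step =ᶠ[𝓝 t] fun _ => 0 := by
    filter_upwards [gt_mem_nhds ht] with s hs using step_eq_zero hs.le
  rw [this.deriv_eq, deriv_const]

lemma exists_bound_deriv_step : ∃ D, 0 ≤ D ∧ ∀ t, |deriv step t| ≤ D := by
  obtain ⟨D, hD⟩ := (isCompact_Icc (a := (0 : ℝ)) (b := 1)).exists_bound_of_continuousOn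
    continuous_deriv_step.continuousOn
  refine ⟨D, (norm_nonneg _).trans (hD 0 ⟨le_rfl, zero_le_one⟩), fun t => ?_⟩
  by_cases ht : t ∈ Icc (0 : ℝ) 1
  · exact hD t ht
  · have h0 : deriv step t = 0 := by
      rw [mem_Icc, not_and_or, not_le, not_le] at ht
      rcases ht with h | h
      · exact deriv_step_eq_zero' (by linarith)
      · exact deriv_step_eq_zero (by linarith)
    rw [h0, abs_zero]
    exact (norm_nonneg _).trans (hD 0 ⟨le_rfl, zero_le_one⟩)

lemma integral_deriv_step : ∫ t in (0 : ℝ)..1, deriv step t = 1 := by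
  rw [intervalIntegral.integral_deriv_eq_sub (fun t _ => differentiable_step t)
    (continuous_deriv_step.intervalIntegrable _ _), step_eq_one (by norm_num),
    step_eq_zero (by norm_num)]
  norm_num

/-- A cut-off function which vanishes near the boundary of `K` and tends to `1` inside `K`. -/
def cutoff (K : Elem d) (ε : ℝ) (x : Vec d) : ℝ := ∏ j, step (bary K j x / ε)

/-- `ε` times the gradient of the cut-off function. With this factor it is bounded uniformly in
`ε`. -/
def cutoffGrad (K : Elem d) (ε : ℝ) (x : Vec d) : Vec d :=
  ∑ l, ((∏ j ∈ Finset.univ.erase l, step (bary K j x / ε)) * deriv step (bary K l x / ε)) •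
    baryGrad K l

lemma hasFDerivAt_bary (K : Elem d) (i : Fin (d + 1)) (x : Vec d) :
    HasFDerivAt (bary K i) (innerSL ℝ (baryGrad K i)) x := by
  have h : bary K i = fun y => bary K i 0 + innerSL ℝ (baryGrad K i) y := by
    funext y
    exact bary_eq_inner K i y
  rw [h]
  exact (innerSL ℝ (baryGrad K i)).hasFDerivAt.const_add _

lemma contDiff_bary (K : Elem d) (i : Fin (d + 1)) {n : ℕ∞} : ContDiff ℝ n (bary K i) := by
  have h : bary K i = fun y => bary K i 0 + innerSL ℝ (baryGrad K i) y := by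
    funext y
    exact bary_eq_inner K i y
  rw [h]
  exact contDiff_const.add (innerSL ℝ (baryGrad K i)).contDiff

lemma contDiff_cutoff (K : Elem d) (ε : ℝ) {n : ℕ∞} : ContDiff ℝ n (cutoff K ε) :=
  contDiff_prod fun j _ => contDiff_step.comp ((contDiff_bary K j).div_const ε)

lemma continuous_cutoffGrad (K : Elem d) (ε : ℝ) : Continuous (cutoffGrad K ε) := by
  refine continuous_finsetSum _ fun l _ => ?_
  have h1 : Continuous fun x => ∏ j ∈ Finset.univ.erase l, step (bary K j x / ε) :=
    continuous_finsetProd _ fun j _ => (contDiff_step (n := 0)).continuous.comp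
      ((continuous_bary K j).div_const ε)
  have h2 : Continuous fun x => deriv step (bary K l x / ε) :=
    continuous_deriv_step.comp ((continuous_bary K l).div_const ε)
  exact (h1.mul h2).smul continuous_const

lemma hasGradientAt_cutoff (K : Elem d) (ε : ℝ) (x : Vec d) :
    HasGradientAt (cutoff K ε) (ε⁻¹ • cutoffGrad K ε x) x := by
  rw [hasGradientAt_iff_hasFDerivAt]
  have h : ∀ j ∈ (Finset.univ : Finset (Fin (d + 1))), HasFDerivAt (fun y => step (bary K j y / ε))
      ((deriv step (bary K j x / ε) * ε⁻¹) • innerSL ℝ (baryGrad K j)) x := by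
    intro j _
    have h1 := (differentiable_step (bary K j x / ε)).hasDerivAt
    have h2 : HasFDerivAt (fun y => bary K j y / ε) (ε⁻¹ • innerSL ℝ (baryGrad K j)) x := by
      simp_rw [div_eq_mul_inv]
      exact (hasFDerivAt_bary K j x).mul_const ε⁻¹
    have h3 := h1.comp_hasFDerivAt x h2
    rwa [smul_smul] at h3
  refine (HasFDerivAt.finsetProd h).congr_fderiv ?_
  ext y
  simp only [cutoffGrad, InnerProductSpace.toDual_apply_apply, inner_smul_left, sum_inner,
    FunLike.coe_sum, Finset.sum_apply, FunLike.coe_smul, Pi.smul_apply, innerSL_apply_apply,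
    smul_eq_mul, Finset.mul_sum, conj_trivial]
  refine Finset.sum_congr rfl fun l _ => ?_
  ring

lemma cutoff_nonneg (K : Elem d) (ε : ℝ) (x : Vec d) : 0 ≤ cutoff K ε x :=
  Finset.prod_nonneg fun _ _ => step_nonneg _

lemma cutoff_le_one (K : Elem d) (ε : ℝ) (x : Vec d) : cutoff K ε x ≤ 1 :=
  Finset.prod_le_one (fun _ _ => step_nonneg _) fun _ _ => step_le_one _

lemma tsupport_cutoff_subset (K : Elem d) {ε : ℝ} (hε : 0 < ε) :
    tsupport (cutoff K ε) ⊆ interior (body K) := by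
  have h1 : tsupport (cutoff K ε) ⊆ ⋂ j, {x | ε / 3 ≤ bary K j x} := by
    refine closure_minimal (fun x hx => ?_)
      (isClosed_iInter fun j => isClosed_le continuous_const (continuous_bary K j))
    rw [mem_iInter]
    intro j
    by_contra h
    refine hx (Finset.prod_eq_zero (Finset.mem_univ j) (step_eq_zero ?_))
    rw [Set.mem_ofPred_eq, not_le] at h
    rw [div_le_iff₀ hε]
    linarith
  intro x hx
  refine mem_interior_body.2 fun j => ?_
  have := mem_iInter.1 (h1 hx) j
  rw [Set.mem_ofPred_eq] at this
  linarith

lemma norm_cutoffGrad_le (K : Elem d) : ∃ D, ∀ ε x, ‖cutoffGrad K ε x‖ ≤ D := by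
  obtain ⟨D, hD0, hD⟩ := exists_bound_deriv_step
  refine ⟨∑ l, D * ‖baryGrad K l‖, fun ε x => (norm_sum_le _ _).trans
    (Finset.sum_le_sum fun l _ => ?_)⟩
  rw [norm_smul]
  refine mul_le_mul_of_nonneg_right ?_ (norm_nonneg _)
  rw [norm_mul, Real.norm_of_nonneg (Finset.prod_nonneg fun _ _ => step_nonneg _)]
  calc _ ≤ 1 * D := mul_le_mul (Finset.prod_le_one (fun _ _ => step_nonneg _)
        fun _ _ => step_le_one _) (hD _) (abs_nonneg _) zero_le_one
    _ = D := one_mul D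

lemma cutoffGrad_eq_zero {K : Elem d} {ε : ℝ} (hε : 0 < ε) {x : Vec d} (h : ∀ j, ε ≤ bary K j x) :
    cutoffGrad K ε x = 0 := by
  refine Finset.sum_eq_zero fun l _ => ?_
  rw [deriv_step_eq_zero, mul_zero, zero_smul]
  rw [lt_div_iff₀ hε]
  have := h l
  linarith

/-- Outside the body the rescaled gradient vanishes as well. -/
lemma cutoffGrad_eq_zero_of_notMem {K : Elem d} {ε : ℝ} (hε : 0 < ε) {x : Vec d}
    (h : x ∉ body K) : cutoffGrad K ε x = 0 := by
  have h1 := hasGradientAt_cutoff K ε x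
  have h2 : cutoff K ε =ᶠ[𝓝 x] fun _ => 0 :=
    notMem_tsupport_iff_eventuallyEq.1 fun hx => h (interior_subset (tsupport_cutoff_subset K hε hx))
  have h3 : HasGradientAt (cutoff K ε) 0 x := (hasGradientAt_const x (0 : ℝ)).congr_of_eventuallyEq h2
  have h4 := h1.unique h3
  exact (smul_eq_zero.1 h4).resolve_left (inv_ne_zero hε.ne')

lemma tendsto_cutoff {K : Elem d} {x : Vec d} (hx : x ∈ interior (body K)) :
    Tendsto (fun ε => cutoff K ε x) (𝓝[>] 0) (𝓝 1) := by
  refine tendsto_const_nhds.congr' ?_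
  have h : ∀ᶠ ε : ℝ in 𝓝[>] 0, ∀ j, ε ≤ bary K j x := by
    rw [eventually_all]
    intro j
    have := mem_interior_body.1 hx j
    filter_upwards [Ioo_mem_nhdsGT this] with ε hε using hε.2.le
  filter_upwards [h, self_mem_nhdsWithin] with ε hε hε0
  refine (Finset.prod_eq_one fun j _ => step_eq_one ?_).symm
  rw [le_div_iff₀ hε0]
  have := hε j
  have : (0 : ℝ) < ε := hε0
  linarith

/-- In the layer along the `i`-th facet, away from the ridges, the rescaled gradient of the cut-off
function tends to a multiple of the gradient of the `i`-th barycentric coordinate. -/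
lemma tendsto_cutoffGrad {K : Elem d} {i : Fin (d + 1)} {x : Vec d} (hi : x ∈ facet K i)
    (hx : x ∉ ridge K) {t : ℝ} :
    Tendsto (fun ε => cutoffGrad K ε (coneMap (center K) (((d : ℝ) + 1) * ε * t, x))) (𝓝[>] 0)
      (𝓝 (deriv step t • baryGrad K i)) := by
  have hN : (0 : ℝ) < (d : ℝ) + 1 := by positivity
  have hb : ∀ j ε, bary K j (coneMap (center K) (((d : ℝ) + 1) * ε * t, x))
      = bary K j x + ε * (t - (d + 1) * t * bary K j x) := by
    intro j ε
    rw [bary_coneMap, bary_center]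
    field_simp
    ring
  have hlarge : ∀ j, j ≠ i → ∀ᶠ ε : ℝ in 𝓝[>] 0,
      1 ≤ bary K j (coneMap (center K) (((d : ℝ) + 1) * ε * t, x)) / ε := by
    intro j hj
    have hpos := bary_pos_of_notMem_ridge hx hi hj
    have hc : Tendsto (fun ε : ℝ => bary K j x + ε * (t - (d + 1) * t * bary K j x) - ε) (𝓝[>] 0)
        (𝓝 (bary K j x)) := by
      have : Continuous fun ε : ℝ => bary K j x + ε * (t - (d + 1) * t * bary K j x) - ε := by
        fun_prop
      have := this.tendsto 0
      simp only [zero_mul, add_zero, sub_zero] at this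
      exact this.mono_left nhdsWithin_le_nhds
    filter_upwards [hc.eventually (lt_mem_nhds hpos), self_mem_nhdsWithin] with ε h1 h2
    rw [hb, le_div_iff₀ h2]
    linarith
  have hall : ∀ᶠ ε : ℝ in 𝓝[>] 0, ∀ j, j ≠ i →
      1 ≤ bary K j (coneMap (center K) (((d : ℝ) + 1) * ε * t, x)) / ε := by
    rw [eventually_all]
    intro j
    by_cases hj : j = i
    · exact Eventually.of_forall fun _ h => absurd hj h
    · filter_upwards [hlarge j hj] with ε h _ using h
  refine tendsto_const_nhds.congr' ?_
  filter_upwards [hall, self_mem_nhdsWithin] with ε hε hε0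
  have hε0' : (0 : ℝ) < ε := hε0
  have hbi : bary K i (coneMap (center K) (((d : ℝ) + 1) * ε * t, x)) / ε = t := by
    rw [hb, bary_eq_zero_of_mem_facet hi]
    field_simp
    ring
  rw [cutoffGrad, Finset.sum_eq_single i]
  · rw [hbi, Finset.prod_eq_one, one_mul]
    intro j hj
    exact step_eq_one (by linarith [hε j (Finset.ne_of_mem_erase hj)])
  · intro l _ hl
    rw [deriv_step_eq_zero (by linarith [hε l hl]), mul_zero, zero_smul]
  · simp

section

variable {Ω : Set (Vec d)} {κ γ : ℝ} {𝒯 : Finset (Elem d)}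

lemma volume_restrict_body_le (hΩ : IsPolyhedralDomain Ω) (hT : IsMesh Ω κ γ 𝒯) {K : Elem d}
    (hK : K ∈ 𝒯) : volume.restrict (body K) ≤ volume.restrict Ω := by
  have h : body K =ᵐ[volume] interior (body K) := by
    refine (ae_eq_set).2 ⟨?_, ?_⟩
    · rw [← (isClosed_body K).frontier_eq]
      exact volume_frontier_body K
    · rw [sdiff_eq_empty.2 interior_subset, measure_empty]
  rw [Measure.restrict_congr_set h]
  exact Measure.restrict_mono (interior_body_subset hΩ hT hK) le_rfl

lemma isTest_cutoff_mul (hΩ : IsPolyhedralDomain Ω) (hT : IsMesh Ω κ γ 𝒯) {K : Elem d}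
    (hK : K ∈ 𝒯) {ε : ℝ} (hε : 0 < ε) {v : Vec d → ℝ} (hv : ContDiff ℝ (⊤ : ℕ∞) v) :
    IsTest Ω (fun x => cutoff K ε x * v x) := by
  have hs : tsupport (fun x => cutoff K ε x * v x) ⊆ interior (body K) :=
    (tsupport_mul_subset_left (f := cutoff K ε) (g := v)).trans (tsupport_cutoff_subset K hε)
  exact ⟨(contDiff_cutoff K ε).mul hv,
    (isCompact_body K).of_isClosed_subset (isClosed_tsupport _) (hs.trans interior_subset),
    hs.trans (interior_body_subset hΩ hT hK)⟩

variable {X : Type} [NormedAddCommGroup X] [InnerProductSpace ℝ X]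
  {V : Type} [NormedAddCommGroup V] [NormedSpace ℝ V] [CompleteSpace V]

/-- The contribution of the cut-off layer to the weak formulation converges to the boundary term. In
polar coordinates around the centroid, whose barycentric coordinates are `1 / (d + 1)`, the layer
is contained in `δ ≤ (d + 1) ε`. -/
lemma tendsto_boundary_layer (hd : 2 ≤ d) (hΩ : IsPolyhedralDomain Ω) (hT : IsMesh Ω κ γ 𝒯)
    {K : Elem d} (hK : K ∈ 𝒯) (L : X →L[ℝ] Vec d →L[ℝ] V) {w : Vec d → X}
    (hw : MemLp w 2 (volume.restrict (body K))) {tr : Set (Vec d) → Vec d → X}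
    (htr : ∀ F ∈ facesOf Ω 𝒯 K, IsTrace K F w (tr F)) {v : Vec d → ℝ} (hv : Continuous v) :
    Tendsto (fun ε : ℝ => ε⁻¹ • ∫ x in body K, v x • L (w x) (cutoffGrad K ε x)) (𝓝[>] 0)
      (𝓝 (-∑ F ∈ facesOf Ω 𝒯 K, ∫ x in F, v x • L (tr F x) (normal K F) ∂(area d))) := by
  have hd1 : 1 ≤ d := by omega
  have hvol : IsFiniteMeasure (volume.restrict (body K)) :=
    ⟨by simpa using volume_body_lt_top K⟩
  have hw1 : IntegrableOn w (body K) := hw.integrable one_le_two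
  set N : ℝ := (d : ℝ) + 1 with hN
  have hN0 : 0 < N := by positivity
  obtain ⟨D, hD⟩ := norm_cutoffGrad_le K
  obtain ⟨A, hA⟩ := (isCompact_body K).exists_bound_of_continuousOn hv.continuousOn
  set m : ℝ → ℝ × Vec d → X →L[ℝ] V := fun ε z => ((1 - z.1) ^ (d - 1) *
    v (coneMap (center K) z)) • L.flip (cutoffGrad K ε (coneMap (center K) z)) with hm
  have hcone : ∀ δ ∈ Icc (0 : ℝ) 1, ∀ x ∈ body K, coneMap (center K) (δ, x) ∈ body K := by
    intro δ hδ x hx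
    refine mem_body.2 fun j => ?_
    rw [bary_coneMap]
    have h1 := mem_body.1 hx j
    have h2 := (bary_center_pos K j).le
    have : 0 ≤ 1 - δ := by linarith [hδ.2]
    exact add_nonneg (mul_nonneg this h1) (mul_nonneg hδ.1 h2)
  have hmc : ∀ ε, Continuous (m ε) := by
    intro ε
    have h1 := continuous_coneMap (center K)
    have h2 := (continuous_cutoffGrad K ε).comp h1
    exact ((((continuous_const.sub continuous_fst).pow _).mul (hv.comp h1))).smul
      (L.flip.continuous.comp h2)
  have hFb : ∀ F ∈ facesOf Ω 𝒯 K, F ⊆ body K := fun F hF => (mem_facesOf.1 hF).2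
  have hFm : ∀ F ∈ facesOf Ω 𝒯 K, MeasurableSet F := fun F hF =>
    measurableSet_of_mem_faces (mem_facesOf.1 hF).1
  have hD0 : 0 ≤ D := (norm_nonneg _).trans (hD 0 0)
  have hM : ∀ F ∈ facesOf Ω 𝒯 K, ∀ ε > 0, N * ε < 1 → ∀ δ ∈ Icc (0 : ℝ) 1, ∀ x ∈ F,
      ‖m ε (δ, x)‖ ≤ A * (‖L.flip‖ * D) := by
    intro F hF ε _ _ δ hδ x hx
    have hmem := hcone δ hδ x (hFb F hF hx)
    have hA0 : 0 ≤ A := (norm_nonneg _).trans (hA _ hmem)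
    rw [hm, norm_smul, norm_mul]
    refine mul_le_mul ?_ ?_ (norm_nonneg _) hA0
    · have h1 : ‖(1 - δ) ^ (d - 1)‖ ≤ 1 := by
        have h2 : 0 ≤ 1 - δ := by linarith [hδ.2]
        rw [Real.norm_of_nonneg (by positivity)]
        exact pow_le_one₀ h2 (by linarith [hδ.1])
      calc _ ≤ 1 * A := mul_le_mul h1 (hA _ hmem) (norm_nonneg _) zero_le_one
        _ = A := one_mul A
    · exact (L.flip.le_opNorm _).trans (mul_le_mul_of_nonneg_left (hD _ _) (norm_nonneg _))
  have hlim : ∀ F ∈ facesOf Ω 𝒯 K, ∀ t ∈ Ioo (0 : ℝ) 1, ∀ᵐ x ∂((area d).restrict F),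
      Tendsto (fun ε => m ε (N * ε * t, x)) (𝓝[>] 0)
        (𝓝 (v x • L.flip (deriv step t • baryGrad K (facetIndex K F)))) := by
    intro F hF t _
    have hr : ∀ᵐ x ∂((area d).restrict F), x ∉ ridge K :=
      ae_restrict_of_ae (measure_eq_zero_iff_ae_notMem.1 (area_ridge hd1 K))
    filter_upwards [hr, ae_restrict_mem (hFm F hF)] with x hx hxF
    have h1 := tendsto_cutoffGrad (subset_facetIndex hd1 hΩ hT hK hF hxF) hx (t := t)
    have h2 := (L.flip.continuous.tendsto _).comp h1
    have h3 : Tendsto (fun ε : ℝ => (1 - N * ε * t) ^ (d - 1) *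
        v (coneMap (center K) (N * ε * t, x))) (𝓝[>] 0) (𝓝 (v x)) := by
      have hc : Continuous fun ε : ℝ => (1 - N * ε * t) ^ (d - 1) *
          v (coneMap (center K) (N * ε * t, x)) := by
        have := continuous_coneMap (center K)
        fun_prop
      have := (hc.tendsto 0).mono_left (nhdsWithin_le_nhds (s := Ioi 0))
      simpa [coneMap] using this
    exact h3.smul h2
  have hkey := fun F (hF : F ∈ facesOf Ω 𝒯 K) => by
    have hfin := area_lt_top_of_mem_facesOf hd1 hΩ hT hK hF
    have : IsFiniteMeasure ((area d).restrict F) := ⟨by simpa using hfin⟩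
    exact tendsto_layer (hFm F hF) hfin (htr F hF)
      (hw.1.comp_quasiMeasurePreserving (quasiMeasurePreserving_coneMap hd hΩ hT hK hF)) hN0 hmc
      (hM F hF) (hlim F hF)
  have hsum := tendsto_finsetSum (facesOf Ω 𝒯 K) fun F hF =>
    (hkey F hF).const_smul (coneHeight K (facetIndex K F) (center K))
  have hval : ∑ F ∈ facesOf Ω 𝒯 K, coneHeight K (facetIndex K F) (center K) •
      (N • ∫ t in (0 : ℝ)..1, ∫ x in F,
        (v x • L.flip (deriv step t • baryGrad K (facetIndex K F))) (tr F x) ∂(area d))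
      = -∑ F ∈ facesOf Ω 𝒯 K, ∫ x in F, v x • L (tr F x) (normal K F) ∂(area d) := by
    rw [← Finset.sum_neg_distrib]
    refine Finset.sum_congr rfl fun F hF => ?_
    rw [normal_eq hd1 hΩ hT hK hF]
    simp only [map_smul, map_neg, FunLike.coe_smul, Pi.smul_apply,
      ContinuousLinearMap.flip_apply]
    simp only [smul_comm (v _), integral_smul, smul_neg, integral_neg, neg_neg,
      intervalIntegral.integral_smul_const, integral_deriv_step, one_smul]
    -- The height of the cone cancels `d + 1` and normalises the gradient.
    rw [smul_smul]
    congr 1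
    rw [coneHeight, bary_center, ← hN]
    field_simp
  rw [hval] at hsum
  refine hsum.congr' ?_
  have hev : ∀ᶠ ε : ℝ in 𝓝[>] 0, 0 < ε ∧ N * ε < 1 := by
    have : Ioo (0 : ℝ) N⁻¹ ∈ 𝓝[>] 0 := Ioo_mem_nhdsGT (by positivity)
    filter_upwards [this] with ε hε
    refine ⟨hε.1, ?_⟩
    have := mul_lt_mul_of_pos_left hε.2 hN0
    rwa [mul_inv_cancel₀ hN0.ne'] at this
  filter_upwards [hev] with ε hε
  have hint : IntegrableOn (fun x => v x • L (w x) (cutoffGrad K ε x)) (body K) := by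
    refine (hw1.norm.const_mul (A * (‖L‖ * D))).mono' ?_ ?_
    · refine hv.aestronglyMeasurable.smul ?_
      exact (isBoundedBilinearMap_apply (𝕜 := ℝ) (E := Vec d) (F := V)).continuous.comp_aestronglyMeasurable
        ((L.continuous.comp_aestronglyMeasurable hw.1).prodMk
          (continuous_cutoffGrad K ε).aestronglyMeasurable)
    · filter_upwards [ae_restrict_mem (isClosed_body K).measurableSet] with x hx
      have hA0 : 0 ≤ A := (norm_nonneg _).trans (hA _ hx)
      rw [norm_smul]
      calc ‖v x‖ * ‖L (w x) (cutoffGrad K ε x)‖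
          ≤ A * (‖L‖ * ‖w x‖ * D) := by
            refine mul_le_mul (hA x hx) ?_ (norm_nonneg _) hA0
            exact (L.le_opNorm₂ _ _).trans (mul_le_mul_of_nonneg_left (hD _ _) (by positivity))
        _ = _ := by ring
  rw [integral_body_eq hd hΩ hT hK hint, Finset.smul_sum]
  refine Finset.sum_congr rfl fun F hF => ?_
  rw [smul_comm]
  congr 2
  have hrw : ∀ δ : ℝ, (1 - δ) ^ (d - 1) • ∫ x in F, v (coneMap (center K) (δ, x)) •
      L (w (coneMap (center K) (δ, x))) (cutoffGrad K ε (coneMap (center K) (δ, x))) ∂(area d)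
      = ∫ x in F, m ε (δ, x) (w (coneMap (center K) (δ, x))) ∂(area d) := by
    intro δ
    rw [← integral_smul]
    refine integral_congr_ae (Eventually.of_forall fun x => ?_)
    simp only [hm, FunLike.coe_smul, Pi.smul_apply, ContinuousLinearMap.flip_apply, smul_smul]
  simp_rw [hrw]
  have hNε : 0 < N * ε := mul_pos hN0 hε.1
  rw [intervalIntegral.integral_of_le hNε.le, intervalIntegral.integral_of_le zero_le_one]
  symm
  refine setIntegral_eq_of_subset_of_forall_sdiff_eq_zero measurableSet_Ioc
    (Ioc_subset_Ioc_right hε.2.le) fun δ hδ => ?_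
  rw [← integral_zero (Vec d) V (μ := (area d).restrict F)]
  refine setIntegral_congr_fun (hFm F hF) fun x hx => ?_
  have hδ1 : N * ε < δ := by
    by_contra h
    exact hδ.2 ⟨hδ.1.1, not_lt.1 h⟩
  have h0 : cutoffGrad K ε (coneMap (center K) (δ, x)) = 0 := by
    refine cutoffGrad_eq_zero hε.1 fun j => ?_
    rw [bary_coneMap, bary_center]
    have h1 := mem_body.1 (hFb F hF hx) j
    have h2 : 0 ≤ (1 - δ) * bary K j x := mul_nonneg (by linarith [hδ.1.2]) h1
    have h3 : ε ≤ δ * N⁻¹ := by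
      rw [← div_eq_mul_inv, le_div_iff₀ hN0]
      linarith
    simp only
    linarith
  simp [hm, h0]

/-- Green's formula on an element, for a field with an `L²` trace and a weak divergence: test the weak
formulation with the product of `v` and the cut-off function of `K`, and let the width of the layer
tend to zero. The pairing `L` covers the scalar and the tensor-valued case at the same time. -/
theorem green_element (hd : 2 ≤ d) (hΩ : IsPolyhedralDomain Ω) (hT : IsMesh Ω κ γ 𝒯)
    {K : Elem d} (hK : K ∈ 𝒯) (L : X →L[ℝ] Vec d →L[ℝ] V) {w : Vec d → X} {g : Vec d → V}
    (hw : MemLp w 2 (volume.restrict Ω)) (hg : MemLp g 2 (volume.restrict Ω))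
    (hweak : ∀ φ, IsTest Ω φ →
      ∫ x in Ω, L (w x) (gradient φ x) = -∫ x in Ω, φ x • g x)
    {tr : Set (Vec d) → Vec d → X} (htr : ∀ F ∈ facesOf Ω 𝒯 K, IsTrace K F w (tr F))
    {v : Vec d → ℝ} (hv : ContDiff ℝ (⊤ : ℕ∞) v) :
    ∑ F ∈ facesOf Ω 𝒯 K, ∫ x in F, v x • L (tr F x) (normal K F) ∂(area d)
      = (∫ x in body K, L (w x) (gradient v x)) + ∫ x in body K, v x • g x := by
  have hvol : IsFiniteMeasure (volume.restrict (body K)) :=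
    ⟨by simpa using volume_body_lt_top K⟩
  have hle := volume_restrict_body_le hΩ hT hK
  have hwK := hw.mono_measure hle
  have hgK := hg.mono_measure hle
  have hw1 : Integrable w (volume.restrict (body K)) := hwK.integrable one_le_two
  have hg1 : Integrable g (volume.restrict (body K)) := hgK.integrable one_le_two
  have hbm := (isClosed_body K).measurableSet
  have hlay := tendsto_boundary_layer hd hΩ hT hK L hwK htr hv.continuous
  have hgrad : Continuous (gradient v) := by
    have h1 := hv.continuous_fderiv (by simp)
    exact (InnerProductSpace.toDual ℝ (Vec d)).symm.continuous.comp h1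
  have hvd : ∀ x, HasGradientAt v (gradient v x) x := fun x =>
    (hv.differentiable (by simp) x).hasGradientAt
  obtain ⟨A, hA⟩ := (isCompact_body K).exists_bound_of_continuousOn hv.continuous.continuousOn
  obtain ⟨B, hB⟩ := (isCompact_body K).exists_bound_of_continuousOn hgrad.continuousOn
  have hLw : Integrable (fun x => L (w x) (gradient v x)) (volume.restrict (body K)) := by
    refine (hw1.norm.const_mul (‖L‖ * B)).mono' ?_ ?_
    · exact (isBoundedBilinearMap_apply (𝕜 := ℝ) (E := Vec d) (F := V)).continuous.comp_aestronglyMeasurable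
        ((L.continuous.comp_aestronglyMeasurable hwK.1).prodMk hgrad.aestronglyMeasurable)
    · filter_upwards [ae_restrict_mem hbm] with x hx
      calc ‖L (w x) (gradient v x)‖ ≤ ‖L‖ * ‖w x‖ * B :=
            (L.le_opNorm₂ _ _).trans (mul_le_mul_of_nonneg_left (hB x hx) (by positivity))
        _ = _ := by ring
  have hvg : Integrable (fun x => v x • g x) (volume.restrict (body K)) := by
    refine (hg1.norm.const_mul A).mono' (hv.continuous.aestronglyMeasurable.smul hgK.1) ?_
    filter_upwards [ae_restrict_mem hbm] with x hx
    rw [norm_smul]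
    exact mul_le_mul_of_nonneg_right (hA x hx) (norm_nonneg _)
  have hint : ∀ᵐ x ∂(volume.restrict (body K)), x ∈ interior (body K) := by
    have h0 : ∀ᵐ x ∂(volume : Measure (Vec d)), x ∉ frontier (body K) :=
      measure_eq_zero_iff_ae_notMem.1 (volume_frontier_body K)
    filter_upwards [ae_restrict_of_ae h0, ae_restrict_mem hbm] with x h1 h2
    rw [(isClosed_body K).frontier_eq] at h1
    by_contra h
    exact h1 ⟨h2, h⟩
  have hdom : ∀ {f : Vec d → V}, Integrable f (volume.restrict (body K)) →
      Tendsto (fun ε : ℝ => ∫ x in body K, cutoff K ε x • f x) (𝓝[>] 0)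
        (𝓝 (∫ x in body K, f x)) := by
    intro f hf
    refine tendsto_integral_filter_of_dominated_convergence (fun x => ‖f x‖) ?_ ?_ hf.norm ?_
    · exact Eventually.of_forall fun ε =>
        ((contDiff_cutoff K ε (n := 0)).continuous.aestronglyMeasurable).smul hf.1
    · refine Eventually.of_forall fun ε => Eventually.of_forall fun x => ?_
      rw [norm_smul, Real.norm_of_nonneg (cutoff_nonneg K ε x)]
      exact mul_le_of_le_one_left (norm_nonneg _) (cutoff_le_one K ε x)
    · filter_upwards [hint] with x hx
      simpa using (tendsto_cutoff hx).smul_const (f x)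
  have hsum := (((hdom hLw).add hlay).add (hdom hvg))
  have hzero : ∀ ε > 0, ((∫ x in body K, cutoff K ε x • L (w x) (gradient v x))
      + ε⁻¹ • ∫ x in body K, v x • L (w x) (cutoffGrad K ε x))
      + ∫ x in body K, cutoff K ε x • (v x • g x) = 0 := by
    intro ε hε
    have h1 := hweak _ (isTest_cutoff_mul hΩ hT hK hε hv)
    have hgr : ∀ x, gradient (fun x => cutoff K ε x * v x) x
        = cutoff K ε x • gradient v x + v x • (ε⁻¹ • cutoffGrad K ε x) := by
      intro x
      refine HasGradientAt.gradient ?_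
      have h2 := (hasGradientAt_cutoff K ε x).hasFDerivAt.mul (hvd x).hasFDerivAt
      rw [hasGradientAt_iff_hasFDerivAt]
      refine h2.congr_fderiv ?_
      simp
    have hc0 : ∀ x ∉ body K, cutoff K ε x = 0 := fun x hx => by
      by_contra h
      exact hx (interior_subset (tsupport_cutoff_subset K hε (subset_tsupport _ h)))
    have hsub : ∀ {f : Vec d → V}, (∀ x ∉ body K, f x = 0) →
        ∫ x in Ω, f x = ∫ x in body K, f x := by
      intro f hf
      have h3 : ∫ x in Ω, f x = ∫ x in interior (body K), f x := by
        have hcl : ∀ x ∈ Ω \ interior (body K), x ∉ frontier (body K) → f x = 0 := by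
          intro x hx hx'
          refine hf x fun hxb => hx' ?_
          rw [(isClosed_body K).frontier_eq]
          exact ⟨hxb, hx.2⟩
        refine setIntegral_eq_of_subset_of_ae_sdiff_eq_zero hΩ.isOpen.measurableSet.nullMeasurableSet
          (interior_body_subset hΩ hT hK) ?_
        have h0 : ∀ᵐ x ∂(volume : Measure (Vec d)), x ∉ frontier (body K) :=
          measure_eq_zero_iff_ae_notMem.1 (volume_frontier_body K)
        filter_upwards [h0] with x h4 h5 using hcl x h5 h4
      rw [h3]
      symm
      refine setIntegral_eq_of_subset_of_ae_sdiff_eq_zero hbm.nullMeasurableSet interior_subset ?_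
      have h0 : ∀ᵐ x ∂(volume : Measure (Vec d)), x ∉ frontier (body K) :=
        measure_eq_zero_iff_ae_notMem.1 (volume_frontier_body K)
      filter_upwards [h0] with x h4 h5
      rw [(isClosed_body K).frontier_eq] at h4
      exact absurd h5 h4
    rw [hsub (fun x hx => by
      rw [hgr, hc0 x hx, cutoffGrad_eq_zero_of_notMem hε hx]; simp),
      hsub (fun x hx => by rw [hc0 x hx]; simp)] at h1
    have h6 : ∀ x, L (w x) (gradient (fun x => cutoff K ε x * v x) x)
        = cutoff K ε x • L (w x) (gradient v x) + ε⁻¹ • (v x • L (w x) (cutoffGrad K ε x)) := by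
      intro x
      rw [hgr, map_add, map_smul, map_smul, map_smul, smul_comm (v x)]
    have hi1 : Integrable (fun x => cutoff K ε x • L (w x) (gradient v x))
        (volume.restrict (body K)) := by
      refine hLw.norm.mono' (((contDiff_cutoff K ε (n := 0)).continuous.aestronglyMeasurable).smul
        hLw.1) (Eventually.of_forall fun x => ?_)
      rw [norm_smul, Real.norm_of_nonneg (cutoff_nonneg K ε x)]
      exact mul_le_of_le_one_left (norm_nonneg _) (cutoff_le_one K ε x)
    have hi2 : Integrable (fun x => v x • L (w x) (cutoffGrad K ε x))
        (volume.restrict (body K)) := by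
      obtain ⟨D, hD⟩ := norm_cutoffGrad_le K
      refine (hw1.norm.const_mul (A * (‖L‖ * D))).mono' ?_ ?_
      · refine hv.continuous.aestronglyMeasurable.smul ?_
        exact (isBoundedBilinearMap_apply (𝕜 := ℝ) (E := Vec d) (F := V)).continuous.comp_aestronglyMeasurable
          ((L.continuous.comp_aestronglyMeasurable hwK.1).prodMk
            (continuous_cutoffGrad K ε).aestronglyMeasurable)
      · filter_upwards [ae_restrict_mem hbm] with x hx
        have hA0 : 0 ≤ A := (norm_nonneg _).trans (hA _ hx)
        rw [norm_smul]
        calc ‖v x‖ * ‖L (w x) (cutoffGrad K ε x)‖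
            ≤ A * (‖L‖ * ‖w x‖ * D) := by
              refine mul_le_mul (hA x hx) ?_ (norm_nonneg _) hA0
              exact (L.le_opNorm₂ _ _).trans (mul_le_mul_of_nonneg_left (hD _ _) (by positivity))
          _ = _ := by ring
    simp_rw [h6] at h1
    have hi3 : Integrable (fun x => ε⁻¹ • (v x • L (w x) (cutoffGrad K ε x)))
        (volume.restrict (body K)) := hi2.smul ε⁻¹
    rw [integral_add hi1 hi3, integral_smul] at h1
    rw [h1]
    simp only [smul_smul]
    exact neg_add_cancel _
  have hlim0 := hsum.congr' (f₂ := fun _ => (0 : V))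
    (by filter_upwards [self_mem_nhdsWithin] with ε hε using hzero ε hε)
  have := tendsto_nhds_unique hlim0 tendsto_const_nhds
  have h7 : (∫ x in body K, L (w x) (gradient v x)) + (∫ x in body K, v x • g x)
      - ∑ F ∈ facesOf Ω 𝒯 K, ∫ x in F, v x • L (tr F x) (normal K F) ∂(area d) = 0 := by
    rw [← this]
    abel
  exact (sub_eq_zero.1 h7).symm

end

/-! ### Continuity of normal traces across the faces -/

section

variable {Ω : Set (Vec d)} {κ γ : ℝ} {𝒯 : Finset (Elem d)}

lemma body_ae_eq_interior (K : Elem d) : body K =ᵐ[volume] interior (body K) := by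
  refine (ae_eq_set).2 ⟨?_, ?_⟩
  · rw [← (isClosed_body K).frontier_eq]
    exact volume_frontier_body K
  · rw [sdiff_eq_empty.2 interior_subset, measure_empty]

lemma volume_restrict_eq_sum (hΩ : IsPolyhedralDomain Ω) (hT : IsMesh Ω κ γ 𝒯) :
    volume.restrict Ω = ∑ K ∈ 𝒯, volume.restrict (body K) := by
  have h1 : Ω =ᵐ[volume] ⋃ K ∈ 𝒯, interior (body K) := by
    refine ae_eq_set.2 ⟨?_, ?_⟩
    · refine measure_mono_null (t := ⋃ K ∈ 𝒯, frontier (body K)) ?_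
        ((measure_biUnion_null_iff 𝒯.countable_toSet).2 fun K _ => volume_frontier_body K)
      rintro x ⟨hx, hx'⟩
      have h2 : x ∈ ⋃ K ∈ 𝒯, body K := by
        rw [hT.cover]
        exact subset_closure hx
      simp only [mem_iUnion, exists_prop, not_exists, not_and] at h2 hx' ⊢
      obtain ⟨K, hK, hxK⟩ := h2
      refine ⟨K, hK, ?_⟩
      rw [(isClosed_body K).frontier_eq]
      exact ⟨hxK, hx' K hK⟩
    · have h2 : (⋃ K ∈ 𝒯, interior (body K)) ⊆ Ω :=
        iUnion₂_subset fun K hK => interior_body_subset hΩ hT hK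
      rw [sdiff_eq_empty.2 h2, measure_empty]
  rw [Measure.restrict_congr_set h1, Measure.restrict_biUnion_finset
    (fun K hK K' hK' hne => hT.disjoint K hK K' hK' hne)
    (fun K => isOpen_interior.measurableSet), Measure.sum_fintype,
    Finset.sum_coe_sort 𝒯 fun K => volume.restrict (interior (body K))]
  exact Finset.sum_congr rfl fun K _ => Measure.restrict_congr_set (body_ae_eq_interior K).symm

variable {X : Type} [NormedAddCommGroup X] [InnerProductSpace ℝ X]
  {V : Type} [NormedAddCommGroup V] [NormedSpace ℝ V]

lemma integrable_clm_apply_continuous {S : Set (Vec d)} {μ : Measure (Vec d)} (hS : IsCompact S)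
    (L : X →L[ℝ] Vec d →L[ℝ] V) {w : Vec d → X} (hw : Integrable w (μ.restrict S))
    {v : Vec d → Vec d} (hv : Continuous v) : Integrable (fun x => L (w x) (v x)) (μ.restrict S) := by
  obtain ⟨B, hB⟩ := hS.exists_bound_of_continuousOn hv.continuousOn
  refine (hw.norm.const_mul (‖L‖ * B)).mono' ?_ ?_
  · exact (isBoundedBilinearMap_apply (𝕜 := ℝ) (E := Vec d) (F := V)).continuous.comp_aestronglyMeasurable
      ((L.continuous.comp_aestronglyMeasurable hw.1).prodMk hv.aestronglyMeasurable)
  · filter_upwards [ae_restrict_mem hS.measurableSet] with x hx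
    calc ‖L (w x) (v x)‖ ≤ ‖L‖ * ‖w x‖ * B :=
          (L.le_opNorm₂ _ _).trans (mul_le_mul_of_nonneg_left (hB x hx) (by positivity))
      _ = _ := by ring

lemma continuous_gradient {v : Vec d → ℝ} (hv : ContDiff ℝ (⊤ : ℕ∞) v) :
    Continuous (gradient v) :=
  (InnerProductSpace.toDual ℝ (Vec d)).symm.continuous.comp (hv.continuous_fderiv (by simp))

lemma integrable_smul_of_continuous {S : Set (Vec d)} {μ : Measure (Vec d)} (hS : IsCompact S)
    {g : Vec d → V} (hg : Integrable g (μ.restrict S)) {v : Vec d → ℝ} (hv : Continuous v) :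
    Integrable (fun x => v x • g x) (μ.restrict S) :=
  IntegrableOn.continuousOn_smul hg hv.continuousOn hS

/-- Green's formula, summed over all the elements. -/
lemma sum_green [CompleteSpace V] (hd : 2 ≤ d) (hΩ : IsPolyhedralDomain Ω) (hT : IsMesh Ω κ γ 𝒯)
    (L : X →L[ℝ] Vec d →L[ℝ] V) {w : Vec d → X} {g : Vec d → V}
    (hw : MemLp w 2 (volume.restrict Ω)) (hg : MemLp g 2 (volume.restrict Ω))
    (hweak : ∀ φ, IsTest Ω φ →
      ∫ x in Ω, L (w x) (gradient φ x) = -∫ x in Ω, φ x • g x)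
    {tr : BdFun d X} (htr : ∀ K ∈ 𝒯, ∀ F ∈ facesOf Ω 𝒯 K, IsTrace K F w (tr K F))
    {v : Vec d → ℝ} (hv : ContDiff ℝ (⊤ : ℕ∞) v) :
    ∑ K ∈ 𝒯, ∑ F ∈ facesOf Ω 𝒯 K, ∫ x in F, v x • L (tr K F x) (normal K F) ∂(area d)
      = (∫ x in Ω, L (w x) (gradient v x)) + ∫ x in Ω, v x • g x := by
  have hfinK : ∀ K : Elem d, IsFiniteMeasure (volume.restrict (body K)) := fun K =>
    ⟨by simpa using volume_body_lt_top K⟩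
  have hwK : ∀ K ∈ 𝒯, Integrable w (volume.restrict (body K)) := fun K hK =>
    (hw.mono_measure (volume_restrict_body_le hΩ hT hK)).integrable one_le_two
  have hgK : ∀ K ∈ 𝒯, Integrable g (volume.restrict (body K)) := fun K hK =>
    (hg.mono_measure (volume_restrict_body_le hΩ hT hK)).integrable one_le_two
  rw [volume_restrict_eq_sum hΩ hT, integral_finsetSum_measure fun K hK =>
    integrable_clm_apply_continuous (isCompact_body K) L (hwK K hK) (continuous_gradient hv),
    integral_finsetSum_measure fun K hK =>
    integrable_smul_of_continuous (isCompact_body K) (hgK K hK) hv.continuous,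
    ← Finset.sum_add_distrib]
  exact Finset.sum_congr rfl fun K hK => green_element hd hΩ hT hK L hw hg hweak (htr K hK) hv

open Classical in
/-- The elements of the mesh that have `F` on their boundary. -/
def elemsAt (𝒯 : Finset (Elem d)) (F : Set (Vec d)) : Finset (Elem d) := {K ∈ 𝒯 | F ⊆ body K}

lemma mem_elemsAt {F : Set (Vec d)} {K : Elem d} : K ∈ elemsAt 𝒯 F ↔ K ∈ 𝒯 ∧ F ⊆ body K := by
  simp [elemsAt]

lemma sum_facesOf_comm {M : Type} [AddCommMonoid M] (f : Elem d → Set (Vec d) → M) :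
    ∑ K ∈ 𝒯, ∑ F ∈ facesOf Ω 𝒯 K, f K F = ∑ F ∈ faces Ω 𝒯, ∑ K ∈ elemsAt 𝒯 F, f K F := by
  simp only [facesOf, elemsAt, Finset.sum_filter]
  exact Finset.sum_comm

/-- If boundary contributions from all the elements cancel in the weak sense, then they cancel
almost everywhere on every face. This is the fundamental lemma of the calculus of variations for
the surface measure on the union of the faces, which overlap in null sets only. -/
theorem sum_faces_ae_eq_zero [CompleteSpace V] (hd : 1 ≤ d) (hΩ : IsPolyhedralDomain Ω)
    (hT : IsMesh Ω κ γ 𝒯) {U : Set (Vec d)} (hU : IsOpen U) {b : BdFun d V}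
    (hb : ∀ K ∈ 𝒯, ∀ F ∈ facesOf Ω 𝒯 K, Integrable (b K F) ((area d).restrict F))
    (h : ∀ φ, IsTest U φ →
      ∑ K ∈ 𝒯, ∑ F ∈ facesOf Ω 𝒯 K, ∫ x in F, φ x • b K F x ∂(area d) = 0)
    {F : Set (Vec d)} (hF : F ∈ faces Ω 𝒯) :
    ∀ᵐ x ∂((area d).restrict F), x ∈ U → ∑ K ∈ elemsAt 𝒯 F, b K F x = 0 := by
  set J : Set (Vec d) → Vec d → V := fun F x => ∑ K ∈ elemsAt 𝒯 F, b K F x with hJ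
  set f : Vec d → V := fun x => ∑ F ∈ faces Ω 𝒯, F.indicator (J F) x with hf
  set μ : Measure (Vec d) := ∑ F ∈ faces Ω 𝒯, (area d).restrict F with hμ
  have hmemof : ∀ {K F}, F ∈ faces Ω 𝒯 → F ⊆ body K → F ∈ facesOf Ω 𝒯 K := fun h1 h2 =>
    mem_facesOf.2 ⟨h1, h2⟩
  have hJint : ∀ F ∈ faces Ω 𝒯, Integrable (J F) ((area d).restrict F) := fun F hF =>
    integrable_finsetSum _ fun K hK => hb K (mem_elemsAt.1 hK).1 F
      (hmemof hF (mem_elemsAt.1 hK).2)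
  have hfJ : ∀ F ∈ faces Ω 𝒯, f =ᵐ[(area d).restrict F] J F := by
    intro F hF
    have h1 : ∀ᵐ x ∂((area d).restrict F), ∀ F' ∈ faces Ω 𝒯, F' ≠ F → x ∉ F' := by
      rw [Finset.eventually_all]
      intro F' hF'
      by_cases hne : F' = F
      · exact Eventually.of_forall fun x h => absurd hne h
      · have h2 : ∀ᵐ x ∂(area d), x ∉ F ∩ F' :=
          measure_eq_zero_iff_ae_notMem.1 (area_face_inter_face hd hΩ hT hF hF' (Ne.symm hne))
        filter_upwards [ae_restrict_of_ae h2, ae_restrict_mem (measurableSet_of_mem_faces hF)]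
          with x h3 h4 _ h5 using h3 ⟨h4, h5⟩
    filter_upwards [h1, ae_restrict_mem (measurableSet_of_mem_faces hF)] with x hx hxF
    simp only [hf]
    rw [Finset.sum_eq_single F (fun F' hF' hne => indicator_of_notMem (hx F' hF' hne) _)
      (fun h => absurd hF h), indicator_of_mem hxF]
  have hfint : ∀ F ∈ faces Ω 𝒯, Integrable f ((area d).restrict F) := fun F hF =>
    (hJint F hF).congr (hfJ F hF).symm
  have hfμ : Integrable f μ := (integrable_finsetSum_measure).2 hfint
  have hfin : ∀ F ∈ faces Ω 𝒯, area d F < ∞ := by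
    intro F hF
    obtain ⟨K, hK, hFK⟩ := exists_mem_of_mem_faces hF
    exact area_lt_top_of_mem_facesOf hd hΩ hT hK hFK
  have hμfin : IsFiniteMeasure μ := by
    refine ⟨?_⟩
    rw [hμ, Measure.finsetSum_apply]
    refine ENNReal.sum_lt_top.2 fun F hF => ?_
    simpa using hfin F hF
  have hzero := hU.ae_eq_zero_of_integral_contDiff_smul_eq_zero (μ := μ) (f := f)
    (hfμ.locallyIntegrable.locallyIntegrableOn U) fun φ hφ hφc hφU => by
      rw [hμ, integral_finsetSum_measure fun F hF => ?_]
      · rw [← h φ ⟨hφ, hφc, hφU⟩]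
        have h1 : ∀ F ∈ faces Ω 𝒯, ∫ x in F, φ x • f x ∂(area d)
            = ∑ K ∈ elemsAt 𝒯 F, ∫ x in F, φ x • b K F x ∂(area d) := by
          intro F hF
          rw [integral_congr_ae (g := fun x => ∑ K ∈ elemsAt 𝒯 F, φ x • b K F x)
            ((hfJ F hF).mono fun x hx => by simp only [hx, hJ, Finset.smul_sum]),
            integral_finsetSum _ fun K hK => integrable_smul_of_continuous
              (isCompact_of_mem_faces hF) (hb K (mem_elemsAt.1 hK).1 F
              (hmemof hF (mem_elemsAt.1 hK).2)) hφ.continuous]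
        rw [Finset.sum_congr rfl h1, sum_facesOf_comm]
      · exact integrable_smul_of_continuous (isCompact_of_mem_faces hF) (hfint F hF) hφ.continuous
  have hle : (area d).restrict F ≤ μ := by
    rw [hμ]
    refine Measure.le_intro fun s _ _ => ?_
    rw [Measure.finsetSum_apply]
    exact Finset.single_le_sum (f := fun F => (area d).restrict F s) (fun _ _ => zero_le) hF
  filter_upwards [hzero.filter_mono (ae_mono hle), hfJ F hF] with x h1 h2 h3
  have := h1 h3
  rw [h2] at this
  exact this

/-- A skeleton function is orthogonal to boundary contributions that cancel on every face on which
the function does not vanish. -/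
lemma bdInner_skel_eq_zero {W : Type} [NormedAddCommGroup W] [InnerProductSpace ℝ W]
    {b : BdFun d W}
    (hb : ∀ K ∈ 𝒯, ∀ F ∈ facesOf Ω 𝒯 K, MemLp (b K F) 2 ((area d).restrict F))
    {v : Skel d W} (hv : ∀ F ∈ faces Ω 𝒯, MemLp (v F) 2 ((area d).restrict F))
    (h : ∀ F ∈ faces Ω 𝒯, (∀ᵐ x ∂((area d).restrict F), ∑ K ∈ elemsAt 𝒯 F, b K F x = 0) ∨
      v F =ᵐ[(area d).restrict F] 0) :
    bdInner Ω 𝒯 (fun _ => 1) b (fun _ F x => v F x) = 0 := by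
  have h1 : bdInner Ω 𝒯 (fun _ => 1) b (fun _ F x => v F x)
      = ∑ F ∈ faces Ω 𝒯, ∑ K ∈ elemsAt 𝒯 F, ∫ x in F, inner ℝ (b K F x) (v F x) ∂(area d) := by
    simp only [bdInner, one_smul]
    exact sum_facesOf_comm _
  rw [h1]
  refine Finset.sum_eq_zero fun F hF => ?_
  rw [← integral_finsetSum]
  · rw [← integral_zero (Vec d) ℝ (μ := (area d).restrict F)]
    refine integral_congr_ae ?_
    rcases h F hF with h2 | h2
    · filter_upwards [h2] with x hx
      rw [← sum_inner, hx, inner_zero_left]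
    · filter_upwards [h2] with x hx
      simp [hx]
  · intro K hK
    have hK' := mem_elemsAt.1 hK
    exact integrable_inner_of_memLp (hb K hK'.1 F (mem_facesOf.2 ⟨hF, hK'.2⟩)) (hv F hF)

end

/-! ### Functions in `H¹₀(Ω)` -/

section

variable {Ω : Set (Vec d)} {κ γ : ℝ} {𝒯 : Finset (Elem d)}

lemma IsTest.mono {U : Set (Vec d)} {φ : Vec d → ℝ} (h : IsTest Ω φ) (hU : Ω ⊆ U) : IsTest U φ :=
  ⟨h.1, h.2.1, h.2.2.trans hU⟩

lemma IsTest.integral_smul_gradient {U : Set (Vec d)} {φ ψ : Vec d → ℝ} (hφ : IsTest U φ)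
    (hψ : IsTest U ψ) : ∫ x, φ x • gradient ψ x = -∫ x, ψ x • gradient φ x := by
  have hcφ := hφ.1.continuous
  have hcψ := hψ.1.continuous
  have hgφ := continuous_gradient hφ.1
  have hgψ := continuous_gradient hψ.1
  have hi1 : Integrable (fun x => φ x • gradient ψ x) :=
    (hcφ.smul hgψ).integrable_of_hasCompactSupport hφ.2.1.smul_right
  have hi2 : Integrable (fun x => ψ x • gradient φ x) :=
    (hcψ.smul hgφ).integrable_of_hasCompactSupport hψ.2.1.smul_right
  refine ext_inner_left ℝ fun v => ?_
  rw [inner_neg_right, ← integral_inner hi1, ← integral_inner hi2]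
  have hg : ∀ {f : Vec d → ℝ} {x : Vec d},
      inner ℝ v (gradient f x) = fderiv ℝ f x v := fun {f x} => by
    rw [real_inner_comm, gradient, InnerProductSpace.toDual_symm_apply]
  simp_rw [inner_smul_right, hg]
  have h1 : Integrable fun x => φ x * fderiv ℝ ψ x v := by
    refine (hi1.const_inner v).congr (Eventually.of_forall fun x => ?_)
    simp only [inner_smul_right, hg]
  have h2 : Integrable fun x => ψ x * fderiv ℝ φ x v := by
    refine (hi2.const_inner v).congr (Eventually.of_forall fun x => ?_)
    simp only [inner_smul_right, hg]
  rw [integral_mul_fderiv_eq_neg_fderiv_mul_of_integrable (by simpa only [mul_comm] using h2) h1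
    ((hcφ.mul hcψ).integrable_of_hasCompactSupport hφ.2.1.mul_right)
    (fun x _ => hφ.1.differentiable (by simp) x) (fun x _ => hψ.1.differentiable (by simp) x)]
  simp_rw [mul_comm]

/-- A function in `H¹₀(Ω)` satisfies the weak formulation of the gradient for all smooth functions
with compact support in the whole space. -/
lemma MemH10.exists_gradient (hΩ : IsPolyhedralDomain Ω) {f : Vec d → ℝ} (h : MemH10 Ω f) :
    ∃ G : Vec d → Vec d, MemLp G 2 (volume.restrict Ω) ∧ ∀ ψ, IsTest univ ψ →
      ∫ x in Ω, f x • gradient ψ x = -∫ x in Ω, ψ x • G x := by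
  obtain ⟨hf, G, hG, φ, hφ, hlim, hlimG⟩ := h
  have hfin : IsFiniteMeasure (volume.restrict Ω) :=
    ⟨by simpa using hΩ.isBounded.measure_lt_top⟩
  refine ⟨G, hG, fun ψ hψ => ?_⟩
  -- On the bounded set `Ω`, convergence in `L²` gives `L¹` convergence of products with `ψ`, `∇ψ`.
  have hL1 : ∀ {A W : Type} [NormedAddCommGroup A] [NormedAddCommGroup W]
      {h : ℕ → Vec d → A} {k : ℕ → Vec d → W} {C : ℝ≥0},
      (∀ n, AEStronglyMeasurable (h n) (volume.restrict Ω)) →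
      (∀ n x, ‖k n x‖ ≤ C * ‖h n x‖) →
      Tendsto (fun n => eLpNorm (h n) 2 (volume.restrict Ω)) atTop (𝓝 0) →
      Tendsto (fun n => eLpNorm (k n) 1 (volume.restrict Ω)) atTop (𝓝 0) := by
    intro A W _ _ h k C hm hb hl
    have h1 : ∀ n, eLpNorm (k n) 1 (volume.restrict Ω) ≤ C * (eLpNorm (h n) 2 (volume.restrict Ω)
        * (volume.restrict Ω) univ ^ (1 / (1 : ℝ≥0∞).toReal - 1 / (2 : ℝ≥0∞).toReal)) := by
      intro n
      refine (eLpNorm_le_nnreal_smul_eLpNorm_of_ae_le_mul (c := C)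
        (Eventually.of_forall fun x => hb n x) 1).trans ?_
      exact mul_le_mul_right (eLpNorm_le_eLpNorm_mul_rpow_measure_univ one_le_two (hm n)) _
    have hne : (volume.restrict Ω) univ ^ (1 / (1 : ℝ≥0∞).toReal - 1 / (2 : ℝ≥0∞).toReal) ≠ ∞ :=
      ENNReal.rpow_ne_top_of_nonneg (by norm_num) (measure_ne_top _ _)
    have h2 := ENNReal.Tendsto.const_mul (a := (C : ℝ≥0∞))
      (ENNReal.Tendsto.mul_const hl (Or.inr hne)) (Or.inr ENNReal.coe_ne_top)
    rw [zero_mul, mul_zero] at h2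
    exact tendsto_of_tendsto_of_tendsto_of_le_of_le tendsto_const_nhds h2 (fun _ => zero_le) h1
  have hgψ := continuous_gradient hψ.1
  have hcψ := hψ.1.continuous
  have hgc : ∀ {u : Vec d → ℝ}, HasCompactSupport u → HasCompactSupport (gradient u) := fun hu =>
    (hu.fderiv ℝ).comp_left (g := (InnerProductSpace.toDual ℝ (Vec d)).symm) (map_zero _)
  obtain ⟨C₁, hC₁⟩ := (hgc hψ.2.1).exists_bound_of_continuous hgψ
  obtain ⟨C₂, hC₂⟩ := hψ.2.1.exists_bound_of_continuous hcψ
  have hφm : ∀ n, MemLp (φ n) 2 (volume.restrict Ω) := fun n =>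
    ((hφ n).1.continuous.memLp_of_hasCompactSupport (hφ n).2.1).restrict Ω
  have hφg : ∀ n, MemLp (gradient (φ n)) 2 (volume.restrict Ω) := fun n =>
    ((continuous_gradient (hφ n).1).memLp_of_hasCompactSupport (hgc (hφ n).2.1)).restrict Ω
  have hI1 : ∀ {u : Vec d → ℝ}, MemLp u 2 (volume.restrict Ω) →
      Integrable (fun x => u x • gradient ψ x) (volume.restrict Ω) := fun {u} hu =>
    (hu.integrable one_le_two).smul_bdd C₁ hgψ.aestronglyMeasurable (Eventually.of_forall hC₁)
  have hI2 : ∀ {u : Vec d → Vec d}, MemLp u 2 (volume.restrict Ω) →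
      Integrable (fun x => ψ x • u x) (volume.restrict Ω) := fun {u} hu =>
    (hu.integrable one_le_two).bdd_smul C₂ hcψ.aestronglyMeasurable (Eventually.of_forall hC₂)
  have hT1 : Tendsto (fun n => ∫ x in Ω, φ n x • gradient ψ x) atTop
      (𝓝 (∫ x in Ω, f x • gradient ψ x)) := by
    refine tendsto_integral_of_L1' _ (hI1 hf).1 (Eventually.of_forall fun n => hI1 (hφm n)) ?_
    refine hL1 (C := C₁.toNNReal) (fun n => hf.1.sub (hφm n).1) (fun n x => ?_) hlim
    simp only [Pi.sub_apply]
    rw [← sub_smul, norm_smul, norm_sub_rev, mul_comm]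
    exact mul_le_mul_of_nonneg_right ((hC₁ x).trans (Real.le_coe_toNNReal _)) (norm_nonneg _)
  have hT2 : Tendsto (fun n => ∫ x in Ω, ψ x • gradient (φ n) x) atTop
      (𝓝 (∫ x in Ω, ψ x • G x)) := by
    refine tendsto_integral_of_L1' _ (hI2 hG).1 (Eventually.of_forall fun n => hI2 (hφg n)) ?_
    refine hL1 (C := C₂.toNNReal) (fun n => hG.1.sub (hφg n).1) (fun n x => ?_) hlimG
    simp only [Pi.sub_apply]
    rw [← smul_sub, norm_smul, norm_sub_rev (G x)]
    exact mul_le_mul_of_nonneg_right ((hC₂ x).trans (Real.le_coe_toNNReal _)) (norm_nonneg _)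
  refine tendsto_nhds_unique hT1 (hT2.neg.congr fun n => ?_)
  have hsupp : ∀ x ∉ Ω, φ n x = 0 := fun x hx =>
    image_eq_zero_of_notMem_tsupport fun h => hx ((hφ n).2.2 h)
  have hsupp' : ∀ x ∉ Ω, gradient (φ n) x = 0 := fun x hx => by
    have : fderiv ℝ (φ n) x = 0 := image_eq_zero_of_notMem_tsupport fun h =>
      hx ((hφ n).2.2 (tsupport_fderiv_subset ℝ h))
    rw [gradient, this, map_zero]
  rw [setIntegral_eq_integral_of_forall_compl_eq_zero (fun x hx => by rw [hsupp' x hx, smul_zero]),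
    setIntegral_eq_integral_of_forall_compl_eq_zero (fun x hx => by rw [hsupp x hx, zero_smul])]
  exact (((hφ n).mono (subset_univ Ω)).integral_smul_gradient hψ).symm

end

/-! ### Symmetric tensors -/

/-- The matrix-vector product as a bounded bilinear map. -/
def mulVecSymL (d : ℕ) : Sym d →L[ℝ] Vec d →L[ℝ] Vec d :=
  LinearMap.toContinuousLinearMap
    ((LinearMap.toContinuousLinearMap : (Vec d →ₗ[ℝ] Vec d) ≃ₗ[ℝ] (Vec d →L[ℝ] Vec d)).toLinearMap ∘ₗ
      LinearMap.mk₂ ℝ (mulVecSym (d := d))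
        (fun a b n => by ext i; simp [mulVecSym, add_mul, Finset.sum_add_distrib])
        (fun c a n => by ext i; simp [mulVecSym, mul_assoc, Finset.mul_sum])
        (fun a m n => by ext i; simp [mulVecSym, mul_add, Finset.sum_add_distrib])
        (fun c a n => by ext i; simp [mulVecSym, mul_left_comm, Finset.mul_sum]))

@[simp]
lemma mulVecSymL_apply (τ : Sym d) (n : Vec d) : mulVecSymL d τ n = mulVecSym τ n := rfl

lemma sym_inner (σ τ : Sym d) : inner ℝ σ τ = ∑ i, ∑ j, σ.1 (i, j) * τ.1 (i, j) := by
  rw [Submodule.coe_inner, PiLp.inner_apply, Fintype.sum_prod_type]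
  simp [mul_comm]

lemma inner_symPart (σ : Sym d) (M : Fin d → Fin d → ℝ) :
    inner ℝ σ (symPart M) = ∑ i, ∑ j, σ.1 (i, j) * M i j := by
  have h1 : ∑ i, ∑ j, σ.1 (i, j) * M j i = ∑ i, ∑ j, σ.1 (i, j) * M i j := by
    rw [Finset.sum_comm]
    exact Finset.sum_congr rfl fun i _ => Finset.sum_congr rfl fun j _ => by rw [σ.2 i j]
  rw [sym_inner]
  have h2 : ∀ i j, σ.1 (i, j) * (symPart M).1 (i, j)
      = (σ.1 (i, j) * M i j + σ.1 (i, j) * M j i) / 2 := by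
    intro i j
    simp only [symPart]
    ring
  simp_rw [h2, ← Finset.sum_div, Finset.sum_add_distrib]
  rw [h1]
  ring

lemma inner_idSym (σ : Sym d) : inner ℝ σ (idSym d) = trSym σ := by
  rw [idSym, inner_symPart]
  simp [trSym]

lemma sym_inner_smul (c : ℝ) (σ τ : Sym d) : inner ℝ σ (c • τ) = c * inner ℝ σ τ :=
  real_inner_smul_right σ τ c

lemma gradient_coord {v : Vec d → Vec d} {x : Vec d} (hv : DifferentiableAt ℝ v x) (i j : Fin d) :
    (gradient (fun y => v y i) x) j = (fderiv ℝ v x (EuclideanSpace.single j 1)) i := by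
  have h1 : (gradient (fun y => v y i) x) j
      = inner ℝ (gradient (fun y => v y i) x) (EuclideanSpace.single j 1) := by
    rw [EuclideanSpace.inner_single_right, one_mul, conj_trivial]
  have h2 : HasFDerivAt (fun y => v y i)
      ((EuclideanSpace.proj i : Vec d →L[ℝ] ℝ).comp (fderiv ℝ v x)) x :=
    (EuclideanSpace.proj i : Vec d →L[ℝ] ℝ).hasFDerivAt.comp x hv.hasFDerivAt
  rw [h1, gradient, InnerProductSpace.toDual_symm_apply, h2.fderiv]
  rfl

lemma inner_strain (τ : Sym d) {v : Vec d → Vec d} {x : Vec d} (hv : DifferentiableAt ℝ v x) :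
    inner ℝ τ (strain v x) = ∑ i, (mulVecSym τ (gradient (fun y => v y i) x)) i := by
  rw [strain, inner_symPart]
  refine Finset.sum_congr rfl fun i _ => ?_
  simp only [mulVecSym, gradient_coord hv]

lemma divergence_eq {v : Vec d → Vec d} {x : Vec d} (hv : DifferentiableAt ℝ v x) :
    divergence v x = ∑ i, (gradient (fun y => v y i) x) i :=
  Finset.sum_congr rfl fun i _ => (gradient_coord hv i i).symm

/-! ### Green's formulas for stresses and scalars -/

section

variable {Ω : Set (Vec d)} {κ γ : ℝ} {𝒯 : Finset (Elem d)}

lemma integrable_face (hd : 1 ≤ d) (hΩ : IsPolyhedralDomain Ω) (hT : IsMesh Ω κ γ 𝒯)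
    {V : Type} [NormedAddCommGroup V]
    {K : Elem d} (hK : K ∈ 𝒯) {F : Set (Vec d)} (hF : F ∈ facesOf Ω 𝒯 K) {g : Vec d → V}
    (hg : MemLp g 2 ((area d).restrict F)) : Integrable g ((area d).restrict F) := by
  have hfin := area_lt_top_of_mem_facesOf hd hΩ hT hK hF
  have : IsFiniteMeasure ((area d).restrict F) := ⟨by simpa using hfin⟩
  exact hg.integrable one_le_two

lemma integrable_body (hΩ : IsPolyhedralDomain Ω) (hT : IsMesh Ω κ γ 𝒯)
    {V : Type} [NormedAddCommGroup V]
    {K : Elem d} (hK : K ∈ 𝒯) {g : Vec d → V} (hg : MemLp g 2 (volume.restrict Ω)) :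
    Integrable g (volume.restrict (body K)) := by
  have : IsFiniteMeasure (volume.restrict (body K)) := ⟨by simpa using volume_body_lt_top K⟩
  exact (hg.mono_measure (volume_restrict_body_le hΩ hT hK)).integrable one_le_two

/-- Green's formula, tested with a vector field. -/
lemma green_vector (hd : 2 ≤ d) (hΩ : IsPolyhedralDomain Ω) (hT : IsMesh Ω κ γ 𝒯)
    {X : Type} [NormedAddCommGroup X] [InnerProductSpace ℝ X]
    {K : Elem d} (hK : K ∈ 𝒯) (L : X →L[ℝ] Vec d →L[ℝ] Vec d) {w : Vec d → X} {g : Vec d → Vec d}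
    (hw : MemLp w 2 (volume.restrict Ω)) (hg : MemLp g 2 (volume.restrict Ω))
    (hweak : ∀ φ, IsTest Ω φ →
      ∫ x in Ω, L (w x) (gradient φ x) = -∫ x in Ω, φ x • g x)
    {tr : Set (Vec d) → Vec d → X} (htr : ∀ F ∈ facesOf Ω 𝒯 K, IsTrace K F w (tr F))
    {v : Vec d → Vec d} (hv : ContDiff ℝ (⊤ : ℕ∞) v) :
    ∑ F ∈ facesOf Ω 𝒯 K, ∫ x in F, inner ℝ (L (tr F x) (normal K F)) (v x) ∂(area d)
      = (∫ x in body K, ∑ i, (L (w x) (gradient (fun y => v y i) x)) i)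
        + ∫ x in body K, inner ℝ (g x) (v x) := by
  have hd1 : 1 ≤ d := by omega
  have hvi : ∀ i, ContDiff ℝ (⊤ : ℕ∞) (fun y => v y i) := fun i =>
    (EuclideanSpace.proj i : Vec d →L[ℝ] ℝ).contDiff.comp hv
  have hw1 := integrable_body hΩ hT hK hw
  have hg1 := integrable_body hΩ hT hK hg
  have hproj : ∀ (i : Fin d) {μ : Measure (Vec d)} {f : Vec d → Vec d}, Integrable f μ →
      (∫ x, f x ∂μ) i = ∫ x, f x i ∂μ := fun i {μ f} hf =>
    ((EuclideanSpace.proj i : Vec d →L[ℝ] ℝ).integral_comp_comm hf).symm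
  have hpi : ∀ (i : Fin d) {μ : Measure (Vec d)} {f : Vec d → Vec d}, Integrable f μ →
      Integrable (fun x => f x i) μ := fun i {μ f} hf =>
    (EuclideanSpace.proj i : Vec d →L[ℝ] ℝ).integrable_comp hf
  have hif : ∀ i, ∀ F ∈ facesOf Ω 𝒯 K,
      Integrable (fun x => v x i • L (tr F x) (normal K F)) ((area d).restrict F) := fun i F hF =>
    integrable_smul_of_continuous (isCompact_of_mem_faces (mem_facesOf.1 hF).1)
      ((L.flip (normal K F)).integrable_comp (integrable_face hd1 hΩ hT hK hF (htr F hF).1))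
      (hvi i).continuous
  have hib : ∀ i, Integrable (fun x => L (w x) (gradient (fun y => v y i) x))
      (volume.restrict (body K)) := fun i =>
    integrable_clm_apply_continuous (isCompact_body K) L hw1 (continuous_gradient (hvi i))
  have hig : ∀ i, Integrable (fun x => v x i • g x) (volume.restrict (body K)) := fun i =>
    integrable_smul_of_continuous (isCompact_body K) hg1 (hvi i).continuous
  have hinner : ∀ a b : Vec d, inner ℝ a b = ∑ i, (b i • a) i := fun a b => by
    simp [PiLp.inner_apply]
  have h1 : ∀ i, ∑ F ∈ facesOf Ω 𝒯 K, ∫ x in F, (v x i • L (tr F x) (normal K F)) i ∂(area d)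
      = (∫ x in body K, (L (w x) (gradient (fun y => v y i) x)) i)
        + ∫ x in body K, (v x i • g x) i := by
    intro i
    have h2 := congrArg (fun z : Vec d => z i)
      (green_element hd hΩ hT hK L hw hg hweak htr (hvi i))
    simp only [PiLp.add_apply] at h2
    rw [hproj i (hib i), hproj i (hig i)] at h2
    rw [← h2]
    have h3 : (∑ F ∈ facesOf Ω 𝒯 K, ∫ x in F, v x i • L (tr F x) (normal K F) ∂(area d)) i
        = ∑ F ∈ facesOf Ω 𝒯 K, (∫ x in F, v x i • L (tr F x) (normal K F) ∂(area d)) i :=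
      map_sum (EuclideanSpace.proj i : Vec d →L[ℝ] ℝ) _ _
    rw [h3]
    exact Finset.sum_congr rfl fun F hF => (hproj i (hif i F hF)).symm
  simp_rw [hinner]
  rw [integral_finsetSum _ fun i _ => hpi i (hib i), integral_finsetSum _ fun i _ => hpi i (hig i),
    ← Finset.sum_add_distrib, ← Finset.sum_congr rfl fun i _ => h1 i, Finset.sum_comm]
  exact Finset.sum_congr rfl fun F hF => integral_finsetSum _ fun i _ => hpi i (hif i F hF)

lemma green_stress (hd : 2 ≤ d) (hΩ : IsPolyhedralDomain Ω) (hT : IsMesh Ω κ γ 𝒯)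
    {K : Elem d} (hK : K ∈ 𝒯) {τ : Vec d → Sym d} {g : Vec d → Vec d}
    (hτ : MemLp τ 2 (volume.restrict Ω)) (hg : MemLp g 2 (volume.restrict Ω))
    (hweak : IsWeakDivSym Ω τ g)
    {tr : Set (Vec d) → Vec d → Sym d} (htr : ∀ F ∈ facesOf Ω 𝒯 K, IsTrace K F τ (tr F))
    {v : Vec d → Vec d} (hv : ContDiff ℝ (⊤ : ℕ∞) v) :
    ∑ F ∈ facesOf Ω 𝒯 K, ∫ x in F, inner ℝ (mulVecSym (tr F x) (normal K F)) (v x) ∂(area d)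
      = (∫ x in body K, inner ℝ (τ x) (strain v x)) + ∫ x in body K, inner ℝ (g x) (v x) := by
  have h := green_vector hd hΩ hT hK (mulVecSymL d) hτ hg hweak htr hv
  simp only [mulVecSymL_apply] at h
  rw [h]
  congr 1
  exact integral_congr_ae (Eventually.of_forall fun x =>
    (inner_strain _ (hv.differentiable (by simp) x)).symm)

lemma green_scalar (hd : 2 ≤ d) (hΩ : IsPolyhedralDomain Ω) (hT : IsMesh Ω κ γ 𝒯)
    {K : Elem d} (hK : K ∈ 𝒯) {f : Vec d → ℝ} {g : Vec d → Vec d}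
    (hf : MemLp f 2 (volume.restrict Ω)) (hg : MemLp g 2 (volume.restrict Ω))
    (hweak : IsWeakGrad Ω f g)
    {tr : Set (Vec d) → Vec d → ℝ} (htr : ∀ F ∈ facesOf Ω 𝒯 K, IsTrace K F f (tr F))
    {v : Vec d → Vec d} (hv : ContDiff ℝ (⊤ : ℕ∞) v) :
    ∑ F ∈ facesOf Ω 𝒯 K, ∫ x in F, inner ℝ (tr F x • normal K F) (v x) ∂(area d)
      = (∫ x in body K, inner ℝ (f x) (divergence v x)) + ∫ x in body K, inner ℝ (g x) (v x) := by
  have h := green_vector hd hΩ hT hK (ContinuousLinearMap.lsmul ℝ ℝ) hf hg hweak htr hv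
  simp only [ContinuousLinearMap.lsmul_apply] at h
  rw [h]
  congr 1
  refine integral_congr_ae (Eventually.of_forall fun x => ?_)
  simp only [divergence_eq (hv.differentiable (by simp) x), PiLp.smul_apply, smul_eq_mul,
    ← Finset.mul_sum]
  simp [mul_comm]

lemma isTrace_totalStress (hd : 2 ≤ d) (hΩ : IsPolyhedralDomain Ω) (hT : IsMesh Ω κ γ 𝒯)
    (m : Coefficients d) {K : Elem d} (hK : K ∈ 𝒯) {F : Set (Vec d)} (hF : F ∈ facesOf Ω 𝒯 K)
    {σE σV sE sV : Vec d → Sym d} {ψ p : Vec d → ℝ}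
    (hσE : MemLp σE 2 (volume.restrict Ω)) (hσV : MemLp σV 2 (volume.restrict Ω))
    (hψ : MemLp ψ 2 (volume.restrict Ω)) (hE : IsTrace K F σE sE) (hV : IsTrace K F σV sV)
    (hp : IsTrace K F ψ p) :
    IsTrace K F (fun x => m.totalStress (σE x) (σV x) (ψ x))
      (fun x => m.totalStress (sE x) (sV x) (p x)) := by
  have hfin := area_lt_top_of_mem_facesOf (by omega) hΩ hT hK hF
  have : IsFiniteMeasure ((area d).restrict F) := ⟨by simpa using hfin⟩
  have hq := quasiMeasurePreserving_coneMap hd hΩ hT hK hF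
  have hle := volume_restrict_body_le hΩ hT hK
  have h1 := (hσE.mono_measure hle).1.comp_quasiMeasurePreserving hq
  have h2 := ((hσV.mono_measure hle).1.const_smul m.ω).comp_quasiMeasurePreserving hq
  have h3 := hV.clm (m.ω • ContinuousLinearMap.id ℝ (Sym d))
  set A : ℝ →L[ℝ] Sym d := -(m.α • ContinuousLinearMap.toSpanSingleton ℝ (idSym d)) with hA
  have h4 := (A.continuous.comp_aestronglyMeasurable
    (hψ.mono_measure hle).1).comp_quasiMeasurePreserving hq
  have h5 := hp.clm A
  have h6 := (hE.add h3 h1 h2).add h5 (h1.add h2) h4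
  have h7 : ∀ a b c, m.totalStress a b c
      = a + (m.ω • ContinuousLinearMap.id ℝ (Sym d)) b + A c := by
    intro a b c
    simp [Coefficients.totalStress, hA, sub_eq_add_neg, smul_smul]
  simp_rw [h7]
  exact h6

lemma norm_normal (hd : 1 ≤ d) (hΩ : IsPolyhedralDomain Ω) (hT : IsMesh Ω κ γ 𝒯)
    {K : Elem d} (hK : K ∈ 𝒯) {F : Set (Vec d)} (hF : F ∈ facesOf Ω 𝒯 K) : ‖normal K F‖ = 1 := by
  rw [normal_eq hd hΩ hT hK hF, norm_neg, norm_smul, norm_inv, norm_norm,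
    inv_mul_cancel₀ (norm_ne_zero_iff.2 (baryGrad_ne_zero hd K _))]

/-- The normal component of a stress with a weak divergence is continuous across the faces: it is
orthogonal to skeleton functions which vanish on `∂Ω`. -/
lemma bdInner_stress_skel (hd : 2 ≤ d) (hΩ : IsPolyhedralDomain Ω) (hT : IsMesh Ω κ γ 𝒯)
    {τ : Vec d → Sym d} {g : Vec d → Vec d}
    (hτ : MemLp τ 2 (volume.restrict Ω)) (hg : MemLp g 2 (volume.restrict Ω))
    (hweak : IsWeakDivSym Ω τ g) {tr : BdFun d (Sym d)}
    (htr : ∀ K ∈ 𝒯, ∀ F ∈ facesOf Ω 𝒯 K, IsTrace K F τ (tr K F))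
    {v : Skel d (Vec d)} (hv : ∀ F ∈ faces Ω 𝒯, MemLp (v F) 2 ((area d).restrict F))
    (hv0 : ∀ F ∈ boundaryFaces Ω 𝒯, v F =ᵐ[(area d).restrict F] 0) :
    bdInner Ω 𝒯 (fun _ => 1) (fun K F x => mulVecSym (tr K F x) (normal K F))
      (fun _ F x => v F x) = 0 := by
  have hd1 : 1 ≤ d := by omega
  have hb : ∀ K ∈ 𝒯, ∀ F ∈ facesOf Ω 𝒯 K,
      MemLp (fun x => mulVecSym (tr K F x) (normal K F)) 2 ((area d).restrict F) :=
    fun K hK F hF => ((mulVecSymL d).flip (normal K F)).comp_memLp' (htr K hK F hF).1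
  refine bdInner_skel_eq_zero hb hv fun F hF => ?_
  rcases mem_faces.1 hF with hi | hbd
  swap
  -- Nothing is known about the stress on `∂Ω`, but there `v` vanishes.
  · exact Or.inr (hv0 F hbd)
  left
  have h1 := sum_faces_ae_eq_zero hd1 hΩ hT hΩ.isOpen
    (b := fun K F x => mulVecSym (tr K F x) (normal K F))
    (fun K hK F hF => integrable_face hd1 hΩ hT hK hF (hb K hK F hF)) (fun φ hφ => by
      have h2 := sum_green hd hΩ hT (mulVecSymL d) hτ hg hweak htr hφ.1
      simp only [mulVecSymL_apply] at h2
      rw [h2, hweak φ hφ, neg_add_cancel]) hF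
  obtain ⟨K, hK, K', hK', hne, -, rfl⟩ := mem_interiorFaces.1 hi
  have h3 : ∀ᵐ x ∂(area d), x ∉ body K ∩ body K' ∩ frontier Ω :=
    measure_eq_zero_iff_ae_notMem.1 (area_inter_frontier hd1 hΩ hT hK hK' hne)
  filter_upwards [h1, ae_restrict_of_ae h3, ae_restrict_mem (measurableSet_of_mem_faces hF)]
    with x h4 h5 h6
  refine h4 ?_
  by_contra h7
  refine h5 ⟨h6, ?_⟩
  rw [hΩ.isOpen.frontier_eq]
  exact ⟨body_subset_closure hT hK h6.1, h7⟩

/-- The traces of a function in `H¹₀(Ω)` from the elements around a face cancel. This includes the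
boundary faces, because the weak formulation holds for test functions on the whole space. -/
lemma sum_trace_H10_ae_eq_zero (hd : 2 ≤ d) (hΩ : IsPolyhedralDomain Ω) (hT : IsMesh Ω κ γ 𝒯)
    {f : Vec d → ℝ} (hf : MemH10 Ω f) {tr : BdFun d ℝ}
    (htr : ∀ K ∈ 𝒯, ∀ F ∈ facesOf Ω 𝒯 K, IsTrace K F f (tr K F)) {F : Set (Vec d)}
    (hF : F ∈ faces Ω 𝒯) :
    ∀ᵐ x ∂((area d).restrict F), ∑ K ∈ elemsAt 𝒯 F, tr K F x • normal K F = 0 := by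
  have hd1 : 1 ≤ d := by omega
  obtain ⟨G, hG, hweak⟩ := hf.exists_gradient hΩ
  have h1 := sum_faces_ae_eq_zero hd1 hΩ hT isOpen_univ
    (b := fun K F x => tr K F x • normal K F)
    (fun K hK F hF => (integrable_face hd1 hΩ hT hK hF (htr K hK F hF).1).smul_const _)
    (fun φ hφ => by
      have h2 := sum_green hd hΩ hT (ContinuousLinearMap.lsmul ℝ ℝ) hf.1 hG
        (fun φ hφ => hweak φ (hφ.mono (subset_univ Ω))) htr hφ.1
      simp only [ContinuousLinearMap.lsmul_apply] at h2
      rw [h2, hweak φ hφ, neg_add_cancel]) hF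
  filter_upwards [h1] with x hx using hx (mem_univ x)

/-- Unlike for stresses, no boundary condition on the skeleton function is needed, since the trace
itself vanishes on `∂Ω`. -/
lemma bdInner_H10_skel (hd : 2 ≤ d) (hΩ : IsPolyhedralDomain Ω) (hT : IsMesh Ω κ γ 𝒯)
    {f : Vec d → ℝ} (hf : MemH10 Ω f) {tr : BdFun d ℝ}
    (htr : ∀ K ∈ 𝒯, ∀ F ∈ facesOf Ω 𝒯 K, IsTrace K F f (tr K F))
    {v : Skel d (Vec d)} (hv : ∀ F ∈ faces Ω 𝒯, MemLp (v F) 2 ((area d).restrict F)) :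
    bdInner Ω 𝒯 (fun _ => 1) (fun K F x => tr K F x • normal K F) (fun _ F x => v F x) = 0 :=
  bdInner_skel_eq_zero (fun K hK F hF =>
    (ContinuousLinearMap.toSpanSingleton ℝ (normal K F)).comp_memLp' (htr K hK F hF).1) hv
    fun _ hF => Or.inl (sum_trace_H10_ae_eq_zero hd hΩ hT hf htr hF)

/-- A boundary face lies on one element only, so the trace of a function in `H¹₀(Ω)` vanishes
there. -/
lemma trace_H10_boundary (hd : 2 ≤ d) (hΩ : IsPolyhedralDomain Ω) (hT : IsMesh Ω κ γ 𝒯)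
    {u : Vec d → Vec d} (hu : ∀ i, MemH10 Ω (fun x => u x i)) {tr : Skel d (Vec d)}
    (htr : ∀ K ∈ 𝒯, ∀ F ∈ facesOf Ω 𝒯 K, IsTrace K F u (tr F)) {F : Set (Vec d)}
    (hF : F ∈ boundaryFaces Ω 𝒯) : tr F =ᵐ[(area d).restrict F] 0 := by
  have hd1 : 1 ≤ d := by omega
  have hF' : F ∈ faces Ω 𝒯 := mem_faces.2 (Or.inr hF)
  obtain ⟨K, hK, hFK⟩ := exists_mem_of_mem_faces hF'
  have hone : elemsAt 𝒯 F = {K} := by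
    ext K'
    rw [mem_elemsAt, Finset.mem_singleton]
    refine ⟨fun h => eq_of_boundaryFace_subset hd1 hΩ hT h.1 hK hF h.2 (mem_facesOf.1 hFK).2, ?_⟩
    rintro rfl
    exact ⟨hK, (mem_facesOf.1 hFK).2⟩
  have h1 : ∀ i, ∀ᵐ x ∂((area d).restrict F), tr F x i = 0 := by
    intro i
    have h2 := sum_trace_H10_ae_eq_zero hd hΩ hT (hu i) (tr := fun _ F x => tr F x i)
      (fun K hK F hF => (htr K hK F hF).clm (EuclideanSpace.proj i : Vec d →L[ℝ] ℝ)) hF'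
    filter_upwards [h2] with x hx
    rw [hone, Finset.sum_singleton] at hx
    refine (smul_eq_zero.1 hx).resolve_right fun h3 => ?_
    have := norm_normal hd1 hΩ hT hK hFK
    rw [h3, norm_zero] at this
    exact zero_ne_one this
  filter_upwards [ae_all_iff.2 h1] with x hx
  ext i
  simpa using hx i

end

/-! ### The compliance tensors -/

section

variable {B : Sym d →L[ℝ] Sym d}

lemma isUnit_of_pos (hpos : ∀ τ : Sym d, τ ≠ 0 → 0 < inner ℝ (B τ) τ) : IsUnit B := by
  have hinj : Function.Injective B := by
    rw [injective_iff_map_eq_zero]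
    intro τ h
    by_contra hτ
    have := hpos τ hτ
    rw [h, inner_zero_left] at this
    exact lt_irrefl _ this
  rw [ContinuousLinearMap.isUnit_iff_bijective]
  exact ⟨hinj, (LinearMap.injective_iff_surjective (f := B.toLinearMap)).1 hinj⟩

lemma inverse_apply_apply (hpos : ∀ τ : Sym d, τ ≠ 0 → 0 < inner ℝ (B τ) τ) (τ : Sym d) :
    Ring.inverse B (B τ) = τ :=
  congrArg (fun A : Sym d →L[ℝ] Sym d => A τ) (Ring.inverse_mul_cancel B (isUnit_of_pos hpos))

lemma apply_inverse_apply (hpos : ∀ τ : Sym d, τ ≠ 0 → 0 < inner ℝ (B τ) τ) (τ : Sym d) :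
    B (Ring.inverse B τ) = τ :=
  congrArg (fun A : Sym d →L[ℝ] Sym d => A τ) (Ring.mul_inverse_cancel B (isUnit_of_pos hpos))

lemma inverse_symm (hsymm : ∀ σ τ : Sym d, inner ℝ (B σ) τ = inner ℝ σ (B τ))
    (hpos : ∀ τ : Sym d, τ ≠ 0 → 0 < inner ℝ (B τ) τ) (σ τ : Sym d) :
    inner ℝ (Ring.inverse B σ) τ = inner ℝ σ (Ring.inverse B τ) := by
  conv_lhs => rw [← apply_inverse_apply hpos τ]
  conv_rhs => rw [← apply_inverse_apply hpos σ]
  exact (hsymm _ _).symm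

/-- Positive definiteness is uniform, by compactness of the unit sphere. -/
lemma inverse_coercive (hpos : ∀ τ : Sym d, τ ≠ 0 → 0 < inner ℝ (B τ) τ) :
    ∃ c > 0, ∀ τ : Sym d, c * ‖τ‖ ^ 2 ≤ inner ℝ (Ring.inverse B τ) τ := by
  set A := Ring.inverse B with hA
  have hpos' : ∀ τ : Sym d, τ ≠ 0 → 0 < inner ℝ (A τ) τ := by
    intro τ hτ
    have h1 := apply_inverse_apply hpos τ
    have h2 : A τ ≠ 0 := fun h => hτ (by rw [← h1, ← hA, h, map_zero])
    have h3 := hpos _ h2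
    rwa [hA, h1, real_inner_comm] at h3
  have hc : Continuous fun τ : Sym d => inner ℝ (A τ) τ := A.continuous.inner continuous_id
  obtain ⟨c, hc0, hcle⟩ := (isCompact_sphere (0 : Sym d) 1).exists_forall_le' hc.continuousOn
    (a := 0) (fun τ hτ => hpos' τ (by
      rintro rfl
      simp at hτ))
  refine ⟨c, hc0, fun τ => ?_⟩
  rcases eq_or_ne τ 0 with rfl | hτ
  · simp
  have hn := norm_ne_zero_iff.2 hτ
  have h1 := hcle (‖τ‖⁻¹ • τ) (by
    rw [mem_sphere_zero_iff_norm, norm_smul, norm_inv, norm_norm, inv_mul_cancel₀ hn])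
  have h2 : inner ℝ (A (‖τ‖⁻¹ • τ)) (‖τ‖⁻¹ • τ) = ‖τ‖⁻¹ * (‖τ‖⁻¹ * inner ℝ (A τ) τ) := by
    rw [A.map_smul, real_inner_smul_left, sym_inner_smul]
  rw [h2] at h1
  have h3 : 0 < ‖τ‖ ^ 2 := by positivity
  calc c * ‖τ‖ ^ 2 ≤ ‖τ‖⁻¹ * (‖τ‖⁻¹ * inner ℝ (A τ) τ) * ‖τ‖ ^ 2 :=
        mul_le_mul_of_nonneg_right h1 h3.le
    _ = _ := by field_simp

end

/-! ### Inner products of broken functions -/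

section

variable {Ω : Set (Vec d)} {κ γ : ℝ} {𝒯 : Finset (Elem d)}
  {V : Type} [NormedAddCommGroup V] [InnerProductSpace ℝ V] [FiniteDimensional ℝ V]

set_option linter.unusedSectionVars false

/-- Broken functions that are square integrable on every element. -/
def VolL2 (𝒯 : Finset (Elem d)) (f : Broken d V) : Prop :=
  ∀ K ∈ 𝒯, MemLp (f K) 2 (volume.restrict (body K))

/-- Functions on the element boundaries that are square integrable on every face. -/
def BdL2 (Ω : Set (Vec d)) (𝒯 : Finset (Elem d)) (f : BdFun d V) : Prop :=
  ∀ K ∈ 𝒯, ∀ F ∈ facesOf Ω 𝒯 K, MemLp (f K F) 2 ((area d).restrict F)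

variable {f g h : Broken d V}

lemma VolL2.add (hf : VolL2 𝒯 f) (hg : VolL2 𝒯 g) : VolL2 𝒯 (fun K x => f K x + g K x) :=
  fun K hK => (hf K hK).add (hg K hK)

lemma VolL2.sub (hf : VolL2 𝒯 f) (hg : VolL2 𝒯 g) : VolL2 𝒯 (fun K x => f K x - g K x) :=
  fun K hK => (hf K hK).sub (hg K hK)

lemma VolL2.const_smul (hf : VolL2 𝒯 f) (c : ℝ) : VolL2 𝒯 (fun K x => c • f K x) :=
  fun K hK => (hf K hK).const_smul c

lemma VolL2.clm {W : Type} [NormedAddCommGroup W] [InnerProductSpace ℝ W] (hf : VolL2 𝒯 f)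
    (A : V →L[ℝ] W) : VolL2 𝒯 (fun K x => A (f K x)) :=
  fun K hK => A.comp_memLp' (hf K hK)

lemma volL2_of_continuous (hf : ∀ K ∈ 𝒯, Continuous (f K)) : VolL2 𝒯 f :=
  fun K hK => memLp_of_continuous (isCompact_body K) (volume_body_lt_top K) (hf K hK)

lemma IsBrokenPoly.volL2 {n : ℕ} (hf : IsBrokenPoly 𝒯 n f) : VolL2 𝒯 f :=
  volL2_of_continuous fun K hK => (hf K hK).continuous

lemma volL2_const (hΩ : IsPolyhedralDomain Ω) (hT : IsMesh Ω κ γ 𝒯) {w : Vec d → V}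
    (hw : MemLp w 2 (volume.restrict Ω)) : VolL2 𝒯 (fun _ => w) :=
  fun _ hK => hw.mono_measure (volume_restrict_body_le hΩ hT hK)

lemma isBrokenPoly_projT (n : ℕ) (w : Vec d → V) : IsBrokenPoly 𝒯 n (projT n w) :=
  fun _ _ => isPoly_l2Proj _ _ _

lemma IsBrokenPoly.sub {n : ℕ} (hf : IsBrokenPoly 𝒯 n f) (hg : IsBrokenPoly 𝒯 n g) :
    IsBrokenPoly 𝒯 n (fun K x => f K x - g K x) := fun K hK => (hf K hK).sub (hg K hK)

lemma volInner_congr_left {w w' : Vec d → V} (hΩ : IsPolyhedralDomain Ω) (hT : IsMesh Ω κ γ 𝒯)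
    (hw : ∀ᵐ x ∂(volume.restrict Ω), w x = w' x) :
    volInner 𝒯 (fun _ => w) g = volInner 𝒯 (fun _ => w') g := by
  refine Finset.sum_congr rfl fun K hK => integral_congr_ae ?_
  filter_upwards [hw.filter_mono (ae_mono (volume_restrict_body_le hΩ hT hK))] with x hx
  rw [hx]

lemma volInner_comm (f g : Broken d V) : volInner 𝒯 f g = volInner 𝒯 g f := by
  simp only [volInner, real_inner_comm]

lemma volInner_add_left (hf : VolL2 𝒯 f) (hg : VolL2 𝒯 g) (hh : VolL2 𝒯 h) :
    volInner 𝒯 (fun K x => f K x + g K x) h = volInner 𝒯 f h + volInner 𝒯 g h := by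
  rw [volInner, volInner, volInner, ← Finset.sum_add_distrib]
  refine Finset.sum_congr rfl fun K hK => ?_
  simp_rw [inner_add_left]
  exact integral_add (integrable_inner_of_memLp (hf K hK) (hh K hK))
    (integrable_inner_of_memLp (hg K hK) (hh K hK))

lemma volInner_sub_left (hf : VolL2 𝒯 f) (hg : VolL2 𝒯 g) (hh : VolL2 𝒯 h) :
    volInner 𝒯 (fun K x => f K x - g K x) h = volInner 𝒯 f h - volInner 𝒯 g h := by
  rw [volInner, volInner, volInner, ← Finset.sum_sub_distrib]
  refine Finset.sum_congr rfl fun K hK => ?_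
  simp_rw [inner_sub_left]
  exact integral_sub (integrable_inner_of_memLp (hf K hK) (hh K hK))
    (integrable_inner_of_memLp (hg K hK) (hh K hK))

lemma volInner_smul_left (c : ℝ) :
    volInner 𝒯 (fun K x => c • f K x) g = c * volInner 𝒯 f g := by
  simp only [volInner, real_inner_smul_left, integral_const_mul, Finset.mul_sum]

lemma volInner_sub_right (hf : VolL2 𝒯 f) (hg : VolL2 𝒯 g) (hh : VolL2 𝒯 h) :
    volInner 𝒯 f (fun K x => g K x - h K x) = volInner 𝒯 f g - volInner 𝒯 f h := by
  rw [volInner_comm, volInner_sub_left hg hh hf, volInner_comm g, volInner_comm h]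

lemma volInner_smul_right (c : ℝ) :
    volInner 𝒯 f (fun K x => c • g K x) = c * volInner 𝒯 f g := by
  rw [volInner_comm, volInner_smul_left, volInner_comm]

lemma volInner_projT {n : ℕ} (hΩ : IsPolyhedralDomain Ω) (hT : IsMesh Ω κ γ 𝒯) {w : Vec d → V}
    (hw : MemLp w 2 (volume.restrict Ω)) (hg : IsBrokenPoly 𝒯 n g) :
    volInner 𝒯 (projT n w) g = volInner 𝒯 (fun _ => w) g :=
  Finset.sum_congr rfl fun K hK => l2Proj_inner (isCompact_body K) (volume_body_lt_top K)
    (hw.mono_measure (volume_restrict_body_le hΩ hT hK)) (hg K hK)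

lemma volInner_self_nonneg (f : Broken d V) : 0 ≤ volInner 𝒯 f f :=
  Finset.sum_nonneg fun _ _ => integral_nonneg fun _ => real_inner_self_nonneg

lemma two_volInner_le (hf : VolL2 𝒯 f) (hg : VolL2 𝒯 g) :
    2 * volInner 𝒯 f g ≤ volInner 𝒯 f f + volInner 𝒯 g g := by
  have h1 := volInner_self_nonneg (𝒯 := 𝒯) (fun K x => f K x - g K x)
  rw [volInner_sub_left hf hg (hf.sub hg), volInner_sub_right hf hf hg,
    volInner_sub_right hg hf hg, volInner_comm g f] at h1
  linarith

lemma ofReal_integral_norm_sq {μ : Measure (Vec d)} {f : Vec d → V} (hf : MemLp f 2 μ) :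
    ENNReal.ofReal (∫ x, inner ℝ (f x) (f x) ∂μ) = ∫⁻ x, ‖f x‖ₑ ^ 2 ∂μ := by
  rw [ofReal_integral_eq_lintegral_ofReal (integrable_inner_of_memLp hf hf)
    (Eventually.of_forall fun x => real_inner_self_nonneg)]
  refine lintegral_congr fun x => ?_
  rw [real_inner_self_eq_norm_sq, ENNReal.ofReal_pow (norm_nonneg _), ofReal_norm]

lemma ofReal_volInner_self (hf : VolL2 𝒯 f) :
    ENNReal.ofReal (volInner 𝒯 f f) = volNormSq 𝒯 f := by
  rw [volInner, ENNReal.ofReal_sum_of_nonneg fun K _ => integral_nonneg fun _ =>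
    real_inner_self_nonneg]
  exact Finset.sum_congr rfl fun K hK => ofReal_integral_norm_sq (hf K hK)

variable {a b e : BdFun d V}

lemma BdL2.sub (ha : BdL2 Ω 𝒯 a) (hb : BdL2 Ω 𝒯 b) : BdL2 Ω 𝒯 (fun K F x => a K F x - b K F x) :=
  fun K hK F hF => (ha K hK F hF).sub (hb K hK F hF)

lemma BdL2.clm {W : Type} [NormedAddCommGroup W] [InnerProductSpace ℝ W] (ha : BdL2 Ω 𝒯 a)
    (A : Elem d → Set (Vec d) → V →L[ℝ] W) : BdL2 Ω 𝒯 (fun K F x => A K F (a K F x)) :=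
  fun K hK F hF => (A K F).comp_memLp' (ha K hK F hF)

lemma bdL2_of_continuous (hd : 1 ≤ d) (hΩ : IsPolyhedralDomain Ω) (hT : IsMesh Ω κ γ 𝒯)
    (ha : ∀ K ∈ 𝒯, ∀ F ∈ facesOf Ω 𝒯 K, Continuous (a K F)) : BdL2 Ω 𝒯 a :=
  fun K hK F hF => memLp_of_continuous (isCompact_of_mem_faces (mem_facesOf.1 hF).1)
    (area_lt_top_of_mem_facesOf hd hΩ hT hK hF) (ha K hK F hF)

lemma IsBrokenPoly.bdL2 (hd : 1 ≤ d) (hΩ : IsPolyhedralDomain Ω) (hT : IsMesh Ω κ γ 𝒯) {n : ℕ}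
    (hf : IsBrokenPoly 𝒯 n f) : BdL2 Ω 𝒯 (fun K _ x => f K x) :=
  bdL2_of_continuous hd hΩ hT fun K hK _ _ => (hf K hK).continuous

lemma IsSkelPoly.memLp (hd : 1 ≤ d) (hΩ : IsPolyhedralDomain Ω) (hT : IsMesh Ω κ γ 𝒯) {n : ℕ}
    {w : Skel d V} (hw : IsSkelPoly Ω 𝒯 n w) {F : Set (Vec d)} (hF : F ∈ faces Ω 𝒯) :
    MemLp (w F) 2 ((area d).restrict F) := by
  obtain ⟨K, hK, hFK⟩ := exists_mem_of_mem_faces hF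
  exact memLp_of_continuous (isCompact_of_mem_faces hF)
    (area_lt_top_of_mem_facesOf hd hΩ hT hK hFK) (hw F hF).continuous

lemma IsSkelPoly.bdL2 (hd : 1 ≤ d) (hΩ : IsPolyhedralDomain Ω) (hT : IsMesh Ω κ γ 𝒯) {n : ℕ}
    {w : Skel d V} (hw : IsSkelPoly Ω 𝒯 n w) : BdL2 Ω 𝒯 (fun _ F x => w F x) :=
  fun _ _ _ hF => hw.memLp hd hΩ hT (mem_facesOf.1 hF).1

variable {c : Set (Vec d) → ℝ}

lemma integrable_bd (ha : BdL2 Ω 𝒯 a) (hb : BdL2 Ω 𝒯 b) {K : Elem d} (hK : K ∈ 𝒯)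
    {F : Set (Vec d)} (hF : F ∈ facesOf Ω 𝒯 K) :
    Integrable (fun x => inner ℝ (c F • a K F x) (b K F x)) ((area d).restrict F) :=
  integrable_inner_of_memLp ((ha K hK F hF).const_smul (c F)) (hb K hK F hF)

lemma bdInner_comm (a b : BdFun d V) : bdInner Ω 𝒯 c a b = bdInner Ω 𝒯 c b a := by
  simp only [bdInner, real_inner_smul_left]
  simp only [real_inner_comm]

lemma bdInner_sub_left (ha : BdL2 Ω 𝒯 a) (hb : BdL2 Ω 𝒯 b) (he : BdL2 Ω 𝒯 e) :
    bdInner Ω 𝒯 c (fun K F x => a K F x - b K F x) e = bdInner Ω 𝒯 c a e - bdInner Ω 𝒯 c b e := by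
  rw [bdInner, bdInner, bdInner, ← Finset.sum_sub_distrib]
  refine Finset.sum_congr rfl fun K hK => ?_
  rw [← Finset.sum_sub_distrib]
  refine Finset.sum_congr rfl fun F hF => ?_
  simp_rw [smul_sub, inner_sub_left]
  exact integral_sub (integrable_bd ha he hK hF) (integrable_bd hb he hK hF)

lemma bdInner_sub_right (ha : BdL2 Ω 𝒯 a) (hb : BdL2 Ω 𝒯 b) (he : BdL2 Ω 𝒯 e) :
    bdInner Ω 𝒯 c a (fun K F x => b K F x - e K F x) = bdInner Ω 𝒯 c a b - bdInner Ω 𝒯 c a e := by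
  rw [bdInner_comm, bdInner_sub_left hb he ha, bdInner_comm b, bdInner_comm e]

lemma bdInner_self_nonneg (hc : ∀ F, 0 ≤ c F) (a : BdFun d V) : 0 ≤ bdInner Ω 𝒯 c a a :=
  Finset.sum_nonneg fun _ _ => Finset.sum_nonneg fun F _ => integral_nonneg fun _ => by
    simp only [real_inner_smul_left, Pi.zero_apply]
    exact mul_nonneg (hc F) real_inner_self_nonneg

lemma ofReal_bdInner_self (ha : BdL2 Ω 𝒯 a) :
    ENNReal.ofReal (bdInner Ω 𝒯 (fun F => c F ^ 2) a a) = bdNormSq Ω 𝒯 c a := by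
  have h1 : ∀ K F, ∫ x in F, inner ℝ (c F ^ 2 • a K F x) (a K F x) ∂(area d)
      = ∫ x in F, inner ℝ (c F • a K F x) (c F • a K F x) ∂(area d) := by
    intro K F
    simp only [real_inner_smul_left, real_inner_smul_right, sq, mul_assoc]
  simp only [bdInner, h1]
  rw [ENNReal.ofReal_sum_of_nonneg fun K _ => Finset.sum_nonneg fun F _ => integral_nonneg fun _ =>
    real_inner_self_nonneg]
  refine Finset.sum_congr rfl fun K hK => ?_
  rw [ENNReal.ofReal_sum_of_nonneg fun F _ => integral_nonneg fun _ => real_inner_self_nonneg]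
  exact Finset.sum_congr rfl fun F hF =>
    ofReal_integral_norm_sq ((ha K hK F hF).const_smul (c F))

/-- Young's inequality on the element boundaries, with reciprocal weights. -/
lemma two_bdInner_le {c' r : Set (Vec d) → ℝ} (ha : BdL2 Ω 𝒯 a) (hb : BdL2 Ω 𝒯 b)
    (hr : ∀ F ∈ faces Ω 𝒯, r F = c F * c' F) :
    2 * |bdInner Ω 𝒯 r a b| ≤
      bdInner Ω 𝒯 (fun F => c F ^ 2) a a + bdInner Ω 𝒯 (fun F => c' F ^ 2) b b := by
  have hY : ∀ K ∈ 𝒯, ∀ F ∈ facesOf Ω 𝒯 K,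
      2 * |∫ x in F, inner ℝ (r F • a K F x) (b K F x) ∂(area d)|
      ≤ (∫ x in F, inner ℝ (c F ^ 2 • a K F x) (a K F x) ∂(area d))
        + ∫ x in F, inner ℝ (c' F ^ 2 • b K F x) (b K F x) ∂(area d) := by
    intro K hK F hF
    rw [← integral_add (integrable_bd (c := fun F => c F ^ 2) ha ha hK hF)
      (integrable_bd (c := fun F => c' F ^ 2) hb hb hK hF)]
    refine (mul_le_mul_of_nonneg_left abs_integral_le_integral_abs zero_le_two).trans ?_
    rw [← integral_const_mul]
    refine integral_mono ((integrable_bd ha hb hK hF).abs.const_mul 2)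
      ((integrable_bd (c := fun F => c F ^ 2) ha ha hK hF).add
      (integrable_bd (c := fun F => c' F ^ 2) hb hb hK hF)) fun x => ?_
    simp only [hr F (mem_facesOf.1 hF).1, real_inner_smul_left, real_inner_self_eq_norm_sq, abs_mul]
    have h1 := abs_real_inner_le_norm (a K F x) (b K F x)
    have h2 : |c F| * |c' F| * |inner ℝ (a K F x) (b K F x)|
        ≤ |c F| * |c' F| * (‖a K F x‖ * ‖b K F x‖) :=
      mul_le_mul_of_nonneg_left h1 (by positivity)
    have h3 := sq_nonneg (|c F| * ‖a K F x‖ - |c' F| * ‖b K F x‖)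
    have h4 := sq_abs (c F)
    have h5 := sq_abs (c' F)
    rw [← h4, ← h5]
    nlinarith
  calc 2 * |bdInner Ω 𝒯 r a b|
      ≤ ∑ K ∈ 𝒯, ∑ F ∈ facesOf Ω 𝒯 K,
          2 * |∫ x in F, inner ℝ (r F • a K F x) (b K F x) ∂(area d)| := by
        rw [bdInner]
        simp_rw [← Finset.mul_sum]
        refine mul_le_mul_of_nonneg_left ?_ zero_le_two
        exact (Finset.abs_sum_le_sum_abs _ _).trans
          (Finset.sum_le_sum fun K _ => Finset.abs_sum_le_sum_abs _ _)
    _ ≤ _ := by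
        rw [bdInner, bdInner, ← Finset.sum_add_distrib]
        refine Finset.sum_le_sum fun K hK => ?_
        rw [← Finset.sum_add_distrib]
        exact Finset.sum_le_sum fun F hF => hY K hK F hF

end

/-! ### Derivatives of broken polynomials -/

lemma strain_sub {a b : Vec d → Vec d} (ha : Differentiable ℝ a) (hb : Differentiable ℝ b)
    (x : Vec d) : strain (fun y => a y - b y) x = strain a x - strain b x := by
  refine Subtype.ext ?_
  ext ij
  have h := fderiv_fun_sub (ha x) (hb x)
  simp only [strain, symPart, h, Submodule.coe_sub, PiLp.sub_apply, FunLike.coe_sub, Pi.sub_apply]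
  ring

lemma divergence_sub {a b : Vec d → Vec d} (ha : Differentiable ℝ a) (hb : Differentiable ℝ b)
    (x : Vec d) : divergence (fun y => a y - b y) x = divergence a x - divergence b x := by
  have h := fderiv_fun_sub (ha x) (hb x)
  simp only [divergence, h, PiLp.sub_apply, FunLike.coe_sub, Pi.sub_apply, Finset.sum_sub_distrib]

lemma symPart_eq_sum (M : Fin d → Fin d → ℝ) :
    symPart M = ∑ i, ∑ j, M i j • symPart (fun a b => if a = i ∧ b = j then (1 : ℝ) else 0) := by
  have h : ∀ τ : Sym d, inner ℝ τ (symPart M) = inner ℝ τ (∑ i, ∑ j, M i j •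
      symPart (fun a b => if a = i ∧ b = j then (1 : ℝ) else 0)) := by
    intro τ
    simp only [inner_sum, sym_inner_smul, inner_symPart]
    refine Finset.sum_congr rfl fun i _ => Finset.sum_congr rfl fun j _ => ?_
    rw [Finset.sum_eq_single i, Finset.sum_eq_single j]
    · simp [mul_comm]
    · intro b _ hb
      simp [hb]
    · simp
    · intro a _ ha
      simp [ha]
    · simp
  exact ext_inner_left ℝ h

lemma IsPoly.strain {n : ℕ} {v : Vec d → Vec d} (hv : IsPoly (n + 1) v) :
    IsPoly n (fun x => strain v x) := by
  have h : ∀ x, HDG.strain v x = ∑ i, ∑ j, (fderiv ℝ v x (EuclideanSpace.single j 1)) i •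
      symPart (fun a b => if a = i ∧ b = j then (1 : ℝ) else 0) := fun x => symPart_eq_sum _
  simp_rw [h]
  refine IsPoly.sum _ fun i _ => IsPoly.sum _ fun j _ => IsPolyReal.smul_const ?_ _
  exact (isPoly_real_iff).1
    ((hv.fderiv_apply (EuclideanSpace.single j 1)).clm_comp (EuclideanSpace.proj i : Vec d →L[ℝ] ℝ))

lemma IsPoly.divergence {n : ℕ} {v : Vec d → Vec d} (hv : IsPoly (n + 1) v) :
    IsPoly n (fun x => divergence v x) :=
  IsPoly.sum _ fun i _ =>
    (hv.fderiv_apply (EuclideanSpace.single i 1)).clm_comp (EuclideanSpace.proj i : Vec d →L[ℝ] ℝ)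

section

variable {Ω : Set (Vec d)} {κ γ : ℝ} {𝒯 : Finset (Elem d)}

lemma isBrokenPoly_dtBroken {V : Type} [NormedAddCommGroup V] [InnerProductSpace ℝ V]
    [FiniteDimensional ℝ V] {n : ℕ} {T : ℝ} (hT : 0 < T) {v : ℝ → Broken d V}
    (hv : IsC1Broken 𝒯 n T v) {t : ℝ} (ht : t ∈ Icc 0 T) :
    IsBrokenPoly 𝒯 n (dtBroken T v t) := by
  intro K hK
  obtain ⟨m, b, c, hb, hc, h⟩ := exists_C1_coefficients (fun t ht => hv.1 t ht K hK) (hv.2 K hK)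
  have h1 : dtBroken T v t K = fun x => ∑ j, derivWithin (c j) (Icc 0 T) t • b j x := by
    funext x
    have h2 : HasDerivWithinAt (fun s => ∑ j, c j s • b j x)
        (∑ j, derivWithin (c j) (Icc 0 T) t • b j x) (Icc 0 T) t :=
      HasDerivWithinAt.fun_sum fun j _ =>
        (((hc j).differentiableOn (by simp) t ht).hasDerivWithinAt).smul_const (b j x)
    exact (h2.congr (fun s hs => h s hs x) (h t ht x)).derivWithin (uniqueDiffOn_Icc hT t ht)
  rw [h1]
  exact IsPoly.sum _ fun j _ => (hb j).const_smul _

/-! ### The continuous problem, tested with broken polynomials -/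

variable {m : Coefficients d}

lemma volInner_totalStress_left {a b w : Broken d (Sym d)} {c : Broken d ℝ} (ha : VolL2 𝒯 a)
    (hb : VolL2 𝒯 b) (hc : VolL2 𝒯 c) (hw : VolL2 𝒯 w) :
    volInner 𝒯 (fun K x => m.totalStress (a K x) (b K x) (c K x)) w
      = volInner 𝒯 a w + m.ω * volInner 𝒯 b w
        - m.α * volInner 𝒯 c (fun K x => inner ℝ (idSym d) (w K x)) := by
  have h1 : VolL2 𝒯 (fun K x => m.ω • b K x) := hb.const_smul m.ω
  have h2 : VolL2 𝒯 (fun K x => (m.α * c K x) • idSym d) :=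
    hc.clm (ContinuousLinearMap.toSpanSingleton ℝ (idSym d) ∘L (m.α • ContinuousLinearMap.id ℝ ℝ))
  have h3 : volInner 𝒯 (fun K x => (m.α * c K x) • idSym d) w
      = m.α * volInner 𝒯 c (fun K x => inner ℝ (idSym d) (w K x)) := by
    simp only [volInner, Finset.mul_sum, ← integral_const_mul]
    refine Finset.sum_congr rfl fun K _ => integral_congr_ae (Eventually.of_forall fun x => ?_)
    have h4 : inner ℝ ((m.α * c K x) • idSym d) (w K x)
        = m.α * c K x * inner ℝ (idSym d) (w K x) :=
      real_inner_smul_left (idSym d) (w K x) (m.α * c K x)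
    simp only [h4, RCLike.inner_apply, conj_trivial]
    ring
  simp only [Coefficients.totalStress]
  rw [volInner_sub_left (ha.add h1) h2 hw, volInner_add_left ha h1 hw, volInner_smul_left, h3]

lemma volInner_totalStress_projT (hΩ : IsPolyhedralDomain Ω) (hT : IsMesh Ω κ γ 𝒯) {n : ℕ}
    {a b : Vec d → Sym d} {c : Vec d → ℝ} (ha : MemLp a 2 (volume.restrict Ω))
    (hb : MemLp b 2 (volume.restrict Ω)) (hc : MemLp c 2 (volume.restrict Ω))
    {w : Broken d (Sym d)} (hw : IsBrokenPoly 𝒯 n w) :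
    volInner 𝒯 (fun K x => m.totalStress (projT n a K x) (projT n b K x) (projT n c K x)) w
      = volInner 𝒯 (fun _ x => m.totalStress (a x) (b x) (c x)) w := by
  rw [volInner_totalStress_left (isBrokenPoly_projT n a).volL2 (isBrokenPoly_projT n b).volL2
    (isBrokenPoly_projT n c).volL2 hw.volL2,
    volInner_totalStress_left (volL2_const hΩ hT ha) (volL2_const hΩ hT hb) (volL2_const hΩ hT hc)
    hw.volL2, volInner_projT hΩ hT ha hw, volInner_projT hΩ hT hb hw,
    volInner_projT hΩ hT hc (g := fun K x => inner ℝ (idSym d) (w K x))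
      fun K hK => (hw K hK).clm_comp (innerSL ℝ (idSym d))]

lemma memLp_totalStress {a b : Vec d → Sym d} {c : Vec d → ℝ} {μ : Measure (Vec d)}
    (ha : MemLp a 2 μ) (hb : MemLp b 2 μ) (hc : MemLp c 2 μ) :
    MemLp (fun x => m.totalStress (a x) (b x) (c x)) 2 μ := by
  have h2 : MemLp (fun x => (m.α * c x) • idSym d) 2 μ :=
    (ContinuousLinearMap.toSpanSingleton ℝ (idSym d) ∘L
      (m.α • ContinuousLinearMap.id ℝ ℝ)).comp_memLp' hc
  exact (ha.add (hb.const_smul m.ω)).sub h2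

lemma totalStress_sub (m : Coefficients d) (a b a' b' : Sym d) (c c' : ℝ) :
    m.totalStress (a - a') (b - b') (c - c') = m.totalStress a b c - m.totalStress a' b' c' := by
  simp only [Coefficients.totalStress, smul_sub, mul_sub, sub_smul]
  abel

lemma bdInner_green_stress (hd : 2 ≤ d) (hΩ : IsPolyhedralDomain Ω) (hT : IsMesh Ω κ γ 𝒯)
    {τ : Vec d → Sym d} {g : Vec d → Vec d}
    (hτ : MemLp τ 2 (volume.restrict Ω)) (hg : MemLp g 2 (volume.restrict Ω))
    (hweak : IsWeakDivSym Ω τ g) {tr : BdFun d (Sym d)}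
    (htr : ∀ K ∈ 𝒯, ∀ F ∈ facesOf Ω 𝒯 K, IsTrace K F τ (tr K F))
    {n : ℕ} {v : Broken d (Vec d)} (hv : IsBrokenPoly 𝒯 n v) :
    bdInner Ω 𝒯 (fun _ => 1) (fun K F x => mulVecSym (tr K F x) (normal K F)) (fun K _ x => v K x)
      = volInner 𝒯 (fun _ => τ) (fun K x => strain (v K) x) + volInner 𝒯 (fun _ => g) v := by
  rw [bdInner, volInner, volInner, ← Finset.sum_add_distrib]
  refine Finset.sum_congr rfl fun K hK => ?_
  simp_rw [one_smul]
  exact green_stress hd hΩ hT hK hτ hg hweak (htr K hK) (hv K hK).contDiff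

lemma bdInner_green_scalar (hd : 2 ≤ d) (hΩ : IsPolyhedralDomain Ω) (hT : IsMesh Ω κ γ 𝒯)
    {f : Vec d → ℝ} {g : Vec d → Vec d}
    (hf : MemLp f 2 (volume.restrict Ω)) (hg : MemLp g 2 (volume.restrict Ω))
    (hweak : IsWeakGrad Ω f g) {tr : BdFun d ℝ}
    (htr : ∀ K ∈ 𝒯, ∀ F ∈ facesOf Ω 𝒯 K, IsTrace K F f (tr K F))
    {n : ℕ} {v : Broken d (Vec d)} (hv : IsBrokenPoly 𝒯 n v) :
    bdInner Ω 𝒯 (fun _ => 1) (fun K F x => tr K F x • normal K F) (fun K _ x => v K x)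
      = volInner 𝒯 (fun _ => f) (fun K x => divergence (v K) x) + volInner 𝒯 (fun _ => g) v := by
  rw [bdInner, volInner, volInner, ← Finset.sum_add_distrib]
  refine Finset.sum_congr rfl fun K hK => ?_
  simp_rw [one_smul]
  exact green_scalar hd hΩ hT hK hf hg hweak (htr K hK) (hv K hK).contDiff

lemma BdL2.mulVecSym {τ : BdFun d (Sym d)} (hτ : BdL2 Ω 𝒯 τ) :
    BdL2 Ω 𝒯 (fun K F x => mulVecSym (τ K F x) (normal K F)) :=
  hτ.clm fun K F => (mulVecSymL d).flip (normal K F)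

lemma BdL2.smul_normal {f : BdFun d ℝ} (hf : BdL2 Ω 𝒯 f) :
    BdL2 Ω 𝒯 (fun K F x => f K F x • normal K F) :=
  hf.clm fun K F => ContinuousLinearMap.toSpanSingleton ℝ (normal K F)

variable {T : ℝ} {F : ℝ → L2 Ω (Vec d)} {g : ℝ → L2 Ω ℝ}

/-- The trace of the total stress of the exact solution. -/
def stressTrace {y : ExactSolution m Ω T F g} (tr : SkeletonTraces y 𝒯) (t : ℝ) : BdFun d (Sym d) :=
  fun K E x => m.totalStress (tr.σE t K E x) (tr.σV t K E x) (tr.ψ t K E x)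

lemma isTrace_stressTrace (hd : 2 ≤ d) (hΩ : IsPolyhedralDomain Ω) (hT : IsMesh Ω κ γ 𝒯)
    {y : ExactSolution m Ω T F g} (tr : SkeletonTraces y 𝒯) {t : ℝ} (ht : t ∈ Icc 0 T)
    {K : Elem d} (hK : K ∈ 𝒯) {E : Set (Vec d)} (hE : E ∈ facesOf Ω 𝒯 K) :
    IsTrace K E (fun x => m.totalStress (y.σE t x) (y.σV t x) (y.ψ t x)) (stressTrace tr t K E) :=
  isTrace_totalStress hd hΩ hT m hK hE (Lp.memLp _) (Lp.memLp _) (Lp.memLp _)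
    (tr.σE_trace t ht K hK E hE) (tr.σV_trace t ht K hK E hE) (tr.ψ_trace t ht K hK E hE)

/-- The exact solution satisfies the equation of the scheme without stabilisation, up to the terms
in which its strain and its divergence replace the discrete ones. -/
lemma exact_tested (hd : 2 ≤ d) (hΩ : IsPolyhedralDomain Ω) (hT : IsMesh Ω κ γ 𝒯)
    (y : ExactSolution m Ω T F g) (tr : SkeletonTraces y 𝒯) {t : ℝ} (ht : t ∈ Icc 0 T)
    {n : ℕ} {v q : Broken d (Vec d)} (hv : IsBrokenPoly 𝒯 n v) (hq : IsBrokenPoly 𝒯 n q)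
    {v' q' : Skel d (Vec d)} (hv' : IsSkelPoly Ω 𝒯 n v') (hv0 : VanishesOnBoundary Ω 𝒯 v')
    (hq' : IsSkelPoly Ω 𝒯 n q') {τE τV : Broken d (Sym d)} {φ : Broken d ℝ}
    (hτE : VolL2 𝒯 τE) (hτV : VolL2 𝒯 τV) (hφ : VolL2 𝒯 φ) :
    innerH1 m 𝒯 (fun _ x => dt T y.u t x) (fun _ x => dt T y.p t x) v q
      + innerH2 m 𝒯 (fun _ x => dt T y.σE t x) (fun _ x => dt T y.σV t x)
          (fun _ x => dt T y.ψ t x) τE τV φ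
      + volInner 𝒯 (fun _ x => m.𝒢 (y.σV t x)) (fun K x => m.ω • τV K x)
      + m.β * volInner 𝒯 (fun _ => y.p t) q
      + (volInner 𝒯 (fun _ x => m.totalStress (y.σE t x) (y.σV t x) (y.ψ t x))
          (fun K x => strain (v K) x)
        - volInner 𝒯 (fun _ => y.ψ t) (fun K x => divergence (q K) x)
        - bdInner Ω 𝒯 (fun _ => 1) (fun K E x => mulVecSym (stressTrace tr t K E x) (normal K E))
            (jump v v')
        + bdInner Ω 𝒯 (fun _ => 1) (fun K E x => tr.ψ t K E x • normal K E) (jump q q'))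
      - volInner 𝒯 (fun _ => y.εu t) (fun K x => m.totalStress (τE K x) (τV K x) (φ K x))
      + volInner 𝒯 (fun _ => y.divp t) φ
    = volInner 𝒯 (fun _ => F t) v + volInner 𝒯 (fun _ => g t) φ := by
  have hd1 : 1 ≤ d := by omega
  have hL : ∀ {V : Type} [NormedAddCommGroup V] [InnerProductSpace ℝ V] [FiniteDimensional ℝ V]
      (w : L2 Ω V), VolL2 𝒯 (fun _ => (w : Vec d → V)) := fun w => volL2_const hΩ hT (Lp.memLp w)
  have h𝒢 := fun w : L2 Ω (Sym d) => (hL w).clm m.𝒢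
  -- Each equation of the problem, tested with the function that belongs to it.
  have e1 : volInner 𝒯 (fun _ => F t) v
      = m.ρ * volInner 𝒯 (fun _ x => dt T y.u t x) v - volInner 𝒯 (fun _ => y.divσ t) v := by
    rw [← volInner_congr_left hΩ hT (y.momentum t ht),
      volInner_sub_left ((hL _).const_smul _) (hL _) hv.volL2, volInner_smul_left]
  have e2 : m.χ * volInner 𝒯 (fun _ x => dt T y.p t x) q + m.β * volInner 𝒯 (fun _ => y.p t) q
      + volInner 𝒯 (fun _ => y.gradψ t) q = 0 := by
    have h := volInner_congr_left (g := q) hΩ hT (y.flux t ht)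
    rw [volInner_add_left (((hL _).const_smul _).add ((hL _).const_smul _)) (hL _) hq.volL2,
      volInner_add_left ((hL _).const_smul _) ((hL _).const_smul _) hq.volL2, volInner_smul_left,
      volInner_smul_left] at h
    rw [h]
    simp [volInner]
  have e3 : volInner 𝒯 (fun _ x => m.𝒜 (dt T y.σE t x)) τE = volInner 𝒯 (fun _ => y.εu t) τE := by
    refine volInner_congr_left hΩ hT ?_
    filter_upwards [y.elastic t ht] with x hx
    rw [hx, Coefficients.𝒜, inverse_apply_apply m.𝒞_pos]
  have e4 : volInner 𝒯 (fun _ x => m.𝒢 (m.ω • dt T y.σV t x)) (fun K x => m.ω • τV K x)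
      + volInner 𝒯 (fun _ x => m.𝒢 (y.σV t x)) (fun K x => m.ω • τV K x)
      = m.ω * volInner 𝒯 (fun _ => y.εu t) τV := by
    rw [← volInner_add_left (((hL _).const_smul m.ω).clm m.𝒢) (h𝒢 _) (hτV.const_smul _),
      ← volInner_smul_right]
    refine volInner_congr_left hΩ hT ?_
    filter_upwards [y.viscous t ht] with x hx
    rw [← map_add, hx, Coefficients.𝒢, inverse_apply_apply m.𝒟_sub_𝒞_pos]
  have htr : VolL2 𝒯 (fun _ x => trSym (y.εu t x)) := by
    have h := (hL (y.εu t)).clm (innerSL ℝ (idSym d))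
    have h1 : ∀ τ : Sym d, innerSL ℝ (idSym d) τ = trSym τ := fun τ => by
      rw [innerSL_apply_apply, real_inner_comm, inner_idSym]
    simpa only [h1] using h
  have e5 : volInner 𝒯 (fun _ => g t) φ = m.s * volInner 𝒯 (fun _ x => dt T y.ψ t x) φ
      + volInner 𝒯 (fun _ => y.divp t) φ + m.α * volInner 𝒯 (fun _ x => trSym (y.εu t x)) φ := by
    have h := volInner_add_left (((hL (dt T y.ψ t)).const_smul m.s).add (hL (y.divp t)))
      (htr.const_smul m.α) hφ
    rw [volInner_add_left ((hL (dt T y.ψ t)).const_smul m.s) (hL _) hφ,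
      volInner_smul_left, volInner_smul_left] at h
    rw [← volInner_congr_left hΩ hT (y.conservation t ht)]
    exact h
  have e6 : volInner 𝒯 (fun _ => y.εu t) (fun K x => m.totalStress (τE K x) (τV K x) (φ K x))
      = volInner 𝒯 (fun _ => y.εu t) τE + m.ω * volInner 𝒯 (fun _ => y.εu t) τV
        - m.α * volInner 𝒯 (fun _ x => trSym (y.εu t x)) φ := by
    rw [volInner_comm, volInner_totalStress_left hτE hτV hφ (hL _), volInner_comm τE,
      volInner_comm τV, volInner_comm φ]
    simp only [real_inner_comm _ (idSym d), inner_idSym]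
  -- Green's formula removes the terms in `v` and `q`. The contributions of `v'` and `q'` vanish.
  have hσ := memLp_totalStress (m := m) (Lp.memLp (y.σE t)) (Lp.memLp (y.σV t)) (Lp.memLp (y.ψ t))
  have hst := fun K (hK : K ∈ 𝒯) E (hE : E ∈ facesOf Ω 𝒯 K) =>
    isTrace_stressTrace hd hΩ hT tr ht hK hE
  have hstL : BdL2 Ω 𝒯 (stressTrace tr t) := fun K hK E hE => (hst K hK E hE).1
  have hψL : BdL2 Ω 𝒯 (tr.ψ t) := fun K hK E hE => (tr.ψ_trace t ht K hK E hE).1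
  have e7 := bdInner_green_stress hd hΩ hT hσ (Lp.memLp _) (y.divσ_weak t ht) hst hv
  have e8 := bdInner_green_scalar hd hΩ hT (Lp.memLp _) (Lp.memLp _) (y.gradψ_weak t ht)
    (fun K hK E hE => tr.ψ_trace t ht K hK E hE) hq
  have e9 := bdInner_stress_skel hd hΩ hT hσ (Lp.memLp _) (y.divσ_weak t ht) hst
    (v := v') (fun E hE => hv'.memLp hd1 hΩ hT hE) fun E hE => by
      filter_upwards [ae_restrict_mem (measurableSet_of_mem_faces (mem_faces.2 (Or.inr hE)))]
        with x hx using hv0 E hE x hx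
  have e10 := bdInner_H10_skel hd hΩ hT (y.ψ_mem t ht)
    (fun K hK E hE => tr.ψ_trace t ht K hK E hE) (v := q') (fun E hE => hq'.memLp hd1 hΩ hT hE)
  have e11 : bdInner Ω 𝒯 (fun _ => 1)
      (fun K E x => mulVecSym (stressTrace tr t K E x) (normal K E)) (jump v v')
      = _ - _ := bdInner_sub_right hstL.mulVecSym (hv.bdL2 hd1 hΩ hT) (hv'.bdL2 hd1 hΩ hT)
  have e12 : bdInner Ω 𝒯 (fun _ => 1) (fun K E x => tr.ψ t K E x • normal K E) (jump q q')
      = _ - _ := bdInner_sub_right hψL.smul_normal (hq.bdL2 hd1 hΩ hT) (hq'.bdL2 hd1 hΩ hT)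
  rw [e9] at e11
  rw [e10] at e12
  rw [e7] at e11
  rw [e8] at e12
  simp only [innerH1, innerH2]
  linarith

end

/-! ### The energy identity for the projected errors -/

section

variable {Ω : Set (Vec d)} {κ γ : ℝ} {𝒯 : Finset (Elem d)} {m : Coefficients d} {T : ℝ}
  {F : ℝ → L2 Ω (Vec d)} {g : ℝ → L2 Ω ℝ}

open Classical in
/-- The `L²` projection on the interior faces, and `0` on the boundary faces. For functions which
vanish on `∂Ω` this is `projF`, up to null sets. It differs from `projF` because discrete test
functions have to vanish at every point of a boundary face. -/
def projF0 (Ω : Set (Vec d)) (𝒯 : Finset (Elem d)) (n : ℕ) (w : Skel d (Vec d)) : Skel d (Vec d) :=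
  fun E => if E ∈ boundaryFaces Ω 𝒯 then 0 else projF n w E

lemma isSkelPoly_projF (n : ℕ) (w : Skel d (Vec d)) : IsSkelPoly Ω 𝒯 n (projF n w) :=
  fun _ _ => isPoly_l2Proj _ _ _

lemma isSkelPoly_projF0 (n : ℕ) (w : Skel d (Vec d)) : IsSkelPoly Ω 𝒯 n (projF0 Ω 𝒯 n w) := by
  intro E _
  rw [projF0]
  split_ifs
  · exact isPoly_zero n
  · exact isPoly_l2Proj _ _ _

lemma IsSkelPoly.sub {n : ℕ} {v w : Skel d (Vec d)} (hv : IsSkelPoly Ω 𝒯 n v)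
    (hw : IsSkelPoly Ω 𝒯 n w) : IsSkelPoly Ω 𝒯 n (fun E x => v E x - w E x) :=
  fun E hE => (hv E hE).sub (hw E hE)

variable {k : ℕ} {y : ExactSolution m Ω T F g}

/-- The energy identity: the time derivative of the energy of the projected errors, plus the
dissipation and the stabilisation, equals the consistency terms. It is the difference of
`exact_tested` and of the scheme, both tested with the projected errors. Terms of the exact
solution that are tested with polynomials of matching degree may be replaced by projections. -/
theorem energy_identity (hd : 2 ≤ d) (hΩ : IsPolyhedralDomain Ω) (hT : IsMesh Ω κ γ 𝒯)
    (hT0 : 0 < T) (tr : SkeletonTraces y 𝒯)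
    (yh : DiscreteSolution m Ω 𝒯 k T F g (y.u 0) (y.p 0) (y.σE 0) (y.σV 0) (y.ψ 0))
    {t : ℝ} (ht : t ∈ Icc 0 T) {Pu Pp eu ep : Broken d (Vec d)} {eE eV : Broken d (Sym d)}
    {eψ : Broken d ℝ} {Ju Jp ju jp : BdFun d (Vec d)}
    (hPu : Pu = projT (k + 1) (y.u t)) (hPp : Pp = projT (k + 1) (y.p t))
    (heu : eu = projError (k + 1) (y.u t) (yh.u t)) (hep : ep = projError (k + 1) (y.p t) (yh.p t))
    (heE : eE = projError k (y.σE t) (yh.σE t)) (heV : eV = projError k (y.σV t) (yh.σV t))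
    (heψ : eψ = projError k (y.ψ t) (yh.ψ t))
    (hJu : Ju = jump Pu (projF0 Ω 𝒯 (k + 1) (tr.u' t)))
    (hJp : Jp = jump Pp (projF (k + 1) (tr.p' t)))
    (hju : ju = fun K E x => Ju K E x - jump (yh.u t) (yh.u' t) K E x)
    (hjp : jp = fun K E x => Jp K E x - jump (yh.p t) (yh.p' t) K E x) :
    innerH1 m 𝒯 (fun K x => dt T y.u t x - dtBroken T yh.u t K x)
        (fun K x => dt T y.p t x - dtBroken T yh.p t K x) eu ep
      + innerH2 m 𝒯 (fun K x => dt T y.σE t x - dtBroken T yh.σE t K x)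
        (fun K x => dt T y.σV t x - dtBroken T yh.σV t K x)
        (fun K x => dt T y.ψ t x - dtBroken T yh.ψ t K x) eE eV eψ
      + volInner 𝒯 (fun K x => m.𝒢 (eV K x)) (fun K x => m.ω • eV K x)
      + m.β * volInner 𝒯 ep ep
      + bdInner Ω 𝒯 (fun E => jumpWeight k E ^ 2) ju ju
      + bdInner Ω 𝒯 (fun E => jumpWeight k E ^ 2) jp jp
    = bdInner Ω 𝒯 (fun _ => 1) (fun K E x => mulVecSym
          (m.totalStress (tr.σE t K E x - projT k (y.σE t) K x)
            (tr.σV t K E x - projT k (y.σV t) K x) (tr.ψ t K E x - projT k (y.ψ t) K x))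
          (normal K E)) ju
      - bdInner Ω 𝒯 (fun _ => 1)
          (fun K E x => (tr.ψ t K E x - projT k (y.ψ t) K x) • normal K E) jp
      + volInner 𝒯 (fun K x => y.εu t x - strain (Pu K) x)
          (fun K x => m.totalStress (eE K x) (eV K x) (eψ K x))
      - volInner 𝒯 (fun K x => y.divp t x - divergence (Pp K) x) eψ
      + bdInner Ω 𝒯 (fun _ => 1)
          (fun K E x => mulVecSym (m.totalStress (eE K x) (eV K x) (eψ K x)) (normal K E)) Ju
      - bdInner Ω 𝒯 (fun _ => 1) (fun K E x => eψ K x • normal K E) Jp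
      + bdInner Ω 𝒯 (fun E => jumpWeight k E ^ 2) Ju ju
      + bdInner Ω 𝒯 (fun E => jumpWeight k E ^ 2) Jp jp := by
  have hd1 : 1 ≤ d := by omega
  have hL : ∀ {V : Type} [NormedAddCommGroup V] [InnerProductSpace ℝ V] [FiniteDimensional ℝ V]
      (w : L2 Ω V), VolL2 𝒯 (fun _ => (w : Vec d → V)) := fun w => volL2_const hΩ hT (Lp.memLp w)
  have qPu : IsBrokenPoly 𝒯 (k + 1) Pu := hPu ▸ isBrokenPoly_projT _ _
  have qPp : IsBrokenPoly 𝒯 (k + 1) Pp := hPp ▸ isBrokenPoly_projT _ _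
  have quh := yh.u_C1.1 t ht
  have qph := yh.p_C1.1 t ht
  have qEh := yh.σE_C1.1 t ht
  have qVh := yh.σV_C1.1 t ht
  have qψh := yh.ψ_C1.1 t ht
  have heu' : eu = fun K x => Pu K x - yh.u t K x := by rw [heu, hPu]; rfl
  have hep' : ep = fun K x => Pp K x - yh.p t K x := by rw [hep, hPp]; rfl
  have qeu : IsBrokenPoly 𝒯 (k + 1) eu := heu' ▸ qPu.sub quh
  have qep : IsBrokenPoly 𝒯 (k + 1) ep := hep' ▸ qPp.sub qph
  have qeE : IsBrokenPoly 𝒯 k eE := heE ▸ (isBrokenPoly_projT _ _).sub qEh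
  have qeV : IsBrokenPoly 𝒯 k eV := heV ▸ (isBrokenPoly_projT _ _).sub qVh
  have qeψ : IsBrokenPoly 𝒯 k eψ := heψ ▸ (isBrokenPoly_projT _ _).sub qψh
  have qdu := isBrokenPoly_dtBroken hT0 yh.u_C1 ht
  have qdp := isBrokenPoly_dtBroken hT0 yh.p_C1 ht
  have qdE := isBrokenPoly_dtBroken hT0 yh.σE_C1 ht
  have qdV := isBrokenPoly_dtBroken hT0 yh.σV_C1 ht
  have qdψ := isBrokenPoly_dtBroken hT0 yh.ψ_C1 ht
  set eu' : Skel d (Vec d) := fun E x => projF0 Ω 𝒯 (k + 1) (tr.u' t) E x - yh.u' t E x with heu1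
  set ep' : Skel d (Vec d) := fun E x => projF (k + 1) (tr.p' t) E x - yh.p' t E x with hep1
  have qu' : IsSkelPoly Ω 𝒯 (k + 1) (projF0 Ω 𝒯 (k + 1) (tr.u' t)) := isSkelPoly_projF0 _ _
  have qp' : IsSkelPoly Ω 𝒯 (k + 1) (projF (k + 1) (tr.p' t)) := isSkelPoly_projF _ _
  have quh' := yh.u'_C1.1 t ht
  have qph' := yh.p'_C1.1 t ht
  have qeu' : IsSkelPoly Ω 𝒯 (k + 1) eu' := qu'.sub quh'
  have qep' : IsSkelPoly Ω 𝒯 (k + 1) ep' := qp'.sub qph'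
  have hvan : VanishesOnBoundary Ω 𝒯 eu' := by
    intro E hE x hx
    simp only [heu1, projF0, if_pos hE, yh.u'_boundary t ht E hE x hx, Pi.zero_apply, sub_zero]
  have hjump_u : jump eu eu' = ju := by
    funext K E x
    simp only [jump, hju, hJu, heu', heu1]
    abel
  have hjump_p : jump ep ep' = jp := by
    funext K E x
    simp only [jump, hjp, hJp, hep', hep1]
    abel
  have H1 := exact_tested hd hΩ hT y tr ht qeu qep qeu' hvan qep' qeE.volL2 qeV.volL2 qeψ.volL2
  have H2 := yh.equation t ht eu ep eu' ep' eE eV eψ qeu qep qeu' hvan qep' qeE qeV qeψ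
  simp only [Bh, innerH1, innerH2, hjump_u, hjump_p] at H1 H2
  simp only [innerH1, innerH2]
  have a1 := volInner_sub_left (hL (dt T y.u t)) qdu.volL2 qeu.volL2
  have a2 := volInner_sub_left (hL (dt T y.p t)) qdp.volL2 qep.volL2
  have a3 := volInner_sub_left ((hL (dt T y.σE t)).clm m.𝒜) (qdE.volL2.clm m.𝒜) qeE.volL2
  have a4 := volInner_sub_left (((hL (dt T y.σV t)).const_smul m.ω).clm m.𝒢)
    ((qdV.volL2.const_smul m.ω).clm m.𝒢) (qeV.volL2.const_smul m.ω)
  simp only [← map_sub, ← smul_sub] at a3 a4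
  have a5 := volInner_sub_left (hL (dt T y.ψ t)) qdψ.volL2 qeψ.volL2
  -- The exact `σV` and `p` may be projected, as they are tested with polynomials.
  have a6 : volInner 𝒯 (fun K x => m.𝒢 (eV K x)) (fun K x => m.ω • eV K x)
      = volInner 𝒯 (fun _ x => m.𝒢 (y.σV t x)) (fun K x => m.ω • eV K x)
        - volInner 𝒯 (fun K x => m.𝒢 (yh.σV t K x)) (fun K x => m.ω • eV K x) := by
    have q1 : IsBrokenPoly 𝒯 k (fun K x => m.𝒢 (m.ω • eV K x)) := fun K hK =>
      ((qeV K hK).const_smul m.ω).clm_comp m.𝒢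
    have hs : ∀ σ τ : Sym d, inner ℝ (m.𝒢 σ) τ = inner ℝ σ (m.𝒢 τ) :=
      inverse_symm (fun σ τ => by
        rw [sub_apply, sub_apply, inner_sub_left,
          inner_sub_right, m.𝒞_symm, m.𝒟_symm]) m.𝒟_sub_𝒞_pos
    have hs' : ∀ f : Broken d (Sym d), volInner 𝒯 (fun K x => m.𝒢 (f K x)) (fun K x => m.ω • eV K x)
        = volInner 𝒯 f (fun K x => m.𝒢 (m.ω • eV K x)) := fun f => by simp only [volInner, hs]
    rw [hs', hs', hs', ← volInner_projT hΩ hT (Lp.memLp (y.σV t)) q1,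
      ← volInner_sub_left (isBrokenPoly_projT _ _).volL2 qVh.volL2 q1.volL2, heV]
    rfl
  have a7 : volInner 𝒯 ep ep = volInner 𝒯 (fun _ => y.p t) ep - volInner 𝒯 (yh.p t) ep := by
    rw [← volInner_projT hΩ hT (Lp.memLp (y.p t)) qep,
      ← volInner_sub_left (isBrokenPoly_projT _ _).volL2 qph.volL2 qep.volL2]
    conv_lhs => rw [hep]
    rw [hep]
    rfl
  -- The same holds for the total stress and `ψ`, tested with derivatives of polynomials.
  set eS : Broken d (Sym d) := fun K x => m.totalStress (eE K x) (eV K x) (eψ K x) with heS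
  set PS : Broken d (Sym d) := fun K x =>
    m.totalStress (projT k (y.σE t) K x) (projT k (y.σV t) K x) (projT k (y.ψ t) K x) with hPS
  set Sh : Broken d (Sym d) := fun K x =>
    m.totalStress (yh.σE t K x) (yh.σV t K x) (yh.ψ t K x) with hSh
  have hpolyS : ∀ {a b : Broken d (Sym d)} {c : Broken d ℝ}, IsBrokenPoly 𝒯 k a →
      IsBrokenPoly 𝒯 k b → IsBrokenPoly 𝒯 k c →
      IsBrokenPoly 𝒯 k (fun K x => m.totalStress (a K x) (b K x) (c K x)) := by
    intro a b c ha hb hc K hK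
    exact ((ha K hK).add ((hb K hK).const_smul m.ω)).sub ((hc K hK).clm_comp
      (ContinuousLinearMap.toSpanSingleton ℝ (idSym d) ∘L (m.α • ContinuousLinearMap.id ℝ ℝ)))
  have qeS : IsBrokenPoly 𝒯 k eS := hpolyS qeE qeV qeψ
  have qPS : IsBrokenPoly 𝒯 k PS :=
    hpolyS (isBrokenPoly_projT _ _) (isBrokenPoly_projT _ _) (isBrokenPoly_projT _ _)
  have qSh : IsBrokenPoly 𝒯 k Sh := hpolyS qEh qVh qψh
  have heS' : eS = fun K x => PS K x - Sh K x := by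
    funext K x
    simp only [heS, hPS, hSh, heE, heV, heψ, projError, totalStress_sub]
  have qstrain : ∀ {v : Broken d (Vec d)}, IsBrokenPoly 𝒯 (k + 1) v →
      IsBrokenPoly 𝒯 k (fun K x => strain (v K) x) := fun hv K hK => (hv K hK).strain
  have qdiv : ∀ {v : Broken d (Vec d)}, IsBrokenPoly 𝒯 (k + 1) v →
      IsBrokenPoly 𝒯 k (fun K x => divergence (v K) x) := fun hv K hK => (hv K hK).divergence
  have hPsi : eψ = fun K x => projT k (y.ψ t) K x - yh.ψ t K x := heψ
  have a8 : volInner 𝒯 eS (fun K x => strain (eu K) x)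
      = volInner 𝒯 (fun _ x => m.totalStress (y.σE t x) (y.σV t x) (y.ψ t x))
          (fun K x => strain (eu K) x) - volInner 𝒯 Sh (fun K x => strain (eu K) x) := by
    rw [heS', volInner_sub_left qPS.volL2 qSh.volL2 (qstrain qeu).volL2, hPS,
      volInner_totalStress_projT hΩ hT (Lp.memLp _) (Lp.memLp _) (Lp.memLp _) (qstrain qeu)]
  have a10 : volInner 𝒯 eψ (fun K x => divergence (ep K) x)
      = volInner 𝒯 (fun _ => y.ψ t) (fun K x => divergence (ep K) x)
        - volInner 𝒯 (yh.ψ t) (fun K x => divergence (ep K) x) := by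
    rw [hPsi, volInner_sub_left (isBrokenPoly_projT _ _).volL2 qψh.volL2 (qdiv qep).volL2,
      volInner_projT hΩ hT (Lp.memLp _) (qdiv qep)]
  have hcongr : ∀ {V : Type} [NormedAddCommGroup V] [InnerProductSpace ℝ V]
      {f a b : Broken d V}, (∀ K ∈ 𝒯, ∀ x, a K x = b K x) → volInner 𝒯 f a = volInner 𝒯 f b :=
    fun h => Finset.sum_congr rfl fun K hK =>
      integral_congr_ae (Eventually.of_forall fun x => by simp only [h K hK x])
  have a11 : volInner 𝒯 eS (fun K x => strain (eu K) x)
      = volInner 𝒯 eS (fun K x => strain (Pu K) x)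
        - volInner 𝒯 eS (fun K x => strain (yh.u t K) x) := by
    rw [← volInner_sub_right qeS.volL2 (qstrain qPu).volL2 (qstrain quh).volL2]
    refine hcongr fun K hK x => ?_
    rw [heu']
    exact strain_sub (qPu K hK).differentiable (quh K hK).differentiable x
  have a12 : volInner 𝒯 eψ (fun K x => divergence (ep K) x)
      = volInner 𝒯 eψ (fun K x => divergence (Pp K) x)
        - volInner 𝒯 eψ (fun K x => divergence (yh.p t K) x) := by
    rw [← volInner_sub_right qeψ.volL2 (qdiv qPp).volL2 (qdiv qph).volL2]
    refine hcongr fun K hK x => ?_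
    rw [hep']
    exact divergence_sub (qPp K hK).differentiable (qph K hK).differentiable x
  have a13 : volInner 𝒯 (fun K x => y.εu t x - strain (Pu K) x) eS
      = volInner 𝒯 (fun _ => y.εu t) eS - volInner 𝒯 eS (fun K x => strain (Pu K) x) := by
    rw [volInner_sub_left (hL _) (qstrain qPu).volL2 qeS.volL2,
      volInner_comm (fun K x => strain (Pu K) x)]
  have a14 : volInner 𝒯 (fun K x => y.divp t x - divergence (Pp K) x) eψ
      = volInner 𝒯 (fun _ => y.divp t) eψ - volInner 𝒯 eψ (fun K x => divergence (Pp K) x) := by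
    rw [volInner_sub_left (hL _) (qdiv qPp).volL2 qeψ.volL2,
      volInner_comm (fun K x => divergence (Pp K) x)]
  -- On the boundary nothing can be projected, and `χ = σ - Πσ` remains.
  have hst : BdL2 Ω 𝒯 (stressTrace tr t) := fun K hK E hE =>
    (isTrace_stressTrace hd hΩ hT tr ht hK hE).1
  have hψ : BdL2 Ω 𝒯 (tr.ψ t) := fun K hK E hE => (tr.ψ_trace t ht K hK E hE).1
  have bJu : BdL2 Ω 𝒯 Ju := by
    rw [hJu]
    exact (qPu.bdL2 hd1 hΩ hT).sub (qu'.bdL2 hd1 hΩ hT)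
  have bJp : BdL2 Ω 𝒯 Jp := by
    rw [hJp]
    exact (qPp.bdL2 hd1 hΩ hT).sub (qp'.bdL2 hd1 hΩ hT)
  have bju1 : BdL2 Ω 𝒯 (jump (yh.u t) (yh.u' t)) := (quh.bdL2 hd1 hΩ hT).sub (quh'.bdL2 hd1 hΩ hT)
  have bjp1 : BdL2 Ω 𝒯 (jump (yh.p t) (yh.p' t)) := (qph.bdL2 hd1 hΩ hT).sub (qph'.bdL2 hd1 hΩ hT)
  have bju : BdL2 Ω 𝒯 ju := by
    rw [hju]
    exact bJu.sub bju1
  have bjp : BdL2 Ω 𝒯 jp := by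
    rw [hjp]
    exact bJp.sub bjp1
  have bPS := (qPS.bdL2 hd1 hΩ hT).mulVecSym
  have bSh := (qSh.bdL2 hd1 hΩ hT).mulVecSym
  have beS := (qeS.bdL2 hd1 hΩ hT).mulVecSym
  have hmul : ∀ (a b : Sym d) (n : Vec d), mulVecSym (a - b) n = mulVecSym a n - mulVecSym b n :=
    fun a b n => by
      rw [← mulVecSymL_apply, map_sub]
      rfl
  have b1 : bdInner Ω 𝒯 (fun _ => 1) (fun K E x => mulVecSym
          (m.totalStress (tr.σE t K E x - projT k (y.σE t) K x)
            (tr.σV t K E x - projT k (y.σV t) K x) (tr.ψ t K E x - projT k (y.ψ t) K x))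
          (normal K E)) ju
      = bdInner Ω 𝒯 (fun _ => 1) (fun K E x => mulVecSym (stressTrace tr t K E x) (normal K E)) ju
        - bdInner Ω 𝒯 (fun _ => 1) (fun K E x => mulVecSym (PS K x) (normal K E)) ju := by
    rw [← bdInner_sub_left hst.mulVecSym bPS bju]
    simp only [totalStress_sub, hmul]
    rfl
  have b2 : bdInner Ω 𝒯 (fun _ => 1) (fun K E x => mulVecSym (eS K x) (normal K E)) ju
      = bdInner Ω 𝒯 (fun _ => 1) (fun K E x => mulVecSym (PS K x) (normal K E)) ju
        - bdInner Ω 𝒯 (fun _ => 1) (fun K E x => mulVecSym (Sh K x) (normal K E)) ju := by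
    rw [← bdInner_sub_left bPS bSh bju, heS']
    simp only [hmul]
  have b3 : bdInner Ω 𝒯 (fun _ => 1) (fun K E x => mulVecSym (eS K x) (normal K E)) ju
      = bdInner Ω 𝒯 (fun _ => 1) (fun K E x => mulVecSym (eS K x) (normal K E)) Ju
        - bdInner Ω 𝒯 (fun _ => 1) (fun K E x => mulVecSym (eS K x) (normal K E))
          (jump (yh.u t) (yh.u' t)) := by
    rw [hju]
    exact bdInner_sub_right beS bJu bju1
  have bPψ := ((isBrokenPoly_projT (𝒯 := 𝒯) k (y.ψ t : Vec d → ℝ)).bdL2 hd1 hΩ hT).smul_normal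
  have bψh := (qψh.bdL2 hd1 hΩ hT).smul_normal
  have beψ := (qeψ.bdL2 hd1 hΩ hT).smul_normal
  have b4 : bdInner Ω 𝒯 (fun _ => 1)
          (fun K E x => (tr.ψ t K E x - projT k (y.ψ t) K x) • normal K E) jp
      = bdInner Ω 𝒯 (fun _ => 1) (fun K E x => tr.ψ t K E x • normal K E) jp
        - bdInner Ω 𝒯 (fun _ => 1) (fun K E x => projT k (y.ψ t) K x • normal K E) jp := by
    rw [← bdInner_sub_left hψ.smul_normal bPψ bjp]
    simp only [sub_smul]
  have b5 : bdInner Ω 𝒯 (fun _ => 1) (fun K E x => eψ K x • normal K E) jp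
      = bdInner Ω 𝒯 (fun _ => 1) (fun K E x => projT k (y.ψ t) K x • normal K E) jp
        - bdInner Ω 𝒯 (fun _ => 1) (fun K E x => yh.ψ t K x • normal K E) jp := by
    rw [← bdInner_sub_left bPψ bψh bjp, hPsi]
    simp only [sub_smul]
  have b6 : bdInner Ω 𝒯 (fun _ => 1) (fun K E x => eψ K x • normal K E) jp
      = bdInner Ω 𝒯 (fun _ => 1) (fun K E x => eψ K x • normal K E) Jp
        - bdInner Ω 𝒯 (fun _ => 1) (fun K E x => eψ K x • normal K E)
          (jump (yh.p t) (yh.p' t)) := by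
    rw [hjp]
    exact bdInner_sub_right beψ bJp bjp1
  have b7 : bdInner Ω 𝒯 (fun E => jumpWeight k E ^ 2) ju ju
      = bdInner Ω 𝒯 (fun E => jumpWeight k E ^ 2) Ju ju
        - bdInner Ω 𝒯 (fun E => jumpWeight k E ^ 2) (jump (yh.u t) (yh.u' t)) ju := by
    rw [← bdInner_sub_left bJu bju1 bju]
    simp only [← hju]
  have b8 : bdInner Ω 𝒯 (fun E => jumpWeight k E ^ 2) jp jp
      = bdInner Ω 𝒯 (fun E => jumpWeight k E ^ 2) Jp jp
        - bdInner Ω 𝒯 (fun E => jumpWeight k E ^ 2) (jump (yh.p t) (yh.p' t)) jp := by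
    rw [← bdInner_sub_left bJp bjp1 bjp]
    simp only [← hjp]
  rw [a1, a2, a3, a4, a5]
  rw [a7]
  linarith

end

/-! ### The differential inequality for the energy of the projected errors -/

section

variable {Ω : Set (Vec d)} {κ γ : ℝ} {𝒯 : Finset (Elem d)}

lemma diam_pos_of_mem_faces (hd : 2 ≤ d) {E : Set (Vec d)} (hE : E ∈ faces Ω 𝒯) :
    0 < Metric.diam E := by
  refine lt_of_le_of_ne Metric.diam_nonneg fun h => ?_
  have hsub : E.Subsingleton := by
    intro x hx y hy
    have := Metric.dist_le_diam_of_mem (isCompact_of_mem_faces hE).isBounded hx hy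
    exact dist_le_zero.1 (h ▸ this)
  have hpos := area_pos_of_mem_faces hE
  have hd' : (0 : ℝ) < (d - 1 : ℕ) := by
    have : 0 < d - 1 := by omega
    exact_mod_cast this
  have := Measure.nullSingletonClass_hausdorff (Vec d) hd'
  have h0 : area d E = 0 := by
    rw [area, Measure.euclideanHausdorffMeasure_def, Measure.smul_apply,
      hsub.measure_zero, smul_zero]
  exact absurd h0 hpos.ne'

lemma traceWeight_mul_jumpWeight (hd : 2 ≤ d) (k : ℕ) {E : Set (Vec d)} (hE : E ∈ faces Ω 𝒯) :
    traceWeight k E * jumpWeight k E = 1 := by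
  have h1 := Real.sqrt_pos.2 (diam_pos_of_mem_faces hd hE)
  have h2 : (0 : ℝ) < k + 1 := by positivity
  rw [traceWeight, jumpWeight]
  field_simp

lemma volInner_nonneg {V : Type} [NormedAddCommGroup V] [InnerProductSpace ℝ V] {f g : Broken d V}
    (h : ∀ K x, 0 ≤ inner ℝ (f K x) (g K x)) : 0 ≤ volInner 𝒯 f g :=
  Finset.sum_nonneg fun K _ => integral_nonneg fun x => h K x

lemma volInner_mono {V W : Type} [NormedAddCommGroup V] [InnerProductSpace ℝ V]
    [NormedAddCommGroup W] [InnerProductSpace ℝ W] {f g : Broken d V} {a b : Broken d W}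
    (hf : VolL2 𝒯 f) (hg : VolL2 𝒯 g) (ha : VolL2 𝒯 a) (hb : VolL2 𝒯 b)
    (h : ∀ K x, inner ℝ (f K x) (g K x) ≤ inner ℝ (a K x) (b K x)) :
    volInner 𝒯 f g ≤ volInner 𝒯 a b :=
  Finset.sum_le_sum fun K hK => integral_mono (integrable_inner_of_memLp (hf K hK) (hg K hK))
    (integrable_inner_of_memLp (ha K hK) (hb K hK)) fun x => h K x

/-- The elastic and viscous energies control the `L²` norms. -/
lemma exists_volInner_le_innerH2 (m : Coefficients d) : ∃ C > 0, ∀ (𝒯 : Finset (Elem d))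
    (τE τV : Broken d (Sym d)) (φ : Broken d ℝ), VolL2 𝒯 τE → VolL2 𝒯 τV →
    volInner 𝒯 τE τE + volInner 𝒯 τV τV + volInner 𝒯 φ φ ≤ C * innerH2 m 𝒯 τE τV φ τE τV φ := by
  obtain ⟨a, ha, hA⟩ := inverse_coercive m.𝒞_pos
  obtain ⟨b, hb, hB⟩ := inverse_coercive m.𝒟_sub_𝒞_pos
  have hω := m.ω_pos
  have hs := m.s_pos
  refine ⟨a⁻¹ + (b * m.ω ^ 2)⁻¹ + m.s⁻¹, by positivity, fun 𝒯 τE τV φ hE hV => ?_⟩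
  have h1 : a * volInner 𝒯 τE τE ≤ volInner 𝒯 (fun K x => m.𝒜 (τE K x)) τE := by
    rw [← volInner_smul_left]
    refine volInner_mono (hE.const_smul a) hE (hE.clm m.𝒜) hE fun K x => ?_
    rw [real_inner_smul_left (τE K x) (τE K x) a, real_inner_self_eq_norm_sq (τE K x)]
    exact hA _
  have h2 : (b * m.ω ^ 2) * volInner 𝒯 τV τV
      ≤ volInner 𝒯 (fun K x => m.𝒢 (m.ω • τV K x)) (fun K x => m.ω • τV K x) := by
    rw [← volInner_smul_left]
    refine volInner_mono (hV.const_smul _) hV ((hV.const_smul m.ω).clm m.𝒢) (hV.const_smul m.ω)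
      fun K x => ?_
    rw [real_inner_smul_left (τV K x) (τV K x), real_inner_self_eq_norm_sq (τV K x)]
    refine le_trans (le_of_eq ?_) (hB _)
    rw [norm_smul, mul_pow, Real.norm_eq_abs, sq_abs]
    ring
  have h3 := volInner_self_nonneg (𝒯 := 𝒯) τE
  have h4 := volInner_self_nonneg (𝒯 := 𝒯) τV
  have h5 := volInner_self_nonneg (𝒯 := 𝒯) φ
  set X := volInner 𝒯 (fun K x => m.𝒜 (τE K x)) τE
  set Y := volInner 𝒯 (fun K x => m.𝒢 (m.ω • τV K x)) (fun K x => m.ω • τV K x)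
  set c := b * m.ω ^ 2 with hc
  have hc0 : 0 < c := by positivity
  have hX : 0 ≤ X := le_trans (by positivity) h1
  have hY : 0 ≤ Y := le_trans (by positivity) h2
  have e1 : volInner 𝒯 τE τE ≤ a⁻¹ * X := by
    rw [inv_mul_eq_div, le_div_iff₀ ha]; linarith
  have e2 : volInner 𝒯 τV τV ≤ c⁻¹ * Y := by
    rw [inv_mul_eq_div, le_div_iff₀ hc0]; linarith
  have e3 : volInner 𝒯 φ φ = m.s⁻¹ * (m.s * volInner 𝒯 φ φ) := by
    field_simp
  have hZ : 0 ≤ m.s * volInner 𝒯 φ φ := by positivity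
  have hInner : innerH2 m 𝒯 τE τV φ τE τV φ = X + Y + m.s * volInner 𝒯 φ φ := rfl
  rw [hInner]
  set Z := m.s * volInner 𝒯 φ φ
  have i1 : 0 ≤ a⁻¹ := by positivity
  have i2 : 0 ≤ c⁻¹ := by positivity
  have i3 : 0 ≤ m.s⁻¹ := by positivity
  have := mul_nonneg i1 hY
  have := mul_nonneg i1 hZ
  have := mul_nonneg i2 hX
  have := mul_nonneg i2 hZ
  have := mul_nonneg i3 hX
  have := mul_nonneg i3 hY
  linarith [add_mul (a⁻¹ + c⁻¹) m.s⁻¹ (X + Y + Z), add_mul a⁻¹ c⁻¹ (X + Y + Z),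
    mul_add a⁻¹ (X + Y) Z, mul_add a⁻¹ X Y, mul_add c⁻¹ (X + Y) Z, mul_add c⁻¹ X Y,
    mul_add m.s⁻¹ (X + Y) Z, mul_add m.s⁻¹ X Y]

lemma exists_norm_totalStress_sq_le (m : Coefficients d) : ∃ M > 0, ∀ (τE τV : Sym d) (φ : ℝ),
    ‖m.totalStress τE τV φ‖ ^ 2 ≤ M * (‖τE‖ ^ 2 + ‖τV‖ ^ 2 + ‖φ‖ ^ 2) := by
  refine ⟨3 * (1 + m.ω ^ 2 + (m.α * ‖idSym d‖) ^ 2), by positivity, fun τE τV φ => ?_⟩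
  have h1 : ‖m.totalStress τE τV φ‖ ≤ ‖τE‖ + m.ω * ‖τV‖ + (m.α * ‖idSym d‖) * ‖φ‖ := by
    rw [Coefficients.totalStress]
    refine (norm_sub_le _ _).trans ?_
    refine add_le_add ((norm_add_le _ _).trans_eq ?_) (le_of_eq ?_)
    · rw [norm_smul, Real.norm_of_nonneg m.ω_pos.le]
    · rw [norm_smul, norm_mul, Real.norm_of_nonneg m.α_pos.le]
      ring
  have h2 := pow_le_pow_left₀ (norm_nonneg _) h1 2
  set a := ‖τE‖
  set b := ‖τV‖
  set c := ‖φ‖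
  set A := m.α * ‖idSym d‖
  have h3 : (a + m.ω * b + A * c) ^ 2 ≤ 3 * (a ^ 2 + (m.ω * b) ^ 2 + (A * c) ^ 2) := by
    nlinarith [sq_nonneg (a - m.ω * b), sq_nonneg (a - A * c), sq_nonneg (m.ω * b - A * c)]
  refine h2.trans (h3.trans ?_)
  have := mul_nonneg (sq_nonneg m.ω) (sq_nonneg a)
  have := mul_nonneg (sq_nonneg m.ω) (sq_nonneg c)
  have := mul_nonneg (sq_nonneg A) (sq_nonneg a)
  have := mul_nonneg (sq_nonneg A) (sq_nonneg b)
  nlinarith [sq_nonneg a, sq_nonneg b, sq_nonneg c]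

lemma exists_norm_mulVecSym_totalStress_sq_le (m : Coefficients d) : ∃ M > 0,
    ∀ (τE τV : Sym d) (φ : ℝ) (n : Vec d), ‖n‖ = 1 →
    ‖mulVecSym (m.totalStress τE τV φ) n‖ ^ 2 ≤ M * (‖τE‖ ^ 2 + ‖τV‖ ^ 2 + ‖φ‖ ^ 2) := by
  obtain ⟨M, hM, h⟩ := exists_norm_totalStress_sq_le m
  refine ⟨(‖mulVecSymL d‖ ^ 2 + 1) * M, by positivity, fun τE τV φ n hn => ?_⟩
  have h1 := (mulVecSymL d).le_opNorm₂ (m.totalStress τE τV φ) n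
  rw [mulVecSymL_apply, hn, mul_one] at h1
  have h2 := pow_le_pow_left₀ (norm_nonneg _) h1 2
  rw [mul_pow] at h2
  have h3 := h τE τV φ
  calc _ ≤ _ := h2
    _ ≤ (‖mulVecSymL d‖ ^ 2 + 1) * ‖m.totalStress τE τV φ‖ ^ 2 := by gcongr; linarith
    _ ≤ (‖mulVecSymL d‖ ^ 2 + 1) * (M * (‖τE‖ ^ 2 + ‖τV‖ ^ 2 + ‖φ‖ ^ 2)) := by gcongr
    _ = _ := by ring

lemma bdNormSq_congr {V : Type} [NormedAddCommGroup V] [InnerProductSpace ℝ V]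
    {w : Set (Vec d) → ℝ} {a b : BdFun d V} (h : ∀ K ∈ 𝒯, ∀ E ∈ facesOf Ω 𝒯 K,
      ∀ᵐ x ∂((area d).restrict E), ‖a K E x‖ = ‖b K E x‖) :
    bdNormSq Ω 𝒯 w a = bdNormSq Ω 𝒯 w b := by
  refine Finset.sum_congr rfl fun K hK => Finset.sum_congr rfl fun E hE => ?_
  refine lintegral_congr_ae ?_
  filter_upwards [h K hK E hE] with x hx
  rw [← ofReal_norm, ← ofReal_norm, norm_smul, norm_smul, hx]

lemma bdNormSq_smul_normal (hd : 1 ≤ d) (hΩ : IsPolyhedralDomain Ω) (hT : IsMesh Ω κ γ 𝒯)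
    (w : Set (Vec d) → ℝ) (f : BdFun d ℝ) :
    bdNormSq Ω 𝒯 w (fun K E x => f K E x • normal K E) = bdNormSq Ω 𝒯 w f := by
  refine Finset.sum_congr rfl fun K hK => Finset.sum_congr rfl fun E hE => ?_
  refine lintegral_congr fun x => ?_
  rw [← ofReal_norm, ← ofReal_norm, norm_smul, norm_smul, norm_smul,
    norm_normal hd hΩ hT hK hE, mul_one]

lemma bdNormSq_le_add {V V₁ V₂ V₃ : Type} [NormedAddCommGroup V] [InnerProductSpace ℝ V]
    [NormedAddCommGroup V₁] [InnerProductSpace ℝ V₁] [NormedAddCommGroup V₂]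
    [InnerProductSpace ℝ V₂] [NormedAddCommGroup V₃] [InnerProductSpace ℝ V₃]
    {w : Set (Vec d) → ℝ} {f : BdFun d V} {f₁ : BdFun d V₁} {f₂ : BdFun d V₂} {f₃ : BdFun d V₃}
    (h₁ : BdL2 Ω 𝒯 f₁) (h₂ : BdL2 Ω 𝒯 f₂) {M : ℝ} (hM : 0 ≤ M)
    (h : ∀ K ∈ 𝒯, ∀ E ∈ facesOf Ω 𝒯 K, ∀ x,
      ‖f K E x‖ ^ 2 ≤ M * (‖f₁ K E x‖ ^ 2 + ‖f₂ K E x‖ ^ 2 + ‖f₃ K E x‖ ^ 2)) :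
    bdNormSq Ω 𝒯 w f ≤
      ENNReal.ofReal M * (bdNormSq Ω 𝒯 w f₁ + bdNormSq Ω 𝒯 w f₂ + bdNormSq Ω 𝒯 w f₃) := by
  simp only [bdNormSq]
  rw [← Finset.sum_add_distrib, ← Finset.sum_add_distrib, Finset.mul_sum]
  refine Finset.sum_le_sum fun K hK => ?_
  rw [← Finset.sum_add_distrib, ← Finset.sum_add_distrib, Finset.mul_sum]
  refine Finset.sum_le_sum fun E hE => ?_
  have m1 : AEMeasurable (fun x => ‖w E • f₁ K E x‖ₑ ^ 2) ((area d).restrict E) :=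
    ((h₁ K hK E hE).1.const_smul (w E)).enorm.pow_const 2
  have m2 : AEMeasurable (fun x => ‖w E • f₂ K E x‖ₑ ^ 2) ((area d).restrict E) :=
    ((h₂ K hK E hE).1.const_smul (w E)).enorm.pow_const 2
  have m12 : AEMeasurable (fun x => ‖w E • f₁ K E x‖ₑ ^ 2 + ‖w E • f₂ K E x‖ₑ ^ 2)
    ((area d).restrict E) := m1.add m2
  rw [← lintegral_add_left' m1, ← lintegral_add_left' m12,
    ← lintegral_const_mul' _ _ ENNReal.ofReal_ne_top]
  refine lintegral_mono fun x => ?_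
  have e : ∀ {X : Type} [NormedAddCommGroup X] (v : X), ‖v‖ₑ ^ 2 = ENNReal.ofReal (‖v‖ ^ 2) :=
    fun v => by rw [← ofReal_norm, ENNReal.ofReal_pow (norm_nonneg _)]
  simp only [e]
  rw [← ENNReal.ofReal_add (by positivity) (by positivity),
    ← ENNReal.ofReal_add (by positivity) (by positivity), ← ENNReal.ofReal_mul hM]
  refine ENNReal.ofReal_le_ofReal ?_
  simp only [norm_smul, mul_pow]
  have := mul_le_mul_of_nonneg_left (h K hK E hE x) (sq_nonneg ‖w E‖)
  linarith

lemma volInner_self_le_add {V V₁ V₂ V₃ : Type} [NormedAddCommGroup V] [InnerProductSpace ℝ V]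
    [NormedAddCommGroup V₁] [InnerProductSpace ℝ V₁] [NormedAddCommGroup V₂]
    [InnerProductSpace ℝ V₂] [NormedAddCommGroup V₃] [InnerProductSpace ℝ V₃]
    {f : Broken d V} {f₁ : Broken d V₁} {f₂ : Broken d V₂} {f₃ : Broken d V₃}
    (hf : VolL2 𝒯 f) (h₁ : VolL2 𝒯 f₁) (h₂ : VolL2 𝒯 f₂) (h₃ : VolL2 𝒯 f₃) {M : ℝ}
    (h : ∀ K x, ‖f K x‖ ^ 2 ≤ M * (‖f₁ K x‖ ^ 2 + ‖f₂ K x‖ ^ 2 + ‖f₃ K x‖ ^ 2)) :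
    volInner 𝒯 f f ≤ M * (volInner 𝒯 f₁ f₁ + volInner 𝒯 f₂ f₂ + volInner 𝒯 f₃ f₃) := by
  simp only [volInner]
  rw [← Finset.sum_add_distrib, ← Finset.sum_add_distrib, Finset.mul_sum]
  refine Finset.sum_le_sum fun K hK => ?_
  have i1 := integrable_inner_of_memLp (h₁ K hK) (h₁ K hK)
  have i2 := integrable_inner_of_memLp (h₂ K hK) (h₂ K hK)
  have i3 := integrable_inner_of_memLp (h₃ K hK) (h₃ K hK)
  have i12 : Integrable (fun x => inner ℝ (f₁ K x) (f₁ K x) + inner ℝ (f₂ K x) (f₂ K x))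
    (volume.restrict (body K)) := i1.add i2
  rw [← integral_add i1 i2, ← integral_add i12 i3, ← integral_const_mul]
  refine integral_mono (integrable_inner_of_memLp (hf K hK) (hf K hK))
    ((i12.add i3).const_mul M) fun x => ?_
  simp only [real_inner_self_eq_norm_sq]
  exact h K x

/-- The trace of `u` vanishes on `∂Ω`, so that `projF0` may be replaced by `projF`. -/
lemma norm_projErrorJump_u_ae (hd : 2 ≤ d) (hΩ : IsPolyhedralDomain Ω) (hT : IsMesh Ω κ γ 𝒯)
    (n : ℕ) {u : Vec d → Vec d} (hu : ∀ i, MemH10 Ω (fun x => u x i)) {u' : Skel d (Vec d)}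
    (htr : ∀ K ∈ 𝒯, ∀ F ∈ facesOf Ω 𝒯 K, IsTrace K F u (u' F)) {K : Elem d} {E : Set (Vec d)}
    (hE : E ∈ facesOf Ω 𝒯 K) (hK : K ∈ 𝒯) : ∀ᵐ x ∂((area d).restrict E),
      ‖jump (projT n u) (projF0 Ω 𝒯 n u') K E x‖ = ‖projErrorJump n u u' K E x‖ := by
  have hd1 : 1 ≤ d := by omega
  have hEf := (mem_facesOf.1 hE).1
  have key : ∀ᵐ x ∂((area d).restrict E), projF0 Ω 𝒯 n u' E x = projF n u' E x := by
    by_cases hb : E ∈ boundaryFaces Ω 𝒯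
    · have h0 := l2Proj_ae_eq_zero (n := n) (isCompact_of_mem_faces hEf)
        (area_lt_top_of_mem_facesOf hd1 hΩ hT hK hE) (trace_H10_boundary hd hΩ hT hu htr hb)
      filter_upwards [h0] with x hx
      simp only [projF0, if_pos hb, projF, hx]
    · exact Eventually.of_forall fun x => by simp only [projF0, if_neg hb]
  filter_upwards [key] with x hx
  rw [jump, hx, projErrorJump, ← norm_neg]
  congr 1
  abel

lemma norm_projErrorJump (n : ℕ) (w : Vec d → Vec d) (w' : Skel d (Vec d)) (K : Elem d)
    (E : Set (Vec d)) (x : Vec d) :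
    ‖jump (projT n w) (projF n w') K E x‖ = ‖projErrorJump n w w' K E x‖ := by
  rw [jump, projErrorJump, ← norm_neg]
  congr 1
  abel

set_option maxHeartbeats 400000 in
/-- The differential inequality for the energy: Young's inequality applied to the energy identity.
The jump terms are absorbed by the stabilisation, and the remaining traces of discrete functions
are estimated by the inverse inequality, whose dependence on `k` is that of `traceWeight`. -/
theorem exists_energy_estimate (hd : d = 2 ∨ d = 3) (hΩ : IsPolyhedralDomain Ω) {T : ℝ}
    (hT0 : 0 < T) (m : Coefficients d) {κ : ℝ} (hκ : 0 < κ) (γ : ℝ) :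
    ∃ C₁ > 0, ∃ C₂ > 0, ∀ {𝒯 : Finset (Elem d)}, IsMesh Ω κ γ 𝒯 → ∀ {k : ℕ}
      {F : ℝ → L2 Ω (Vec d)} {g : ℝ → L2 Ω ℝ} {y : ExactSolution m Ω T F g}
      (tr : SkeletonTraces y 𝒯)
      (yh : DiscreteSolution m Ω 𝒯 k T F g (y.u 0) (y.p 0) (y.σE 0) (y.σV 0) (y.ψ 0)),
      ∀ t ∈ Icc 0 T, ENNReal.ofReal
        (2 * (innerH1 m 𝒯 (fun K x => dt T y.u t x - dtBroken T yh.u t K x)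
            (fun K x => dt T y.p t x - dtBroken T yh.p t K x)
            (projError (k + 1) (y.u t) (yh.u t)) (projError (k + 1) (y.p t) (yh.p t))
          + innerH2 m 𝒯 (fun K x => dt T y.σE t x - dtBroken T yh.σE t K x)
            (fun K x => dt T y.σV t x - dtBroken T yh.σV t K x)
            (fun K x => dt T y.ψ t x - dtBroken T yh.ψ t K x)
            (projError k (y.σE t) (yh.σE t)) (projError k (y.σV t) (yh.σV t))
            (projError k (y.ψ t) (yh.ψ t)))
          - C₁ * (errorH1Sq y yh t + errorH2Sq y yh t))
        ≤ ENNReal.ofReal C₂ * approxErrorSq y tr k t := by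
  obtain ⟨C₀, hC₀, hcoer⟩ := exists_volInner_le_innerH2 m
  obtain ⟨M, hM, hMle⟩ := exists_norm_totalStress_sq_le m
  obtain ⟨N, hN, hNle⟩ := exists_norm_mulVecSym_totalStress_sq_le m
  -- The constant of the inverse inequality `bdNormSq_le_volNormSq`.
  set c := 4 * κ * (d + 1) with hc
  have hc0 : 0 < c := by positivity
  refine ⟨(M + 1 + N * c + c) * C₀, by positivity, N + 2, by positivity, ?_⟩
  intro 𝒯 hT k F g y tr yh t ht
  have hd2 : 2 ≤ d := by omega
  have hd1 : 1 ≤ d := by omega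
  obtain ⟨Pu, hPu⟩ : ∃ P, P = projT (k + 1) (y.u t : Vec d → Vec d) := ⟨_, rfl⟩
  obtain ⟨Pp, hPp⟩ : ∃ P, P = projT (k + 1) (y.p t : Vec d → Vec d) := ⟨_, rfl⟩
  obtain ⟨eu, heu⟩ : ∃ e, e = projError (k + 1) (y.u t) (yh.u t) := ⟨_, rfl⟩
  obtain ⟨ep, hep⟩ : ∃ e, e = projError (k + 1) (y.p t) (yh.p t) := ⟨_, rfl⟩
  obtain ⟨eE, heE⟩ : ∃ e, e = projError k (y.σE t) (yh.σE t) := ⟨_, rfl⟩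
  obtain ⟨eV, heV⟩ : ∃ e, e = projError k (y.σV t) (yh.σV t) := ⟨_, rfl⟩
  obtain ⟨eψ, heψ⟩ : ∃ e, e = projError k (y.ψ t) (yh.ψ t) := ⟨_, rfl⟩
  obtain ⟨Ju, hJu⟩ : ∃ J, J = jump Pu (projF0 Ω 𝒯 (k + 1) (tr.u' t)) := ⟨_, rfl⟩
  obtain ⟨Jp, hJp⟩ : ∃ J, J = jump Pp (projF (k + 1) (tr.p' t)) := ⟨_, rfl⟩
  obtain ⟨ju, hju⟩ : ∃ j : BdFun d (Vec d),
    j = fun K E x => Ju K E x - jump (yh.u t) (yh.u' t) K E x := ⟨_, rfl⟩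
  obtain ⟨jp, hjp⟩ : ∃ j : BdFun d (Vec d),
    j = fun K E x => Jp K E x - jump (yh.p t) (yh.p' t) K E x := ⟨_, rfl⟩
  have hid := energy_identity hd2 hΩ hT hT0 tr yh ht hPu hPp heu hep heE heV heψ hJu hJp hju hjp
  have qPu : IsBrokenPoly 𝒯 (k + 1) Pu := hPu ▸ isBrokenPoly_projT _ _
  have qPp : IsBrokenPoly 𝒯 (k + 1) Pp := hPp ▸ isBrokenPoly_projT _ _
  have qeu : IsBrokenPoly 𝒯 (k + 1) eu := heu ▸ (isBrokenPoly_projT _ _).sub (yh.u_C1.1 t ht)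
  have qep : IsBrokenPoly 𝒯 (k + 1) ep := hep ▸ (isBrokenPoly_projT _ _).sub (yh.p_C1.1 t ht)
  have qeE : IsBrokenPoly 𝒯 k eE := heE ▸ (isBrokenPoly_projT _ _).sub (yh.σE_C1.1 t ht)
  have qeV : IsBrokenPoly 𝒯 k eV := heV ▸ (isBrokenPoly_projT _ _).sub (yh.σV_C1.1 t ht)
  have qeψ : IsBrokenPoly 𝒯 k eψ := heψ ▸ (isBrokenPoly_projT _ _).sub (yh.ψ_C1.1 t ht)
  have bJu : BdL2 Ω 𝒯 Ju := by
    rw [hJu]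
    exact (qPu.bdL2 hd1 hΩ hT).sub ((isSkelPoly_projF0 _ _).bdL2 hd1 hΩ hT)
  have bJp : BdL2 Ω 𝒯 Jp := by
    rw [hJp]
    exact (qPp.bdL2 hd1 hΩ hT).sub ((isSkelPoly_projF _ _).bdL2 hd1 hΩ hT)
  have bju : BdL2 Ω 𝒯 ju := by
    rw [hju]
    exact bJu.sub (((yh.u_C1.1 t ht).bdL2 hd1 hΩ hT).sub ((yh.u'_C1.1 t ht).bdL2 hd1 hΩ hT))
  have bjp : BdL2 Ω 𝒯 jp := by
    rw [hjp]
    exact bJp.sub (((yh.p_C1.1 t ht).bdL2 hd1 hΩ hT).sub ((yh.p'_C1.1 t ht).bdL2 hd1 hΩ hT))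
  have bχE : BdL2 Ω 𝒯 (fun K E x => tr.σE t K E x - projT k (y.σE t) K x) :=
    BdL2.sub (fun K hK E hE => (tr.σE_trace t ht K hK E hE).1)
      ((isBrokenPoly_projT k _).bdL2 hd1 hΩ hT)
  have bχV : BdL2 Ω 𝒯 (fun K E x => tr.σV t K E x - projT k (y.σV t) K x) :=
    BdL2.sub (fun K hK E hE => (tr.σV_trace t ht K hK E hE).1)
      ((isBrokenPoly_projT k _).bdL2 hd1 hΩ hT)
  have bχψ : BdL2 Ω 𝒯 (fun K E x => tr.ψ t K E x - projT k (y.ψ t) K x) :=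
    BdL2.sub (fun K hK E hE => (tr.ψ_trace t ht K hK E hE).1)
      ((isBrokenPoly_projT k _).bdL2 hd1 hΩ hT)
  have hts : ∀ {μ : Measure (Vec d)} {a b : Vec d → Sym d} {r : Vec d → ℝ}, MemLp a 2 μ →
      MemLp b 2 μ → MemLp r 2 μ → MemLp (fun x => m.totalStress (a x) (b x) (r x)) 2 μ :=
    fun ha hb hr => memLp_totalStress ha hb hr
  have vS : VolL2 𝒯 (fun K x => m.totalStress (eE K x) (eV K x) (eψ K x)) := fun K hK =>
    hts (qeE.volL2 K hK) (qeV.volL2 K hK) (qeψ.volL2 K hK)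
  have bS : BdL2 Ω 𝒯 (fun K E x => mulVecSym (m.totalStress (eE K x) (eV K x) (eψ K x))
      (normal K E)) := BdL2.mulVecSym fun K hK E hE =>
    hts (qeE.bdL2 hd1 hΩ hT K hK E hE) (qeV.bdL2 hd1 hΩ hT K hK E hE)
      (qeψ.bdL2 hd1 hΩ hT K hK E hE)
  have bψn := (qeψ.bdL2 hd1 hΩ hT).smul_normal
  have bχS : BdL2 Ω 𝒯 (fun K E x => mulVecSym
      (m.totalStress (tr.σE t K E x - projT k (y.σE t) K x)
        (tr.σV t K E x - projT k (y.σV t) K x) (tr.ψ t K E x - projT k (y.ψ t) K x))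
      (normal K E)) := BdL2.mulVecSym fun K hK E hE =>
    hts (bχE K hK E hE) (bχV K hK E hE) (bχψ K hK E hE)
  have bχψn := bχψ.smul_normal
  have vε : VolL2 𝒯 (fun K x => y.εu t x - strain (Pu K) x) :=
    (volL2_const hΩ hT (Lp.memLp _)).sub
      (IsBrokenPoly.volL2 (n := k) fun K hK => (qPu K hK).strain)
  have vdiv : VolL2 𝒯 (fun K x => y.divp t x - divergence (Pp K) x) :=
    (volL2_const hΩ hT (Lp.memLp _)).sub
      (IsBrokenPoly.volL2 (n := k) fun K hK => (qPp K hK).divergence)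
  -- Each of the squares of `ju` and `jp` appears twice, with a factor `1/2`. Together they are exactly
  -- the stabilisation terms of the energy identity.
  have hw : ∀ E ∈ faces Ω 𝒯, (fun _ : Set (Vec d) => (1 : ℝ)) E = traceWeight k E * jumpWeight k E :=
    fun E hE => (traceWeight_mul_jumpWeight hd2 k hE).symm
  have y1 := two_bdInner_le bχS bju hw
  have y2 := two_bdInner_le bχψn bjp hw
  have y3 := two_volInner_le vε vS
  have y4 := two_volInner_le vdiv (qeψ.volL2.const_smul (-1))
  rw [volInner_smul_right, volInner_smul_left, volInner_smul_right] at y4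
  have y5 := two_bdInner_le bS bJu hw
  have y6 := two_bdInner_le bψn bJp hw
  have y7 := two_bdInner_le (r := fun E => jumpWeight k E ^ 2) bJu bju fun E _ => sq _
  have y8 := two_bdInner_le (r := fun E => jumpWeight k E ^ 2) bJp bjp fun E _ => sq _
  -- The squares of the projected errors of the stresses and of `ψ` are controlled by the energy.
  set S := volInner 𝒯 eE eE + volInner 𝒯 eV eV + volInner 𝒯 eψ eψ with hS
  have hSnn : 0 ≤ S := by
    have h1 := volInner_self_nonneg (𝒯 := 𝒯) eE
    have h2 := volInner_self_nonneg (𝒯 := 𝒯) eV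
    have h3 := volInner_self_nonneg (𝒯 := 𝒯) eψ
    positivity
  have hH1 : 0 ≤ errorH1Sq y yh t := by
    have h1 := volInner_self_nonneg (𝒯 := 𝒯) eu
    have h2 := volInner_self_nonneg (𝒯 := 𝒯) ep
    have h3 := m.ρ_pos
    have h4 := m.χ_pos
    rw [errorH1Sq, innerH1, ← heu, ← hep]
    positivity
  have hSE : S ≤ C₀ * (errorH1Sq y yh t + errorH2Sq y yh t) := by
    have h2 := hcoer 𝒯 eE eV eψ qeE.volL2 qeV.volL2
    have h3 : innerH2 m 𝒯 eE eV eψ eE eV eψ = errorH2Sq y yh t := by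
      rw [errorH2Sq, heE, heV, heψ]
    rw [h3] at h2
    have := mul_nonneg hC₀.le hH1
    linarith
  have z1 := volInner_self_le_add vS qeE.volL2 qeV.volL2 qeψ.volL2
    (fun K x => hMle (eE K x) (eV K x) (eψ K x))
  have z2 : volInner 𝒯 eψ eψ ≤ S := by
    have h1 := volInner_self_nonneg (𝒯 := 𝒯) eE
    have h2 := volInner_self_nonneg (𝒯 := 𝒯) eV
    linarith
  have hinv : ∀ {V : Type} [NormedAddCommGroup V] [InnerProductSpace ℝ V]
      [FiniteDimensional ℝ V] {v : Broken d V}, IsBrokenPoly 𝒯 k v →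
      bdNormSq Ω 𝒯 (traceWeight k) (fun K _ x => v K x) ≤ ENNReal.ofReal (c * volInner 𝒯 v v) :=
    fun hv => by
      rw [ENNReal.ofReal_mul hc0.le, ofReal_volInner_self hv.volL2]
      exact bdNormSq_le_volNormSq hd hΩ hT hκ hv
  have z3 : bdInner Ω 𝒯 (fun E => traceWeight k E ^ 2)
      (fun K E x => mulVecSym (m.totalStress (eE K x) (eV K x) (eψ K x)) (normal K E))
      (fun K E x => mulVecSym (m.totalStress (eE K x) (eV K x) (eψ K x)) (normal K E))
      ≤ N * (c * S) := by
    rw [← ENNReal.ofReal_le_ofReal_iff (by positivity), ofReal_bdInner_self bS]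
    refine (bdNormSq_le_add (qeE.bdL2 hd1 hΩ hT) (qeV.bdL2 hd1 hΩ hT) hN.le
      fun K hK E hE x => hNle (eE K x) (eV K x) (eψ K x) _ (norm_normal hd1 hΩ hT hK hE)).trans ?_
    have h1 := volInner_self_nonneg (𝒯 := 𝒯) eE
    have h2 := volInner_self_nonneg (𝒯 := 𝒯) eV
    have h3 := volInner_self_nonneg (𝒯 := 𝒯) eψ
    rw [ENNReal.ofReal_mul hN.le, hS, mul_add c, mul_add c, ENNReal.ofReal_add (by positivity)
      (by positivity), ENNReal.ofReal_add (by positivity) (by positivity)]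
    gcongr
    · exact hinv qeE
    · exact hinv qeV
    · exact hinv qeψ
  have hsmul : ∀ f : BdFun d ℝ, bdNormSq Ω 𝒯 (traceWeight k) (fun K E x => f K E x • normal K E)
      = bdNormSq Ω 𝒯 (traceWeight k) f := fun f => bdNormSq_smul_normal hd1 hΩ hT _ f
  have z4 : bdInner Ω 𝒯 (fun E => traceWeight k E ^ 2) (fun K E x => eψ K x • normal K E)
      (fun K E x => eψ K x • normal K E) ≤ c * S := by
    rw [← ENNReal.ofReal_le_ofReal_iff (by positivity), ofReal_bdInner_self bψn, hsmul (fun K _ x => eψ K x)]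
    exact (hinv qeψ).trans (ENNReal.ofReal_le_ofReal (by gcongr))
  -- The dissipation has a sign and can be dropped.
  have d1 : 0 ≤ volInner 𝒯 (fun K x => m.𝒢 (eV K x)) (fun K x => m.ω • eV K x) := by
    obtain ⟨b, hb, hB⟩ := inverse_coercive m.𝒟_sub_𝒞_pos
    refine volInner_nonneg fun K x => ?_
    rw [sym_inner_smul]
    exact mul_nonneg m.ω_pos.le (le_trans (by positivity) (hB (eV K x)))
  have d2 : 0 ≤ m.β * volInner 𝒯 ep ep := mul_nonneg m.β_pos.le (volInner_self_nonneg _)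
  -- The remaining squares are the terms of `approxErrorSq`.
  have w1 := ofReal_bdInner_self (c := traceWeight k) bχS
  have w2 := ofReal_bdInner_self (c := traceWeight k) bχψn
  have w3 := ofReal_bdInner_self (c := jumpWeight k) bJu
  have w4 := ofReal_bdInner_self (c := jumpWeight k) bJp
  have w5 := ofReal_volInner_self vε
  have w6 := ofReal_volInner_self vdiv
  have w1' := bdNormSq_le_add (w := traceWeight k) (f₃ := fun K E x => tr.ψ t K E x - projT k (y.ψ t) K x)
    bχE bχV hN.le fun K hK E hE x => hNle _ _ _ _ (norm_normal hd1 hΩ hT hK hE)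
  rw [hsmul (fun K E x => tr.ψ t K E x - projT k (y.ψ t) K x)] at w2
  have w3' : bdNormSq Ω 𝒯 (jumpWeight k) Ju
      = bdNormSq Ω 𝒯 (jumpWeight k) (projErrorJump (k + 1) (y.u t) (tr.u' t)) := by
    rw [hJu, hPu]
    exact bdNormSq_congr fun K hK E hE => norm_projErrorJump_u_ae hd2 hΩ hT _ (y.u_mem t ht)
      (tr.u_trace t ht) hE hK
  have w4' : bdNormSq Ω 𝒯 (jumpWeight k) Jp
      = bdNormSq Ω 𝒯 (jumpWeight k) (projErrorJump (k + 1) (y.p t) (tr.p' t)) := by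
    rw [hJp, hPp]
    exact bdNormSq_congr fun K hK E hE => Eventually.of_forall fun x => norm_projErrorJump _ _ _ _ _ _
  rw [← heu, ← hep, ← heE, ← heV, ← heψ]
  rw [w3'] at w3
  rw [w4'] at w4
  rw [← w1] at w1'
  simp only [approxErrorSq, seminormUSq, seminormQSq]
  rw [← hPu, ← hPp, ← w3, ← w4, ← w5, ← w6, ← w2]
  rw [← w2] at w1'
  set A1 := bdInner Ω 𝒯 (fun E => traceWeight k E ^ 2)
    (fun K E x => mulVecSym (m.totalStress (tr.σE t K E x - projT k (y.σE t) K x)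
      (tr.σV t K E x - projT k (y.σV t) K x) (tr.ψ t K E x - projT k (y.ψ t) K x)) (normal K E))
    (fun K E x => mulVecSym (m.totalStress (tr.σE t K E x - projT k (y.σE t) K x)
      (tr.σV t K E x - projT k (y.σV t) K x) (tr.ψ t K E x - projT k (y.ψ t) K x)) (normal K E))
  set A2 := bdInner Ω 𝒯 (fun E => traceWeight k E ^ 2)
    (fun K E x => (tr.ψ t K E x - projT k (y.ψ t) K x) • normal K E)
    (fun K E x => (tr.ψ t K E x - projT k (y.ψ t) K x) • normal K E)
  set A3 := bdInner Ω 𝒯 (fun E => jumpWeight k E ^ 2) Ju Ju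
  set A4 := bdInner Ω 𝒯 (fun E => jumpWeight k E ^ 2) Jp Jp
  set A5 := volInner 𝒯 (fun K x => y.εu t x - strain (Pu K) x)
    (fun K x => y.εu t x - strain (Pu K) x)
  set A6 := volInner 𝒯 (fun K x => y.divp t x - divergence (Pp K) x)
    (fun K x => y.divp t x - divergence (Pp K) x)
  have hle : 2 * (innerH1 m 𝒯 (fun K x => dt T y.u t x - dtBroken T yh.u t K x)
        (fun K x => dt T y.p t x - dtBroken T yh.p t K x) eu ep
      + innerH2 m 𝒯 (fun K x => dt T y.σE t x - dtBroken T yh.σE t K x)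
        (fun K x => dt T y.σV t x - dtBroken T yh.σV t K x)
        (fun K x => dt T y.ψ t x - dtBroken T yh.ψ t K x) eE eV eψ)
      - (M + 1 + N * c + c) * C₀ * (errorH1Sq y yh t + errorH2Sq y yh t)
      ≤ A1 + A2 + (2 * A3 + 2 * A4) + (A5 + A6) := by
    have hb : (M + 1 + N * c + c) * S
        ≤ (M + 1 + N * c + c) * C₀ * (errorH1Sq y yh t + errorH2Sq y yh t) := by
      rw [mul_assoc]
      gcongr
    have ha : (M + 1 + N * c + c) * S = M * S + S + N * (c * S) + c * S := by ring
    have x1 := le_abs_self (bdInner Ω 𝒯 (fun _ => 1) (fun K E x => mulVecSym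
          (m.totalStress (tr.σE t K E x - projT k (y.σE t) K x)
            (tr.σV t K E x - projT k (y.σV t) K x) (tr.ψ t K E x - projT k (y.ψ t) K x))
          (normal K E)) ju)
    have x2 := neg_abs_le (bdInner Ω 𝒯 (fun _ => 1)
      (fun K E x => (tr.ψ t K E x - projT k (y.ψ t) K x) • normal K E) jp)
    have x5 := le_abs_self (bdInner Ω 𝒯 (fun _ => 1)
          (fun K E x => mulVecSym (m.totalStress (eE K x) (eV K x) (eψ K x)) (normal K E)) Ju)
    have x6 := neg_abs_le (bdInner Ω 𝒯 (fun _ => 1) (fun K E x => eψ K x • normal K E) Jp)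
    have x7 := le_abs_self (bdInner Ω 𝒯 (fun E => jumpWeight k E ^ 2) Ju ju)
    have x8 := le_abs_self (bdInner Ω 𝒯 (fun E => jumpWeight k E ^ 2) Jp jp)
    linarith
  refine (ENNReal.ofReal_le_ofReal hle).trans ?_
  have n2 : 0 ≤ A2 := bdInner_self_nonneg (fun E => sq_nonneg _) _
  have n3 : 0 ≤ A3 := bdInner_self_nonneg (fun E => sq_nonneg _) _
  have n4 : 0 ≤ A4 := bdInner_self_nonneg (fun E => sq_nonneg _) _
  have n5 : 0 ≤ A5 := volInner_self_nonneg _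
  have n6 : 0 ≤ A6 := volInner_self_nonneg _
  generalize bdNormSq Ω 𝒯 (traceWeight k) (fun K E x => tr.σE t K E x - projT k (y.σE t) K x)
    = X at w1' ⊢
  generalize bdNormSq Ω 𝒯 (traceWeight k) (fun K E x => tr.σV t K E x - projT k (y.σV t) K x)
    = Y at w1' ⊢
  calc ENNReal.ofReal (A1 + A2 + (2 * A3 + 2 * A4) + (A5 + A6))
      ≤ ENNReal.ofReal A1 + ENNReal.ofReal (A2 + (2 * A3 + 2 * A4) + (A5 + A6)) := by
        rw [add_assoc A1, add_assoc A1]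
        exact ENNReal.ofReal_add_le
    _ ≤ ENNReal.ofReal N * (X + Y + ENNReal.ofReal A2)
        + ENNReal.ofReal 2 * (X + Y + ENNReal.ofReal A2 +
          (ENNReal.ofReal A5 + ENNReal.ofReal A3 + (ENNReal.ofReal A6 + ENNReal.ofReal A4))) := by
        refine add_le_add w1' ?_
        rw [← ENNReal.ofReal_add n5 n3, ← ENNReal.ofReal_add n6 n4,
          ← ENNReal.ofReal_add (by positivity) (by positivity), add_assoc (X + Y),
          ← ENNReal.ofReal_add n2 (by positivity)]
        refine le_trans ?_ (mul_le_mul_right le_add_self _)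
        rw [← ENNReal.ofReal_mul (by norm_num)]
        exact ENNReal.ofReal_le_ofReal (by linarith)
    _ ≤ _ := by
        rw [ENNReal.ofReal_add hN.le (by norm_num), add_mul]
        exact add_le_add_left (mul_le_mul_right le_self_add _) _

end

/-! ### The energy as a function of time -/

section

variable {V : Type} [NormedAddCommGroup V] [InnerProductSpace ℝ V]

/-- The restriction `L²(ν) → L²(μ)`, for `μ ≤ ν`. -/
def restrictL2 {μ ν : Measure (Vec d)} (h : μ ≤ ν) : Lp V 2 ν →L[ℝ] Lp V 2 μ :=
  LinearMap.mkContinuous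
    { toFun := fun w => ((Lp.memLp w).mono_measure h).toLp w
      map_add' := fun v w => by
        refine Lp.ext ?_
        filter_upwards [((Lp.memLp (v + w)).mono_measure h).coeFn_toLp,
          ((Lp.memLp v).mono_measure h).coeFn_toLp, ((Lp.memLp w).mono_measure h).coeFn_toLp,
          Lp.coeFn_add (((Lp.memLp v).mono_measure h).toLp v)
            (((Lp.memLp w).mono_measure h).toLp w),
          h.absolutelyContinuous.ae_le (Lp.coeFn_add v w)] with x h1 h2 h3 h4 h5
        rw [h1, h4, h5, Pi.add_apply, Pi.add_apply, h2, h3]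
      map_smul' := fun c v => by
        refine Lp.ext ?_
        filter_upwards [((Lp.memLp (c • v)).mono_measure h).coeFn_toLp,
          ((Lp.memLp v).mono_measure h).coeFn_toLp,
          Lp.coeFn_smul c (((Lp.memLp v).mono_measure h).toLp v),
          h.absolutelyContinuous.ae_le (Lp.coeFn_smul c v)] with x h1 h2 h3 h4
        rw [h1, h4, Pi.smul_apply, RingHom.id_apply, h3, Pi.smul_apply, h2] }
    1 fun w => by
      change ‖((Lp.memLp w).mono_measure h).toLp w‖ ≤ 1 * ‖w‖
      rw [one_mul, Lp.norm_toLp, Lp.norm_def]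
      exact ENNReal.toReal_mono (Lp.eLpNorm_ne_top w) (eLpNorm_mono_measure _ h)

lemma restrictL2_apply {μ ν : Measure (Vec d)} (h : μ ≤ ν) (w : Lp V 2 ν) :
    restrictL2 h w = ((Lp.memLp w).mono_measure h).toLp w := rfl

variable [FiniteDimensional ℝ V]

lemma IsPoly.memLp_body {n : ℕ} {f : Vec d → V} (hf : IsPoly n f) (K : Elem d) :
    MemLp f 2 (volume.restrict (body K)) :=
  memLp_of_continuous (isCompact_body K) (isCompact_body K).measure_lt_top hf.continuous

/-- The map `𝒫_n(K, V) → L²(K, V)`. -/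
def polyToL2 (V : Type) [NormedAddCommGroup V] [InnerProductSpace ℝ V] [FiniteDimensional ℝ V]
    (n : ℕ) (K : Elem d) : polySpace d V n →ₗ[ℝ] Lp V 2 (volume.restrict (body K)) where
  toFun q := (q.2.memLp_body K).toLp q.1
  map_add' _ _ := rfl
  map_smul' _ _ := rfl

/-- The polynomial functions of degree at most `n`, as a subspace of `L²(K, V)`. -/
def polyL2 (V : Type) [NormedAddCommGroup V] [InnerProductSpace ℝ V] [FiniteDimensional ℝ V]
    (n : ℕ) (K : Elem d) : Submodule ℝ (Lp V 2 (volume.restrict (body K))) :=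
  LinearMap.range (polyToL2 V n K)

instance (n : ℕ) (K : Elem d) : FiniteDimensional ℝ (polyL2 V n K) := by
  rw [polyL2]
  infer_instance

lemma IsPoly.toLp_mem_polyL2 {n : ℕ} {K : Elem d} {f : Vec d → V} (hf : IsPoly n f) :
    (hf.memLp_body K).toLp f ∈ polyL2 V n K := ⟨⟨f, hf⟩, rfl⟩

lemma toLp_l2Proj {n : ℕ} {K : Elem d} {f : Vec d → V} (hf : MemLp f 2 (volume.restrict (body K))) :
    ((isPoly_l2Proj (volume.restrict (body K)) n f).memLp_body K).toLp _
      = (polyL2 V n K).starProjection hf.toLp := by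
  refine (Submodule.eq_starProjection_of_mem_of_inner_eq_zero
    (isPoly_l2Proj _ n f).toLp_mem_polyL2 ?_).symm
  rintro _ ⟨Q, rfl⟩
  change inner ℝ _ ((Q.2.memLp_body K).toLp Q.1) = 0
  rw [L2.inner_def, ← l2Proj_orthogonal (isCompact_body K) (isCompact_body K).measure_lt_top hf Q.2]
  refine integral_congr_ae ?_
  filter_upwards [Lp.coeFn_sub hf.toLp
    (((isPoly_l2Proj (volume.restrict (body K)) n f).memLp_body K).toLp _), hf.coeFn_toLp,
    ((isPoly_l2Proj (volume.restrict (body K)) n f).memLp_body K).coeFn_toLp,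
    (Q.2.memLp_body K).coeFn_toLp] with x h1 h2 h3 h4
  rw [h1, Pi.sub_apply, h2, h3, h4]

omit [FiniteDimensional ℝ V] in
lemma inner_toLp {μ : Measure (Vec d)} {f g : Vec d → V} (hf : MemLp f 2 μ) (hg : MemLp g 2 μ) :
    inner ℝ hf.toLp hg.toLp = ∫ x, inner ℝ (f x) (g x) ∂μ := by
  rw [L2.inner_def]
  refine integral_congr_ae ?_
  filter_upwards [hf.coeFn_toLp, hg.coeFn_toLp] with x h1 h2
  rw [h1, h2]

omit [FiniteDimensional ℝ V] in
lemma toLp_clm {μ : Measure (Vec d)} (A : V →L[ℝ] V) {f : Vec d → V} (hf : MemLp f 2 μ) :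
    A.compLpL 2 μ hf.toLp = (A.comp_memLp' hf).toLp _ := by
  refine Lp.ext ?_
  filter_upwards [A.coeFn_compLpL hf.toLp, hf.coeFn_toLp, (A.comp_memLp' hf).coeFn_toLp]
    with x h1 h2 h3
  rw [h1, h2, h3]
  rfl

variable {Ω : Set (Vec d)} {κ γ T : ℝ} {𝒯 : Finset (Elem d)}

/-- On one element, the energy of a projected error is `C¹` in time. In the derivative, the
projection may be dropped because the error is a polynomial. -/
lemma energy_element (hΩ : IsPolyhedralDomain Ω) (hT : IsMesh Ω κ γ 𝒯) (hT0 : 0 < T) {n : ℕ}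
    (A : V →L[ℝ] V) (hA : ∀ σ τ, inner ℝ (A σ) τ = inner ℝ σ (A τ)) {w : ℝ → L2 Ω V}
    (hw : ContDiffOn ℝ 1 w (Icc 0 T)) {v : ℝ → Broken d V} (hv : IsC1Broken 𝒯 n T v)
    {K : Elem d} (hK : K ∈ 𝒯) :
    ContDiffOn ℝ 1 (fun t => ∫ x in body K, inner ℝ (A (projError n (w t) (v t) K x))
        (projError n (w t) (v t) K x)) (Icc 0 T) ∧
      ∀ t ∈ Icc 0 T, HasDerivWithinAt
        (fun t => ∫ x in body K, inner ℝ (A (projError n (w t) (v t) K x))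
          (projError n (w t) (v t) K x))
        (2 * ∫ x in body K, inner ℝ (A (dt T w t x - dtBroken T v t K x))
          (projError n (w t) (v t) K x)) (Icc 0 T) t := by
  set μ := volume.restrict (body K) with hμ
  have hle : μ ≤ volume.restrict Ω := volume_restrict_body_le hΩ hT hK
  obtain ⟨N, b, c, hb, hc, hvc⟩ :=
    exists_C1_coefficients (fun t ht => hv.1 t ht K hK) (hv.2 K hK)
  set Q := (polyL2 V n K).starProjection with hQ
  -- The error as a curve in `L²(K, V)`: the first summand is a bounded linear image of `w`, and the
  -- second has finitely many coefficients of class `C¹`.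
  set z : ℝ → Lp V 2 μ := fun t =>
    Q (restrictL2 hle (w t)) - ∑ j, c j t • ((hb j).memLp_body K).toLp (b j) with hz
  have hz1 : ContDiffOn ℝ 1 z (Icc 0 T) := by
    refine ContDiffOn.sub ?_ (ContDiffOn.sum fun j _ => (hc j).smul contDiffOn_const)
    exact (Q ∘L restrictL2 hle).contDiff.comp_contDiffOn hw
  set z' : ℝ → Lp V 2 μ := fun t => Q (restrictL2 hle (dt T w t))
    - ∑ j, derivWithin (c j) (Icc 0 T) t • ((hb j).memLp_body K).toLp (b j) with hz'
  have hdz : ∀ t ∈ Icc 0 T, HasDerivWithinAt z (z' t) (Icc 0 T) t := fun t ht => by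
    refine HasDerivWithinAt.sub ?_ (HasDerivWithinAt.fun_sum fun j _ =>
      (((hc j).differentiableOn (by simp) t ht).hasDerivWithinAt).smul_const _)
    exact (Q ∘L restrictL2 hle).hasFDerivAt.comp_hasDerivWithinAt t
      ((hw.differentiableOn (by simp) t ht).hasDerivWithinAt)
  have hsumLp : ∀ a : Fin N → ℝ, ∀ q : Vec d → V, ∀ hq : IsPoly n q, (∀ x, q x = ∑ j, a j • b j x) →
      ∑ j, a j • ((hb j).memLp_body K).toLp (b j) = (hq.memLp_body K).toLp q := by
    intro a q hq h
    change ∑ j, a j • polyToL2 V n K ⟨b j, hb j⟩ = polyToL2 V n K ⟨q, hq⟩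
    simp only [← map_smul, ← map_sum]
    congr 1
    have hval : ((∑ j, a j • (⟨b j, hb j⟩ : polySpace d V n) : polySpace d V n) : Vec d → V)
        = ∑ j, a j • b j := by
      rw [Submodule.coe_sum]
      rfl
    refine Subtype.ext (hval.trans (funext fun x => ?_))
    rw [Finset.sum_apply]
    exact (h x).symm
  have herr : ∀ t ∈ Icc 0 T, IsPoly n (projError n (w t) (v t) K) := fun t ht =>
    (isPoly_l2Proj _ _ _).sub (hv.1 t ht K hK)
  have hzt : ∀ t (ht : t ∈ Icc 0 T), z t = ((herr t ht).memLp_body K).toLp _ := by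
    intro t ht
    rw [hz]
    simp only
    rw [hsumLp (fun j => c j t) (v t K) (hv.1 t ht K hK) (hvc t ht), restrictL2_apply, hQ,
      ← toLp_l2Proj]
    rfl
  have hEq : ∀ t ∈ Icc 0 T, ∫ x in body K, inner ℝ (A (projError n (w t) (v t) K x))
      (projError n (w t) (v t) K x) = inner ℝ (A.compLpL 2 μ (z t)) (z t) := by
    intro t ht
    rw [hzt t ht, toLp_clm, inner_toLp]
    rfl
  have hsymm : ∀ f g : Lp V 2 μ, inner ℝ (A.compLpL 2 μ f) g = inner ℝ f (A.compLpL 2 μ g) := by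
    intro f g
    rw [L2.inner_def, L2.inner_def]
    refine integral_congr_ae ?_
    filter_upwards [A.coeFn_compLpL f, A.coeFn_compLpL g] with x h1 h2
    rw [h1, h2, hA]
  refine ⟨(((A.compLpL 2 μ).contDiff.comp_contDiffOn hz1).inner ℝ hz1).congr hEq, fun t ht => ?_⟩
  have hder := (((A.compLpL 2 μ).hasFDerivAt.comp_hasDerivWithinAt t (hdz t ht)).inner ℝ
    (hdz t ht)).congr hEq (hEq t ht)
  refine hder.congr_deriv ?_
  have hdt : IsPoly n (dtBroken T v t K) := isBrokenPoly_dtBroken hT0 hv ht K hK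
  have hdt' : ∀ x, dtBroken T v t K x = ∑ j, derivWithin (c j) (Icc 0 T) t • b j x := fun x => by
    have h2 : HasDerivWithinAt (fun s => ∑ j, c j s • b j x)
        (∑ j, derivWithin (c j) (Icc 0 T) t • b j x) (Icc 0 T) t :=
      HasDerivWithinAt.fun_sum fun j _ =>
        (((hc j).differentiableOn (by simp) t ht).hasDerivWithinAt).smul_const (b j x)
    exact (h2.congr (fun s hs => hvc s hs x) (hvc t ht x)).derivWithin (uniqueDiffOn_Icc hT0 t ht)
  have hAe : IsPoly n (fun x => A (projError n (w t) (v t) K x)) := (herr t ht).clm_comp A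
  have hAz : A.compLpL 2 μ (z t) = (hAe.memLp_body K).toLp _ := by
    rw [hzt t ht, toLp_clm]
    rfl
  have hwd : MemLp (⇑(dt T w t : L2 Ω V)) 2 μ := (Lp.memLp (dt T w t)).mono_measure hle
  have hmain : inner ℝ (z' t) (A.compLpL 2 μ (z t))
      = ∫ x in body K, inner ℝ (A (dt T w t x - dtBroken T v t K x))
          (projError n (w t) (v t) K x) := by
    rw [hz']
    simp only
    rw [hsumLp (fun j => derivWithin (c j) (Icc 0 T) t) _ hdt hdt', hAz, inner_sub_left, hQ,
      Submodule.inner_starProjection_left_eq_right,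
      Submodule.starProjection_eq_self_iff.2 hAe.toLp_mem_polyL2, ← inner_sub_left,
      restrictL2_apply, ← MemLp.toLp_sub, inner_toLp]
    exact integral_congr_ae (Eventually.of_forall fun x => (hA _ _).symm)
  -- By symmetry of `A`, the two terms of the product rule agree.
  rw [← hmain, Function.comp_apply, real_inner_comm (z' t), hsymm (z' t)]
  ring

lemma energy_mesh (hΩ : IsPolyhedralDomain Ω) (hT : IsMesh Ω κ γ 𝒯) (hT0 : 0 < T) {n : ℕ}
    (A : V →L[ℝ] V) (hA : ∀ σ τ, inner ℝ (A σ) τ = inner ℝ σ (A τ)) {w : ℝ → L2 Ω V}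
    (hw : ContDiffOn ℝ 1 w (Icc 0 T)) {v : ℝ → Broken d V} (hv : IsC1Broken 𝒯 n T v) :
    ContDiffOn ℝ 1 (fun t => volInner 𝒯 (fun K x => A (projError n (w t) (v t) K x))
        (projError n (w t) (v t))) (Icc 0 T) ∧
      ∀ t ∈ Icc 0 T, HasDerivWithinAt
        (fun t => volInner 𝒯 (fun K x => A (projError n (w t) (v t) K x))
          (projError n (w t) (v t)))
        (2 * volInner 𝒯 (fun K x => A (dt T w t x - dtBroken T v t K x))
          (projError n (w t) (v t))) (Icc 0 T) t := by
  simp only [volInner, Finset.mul_sum]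
  exact ⟨ContDiffOn.sum fun K hK => (energy_element hΩ hT hT0 A hA hw hv hK).1,
    fun t ht => HasDerivWithinAt.fun_sum fun K hK =>
      (energy_element hΩ hT hT0 A hA hw hv hK).2 t ht⟩

variable {m : Coefficients d} {F : ℝ → L2 Ω (Vec d)} {g : ℝ → L2 Ω ℝ} {k : ℕ}
  {y : ExactSolution m Ω T F g}

lemma energy_contDiffOn (hΩ : IsPolyhedralDomain Ω) (hT : IsMesh Ω κ γ 𝒯) (hT0 : 0 < T)
    (yh : DiscreteSolution m Ω 𝒯 k T F g (y.u 0) (y.p 0) (y.σE 0) (y.σV 0) (y.ψ 0)) :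
    ContDiffOn ℝ 1 (fun t => errorH1Sq y yh t + errorH2Sq y yh t) (Icc 0 T) ∧
      ∀ t ∈ Icc 0 T, HasDerivWithinAt (fun t => errorH1Sq y yh t + errorH2Sq y yh t)
        (2 * (innerH1 m 𝒯 (fun K x => dt T y.u t x - dtBroken T yh.u t K x)
            (fun K x => dt T y.p t x - dtBroken T yh.p t K x)
            (projError (k + 1) (y.u t) (yh.u t)) (projError (k + 1) (y.p t) (yh.p t))
          + innerH2 m 𝒯 (fun K x => dt T y.σE t x - dtBroken T yh.σE t K x)
            (fun K x => dt T y.σV t x - dtBroken T yh.σV t K x)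
            (fun K x => dt T y.ψ t x - dtBroken T yh.ψ t K x)
            (projError k (y.σE t) (yh.σE t)) (projError k (y.σV t) (yh.σV t))
            (projError k (y.ψ t) (yh.ψ t)))) (Icc 0 T) t := by
  have hG : ∀ σ τ : Sym d, inner ℝ (m.𝒢 σ) τ = inner ℝ σ (m.𝒢 τ) :=
    inverse_symm (fun σ τ => by
      rw [sub_apply, sub_apply, inner_sub_left, inner_sub_right, m.𝒞_symm, m.𝒟_symm])
      m.𝒟_sub_𝒞_pos
  have hω : ∀ a b : Broken d (Sym d),
      volInner 𝒯 (fun K x => m.𝒢 (m.ω • a K x)) (fun K x => m.ω • b K x)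
        = volInner 𝒯 (fun K x => (m.ω ^ 2 • m.𝒢) (a K x)) b := fun a b => by
    refine Finset.sum_congr rfl fun K _ => integral_congr_ae (Eventually.of_forall fun x => ?_)
    change inner ℝ (m.𝒢 (m.ω • a K x)) (m.ω • b K x) = inner ℝ (m.ω ^ 2 • m.𝒢 (a K x)) (b K x)
    rw [map_smul, sym_inner_smul, real_inner_smul_left (m.𝒢 (a K x)) (b K x) m.ω,
      real_inner_smul_left (m.𝒢 (a K x)) (b K x) (m.ω ^ 2)]
    ring
  obtain ⟨u1, u2⟩ := energy_mesh hΩ hT hT0 (ContinuousLinearMap.id ℝ (Vec d))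
    (fun _ _ => rfl) y.u_C1 yh.u_C1
  obtain ⟨p1, p2⟩ := energy_mesh hΩ hT hT0 (ContinuousLinearMap.id ℝ (Vec d))
    (fun _ _ => rfl) y.p_C1 yh.p_C1
  obtain ⟨E1, E2⟩ := energy_mesh hΩ hT hT0 m.𝒜 (inverse_symm m.𝒞_symm m.𝒞_pos) y.σE_C1 yh.σE_C1
  obtain ⟨V1, V2⟩ := energy_mesh hΩ hT hT0 (m.ω ^ 2 • m.𝒢) (fun σ τ => by
    change inner ℝ (m.ω ^ 2 • m.𝒢 σ) τ = inner ℝ σ (m.ω ^ 2 • m.𝒢 τ)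
    rw [sym_inner_smul, real_inner_smul_left (m.𝒢 σ) τ, hG]) y.σV_C1 yh.σV_C1
  obtain ⟨ψ1, ψ2⟩ := energy_mesh hΩ hT hT0 (ContinuousLinearMap.id ℝ ℝ)
    (fun _ _ => rfl) y.ψ_C1 yh.ψ_C1
  simp only [errorH1Sq, errorH2Sq, innerH1, innerH2, hω]
  refine ⟨((u1.const_smul m.ρ).add (p1.const_smul m.χ)).add ((E1.add V1).add (ψ1.const_smul m.s)),
    fun t ht => ?_⟩
  refine ((((u2 t ht).const_mul m.ρ).add ((p2 t ht).const_mul m.χ)).add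
    (((E2 t ht).add (V2 t ht)).add ((ψ2 t ht).const_mul m.s))).congr_deriv ?_
  simp only [ContinuousLinearMap.id_apply]
  ring

/-- The discrete initial values are the projections of the exact ones, so the projected errors vanish
at time `0`. -/
lemma energy_zero
    (yh : DiscreteSolution m Ω 𝒯 k T F g (y.u 0) (y.p 0) (y.σE 0) (y.σV 0) (y.ψ 0)) :
    errorH1Sq y yh 0 + errorH2Sq y yh 0 = 0 := by
  have h : ∀ {W : Type} [NormedAddCommGroup W] [InnerProductSpace ℝ W] {f e : Broken d W},
      (∀ K ∈ 𝒯, ∀ x, e K x = 0) → volInner 𝒯 f e = 0 := fun he =>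
    Finset.sum_eq_zero fun K hK => by simp only [he K hK, inner_zero_right, integral_zero]
  have hu := h (f := projError (k + 1) (y.u 0) (yh.u 0)) (e := projError (k + 1) (y.u 0) (yh.u 0))
    fun K hK x => by rw [projError, yh.u_init K hK x, sub_self]
  have hp := h (f := projError (k + 1) (y.p 0) (yh.p 0)) (e := projError (k + 1) (y.p 0) (yh.p 0))
    fun K hK x => by rw [projError, yh.p_init K hK x, sub_self]
  have hE := h (f := fun K x => m.𝒜 (projError k (y.σE 0) (yh.σE 0) K x))
    (e := projError k (y.σE 0) (yh.σE 0))
    fun K hK x => by rw [projError, yh.σE_init K hK x, sub_self]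
  have hV := h (f := fun K x => m.𝒢 (m.ω • projError k (y.σV 0) (yh.σV 0) K x))
    (e := fun K x => m.ω • projError k (y.σV 0) (yh.σV 0) K x)
    fun K hK x => by rw [projError, yh.σV_init K hK x, sub_self, smul_zero]
  have hψ := h (f := projError k (y.ψ 0) (yh.ψ 0)) (e := projError k (y.ψ 0) (yh.ψ 0))
    fun K hK x => by rw [projError, yh.ψ_init K hK x, sub_self]
  rw [errorH1Sq, errorH2Sq, innerH1, innerH2, hu, hp, hE, hV, hψ]
  ring

lemma errorH1Sq_nonneg
    (yh : DiscreteSolution m Ω 𝒯 k T F g (y.u 0) (y.p 0) (y.σE 0) (y.σV 0) (y.ψ 0)) (t : ℝ) :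
    0 ≤ errorH1Sq y yh t :=
  add_nonneg (mul_nonneg m.ρ_pos.le (volInner_self_nonneg _))
    (mul_nonneg m.χ_pos.le (volInner_self_nonneg _))

lemma errorH2Sq_nonneg
    (yh : DiscreteSolution m Ω 𝒯 k T F g (y.u 0) (y.p 0) (y.σE 0) (y.σV 0) (y.ψ 0)) (t : ℝ) :
    0 ≤ errorH2Sq y yh t := by
  obtain ⟨a, ha, hA⟩ := inverse_coercive m.𝒞_pos
  obtain ⟨b, hb, hB⟩ := inverse_coercive m.𝒟_sub_𝒞_pos
  exact add_nonneg (add_nonneg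
    (volInner_nonneg fun K x => le_trans (by positivity) (hA (projError k (y.σE t) (yh.σE t) K x)))
    (volInner_nonneg fun K x =>
      le_trans (by positivity) (hB (m.ω • projError k (y.σV t) (yh.σV t) K x))))
    (mul_nonneg m.s_pos.le (volInner_self_nonneg _))

lemma ofReal_integral_le {X : Type*} [MeasurableSpace X] {μ : Measure X} {f : X → ℝ}
    (hf : Integrable f μ) : ENNReal.ofReal (∫ x, f x ∂μ) ≤ ∫⁻ x, ENNReal.ofReal (f x) ∂μ := by
  rw [integral_eq_lintegral_pos_part_sub_lintegral_neg_part hf]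
  exact (ENNReal.ofReal_le_ofReal (sub_le_self _ ENNReal.toReal_nonneg)).trans
    ENNReal.ofReal_toReal_le

/-- Gronwall's inequality for a `C¹` function which vanishes at `0`. The upper bound `a` of
`E' - c E` need not be measurable: only the continuous function `exp (-c t) E` is differentiated
and integrated. -/
theorem gronwall_lintegral (hT0 : 0 < T) {E D : ℝ → ℝ} (hE : ContDiffOn ℝ 1 E (Icc 0 T))
    (hD : ∀ t ∈ Icc 0 T, HasDerivWithinAt E (D t) (Icc 0 T) t) (h0 : E 0 = 0) {c : ℝ} (hc : 0 ≤ c)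
    {a : ℝ → ℝ≥0∞} (hle : ∀ t ∈ Icc 0 T, ENNReal.ofReal (D t - c * E t) ≤ a t) {t : ℝ}
    (ht : t ∈ Icc 0 T) :
    ENNReal.ofReal (E t) ≤ ENNReal.ofReal (Real.exp (c * T)) * ∫⁻ s in Icc 0 T, a s := by
  have hsub : Icc 0 t ⊆ Icc 0 T := Icc_subset_Icc le_rfl ht.2
  set f' : ℝ → ℝ := fun s => Real.exp (-(c * s)) * (D s - c * E s) with hf'
  have hDc : ContinuousOn D (Icc 0 T) :=
    (hE.continuousOn_derivWithin (uniqueDiffOn_Icc hT0) le_rfl).congr fun s hs =>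
      ((hD s hs).derivWithin (uniqueDiffOn_Icc hT0 s hs)).symm
  have hexp : ∀ s, HasDerivAt (fun s => Real.exp (-(c * s))) (Real.exp (-(c * s)) * (-c)) s :=
    fun s => by
      have h1 : HasDerivAt (fun s : ℝ => -(c * s)) (-c) s := by
        simpa only [neg_mul, mul_one] using (hasDerivAt_id' s).const_mul (-c)
      exact h1.exp
  have hf : ∀ s ∈ Icc 0 T, HasDerivWithinAt (fun s => Real.exp (-(c * s)) * E s) (f' s)
      (Icc 0 T) s := fun s hs =>
    ((hexp s).hasDerivWithinAt.mul (hD s hs)).congr_deriv (by rw [hf']; ring)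
  have hf'c : ContinuousOn f' (Icc 0 T) := by
    refine ContinuousOn.mul (by fun_prop) (hDc.sub (hE.continuousOn.const_smul c))
  have hint : IntervalIntegrable f' volume 0 t :=
    (hf'c.mono hsub).intervalIntegrable_of_Icc ht.1
  have hftc : ∫ s in (0 : ℝ)..t, f' s = Real.exp (-(c * t)) * E t := by
    rw [intervalIntegral.integral_eq_sub_of_hasDerivAt_of_le ht.1
      (fun s hs => ((hf s (hsub hs)).continuousWithinAt).mono hsub)
      (fun s hs => (hf s (hsub (Ioo_subset_Icc_self hs))).hasDerivAt
        (Icc_mem_nhds hs.1 (hs.2.trans_le ht.2))) hint, h0]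
    ring
  have hEt : E t = Real.exp (c * t) * ∫ s in (0 : ℝ)..t, f' s := by
    rw [hftc, ← mul_assoc, ← Real.exp_add]
    simp
  have hle' : ENNReal.ofReal (∫ s in (0 : ℝ)..t, f' s) ≤ ∫⁻ s in Icc 0 T, a s := by
    rw [intervalIntegral.integral_of_le ht.1]
    refine (ofReal_integral_le hint.1).trans ?_
    refine (setLIntegral_mono' measurableSet_Ioc fun s hs => ?_).trans
      (lintegral_mono_set (Ioc_subset_Icc_self.trans hsub))
    refine le_trans ?_ (hle s (hsub (Ioc_subset_Icc_self hs)))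
    have h1 : Real.exp (-(c * s)) ≤ 1 :=
      Real.exp_le_one_iff.2 (neg_nonpos.2 (mul_nonneg hc hs.1.le))
    rw [hf', ENNReal.ofReal_mul (Real.exp_pos _).le]
    exact mul_le_of_le_one_left zero_le (ENNReal.ofReal_le_one.2 h1)
  rw [hEt, ENNReal.ofReal_mul (Real.exp_pos _).le]
  gcongr
  exact ht.2

end

end HDG

end

theorem lemma2 (d : ℕ) (hd : d = 2 ∨ d = 3) (Ω : Set (Vec d)) (hΩ : IsPolyhedralDomain Ω)
    (T : ℝ) (hT : 0 < T) (m : Coefficients d) (κ γ : ℝ) (hκ : 0 < κ) (hγ : 0 < γ) :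
    ∃ C : ℝ, 0 < C ∧
      ∀ (𝒯 : Finset (Elem d)), IsMesh Ω κ γ 𝒯 → ∀ (k : ℕ)
        (F : ℝ → L2 Ω (Vec d)) (g : ℝ → L2 Ω ℝ) (y : ExactSolution m Ω T F g)
        (s : ℝ), 1 / 2 < s → s < 1 →
        ContinuousInHs s 𝒯 T (fun t x => m.totalStress (y.σE t x) (y.σV t x) (y.ψ t x)) →
        ContinuousInHs s 𝒯 T (fun t => y.u t) →
        ContinuousInHs s 𝒯 T (fun t => y.p t) →
        ∀ (tr : SkeletonTraces y 𝒯)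
          (yh : DiscreteSolution m Ω 𝒯 k T F g (y.u 0) (y.p 0) (y.σE 0) (y.σV 0) (y.ψ 0)),
          (⨆ t ∈ Set.Icc 0 T, ENNReal.ofReal (errorH1Sq y yh t))
            + (⨆ t ∈ Set.Icc 0 T, ENNReal.ofReal (errorH2Sq y yh t))
          ≤ ENNReal.ofReal C * ∫⁻ t in Set.Icc 0 T, approxErrorSq y tr k t := by
  obtain ⟨C₁, hC₁, C₂, hC₂, hest⟩ := exists_energy_estimate hd hΩ hT m hκ γ
  -- The factor `2` occurs because the two maxima may be attained at different times.
  refine ⟨2 * (Real.exp (C₁ * T) * C₂), by positivity, ?_⟩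
  intro 𝒯 hmesh k F g y s _ _ _ _ _ tr yh
  obtain ⟨hE, hD⟩ := energy_contDiffOn hΩ hmesh hT yh
  have hbound : ∀ t ∈ Set.Icc 0 T, ENNReal.ofReal (errorH1Sq y yh t + errorH2Sq y yh t)
      ≤ ENNReal.ofReal (Real.exp (C₁ * T) * C₂) * ∫⁻ t in Set.Icc 0 T, approxErrorSq y tr k t := by
    intro t ht
    refine (gronwall_lintegral hT hE hD (energy_zero yh) hC₁.le
      (fun t ht => hest hmesh tr yh t ht) ht).trans (le_of_eq ?_)
    rw [MeasureTheory.lintegral_const_mul' _ _ ENNReal.ofReal_ne_top, ← mul_assoc,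
      ENNReal.ofReal_mul (Real.exp_pos _).le]
  rw [ENNReal.ofReal_mul zero_le_two, ENNReal.ofReal_ofNat, mul_assoc, two_mul]
  refine add_le_add (iSup₂_le fun t ht => ?_) (iSup₂_le fun t ht => ?_)
  · exact (ENNReal.ofReal_le_ofReal
      (le_add_of_nonneg_right (errorH2Sq_nonneg yh t))).trans (hbound t ht)
  · exact (ENNReal.ofReal_le_ofReal
      (le_add_of_nonneg_left (errorH1Sq_nonneg yh t))).trans (hbound t ht)
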